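/- Let $D=\{x\in\mathbb R^2:|x|<1\}$ and $S^1=\{v\in\mathbb R^2:|v|=1\}$. For a smooth function $A:D\times S^1\times\mathbb R\to\mathbb C$ and $f\in C_c^\infty(D)$, extended by zero to $\mathbb R^2$, put $$T_Af(x)=\int_{S^1}\int_{\mathbb R}A(x,v,t)\,f(x+tv)\,dt\,dv\quad(x\in D),\qquad \sigma_A(x,\xi)=2\pi\big(A(x,\xi^\perp,0)+A(x,-\xi^\perp,0)\big)\quad(x\in D,\ \xi\in S^1),$$ where $\xi^\perp$ is $\xi$ rotated by a right angle, and $$\|A\|_{C^k}=\sup_{|\alpha|\le k}\ \sup_{D\times S^1\times\mathbb R}\big|\partial_{x_1}^{\alpha_1}\partial_{x_2}^{\alpha_2}\partial_v^{\alpha_3}\partial_t^{\alpha_4}A\big|\in[0,\infty],$$ where $\partial_v$ is the derivative with respect to the angle on $S^1$. For $s\ge 0$ let $\|g\|_{H^s(\mathbb R^2)}=\|(1+|\xi|^2)^{s/2}\hat g\|_{L^2(\mathbb R^2)}$, with $\hat g(\xi)=\int e^{-2\pi i x\cdot\xi}g(x)\,dx$ (extended to $L^2$), and let $\|u\|_{H^s(D)}$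 be the infimum of $\|g\|_{H^s(\mathbb R^2)}$ over all $g\in L^2(\mathbb R^2)$ with $g=u$ almost everywhere on $D$. The convention $0\cdot\infty=0$ is used. Let $P,Q$ be linear differential operators on $D$ of orders at most $p$ and $q$ with coefficients in $C^\infty(\overline D)$, and let $m=p+q$. Consider those smooth $A$ for which either $m\le 1$, or $m\le 2$ and $\sigma_A\equiv 0$. (i) There is a constant $C>0$ depending only on $P$ and $Q$ (and on $p,q$) such that for all such $A$, all $s\in[0,m]$ and all $f\in C_c^\infty(D)$ (extended by zero) $$\|PT_AQf\|_{H^s(D)}\le C\,\|A\|_{C^{2m}}\,\|f\|_{H^s(\mathbb R^2)}.$$ (ii) For every $s\in[0,m]$ with $s\ne\tfrac12,\tfrac32$ there is a constant $C>0$ depending only on $P$, $Q$, $p$, $q$ and $s$ such that for all such $A$ and all $f\in C_c^\infty(D)$ $$\|PT_AQf\|_{H^s(D)}\le C\,\|A\|_{C^{2m}}\,\|f\|_{H^s(D)}.$$ -/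

import Mathlib

open MeasureTheory
open scoped ENNReal NNReal ContDiff

noncomputable section

namespace DiskOp

/-- The Euclidean plane. -/
abbrev Plane : Type := EuclideanSpace ℝ (Fin 2)

/-- The open unit disk. -/
def disk : Set Plane := Metric.ball 0 1

/-- The unit circle of directions. -/
def circle : Set Plane := Metric.sphere 0 1

/-- The unit vector `(cos θ, sin θ)`; a parametrisation of the circle by arc length. -/
def dir (θ : ℝ) : Plane := !₂[Real.cos θ, Real.sin θ]

/-- The standard basis vectors of the plane. -/
def basisVec (j : Fin 2) : Plane := EuclideanSpace.single j 1

/-- The derivative of `F` in the direction `w`. -/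
def dirDeriv {V : Type*} [NormedAddCommGroup V] [NormedSpace ℝ V] (w : V) (F : V → ℂ) : V → ℂ :=
  fun z => fderiv ℝ F z w

/-- A kernel `A(x, v, t)`; only its values for `x` in the disk and `v` on the circle matter. -/
abbrev Kernel : Type := Plane → Plane → ℝ → ℂ

/-- The kernel in the coordinates `(x, θ, t)`, where `v = (cos θ, sin θ)`. -/
def Kernel.inCoords (A : Kernel) : Plane × ℝ × ℝ → ℂ :=
  fun z => A z.1 (dir z.2.1) z.2.2

/-- The coordinate domain corresponding to `disk × circle × ℝ`. -/
def coordDomain : Set (Plane × ℝ × ℝ) := disk ×ˢ Set.univ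

/-- `A` is a smooth function on `disk × circle × ℝ`. -/
def Kernel.IsSmooth (A : Kernel) : Prop :=
  ContDiffOn ℝ ∞ A.inCoords coordDomain

/-- `∂_{x₁}^{α₁} ∂_{x₂}^{α₂} ∂_v^{α₃} ∂_t^{α₄} A` in the coordinates `(x, θ, t)`. -/
def Kernel.partialDeriv (A : Kernel) (α : Fin 4 → ℕ) : Plane × ℝ × ℝ → ℂ :=
  (dirDeriv (V := Plane × ℝ × ℝ) (basisVec 0, 0, 0))^[α 0]
    ((dirDeriv (V := Plane × ℝ × ℝ) (basisVec 1, 0, 0))^[α 1]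
      ((dirDeriv (V := Plane × ℝ × ℝ) (0, 1, 0))^[α 2]
        ((dirDeriv (V := Plane × ℝ × ℝ) (0, 0, 1))^[α 3] A.inCoords)))

/-- The `C^k` norm: the supremum over `disk × circle × ℝ` of all partial derivatives of order at
most `k`. It may be infinite. -/
def Kernel.cNorm (k : ℕ) (A : Kernel) : ℝ≥0∞ :=
  ⨆ (α : Fin 4 → ℕ) (_ : ∑ i, α i ≤ k) (z ∈ coordDomain), ‖A.partialDeriv α z‖ₑ

/-- The operator `T_A f(x) = ∫_{S¹} ∫_ℝ A(x, v, t) f(x + t v) dt dv`. -/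
def Kernel.op (A : Kernel) (f : Plane → ℂ) : Plane → ℂ :=
  fun x => ∫ θ in (0 : ℝ)..(2 * Real.pi), ∫ t : ℝ, A x (dir θ) t * f (x + t • dir θ)

/-- Rotation by a right angle. -/
def perp (ξ : Plane) : Plane := !₂[-(ξ 1), ξ 0]

/-- The principal symbol `σ_A(x, ξ) = 2π (A(x, ξ^⊥, 0) + A(x, -ξ^⊥, 0))`. -/
def Kernel.symbol (A : Kernel) (x ξ : Plane) : ℂ :=
  2 * (Real.pi : ℂ) * (A x (perp ξ) 0 + A x (-perp ξ) 0)

/-- The multi-indices `α ∈ ℕ²` with `α₁ + α₂ ≤ p`. -/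
def multiIndices (p : ℕ) : Finset (ℕ × ℕ) :=
  (Finset.range (p + 1) ×ˢ Finset.range (p + 1)).filter fun α => α.1 + α.2 ≤ p

/-- Linear differential operators `∑_{|α| ≤ p} c_α ∂^α` of order at most `p` whose coefficients
are smooth up to the boundary of the disk. -/
structure DiffOp (p : ℕ) where
  /-- The coefficient of `∂_{x₁}^{α₁} ∂_{x₂}^{α₂}`. -/
  coeff : ℕ × ℕ → Plane → ℂ
  smooth_coeff : ∀ α ∈ multiIndices p, ContDiffOn ℝ ∞ (coeff α) (closure disk)

/-- The action of a differential operator on functions. -/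
def DiffOp.apply {p : ℕ} (P : DiffOp p) (u : Plane → ℂ) : Plane → ℂ :=
  fun x => ∑ α ∈ multiIndices p,
    P.coeff α x * (dirDeriv (basisVec 0))^[α.1] ((dirDeriv (basisVec 1))^[α.2] u) x

/-- The space `C_c^∞` of the disk; its elements are extended by zero to the plane. -/
structure IsTestFunction (f : Plane → ℂ) : Prop where
  smooth : ContDiff ℝ ∞ f
  compact_support : HasCompactSupport f
  support_subset : tsupport f ⊆ disk

/-- The norm `‖(1 + |ξ|²)^{s/2} 𝓕 g‖_{L²}` of `H^s(ℝ²)` for `g ∈ L²(ℝ²)`; it is infinite if `g` is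
not in `H^s(ℝ²)`. -/
def planeSobolevNorm (s : ℝ) (g : Lp ℂ 2 (volume : Measure Plane)) : ℝ≥0∞ :=
  eLpNorm (fun ξ : Plane => (((1 + ‖ξ‖ ^ 2) ^ (s / 2) : ℝ) : ℂ) *
    (FourierTransform.fourier g : Lp ℂ 2 (volume : Measure Plane)) ξ) 2 volume

/-- The norm of `H^s(Ω)`, `s ≥ 0`: the infimum of the `H^s(ℝ²)` norms of all extensions of `u` from
`Ω` to the plane, infinite if there is none. For `Ω = ℝ²` this is the norm of `H^s(ℝ²)`. -/
def sobolevNorm (Ω : Set Plane) (s : ℝ) (u : Plane → ℂ) : ℝ≥0∞ :=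
  ⨅ (g : Lp ℂ 2 (volume : Measure Plane)) (_ : g =ᵐ[volume.restrict Ω] u), planeSobolevNorm s g

end DiskOp

end

noncomputable section

namespace DiskOp

open FourierTransform SchwartzMap LineDeriv Set Filter Topology

/-! In polar coordinates around `x` the operator `T_A` averages `f` over lines, and such an average
gains one derivative. Everything reduces to `L²` bounds for derivatives of `T_A f`, interpolated
with bounds in `H^m`.

Gain of one derivative (`opEst_one`). Write `A = A(x, v, 0) + t R`. A derivative of `f` splits into
a part along the ray, which is a total `t`-derivative, and a part across it, which is `1/t` times a
total `θ`-derivative. On the term `t R` both can be integrated by parts, the factor `t` cancelling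
`1/t`, and an operator of the same type is left (`kOp_lineDeriv`). On the frozen term `A(x, v, 0)`
integration by parts in `θ` leaves translation invariant operators, namely integrals of `∂ᵢ f` over
arcs of directions. Their Fourier multipliers are bounded, because the transform of an arc is
`O(1/|ξ|)` uniformly in the arc (`exists_arcSymbol_bound`, `exists_arcOp_bound`). If `σ_A = 0`, the
frozen kernel is odd under `v ↦ -v` while the integral over a line is even. The frozen term
vanishes, one derivative of `T_A` is again an operator of the same type, and a second derivative is
gained (`opEst_two`).

Conjugation by `P` and `Q`. Derivatives in `Q` are moved to the left of `T_A` at the price of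
derivatives of the kernel and of the coefficients (`kOp_mul_dirDeriv`,
`IsGaining.exists_word_bound`). Commuting derivatives through `T_A` gives the bound at `s = m`, the
gain itself the bound at `s = 0`, and together they use at most `2m` derivatives of `A`. Real
interpolation with `L²` and `H^k`, `k ≤ 2`, is carried out by hand so that its constant does not
depend on `s` (`planeSobolevNorm_interp`). Values on the disk are extended to the plane by a
reflection that matches first derivatives on the circle, after a dilation that makes them smooth up
to the boundary (`exists_extL_bound`, `sobolevNorm_disk_le_of_dil`). This proves (i).

For (ii) it remains to bound extension by zero on `H^s` (`exists_zeroExtension_bound`). For `0 < s <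
1` this follows from a fractional Hardy inequality. The substitution `x ↦ |x| x` doubles `log |x|`
and multiplies the Hardy norm by `2 ^ (s - 1/2)`, while the difference of `f` and its substituted
copy is controlled by the `H^s(D)` norm. For `s ≠ 1/2` the Hardy norm can be absorbed
(`exists_hardyN_le`). Differentiating raises `s` by one, hence the second exception `3/2`. -/

/-- Square-integrable functions on the plane. -/
abbrev L2 : Type := Lp ℂ 2 (volume : Measure Plane)

theorem eLpNorm_two_sq {Y : Type*} [MeasurableSpace Y] (μ : Measure Y) (f : Y → ℂ) :
    eLpNorm f 2 μ ^ 2 = ∫⁻ x, ‖f x‖ₑ ^ 2 ∂μ := by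
  have := eLpNorm_nnreal_pow_eq_lintegral (μ := μ) (f := f) (p := 2) (by norm_num)
  simpa using this

theorem sq_le_sq_iff_ennreal {a b : ℝ≥0∞} : a ^ 2 ≤ b ^ 2 ↔ a ≤ b :=
  ENNReal.pow_le_pow_left_iff (by norm_num)

theorem add_sq_le_two_mul (a b : ℝ≥0∞) : (a + b) ^ 2 ≤ 2 * (a ^ 2 + b ^ 2) := by
  have := ENNReal.rpow_add_le_mul_rpow_add_rpow a b (p := 2) (by norm_num)
  norm_num at this
  simpa using this

/-! ### Sobolev norms of the plane on the Fourier side -/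

/-- The weight `1 + |ξ|²`. -/
def weight (ξ : Plane) : ℝ := 1 + ‖ξ‖ ^ 2

theorem one_le_weight (ξ : Plane) : 1 ≤ weight ξ := by unfold weight; nlinarith [sq_nonneg ‖ξ‖]

theorem weight_pos (ξ : Plane) : 0 < weight ξ := lt_of_lt_of_le one_pos (one_le_weight ξ)

theorem continuous_weight : Continuous weight := by unfold weight; fun_prop

theorem measurable_weight : Measurable weight := continuous_weight.measurable

theorem hasTemperateGrowth_weight_rpow (r : ℝ) :
    (fun ξ => weight ξ ^ r).HasTemperateGrowth :=
  Function.hasTemperateGrowth_one_add_norm_sq_rpow Plane r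

theorem planeSobolevNorm_sq (s : ℝ) (g : L2) :
    planeSobolevNorm s g ^ 2 = ∫⁻ ξ, ENNReal.ofReal (weight ξ ^ s) * ‖(𝓕 g : L2) ξ‖ₑ ^ 2 := by
  rw [planeSobolevNorm, eLpNorm_two_sq]
  refine lintegral_congr fun ξ => ?_
  rw [enorm_mul, mul_pow]
  congr 1
  have h := weight_pos ξ
  change ‖((weight ξ ^ (s / 2) : ℝ) : ℂ)‖ₑ ^ 2 = _
  rw [← ofReal_norm, Complex.norm_real, Real.norm_of_nonneg (by positivity),
    ← ENNReal.ofReal_pow (by positivity), ← Real.rpow_natCast, ← Real.rpow_mul h.le]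
  norm_num

theorem planeSobolevNorm_zero (g : L2) : planeSobolevNorm 0 g = ‖g‖ₑ := by
  have h : planeSobolevNorm 0 g ^ 2 = ‖g‖ₑ ^ 2 := by
    rw [planeSobolevNorm_sq]
    simp only [Real.rpow_zero, ENNReal.ofReal_one, one_mul]
    rw [← eLpNorm_two_sq, ← Lp.enorm_def]
    congr 1
    rw [← ofReal_norm, ← ofReal_norm, Lp.norm_fourier_eq]
  exact le_antisymm (sq_le_sq_iff_ennreal.1 h.le) (sq_le_sq_iff_ennreal.1 h.ge)

theorem planeSobolevNorm_mono {s t : ℝ} (h : s ≤ t) (g : L2) :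
    planeSobolevNorm s g ≤ planeSobolevNorm t g := by
  rw [← sq_le_sq_iff_ennreal, planeSobolevNorm_sq, planeSobolevNorm_sq]
  gcongr with ξ
  exact one_le_weight ξ

theorem planeSobolevNorm_add_le (s : ℝ) (g h : L2) :
    planeSobolevNorm s (g + h) ≤ planeSobolevNorm s g + planeSobolevNorm s h := by
  unfold planeSobolevNorm
  have hm : Continuous fun ξ : Plane => (((1 + ‖ξ‖ ^ 2) ^ (s / 2) : ℝ) : ℂ) := by
    refine Complex.continuous_ofReal.comp (Continuous.rpow_const (by fun_prop) fun ξ => Or.inl ?_)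
    positivity
  refine le_trans (le_of_eq ?_) (eLpNorm_add_le
    (hm.aestronglyMeasurable.mul (Lp.aestronglyMeasurable _))
    (hm.aestronglyMeasurable.mul (Lp.aestronglyMeasurable _)) (by norm_num))
  refine eLpNorm_congr_ae ?_
  rw [FourierTransform.fourier_add]
  filter_upwards [Lp.coeFn_add (𝓕 g : L2) (𝓕 h : L2)] with ξ hξ
  rw [hξ]
  exact mul_add _ _ _

theorem planeSobolevNorm_smul (s : ℝ) (c : ℂ) (g : L2) :
    planeSobolevNorm s (c • g) = ‖c‖ₑ * planeSobolevNorm s g := by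
  unfold planeSobolevNorm
  rw [← eLpNorm_const_smul]
  refine eLpNorm_congr_ae ?_
  rw [FourierTransform.fourier_smul]
  filter_upwards [Lp.coeFn_smul c (𝓕 g : L2)] with ξ hξ
  rw [hξ]
  exact mul_left_comm _ _ _

/-- The Sobolev norms are lower semicontinuous for convergence in `L²`. -/
theorem planeSobolevNorm_le_of_tendsto (s : ℝ) {g : ℕ → L2} {g₀ : L2}
    (h : Tendsto g atTop (𝓝 g₀)) {M : ℝ≥0∞} (hM : ∀ n, planeSobolevNorm s (g n) ≤ M) :
    planeSobolevNorm s g₀ ≤ M := by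
  have h1 : Tendsto (fun n => (𝓕 (g n) : L2)) atTop (𝓝 (𝓕 g₀)) :=
    ((Lp.fourierTransformₗᵢ Plane ℂ).continuous.tendsto g₀).comp h
  -- A subsequence of the transforms converges almost everywhere, and Fatou's lemma gives the bound.
  obtain ⟨ns, -, hns⟩ := (tendstoInMeasure_of_tendsto_Lp h1).exists_seq_tendsto_ae
  rw [← sq_le_sq_iff_ennreal, planeSobolevNorm_sq]
  calc ∫⁻ ξ, ENNReal.ofReal (weight ξ ^ s) * ‖(𝓕 g₀ : L2) ξ‖ₑ ^ 2
      = ∫⁻ ξ, liminf (fun n => ENNReal.ofReal (weight ξ ^ s) * ‖(𝓕 (g (ns n)) : L2) ξ‖ₑ ^ 2)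
          atTop := by
        refine lintegral_congr_ae ?_
        filter_upwards [hns] with ξ hξ
        refine (Tendsto.liminf_eq ?_).symm
        refine ENNReal.Tendsto.const_mul ?_ (Or.inr ENNReal.ofReal_ne_top)
        exact (ENNReal.continuous_pow 2).continuousAt.tendsto.comp hξ.enorm
    _ ≤ liminf (fun n => ∫⁻ ξ, ENNReal.ofReal (weight ξ ^ s) * ‖(𝓕 (g (ns n)) : L2) ξ‖ₑ ^ 2)
          atTop := by
        refine lintegral_liminf_le' fun n => ?_
        refine AEMeasurable.mul ?_ ((Lp.aestronglyMeasurable _).enorm.pow_const 2)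
        exact (measurable_weight.pow_const s).ennreal_ofReal.aemeasurable
    _ ≤ M ^ 2 := by
        refine liminf_le_of_le (by isBoundedDefault) fun b hb => ?_
        obtain ⟨n, hn⟩ := hb.exists
        refine hn.trans ?_
        rw [← planeSobolevNorm_sq]
        gcongr
        exact hM _

/-! ### The weak derivative -/

/-- The frequency variable of the `i`th derivative. -/
def freq (i : Fin 2) (ξ : Plane) : ℂ := 2 * Real.pi * Complex.I * (ξ i : ℂ)

/-- `G` is the `i`th derivative of `g`, on the Fourier side. -/
def IsWeakDeriv (i : Fin 2) (g G : L2) : Prop :=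
  (𝓕 G : L2) =ᵐ[volume] fun ξ => freq i ξ * (𝓕 g : L2) ξ

/-- The pairing is bilinear, so the transform changes sides without conjugation. This transfers
identities between `g` and its transform. -/
theorem integral_fourier_mul (g : L2) (φ : 𝓢(Plane, ℂ)) :
    ∫ x, φ x * (𝓕 g : L2) x = ∫ x, (𝓕 φ : 𝓢(Plane, ℂ)) x * g x := by
  have h := congrArg (fun T : TemperedDistribution Plane ℂ => T φ)
    (Lp.fourier_toTemperedDistribution_eq g)
  simp only [TemperedDistribution.fourier_apply, Lp.toTemperedDistribution_apply,
    smul_eq_mul] at h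
  exact h.symm

theorem inner_basisVec (i : Fin 2) (ξ : Plane) : inner ℝ ξ (basisVec i) = ξ i := by
  simp [basisVec, EuclideanSpace.inner_single_right]

theorem lineDerivOp_fourier_apply (i : Fin 2) (φ : 𝓢(Plane, ℂ)) :
    ∃ ψ : 𝓢(Plane, ℂ), (∀ ξ, ψ ξ = freq i ξ * φ ξ) ∧
      ∂_{basisVec i} (𝓕 φ) = - (𝓕 ψ : 𝓢(Plane, ℂ)) := by
  refine ⟨(2 * Real.pi * Complex.I) • smulLeftCLM ℂ (inner ℝ · (basisVec i)) φ, ?_, ?_⟩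
  · intro ξ
    have : (fun x : Plane => inner ℝ x (basisVec i)).HasTemperateGrowth := by fun_prop
    rw [smul_apply, smulLeftCLM_apply_apply this, inner_basisVec]
    simp [freq, mul_assoc]
  · rw [SchwartzMap.lineDerivOp_fourier_eq, neg_smul, FourierTransform.fourier_neg]

theorem integrable_schwartz_mul (φ : 𝓢(Plane, ℂ)) (g : L2) : Integrable fun x => φ x * g x :=
  (φ.memLp 2).integrable_mul (Lp.memLp g)

theorem exists_schwartz_eq_ofReal {g : Plane → ℝ} (hg : ContDiff ℝ ∞ g)
    (hs : HasCompactSupport g) : ∃ φ : 𝓢(Plane, ℂ), ∀ x, φ x = (g x : ℂ) := by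
  have h1 : ContDiff ℝ ∞ fun x => (g x : ℂ) := Complex.ofRealCLM.contDiff.comp hg
  have h2 : HasCompactSupport fun x => (g x : ℂ) := hs.comp_left (g := fun r : ℝ => (r : ℂ)) (by simp)
  exact ⟨h2.toSchwartzMap h1, fun x => rfl⟩

theorem continuous_freq (i : Fin 2) : Continuous (freq i) := by
  unfold freq; fun_prop

theorem locallyIntegrable_L2 (g : L2) : LocallyIntegrable (g : Plane → ℂ) volume :=
  (Lp.memLp g).locallyIntegrable (by norm_num)

/-- Testing with the Fourier transform of a compactly supported function turns the derivative into
multiplication by `freq i`, and such functions separate locally integrable ones. -/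
theorem isWeakDeriv_of_integral {i : Fin 2} {g G : L2}
    (h : ∀ φ : 𝓢(Plane, ℂ), ∫ x, (∂_{basisVec i} φ : 𝓢(Plane, ℂ)) x * g x = - ∫ x, φ x * G x) :
    IsWeakDeriv i g G := by
  refine ae_eq_of_integral_contDiff_smul_eq (locallyIntegrable_L2 _) ?_ fun χ hχ hs => ?_
  · exact (locallyIntegrable_L2 (𝓕 g : L2)).continuous_mul (continuous_freq i)
  · obtain ⟨φ, hφ⟩ := exists_schwartz_eq_ofReal hχ hs
    obtain ⟨ψ, hψ, hd⟩ := lineDerivOp_fourier_apply i φ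
    have h1 := h (𝓕 φ)
    rw [← integral_fourier_mul G φ, hd] at h1
    have h2 : ∫ x, (-(𝓕 ψ : 𝓢(Plane, ℂ))) x * g x = - ∫ x, ψ x * (𝓕 g : L2) x := by
      rw [integral_fourier_mul, ← integral_neg]; simp
    rw [h2, neg_inj] at h1
    calc ∫ x, χ x • (𝓕 G : L2) x = ∫ x, φ x * (𝓕 G : L2) x := by simp [hφ]
      _ = _ := by
        rw [← h1]
        refine integral_congr_ae (ae_of_all _ fun x => ?_)
        simp [hψ, hφ]; ring

theorem IsWeakDeriv.integral_eq {i : Fin 2} {g G : L2} (h : IsWeakDeriv i g G)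
    (φ : 𝓢(Plane, ℂ)) :
    ∫ x, (∂_{basisVec i} φ : 𝓢(Plane, ℂ)) x * g x = - ∫ x, φ x * G x := by
  obtain ⟨φ', rfl⟩ : ∃ φ' : 𝓢(Plane, ℂ), φ = 𝓕 φ' :=
    ⟨𝓕⁻ φ, (FourierTransform.fourier_fourierInv_eq φ).symm⟩
  obtain ⟨ψ, hψ, hd⟩ := lineDerivOp_fourier_apply i φ'
  have h2 : ∫ x, (-(𝓕 ψ : 𝓢(Plane, ℂ))) x * g x = - ∫ x, ψ x * (𝓕 g : L2) x := by
    rw [integral_fourier_mul, ← integral_neg]; simp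
  rw [hd, h2, ← integral_fourier_mul, neg_inj]
  refine integral_congr_ae ?_
  filter_upwards [h] with x hx
  rw [hx, hψ]; ring

theorem enorm_freq_sq (i : Fin 2) (ξ : Plane) :
    ‖freq i ξ‖ₑ ^ 2 = ENNReal.ofReal ((2 * Real.pi) ^ 2 * (ξ i) ^ 2) := by
  rw [← ofReal_norm, ← ENNReal.ofReal_pow (norm_nonneg _)]
  congr 1
  simp [freq, mul_pow]

theorem norm_sq_eq (ξ : Plane) : ‖ξ‖ ^ 2 = ξ 0 ^ 2 + ξ 1 ^ 2 := by
  rw [EuclideanSpace.norm_sq_eq]; simp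

theorem IsWeakDeriv.planeSobolevNorm_sq {i : Fin 2} {g G : L2} (h : IsWeakDeriv i g G) (s : ℝ) :
    planeSobolevNorm s G ^ 2 =
      ∫⁻ ξ, ENNReal.ofReal (weight ξ ^ s * ((2 * Real.pi) ^ 2 * (ξ i) ^ 2)) *
        ‖(𝓕 g : L2) ξ‖ₑ ^ 2 := by
  rw [DiskOp.planeSobolevNorm_sq]
  refine lintegral_congr_ae ?_
  filter_upwards [h] with ξ hξ
  have := weight_pos ξ
  rw [hξ, enorm_mul, mul_pow, enorm_freq_sq, ← mul_assoc, ← ENNReal.ofReal_mul (by positivity)]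

/-- The constant `7` dominates the `2π` of the normalisation of the Fourier transform, which the
weight does not contain. -/
theorem IsWeakDeriv.planeSobolevNorm_le {i : Fin 2} {g G : L2} (h : IsWeakDeriv i g G) (s : ℝ) :
    planeSobolevNorm s G ≤ 7 * planeSobolevNorm (s + 1) g := by
  rw [← sq_le_sq_iff_ennreal, h.planeSobolevNorm_sq, mul_pow (7 : ℝ≥0∞),
    DiskOp.planeSobolevNorm_sq, ← lintegral_const_mul' _ _ (by norm_num)]
  · refine lintegral_mono fun ξ => ?_
    have h0 := weight_pos ξ
    beta_reduce
    rw [← mul_assoc ((7 : ℝ≥0∞) ^ 2)]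
    gcongr
    rw [show (7 : ℝ≥0∞) ^ 2 = ENNReal.ofReal 49 by norm_num, ← ENNReal.ofReal_mul (by norm_num)]
    refine ENNReal.ofReal_le_ofReal ?_
    rw [Real.rpow_add h0, Real.rpow_one]
    have h1 : (ξ i) ^ 2 ≤ weight ξ := by
      unfold weight
      rw [norm_sq_eq]
      fin_cases i <;> simp <;> nlinarith [sq_nonneg (ξ 0), sq_nonneg (ξ 1)]
    have h2 : (2 * Real.pi) ^ 2 ≤ 49 := by nlinarith [Real.pi_lt_d2, Real.pi_pos]
    have h3 : 0 ≤ weight ξ ^ s := by positivity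
    calc weight ξ ^ s * ((2 * Real.pi) ^ 2 * (ξ i) ^ 2) ≤ weight ξ ^ s * (49 * weight ξ) := by
          gcongr
      _ = _ := by ring

/-- This follows from `1 + |ξ|² ≤ 1 + (2π)²|ξ|²`, and lets norms of integer order be bounded one
derivative at a time. -/
theorem planeSobolevNorm_succ_le {g : L2} {G : Fin 2 → L2} (h : ∀ i, IsWeakDeriv i g (G i))
    (s : ℝ) :
    planeSobolevNorm (s + 1) g ≤ planeSobolevNorm s g + ∑ i, planeSobolevNorm s (G i) := by
  have key : planeSobolevNorm (s + 1) g ^ 2 ≤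
      planeSobolevNorm s g ^ 2 + ∑ i, planeSobolevNorm s (G i) ^ 2 := by
    simp only [(h _).planeSobolevNorm_sq, DiskOp.planeSobolevNorm_sq, Fin.sum_univ_two]
    have hm : ∀ f : Plane → ℝ, Measurable f →
      AEMeasurable (fun ξ => ENNReal.ofReal (f ξ) * ‖(𝓕 g : L2) ξ‖ₑ ^ 2) volume := fun f hf =>
      hf.ennreal_ofReal.aemeasurable.mul ((Lp.aestronglyMeasurable _).enorm.pow_const 2)
    have hw := measurable_weight.pow_const s
    have hc : ∀ i : Fin 2, Measurable fun ξ : Plane => ξ i := fun i =>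
      Continuous.measurable (by fun_prop)
    rw [← lintegral_add_left' (hm (fun ξ => weight ξ ^ s * ((2 * Real.pi) ^ 2 * ξ 0 ^ 2))
      (hw.mul ((hc 0).pow_const 2 |>.const_mul _))),
      ← lintegral_add_left' (hm (fun ξ => weight ξ ^ s) hw)]
    gcongr with ξ
    have h0 := weight_pos ξ
    rw [← add_mul, ← add_mul, ← ENNReal.ofReal_add (by positivity) (by positivity),
      ← ENNReal.ofReal_add (by positivity) (by positivity)]
    gcongr
    rw [Real.rpow_add h0, Real.rpow_one]
    have h2 : 1 ≤ (2 * Real.pi) ^ 2 := by nlinarith [Real.pi_gt_three]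
    have h3 : 0 ≤ weight ξ ^ s := by positivity
    have h4 : weight ξ ≤ 1 + (2 * Real.pi) ^ 2 * ξ 0 ^ 2 + (2 * Real.pi) ^ 2 * ξ 1 ^ 2 := by
      unfold weight
      rw [norm_sq_eq]
      nlinarith [sq_nonneg (ξ 0), sq_nonneg (ξ 1)]
    nlinarith
  have h5 : ∀ a b c : ℝ≥0∞, a ^ 2 + (b ^ 2 + c ^ 2) ≤ (a + (b + c)) ^ 2 := by
    intro a b c
    have : (a + (b + c)) ^ 2 = a ^ 2 + (b ^ 2 + c ^ 2) + (2 * a * b + 2 * a * c + 2 * b * c) := by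
      ring
    rw [this]
    exact le_self_add
  rw [← sq_le_sq_iff_ennreal]
  refine key.trans ?_
  simp only [Fin.sum_univ_two]
  exact h5 _ _ _

theorem exists_isWeakDeriv {g : L2} (hg : planeSobolevNorm 1 g ≠ ⊤) (i : Fin 2) :
    ∃ G : L2, IsWeakDeriv i g G := by
  have hm : MemLp (fun ξ => freq i ξ * (𝓕 g : L2) ξ) 2 volume := by
    refine ⟨(continuous_freq i).aestronglyMeasurable.mul (Lp.aestronglyMeasurable _), ?_⟩
    have h1 : eLpNorm (fun ξ => freq i ξ * (𝓕 g : L2) ξ) 2 volume ^ 2 ≤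
        (7 * planeSobolevNorm 1 g) ^ 2 := by
      rw [eLpNorm_two_sq, mul_pow (7 : ℝ≥0∞), planeSobolevNorm_sq, ← lintegral_const_mul' _ _ (by norm_num)]
      gcongr with ξ
      rw [enorm_mul, mul_pow, enorm_freq_sq, ← mul_assoc, Real.rpow_one]
      gcongr
      rw [show (7 : ℝ≥0∞) ^ 2 = ENNReal.ofReal 49 by norm_num, ← ENNReal.ofReal_mul (by norm_num)]
      refine ENNReal.ofReal_le_ofReal ?_
      have h1 : (ξ i) ^ 2 ≤ weight ξ := by
        unfold weight
        rw [norm_sq_eq]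
        fin_cases i <;> simp <;> nlinarith [sq_nonneg (ξ 0), sq_nonneg (ξ 1)]
      have h2 : (2 * Real.pi) ^ 2 ≤ 49 := by nlinarith [Real.pi_lt_d2, Real.pi_pos]
      have h3 := weight_pos ξ
      gcongr
    refine lt_of_le_of_lt (sq_le_sq_iff_ennreal.1 h1) ?_
    exact ENNReal.mul_lt_top (by norm_num) hg.lt_top
  refine ⟨𝓕⁻ (hm.toLp _ : L2), ?_⟩
  unfold IsWeakDeriv
  rw [FourierTransform.fourier_fourierInv_eq]
  exact hm.coeFn_toLp

theorem isWeakDeriv_schwartz (i : Fin 2) (φ : 𝓢(Plane, ℂ)) :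
    IsWeakDeriv i (φ.toLp 2) ((∂_{basisVec i} φ : 𝓢(Plane, ℂ)).toLp 2) := by
  refine isWeakDeriv_of_integral fun ψ => ?_
  have h := SchwartzMap.integral_mul_lineDerivOp_right_eq_neg_left (μ := volume) φ ψ (basisVec i)
  rw [integral_congr_ae (g := fun x => φ x * (∂_{basisVec i} ψ : 𝓢(Plane, ℂ)) x), h,
    integral_congr_ae]
  · filter_upwards [(∂_{basisVec i} φ : 𝓢(Plane, ℂ)).coeFn_toLp 2 volume] with x hx
    rw [hx, mul_comm]
  · filter_upwards [φ.coeFn_toLp 2 volume] with x hx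
    rw [hx, mul_comm]

theorem enorm_toLp_schwartz (φ : 𝓢(Plane, ℂ)) : ‖φ.toLp 2 volume‖ₑ = eLpNorm φ 2 volume := by
  rw [Lp.enorm_def, eLpNorm_congr_ae (φ.coeFn_toLp 2 volume)]

theorem enorm_toLp {f : Plane → ℂ} (hf : MemLp f 2 volume) :
    ‖(hf.toLp f : L2)‖ₑ = eLpNorm f 2 volume := by
  rw [Lp.enorm_def, eLpNorm_congr_ae hf.coeFn_toLp]

/-- Schwartz functions are dense in `H^k`. -/
theorem exists_schwartz_approx (k : ℝ) {g : L2} (hg : planeSobolevNorm k g ≠ ⊤)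
    {ε : ℝ≥0∞} (hε : ε ≠ 0) :
    ∃ φ : 𝓢(Plane, ℂ), planeSobolevNorm k (φ.toLp 2 volume - g) ≤ ε := by
  have hm : MemLp (fun ξ : Plane => (((1 + ‖ξ‖ ^ 2) ^ (k / 2) : ℝ) : ℂ) * (𝓕 g : L2) ξ) 2
      volume := by
    refine ⟨?_, hg.lt_top⟩
    have hm : Continuous fun ξ : Plane => (((1 + ‖ξ‖ ^ 2) ^ (k / 2) : ℝ) : ℂ) := by
      refine Complex.continuous_ofReal.comp (Continuous.rpow_const (by fun_prop) fun ξ => Or.inl ?_)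
      positivity
    exact hm.aestronglyMeasurable.mul (Lp.aestronglyMeasurable _)
  -- The weighted transform is approximated in `L²`; dividing by the weight keeps the approximant a
  -- Schwartz function.
  obtain ⟨_, ⟨ψ, rfl⟩, hψ⟩ := EMetric.mem_closure_iff.1
    ((SchwartzMap.denseRange_toLpCLM (E := Plane) (F := ℂ) (p := 2) (μ := volume)
      ENNReal.ofNat_ne_top) (hm.toLp _)) ε hε.bot_lt
  have ht := hasTemperateGrowth_weight_rpow (-(k / 2))
  refine ⟨𝓕⁻ (smulLeftCLM ℂ (fun ξ => weight ξ ^ (-(k / 2))) ψ), ?_⟩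
  refine le_trans (le_of_eq ?_) hψ.le
  rw [edist_comm, edist_eq_enorm_sub, Lp.enorm_def, planeSobolevNorm]
  refine eLpNorm_congr_ae ?_
  rw [sub_eq_add_neg, FourierTransform.fourier_add, FourierTransform.fourier_neg,
    ← sub_eq_add_neg, SchwartzMap.toLp_fourier_eq, FourierTransform.fourier_fourierInv_eq]
  filter_upwards [Lp.coeFn_sub ((smulLeftCLM ℂ (fun ξ => weight ξ ^ (-(k / 2))) ψ).toLp 2 volume) (𝓕 g),
    (smulLeftCLM ℂ (fun ξ => weight ξ ^ (-(k / 2))) ψ).coeFn_toLp 2 volume,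
    Lp.coeFn_sub (toLpCLM ℝ ℂ 2 volume ψ) (hm.toLp _), hm.coeFn_toLp,
    ψ.coeFn_toLp 2 volume] with ξ h1 h2 h3 h4 h5
  rw [h1, h3, Pi.sub_apply, Pi.sub_apply, h4, h2, SchwartzMap.toLpCLM_apply, h5, mul_sub,
    smulLeftCLM_apply_apply ht]
  congr 1
  have h0 := weight_pos ξ
  change ((weight ξ ^ (k / 2) : ℝ) : ℂ) * _ = _
  rw [Complex.real_smul, ← mul_assoc, ← Complex.ofReal_mul, ← Real.rpow_add h0]
  simp

/-! ### Real interpolation of weighted `L²` spaces -/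

/-- The normalising constant of real interpolation. -/
def interpConst (k : ℕ) (s : ℝ) : ℝ≥0∞ :=
  ∫⁻ u in Ioi (0 : ℝ), ENNReal.ofReal (min 1 (u ^ k) * u ^ (-s - 1))

/-- The integrand is `u ^ (k - s - 1)` near zero and `u ^ (-s - 1)` near infinity. -/
theorem interpConst_ne_top {k : ℕ} {s : ℝ} (hs : 0 < s) (hk : s < k) :
    interpConst k s ≠ ⊤ := by
  have h1 : IntegrableOn (fun u : ℝ => u ^ ((k : ℝ) - s - 1)) (Ioc 0 1) :=
    (intervalIntegrable_iff_integrableOn_Ioc_of_le zero_le_one).1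
      (intervalIntegral.intervalIntegrable_rpow' (by linarith))
  have h2 : IntegrableOn (fun u : ℝ => u ^ (-s - 1)) (Ioi 1) :=
    integrableOn_Ioi_rpow_of_lt (by linarith) one_pos
  have h3 : interpConst k s ≤
      (∫⁻ u in Ioc (0 : ℝ) 1, ENNReal.ofReal (u ^ ((k : ℝ) - s - 1))) +
        ∫⁻ u in Ioi (1 : ℝ), ENNReal.ofReal (u ^ (-s - 1)) := by
    unfold interpConst
    rw [← Ioc_union_Ioi_eq_Ioi (zero_le_one (α := ℝ))]
    refine (lintegral_union_le _ _ _).trans (add_le_add ?_ ?_)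
    · refine setLIntegral_mono_ae' measurableSet_Ioc (ae_of_all _ fun u hu => ?_)
      refine ENNReal.ofReal_le_ofReal ?_
      have hu0 : 0 < u := hu.1
      calc min 1 (u ^ k) * u ^ (-s - 1) ≤ u ^ k * u ^ (-s - 1) := by
            gcongr; exact min_le_right _ _
        _ = _ := by rw [← Real.rpow_natCast, ← Real.rpow_add hu0]; ring_nf
    · refine setLIntegral_mono_ae' measurableSet_Ioi (ae_of_all _ fun u hu => ?_)
      refine ENNReal.ofReal_le_ofReal ?_
      have hu0 : (0 : ℝ) < u := lt_trans one_pos hu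
      calc min 1 (u ^ k) * u ^ (-s - 1) ≤ 1 * u ^ (-s - 1) := by
            gcongr; exact min_le_left _ _
        _ = _ := one_mul _
  refine ne_top_of_le_ne_top (ENNReal.add_ne_top.2 ⟨?_, ?_⟩) h3
  · exact h1.setLIntegral_lt_top.ne
  · exact h2.setLIntegral_lt_top.ne

theorem interpConst_ne_zero (k : ℕ) (s : ℝ) : interpConst k s ≠ 0 := by
  unfold interpConst
  rw [← pos_iff_ne_zero, setLIntegral_pos_iff]
  · have : Ioi (0 : ℝ) ⊆
        (Function.support fun u : ℝ => ENNReal.ofReal (min 1 (u ^ k) * u ^ (-s - 1))) ∩ Ioi 0 := by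
      intro u hu
      have hu0 : (0 : ℝ) < u := hu
      refine ⟨?_, hu⟩
      have : 0 < min 1 (u ^ k) * u ^ (-s - 1) := by positivity
      simpa using this
    refine lt_of_lt_of_le ?_ (measure_mono this)
    simp
  · fun_prop

/-- Substitute `u = r W`. Since this is an identity, `interpConst` occurs on both sides of every
interpolation and cancels; this is why the constants there do not depend on `s`. -/
theorem lintegral_min_mul_rpow {k : ℕ} (hk : k ≠ 0) {s : ℝ} (hs : 0 < s) {W : ℝ} (hW : 0 ≤ W) :
    ∫⁻ r in Ioi (0 : ℝ), ENNReal.ofReal (min 1 ((r * W) ^ k) * r ^ (-s - 1)) =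
      ENNReal.ofReal (W ^ s) * interpConst k s := by
  rcases hW.eq_or_lt with rfl | hW
  · simp [hk, hs.ne']
  · have h := lintegral_image_eq_lintegral_abs_deriv_mul (s := Ioi (0 : ℝ)) (f := fun r => r * W)
      (f' := fun _ => W) measurableSet_Ioi
      (fun r _ => by simpa using ((hasDerivAt_id r).mul_const W).hasDerivWithinAt)
      (fun a _ b _ hab => by simpa [hW.ne'] using hab)
      (fun u => ENNReal.ofReal (min 1 (u ^ k) * u ^ (-s - 1)))
    have hi : (fun r => r * W) '' Ioi (0 : ℝ) = Ioi 0 := by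
      ext x
      constructor
      · rintro ⟨r, hr, rfl⟩
        exact mul_pos hr hW
      · intro hx
        exact ⟨x / W, div_pos hx hW, div_mul_cancel₀ _ hW.ne'⟩
    rw [hi] at h
    unfold interpConst
    rw [h, ← lintegral_const_mul' _ _ ENNReal.ofReal_ne_top]
    refine setLIntegral_congr_fun measurableSet_Ioi fun r hr => ?_
    have hr0 : (0 : ℝ) < r := hr
    rw [← ENNReal.ofReal_mul (abs_nonneg _), ← ENNReal.ofReal_mul (by positivity), abs_of_pos hW]
    congr 1
    rw [Real.mul_rpow hr0.le hW.le]
    have : W ^ s * (W * W ^ (-s - 1)) = 1 := by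
      nth_rewrite 2 [← Real.rpow_one W]
      rw [← Real.rpow_add hW, ← Real.rpow_add hW]
      norm_num
    calc min 1 ((r * W) ^ k) * r ^ (-s - 1)
        = min 1 ((r * W) ^ k) * r ^ (-s - 1) * (W ^ s * (W * W ^ (-s - 1))) := by
          rw [this, mul_one]
      _ = _ := by ring

theorem lintegral_interp {Y : Type*} [MeasurableSpace Y] (μ : Measure Y) [SFinite μ]
    {W : Y → ℝ} (hWm : Measurable W) (hW : ∀ y, 0 ≤ W y) {H : Y → ℂ}
    (hH : AEStronglyMeasurable H μ) {k : ℕ} (hk : k ≠ 0) {s : ℝ} (hs : 0 < s) :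
    ∫⁻ r in Ioi (0 : ℝ), (∫⁻ y, ENNReal.ofReal (min 1 ((r * W y) ^ k)) * ‖H y‖ₑ ^ 2 ∂μ) *
        ENNReal.ofReal (r ^ (-s - 1)) =
      interpConst k s * ∫⁻ y, ENNReal.ofReal (W y ^ s) * ‖H y‖ₑ ^ 2 ∂μ := by
  have hm1 : AEMeasurable (fun y => ‖H y‖ₑ ^ 2) μ := hH.enorm.pow_const 2
  calc _ = ∫⁻ r in Ioi (0 : ℝ), ∫⁻ y, ENNReal.ofReal (min 1 ((r * W y) ^ k) * r ^ (-s - 1)) *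
        ‖H y‖ₑ ^ 2 ∂μ := by
        refine setLIntegral_congr_fun measurableSet_Ioi fun r hr => ?_
        rw [← lintegral_mul_const' _ _ ENNReal.ofReal_ne_top]
        refine lintegral_congr fun y => ?_
        have hr0 : (0 : ℝ) < r := hr
        have := hW y
        rw [ENNReal.ofReal_mul (by positivity)]
        ring
    _ = ∫⁻ y, (∫⁻ r in Ioi (0 : ℝ), ENNReal.ofReal (min 1 ((r * W y) ^ k) * r ^ (-s - 1)) *
        ‖H y‖ₑ ^ 2) ∂μ := by
        rw [lintegral_lintegral_swap]
        have hm2 : Measurable fun p : ℝ × Y =>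
            ENNReal.ofReal (min 1 ((p.1 * W p.2) ^ k) * p.1 ^ (-s - 1)) := by fun_prop
        exact hm2.aemeasurable.mul hm1.comp_snd
    _ = _ := by
        have hm2 : AEMeasurable (fun y => ENNReal.ofReal (W y ^ s) * ‖H y‖ₑ ^ 2) μ :=
          (hWm.pow_const s).ennreal_ofReal.aemeasurable.mul hm1
        rw [← lintegral_const_mul'' _ hm2]
        refine lintegral_congr fun y => ?_
        rw [lintegral_mul_const, lintegral_min_mul_rpow hk hs (hW y)]
        · ring
        · fun_prop

/-- The real interpolation method for weighted `L²` spaces. -/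
theorem interp_weighted {Y : Type*} [MeasurableSpace Y] (μ : Measure Y) [SFinite μ]
    {W : Y → ℝ} (hWm : Measurable W) (hW : ∀ y, 0 ≤ W y) {H : Y → ℂ}
    (hH : AEStronglyMeasurable H μ) {k : ℕ} (hk : k ≠ 0) {s : ℝ} (hs : 0 < s)
    {Φ : ℝ → ℝ≥0∞}
    (hΦ : ∀ r, 0 < r → ∃ H₀ H₁ : Y → ℂ, AEStronglyMeasurable H₀ μ ∧
      H =ᵐ[μ] (fun y => H₀ y + H₁ y) ∧
      ∫⁻ y, ‖H₀ y‖ₑ ^ 2 ∂μ + ENNReal.ofReal (r ^ k) *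
        ∫⁻ y, ENNReal.ofReal (W y ^ k) * ‖H₁ y‖ₑ ^ 2 ∂μ ≤ Φ r) :
    interpConst k s * ∫⁻ y, ENNReal.ofReal (W y ^ s) * ‖H y‖ₑ ^ 2 ∂μ ≤
      ∫⁻ r in Ioi (0 : ℝ), 2 * Φ r * ENNReal.ofReal (r ^ (-s - 1)) := by
  rw [← lintegral_interp μ hWm hW hH hk hs]
  refine setLIntegral_mono' measurableSet_Ioi fun r hr => ?_
  have hr0 : (0 : ℝ) < r := hr
  gcongr
  obtain ⟨H₀, H₁, hm0, hH, hle⟩ := hΦ r hr0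
  refine le_trans ?_ (mul_le_mul_right hle 2)
  rw [← lintegral_const_mul' _ _ ENNReal.ofReal_ne_top, ← lintegral_add_left' (hm0.enorm.pow_const 2),
    ← lintegral_const_mul' _ _ (by norm_num)]
  refine lintegral_mono_ae ?_
  filter_upwards [hH] with y hy
  rw [hy]
  have hWy := hW y
  -- The minimum is bounded by its first entry on `H₀` and by its second entry on `H₁`.
  calc ENNReal.ofReal (min 1 ((r * W y) ^ k)) * ‖H₀ y + H₁ y‖ₑ ^ 2
      ≤ ENNReal.ofReal (min 1 ((r * W y) ^ k)) * (2 * (‖H₀ y‖ₑ ^ 2 + ‖H₁ y‖ₑ ^ 2)) := by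
        gcongr
        exact (pow_le_pow_left₀ (by positivity) (enorm_add_le _ _) 2).trans (add_sq_le_two_mul _ _)
    _ = 2 * (ENNReal.ofReal (min 1 ((r * W y) ^ k)) * ‖H₀ y‖ₑ ^ 2 +
          ENNReal.ofReal (min 1 ((r * W y) ^ k)) * ‖H₁ y‖ₑ ^ 2) := by ring
    _ ≤ 2 * (1 * ‖H₀ y‖ₑ ^ 2 +
          (ENNReal.ofReal (r ^ k) * ENNReal.ofReal (W y ^ k)) * ‖H₁ y‖ₑ ^ 2) := by
        gcongr
        · rw [← ENNReal.ofReal_one]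
          exact ENNReal.ofReal_le_ofReal (min_le_left _ _)
        · rw [← ENNReal.ofReal_mul (by positivity), ← mul_pow]
          exact ENNReal.ofReal_le_ofReal (min_le_right _ _)
    _ = _ := by rw [one_mul, mul_assoc]

/-! ### The splitting of a function into low and high frequencies -/

/-- The symbol of the low frequency part. -/
def lowSymbol (r : ℝ) (ξ : Plane) : ℝ := (1 + r * weight ξ)⁻¹

/-- `g₁` is the low frequency part of `g`. -/
def IsLowPart (r : ℝ) (g g₁ : L2) : Prop :=
  (𝓕 g₁ : L2) =ᵐ[volume] fun ξ => (lowSymbol r ξ : ℂ) * (𝓕 g : L2) ξ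

theorem continuous_lowSymbol {r : ℝ} (hr : 0 < r) : Continuous (lowSymbol r) := by
  unfold lowSymbol
  refine Continuous.inv₀ (by have := continuous_weight; fun_prop) fun ξ => ?_
  have := weight_pos ξ
  positivity

theorem lowSymbol_mem {r : ℝ} (hr : 0 < r) (ξ : Plane) : 0 < lowSymbol r ξ ∧ lowSymbol r ξ ≤ 1 := by
  have := weight_pos ξ
  unfold lowSymbol
  refine ⟨by positivity, inv_le_one_of_one_le₀ ?_⟩
  nlinarith [mul_pos hr this]

/-- A dilated power of the weight: `1 + r (1 + |ξ|²) = (1 + r) (1 + |√(r / (1 + r)) ξ|²)`. -/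
theorem hasTemperateGrowth_lowSymbol {r : ℝ} (hr : 0 < r) : (lowSymbol r).HasTemperateGrowth := by
  have h1 : (fun ξ : Plane => Real.sqrt (r / (1 + r)) • ξ).HasTemperateGrowth :=
    ((Real.sqrt (r / (1 + r))) • ContinuousLinearMap.id ℝ Plane).hasTemperateGrowth
  have h2 := ((hasTemperateGrowth_weight_rpow (-1)).comp h1)
  have h3 := (Function.HasTemperateGrowth.const ((1 + r)⁻¹ : ℝ) (E := Plane)).mul h2
  suffices h : lowSymbol r = _ from h ▸ h3
  funext ξ
  simp only [Pi.mul_apply, Function.comp_apply, lowSymbol, weight]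
  rw [Real.rpow_neg_one, ← mul_inv, norm_smul, mul_pow, Real.norm_of_nonneg (Real.sqrt_nonneg _),
    Real.sq_sqrt (by positivity)]
  congr 1
  field_simp
  ring

theorem exists_isLowPart {r : ℝ} (hr : 0 < r) (g : L2) : ∃ g₁, IsLowPart r g g₁ := by
  have hm : MemLp (fun ξ => (lowSymbol r ξ : ℂ) * (𝓕 g : L2) ξ) 2 volume := by
    refine (Lp.memLp (𝓕 g : L2)).mono ((Complex.continuous_ofReal.comp
      (continuous_lowSymbol hr)).aestronglyMeasurable.mul (Lp.aestronglyMeasurable _))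
      (ae_of_all _ fun ξ => ?_)
    have := lowSymbol_mem hr ξ
    rw [norm_mul, Complex.norm_real, Real.norm_of_nonneg this.1.le]
    exact mul_le_of_le_one_left (norm_nonneg _) this.2
  refine ⟨𝓕⁻ (hm.toLp _ : L2), ?_⟩
  unfold IsLowPart
  rw [FourierTransform.fourier_fourierInv_eq]
  exact hm.coeFn_toLp

theorem exists_isLowPart_schwartz {r : ℝ} (hr : 0 < r) (φ : 𝓢(Plane, ℂ)) :
    ∃ φ₁ : 𝓢(Plane, ℂ), IsLowPart r (φ.toLp 2) (φ₁.toLp 2) := by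
  refine ⟨𝓕⁻ (smulLeftCLM ℂ (lowSymbol r) (𝓕 φ)), ?_⟩
  unfold IsLowPart
  rw [SchwartzMap.toLp_fourier_eq, SchwartzMap.toLp_fourier_eq,
    FourierTransform.fourier_fourierInv_eq]
  filter_upwards [(smulLeftCLM ℂ (lowSymbol r) (𝓕 φ)).coeFn_toLp 2 volume,
    (𝓕 φ : 𝓢(Plane, ℂ)).coeFn_toLp 2 volume] with ξ h1 h2
  rw [h1, h2, smulLeftCLM_apply_apply (hasTemperateGrowth_lowSymbol hr)]
  simp

/-- With `z = r (1 + |ξ|²)` both terms reduce to scalar inequalities: `z² / (1 + z)²` and `z ^ k /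
(1 + z)²` are at most `min 1 (z ^ k)`. Here `k ≤ 2` is essential. The splitting is thus optimal up
to a constant and serves `k = 1` and `k = 2` alike. -/
theorem IsLowPart.split_le {r : ℝ} (hr : 0 < r) {g g₁ : L2} (h : IsLowPart r g g₁) {k : ℕ}
    (hk : k = 1 ∨ k = 2) :
    ‖g - g₁‖ₑ ^ 2 + ENNReal.ofReal (r ^ k) * planeSobolevNorm k g₁ ^ 2 ≤
      2 * ∫⁻ ξ, ENNReal.ofReal (min 1 ((r * weight ξ) ^ k)) * ‖(𝓕 g : L2) ξ‖ₑ ^ 2 := by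
  rw [← planeSobolevNorm_zero, planeSobolevNorm_sq, planeSobolevNorm_sq, two_mul]
  have hsub : (𝓕 (g - g₁) : L2) =ᵐ[volume]
      fun ξ => ((1 - lowSymbol r ξ : ℝ) : ℂ) * (𝓕 g : L2) ξ := by
    rw [sub_eq_add_neg, FourierTransform.fourier_add, FourierTransform.fourier_neg,
      ← sub_eq_add_neg]
    filter_upwards [h, Lp.coeFn_sub (𝓕 g : L2) (𝓕 g₁ : L2)] with ξ h1 h2
    rw [h2, Pi.sub_apply, h1]
    push_cast
    ring
  have key : ∀ z : ℝ, 0 < z → (1 - (1 + z)⁻¹) ^ 2 ≤ min 1 (z ^ k) ∧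
      z ^ k * (1 + z)⁻¹ ^ 2 ≤ min 1 (z ^ k) := by
    intro z hz
    have e1 : (1 - (1 + z)⁻¹) ^ 2 = z ^ 2 / (1 + z) ^ 2 := by field_simp; ring
    have e2 : z ^ k * (1 + z)⁻¹ ^ 2 = z ^ k / (1 + z) ^ 2 := by field_simp
    rw [e1, e2]
    refine ⟨le_min ?_ ?_, le_min ?_ ?_⟩ <;> rw [div_le_iff₀ (by positivity)] <;>
      rcases hk with rfl | rfl <;> nlinarith [sq_nonneg z, mul_pos hz hz, pow_pos hz 3, pow_pos hz 4]
  refine add_le_add ?_ ?_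
  · refine lintegral_mono_ae ?_
    filter_upwards [hsub] with ξ hξ
    rw [hξ, Real.rpow_zero, ENNReal.ofReal_one, one_mul, enorm_mul, mul_pow]
    gcongr
    rw [← ofReal_norm, Complex.norm_real, ← ENNReal.ofReal_pow (norm_nonneg _), Real.norm_eq_abs,
      sq_abs]
    exact ENNReal.ofReal_le_ofReal (key _ (mul_pos hr (weight_pos ξ))).1
  · rw [← lintegral_const_mul' _ _ ENNReal.ofReal_ne_top]
    refine lintegral_mono_ae ?_
    filter_upwards [h] with ξ hξ
    have hw := weight_pos ξ
    rw [hξ, enorm_mul, mul_pow, ← mul_assoc, ← mul_assoc]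
    gcongr
    rw [← ofReal_norm, Complex.norm_real, ← ENNReal.ofReal_pow (norm_nonneg _), Real.norm_eq_abs,
      sq_abs, ← ENNReal.ofReal_mul (by positivity), ← ENNReal.ofReal_mul (by positivity),
      Real.rpow_natCast, ← mul_pow]
    exact ENNReal.ofReal_le_ofReal (key _ (mul_pos hr hw)).2

theorem lintegral_interp_planeSobolevNorm (g : L2) {k : ℕ} (hk : k ≠ 0) {s : ℝ} (hs : 0 < s) :
    ∫⁻ r in Ioi (0 : ℝ), (∫⁻ ξ, ENNReal.ofReal (min 1 ((r * weight ξ) ^ k)) *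
        ‖(𝓕 g : L2) ξ‖ₑ ^ 2) * ENNReal.ofReal (r ^ (-s - 1)) =
      interpConst k s * planeSobolevNorm s g ^ 2 := by
  rw [planeSobolevNorm_sq]
  exact lintegral_interp volume measurable_weight (fun ξ => (weight_pos ξ).le)
    (Lp.aestronglyMeasurable _) hk hs

/-- Interpolation between `L²` and `H^k` for linear maps on Schwartz functions, with a constant that
does not depend on the exponent. -/
theorem planeSobolevNorm_interp {k : ℕ} (hk : k = 1 ∨ k = 2) (S : 𝓢(Plane, ℂ) → L2)
    (hS : ∀ φ ψ, S (φ - ψ) = S φ - S ψ) {M : ℝ≥0∞}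
    (h0 : ∀ φ, planeSobolevNorm 0 (S φ) ≤ M * planeSobolevNorm 0 (φ.toLp 2))
    (h1 : ∀ φ, planeSobolevNorm k (S φ) ≤ M * planeSobolevNorm k (φ.toLp 2))
    {s : ℝ} (hs : 0 ≤ s) (hsk : s ≤ k) (φ : 𝓢(Plane, ℂ)) :
    planeSobolevNorm s (S φ) ≤ 2 * M * planeSobolevNorm s (φ.toLp 2) := by
  have h2 : ∀ x : ℝ≥0∞, M * x ≤ 2 * M * x := fun x => by
    rw [mul_assoc, two_mul]; exact le_self_add
  rcases hs.eq_or_lt with rfl | hs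
  · exact (h0 φ).trans (h2 _)
  rcases hsk.eq_or_lt with rfl | hsk
  · exact (h1 φ).trans (h2 _)
  have hk0 : k ≠ 0 := by rcases hk with rfl | rfl <;> norm_num
  have key := interp_weighted volume measurable_weight (fun ξ => (weight_pos ξ).le)
    (H := (𝓕 (S φ) : L2)) (Lp.aestronglyMeasurable _) hk0 hs (Φ := fun r => M ^ 2 *
      (2 * ∫⁻ ξ, ENNReal.ofReal (min 1 ((r * weight ξ) ^ k)) * ‖(𝓕 (φ.toLp 2) : L2) ξ‖ₑ ^ 2))
    (fun r hr => by
      obtain ⟨φ₁, hφ₁⟩ := exists_isLowPart_schwartz hr φ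
      refine ⟨(𝓕 (S (φ - φ₁)) : L2), (𝓕 (S φ₁) : L2), Lp.aestronglyMeasurable _, ?_, ?_⟩
      · have e : S φ = S (φ - φ₁) + S φ₁ := by rw [hS]; abel
        nth_rewrite 1 [e]
        rw [FourierTransform.fourier_add]
        exact Lp.coeFn_add _ _
      · refine le_trans ?_ (mul_le_mul_right (hφ₁.split_le hr hk) (M ^ 2))
        have e0 := h0 (φ - φ₁)
        have e1 := h1 φ₁
        rw [← sq_le_sq_iff_ennreal, mul_pow] at e0 e1
        have e2 : (φ - φ₁).toLp 2 volume = φ.toLp 2 volume - φ₁.toLp 2 volume :=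
          map_sub (toLpCLM ℝ ℂ 2 (volume : Measure Plane)) φ φ₁
        rw [planeSobolevNorm_zero ((φ - φ₁).toLp 2 volume), e2] at e0
        rw [planeSobolevNorm_sq] at e0
        rw [planeSobolevNorm_sq _ (S φ₁)] at e1
        simp only [Real.rpow_zero, ENNReal.ofReal_one, one_mul, Real.rpow_natCast] at e0 e1
        rw [mul_add]
        refine add_le_add e0 ?_
        rw [mul_left_comm]
        gcongr)
  -- One factor `2` comes from `interp_weighted`, the other from `IsLowPart.split_le`; together they
  -- are the square of the `2` in the conclusion.
  have e : ∀ r, 2 * (M ^ 2 * (2 * ∫⁻ ξ, ENNReal.ofReal (min 1 ((r * weight ξ) ^ k)) *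
      ‖(𝓕 (φ.toLp 2) : L2) ξ‖ₑ ^ 2)) * ENNReal.ofReal (r ^ (-s - 1)) = (2 * M) ^ 2 *
      ((∫⁻ ξ, ENNReal.ofReal (min 1 ((r * weight ξ) ^ k)) *
        ‖(𝓕 (φ.toLp 2) : L2) ξ‖ₑ ^ 2) * ENNReal.ofReal (r ^ (-s - 1))) := fun r => by ring
  simp only [e] at key
  -- For infinite `M` the right-hand side can still be `⊤ * 0 = 0`; in that case the bound at
  -- exponent zero forces `S φ = 0`.
  by_cases hM : M = ⊤
  · by_cases hz : planeSobolevNorm s (φ.toLp 2 volume) = 0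
    · have hz0 : planeSobolevNorm 0 (φ.toLp 2 volume) = 0 :=
        le_antisymm ((planeSobolevNorm_mono hs.le _).trans hz.le) bot_le
      have := h0 φ
      rw [hz0, mul_zero, planeSobolevNorm_zero] at this
      have h3 : S φ = 0 := by simpa using this
      have h4 := planeSobolevNorm_smul s 0 (0 : L2)
      rw [h3]
      simp only [smul_zero, enorm_zero, zero_mul] at h4
      rw [h4]
      exact bot_le
    · rw [hM, ENNReal.mul_top (by norm_num), ENNReal.top_mul hz]
      exact le_top
  · rw [lintegral_const_mul' _ _ (by finiteness), lintegral_interp_planeSobolevNorm _ hk0 hs,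
      ← planeSobolevNorm_sq, mul_left_comm,
      ENNReal.mul_le_mul_iff_right (interpConst_ne_zero k s) (interpConst_ne_top hs hsk),
      ← mul_pow, sq_le_sq_iff_ennreal] at key
    exact key

/-! ### Averages of directional integrals over arcs -/

theorem continuous_fourier_of_integrable {h : Plane → ℂ} (hi : Integrable h) :
    Continuous (𝓕 h) :=
  VectorFourier.fourierIntegral_continuous Real.continuous_fourierChar continuous_inner hi

/-- Both transforms have the same pairing with test functions. This makes Plancherel's theorem
available for transforms given by integrals. -/
theorem fourier_toLp_ae {h : Plane → ℂ} (hi : Integrable h) (h2 : MemLp h 2 volume) :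
    (𝓕 (h2.toLp h : L2) : L2) =ᵐ[volume] 𝓕 h := by
  refine ae_eq_of_integral_contDiff_smul_eq (locallyIntegrable_L2 _)
    (continuous_fourier_of_integrable hi).locallyIntegrable fun χ hχ hs => ?_
  obtain ⟨φ, hφ⟩ := exists_schwartz_eq_ofReal hχ hs
  calc ∫ x, χ x • (𝓕 (h2.toLp h : L2) : L2) x = ∫ x, φ x * (𝓕 (h2.toLp h : L2) : L2) x := by
        simp [hφ]
    _ = ∫ x, (𝓕 φ : 𝓢(Plane, ℂ)) x * h x := by
        rw [integral_fourier_mul]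
        refine integral_congr_ae ?_
        filter_upwards [h2.coeFn_toLp] with x hx
        rw [hx]
    _ = ∫ x, φ x * 𝓕 h x := by
        simpa using! VectorFourier.integral_bilin_fourierIntegral_eq_flip
          (ContinuousLinearMap.mul ℂ ℂ) (L := innerₗ Plane) (μ := volume) (ν := volume)
          Real.continuous_fourierChar continuous_inner φ.integrable hi
    _ = _ := by simp [hφ]

theorem eLpNorm_fourier_eq {h : Plane → ℂ} (hi : Integrable h) (h2 : MemLp h 2 volume) :
    eLpNorm (𝓕 h) 2 volume = eLpNorm h 2 volume := by
  rw [← eLpNorm_congr_ae (fourier_toLp_ae hi h2), ← Lp.enorm_def, ← ofReal_norm,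
    Lp.norm_fourier_eq, ofReal_norm, enorm_toLp]

/-- A smooth cutoff that equals one on `[-3, 3]`. -/
def cutBump : ContDiffBump (0 : ℝ) := ⟨3, 4, by norm_num, by norm_num⟩

/-- A smooth cutoff that equals one on `[-3, 3]`, as a Schwartz function. -/
def cut : 𝓢(ℝ, ℂ) :=
  HasCompactSupport.toSchwartzMap (f := fun t => (cutBump t : ℂ))
    (cutBump.hasCompactSupport.comp_left (g := fun r : ℝ => (r : ℂ)) (by simp))
    (Complex.ofRealCLM.contDiff.comp cutBump.contDiff)

theorem cut_apply (t : ℝ) : cut t = (cutBump t : ℂ) := rfl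

theorem cut_eq_one {t : ℝ} (ht : |t| ≤ 3) : cut t = 1 := by
  rw [cut_apply, cutBump.one_of_mem_closedBall]
  · simp
  · simpa [cutBump] using ht

theorem exists_fourier_cut_bound : ∃ C : ℝ, 0 < C ∧ ∀ u, ‖(𝓕 cut : 𝓢(ℝ, ℂ)) u‖ ≤ C / (1 + u ^ 2) := by
  obtain ⟨C₀, h0⟩ := (𝓕 cut : 𝓢(ℝ, ℂ)).decay 0 0
  obtain ⟨C₂, h2⟩ := (𝓕 cut : 𝓢(ℝ, ℂ)).decay 2 0
  refine ⟨C₀ + C₂, by linarith [h0.1, h2.1], fun u => ?_⟩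
  rw [le_div_iff₀ (by positivity)]
  have e0 := h0.2 u
  have e2 := h2.2 u
  simp at e0 e2
  nlinarith

theorem dir_norm (θ : ℝ) : ‖dir θ‖ = 1 := by
  have : ‖dir θ‖ ^ 2 = 1 := by rw [norm_sq_eq]; simp [dir]
  nlinarith [norm_nonneg (dir θ)]

theorem contDiff_dir : ContDiff ℝ ∞ dir := by
  rw [contDiff_euclidean]
  intro i
  fin_cases i <;> simp [dir] <;> fun_prop

theorem continuous_dir : Continuous dir := contDiff_dir.continuous

/-- On `[0, π]` the sine is nonnegative and `-arctan (ρ cos θ)` is a primitive, so a half period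
contributes `2 arctan ρ < π`. -/
theorem integral_abs_sin_div (ρ : ℝ) (hρ : 0 ≤ ρ) :
    ∫ θ in (0 : ℝ)..2 * Real.pi, |ρ * Real.sin θ| / (1 + (ρ * Real.cos θ) ^ 2) ≤ 2 * Real.pi := by
  set F : ℝ → ℝ := fun θ => |ρ * Real.sin θ| / (1 + (ρ * Real.cos θ) ^ 2) with hF
  have hc : Continuous F := by
    refine Continuous.div (by fun_prop) (by fun_prop) fun θ => by positivity
  have hper : Function.Periodic F Real.pi := by
    intro θ
    simp [hF, Real.sin_add_pi, Real.cos_add_pi]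
  have h1 : ∫ θ in (0 : ℝ)..Real.pi, F θ ≤ Real.pi := by
    have hd : ∀ θ ∈ uIcc 0 Real.pi, HasDerivAt (fun θ => - Real.arctan (ρ * Real.cos θ)) (F θ) θ := by
      intro θ hθ
      rw [uIcc_of_le Real.pi_pos.le] at hθ
      have hs : 0 ≤ Real.sin θ := Real.sin_nonneg_of_mem_Icc hθ
      have := ((((Real.hasDerivAt_cos θ).const_mul ρ).arctan)).neg
      convert! this using 1
      simp only [hF]
      rw [abs_of_nonneg (by positivity)]
      ring
    rw [intervalIntegral.integral_eq_sub_of_hasDerivAt hd (hc.intervalIntegrable _ _)]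
    simp only [Real.cos_pi, Real.cos_zero, mul_neg, mul_one, Real.arctan_neg, neg_neg, sub_neg_eq_add]
    linarith [Real.arctan_lt_pi_div_two ρ]
  have h2 : ∫ θ in Real.pi..2 * Real.pi, F θ = ∫ θ in (0 : ℝ)..Real.pi, F θ := by
    have := hper.intervalIntegral_add_eq Real.pi 0
    rw [zero_add] at this
    rw [← this]
    ring_nf
  rw [← intervalIntegral.integral_add_adjacent_intervals (hc.intervalIntegrable 0 Real.pi)
    (hc.intervalIntegrable _ _), h2]
  linarith

theorem exists_polar (ξ : Plane) : ∃ ρ α : ℝ, 0 ≤ ρ ∧ ρ = ‖ξ‖ ∧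
    ∀ θ, inner ℝ (dir θ) ξ = ρ * Real.cos (θ - α) := by
  refine ⟨‖ξ‖, Complex.arg ⟨ξ 0, ξ 1⟩, norm_nonneg _, rfl, fun θ => ?_⟩
  set z : ℂ := ⟨ξ 0, ξ 1⟩ with hz
  have hn : ‖z‖ = ‖ξ‖ := by
    rw [← sq_eq_sq₀ (norm_nonneg _) (norm_nonneg _), norm_sq_eq, Complex.sq_norm,
      Complex.normSq_apply]
    simp [hz]; ring
  have h0 : ‖ξ‖ * Real.cos (Complex.arg z) = ξ 0 := by
    rw [← hn, Complex.norm_mul_cos_arg]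
  have h1 : ‖ξ‖ * Real.sin (Complex.arg z) = ξ 1 := by
    rw [← hn, Complex.norm_mul_sin_arg]
  rw [Real.cos_sub, EuclideanSpace.inner_eq_star_dotProduct]
  simp [dir, dotProduct, Fin.sum_univ_two]
  rw [← h0, ← h1]
  ring

/-- The directions almost orthogonal to `ξ` fill a set of length `O(1/|ξ|)`. Where `|sin θ| ≥ 1/2`,
the factor `ρ` is at most `2 ρ |sin θ|` and the previous integral applies; elsewhere `cos² θ ≥ 3/4`
and the integrand is at most `2`. In total `2 · 2π + 2 · 2π`. -/
theorem norm_mul_integral_le (ξ : Plane) :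
    ‖ξ‖ * ∫ θ in (0 : ℝ)..2 * Real.pi, (1 + (inner ℝ (dir θ) ξ) ^ 2)⁻¹ ≤ 8 * Real.pi := by
  obtain ⟨ρ, α, hρ, hρξ, h⟩ := exists_polar ξ
  simp only [h, ← hρξ]
  have hper : Function.Periodic (fun θ => (1 + (ρ * Real.cos θ) ^ 2)⁻¹) (2 * Real.pi) := by
    intro θ
    simp
  have e1 := intervalIntegral.integral_comp_sub_right (a := 0) (b := 2 * Real.pi)
    (fun θ => (1 + (ρ * Real.cos θ) ^ 2)⁻¹) α
  have e2 := hper.intervalIntegral_add_eq (0 - α) 0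
  rw [zero_add, show 0 - α + 2 * Real.pi = 2 * Real.pi - α by ring] at e2
  rw [e1, e2, ← intervalIntegral.integral_const_mul]
  have hp := Real.pi_pos
  have hc1 : Continuous fun θ => ρ * (1 + (ρ * Real.cos θ) ^ 2)⁻¹ :=
    continuous_const.mul (Continuous.inv₀ (by fun_prop) fun θ => by positivity)
  have hc2 : Continuous fun θ => |ρ * Real.sin θ| / (1 + (ρ * Real.cos θ) ^ 2) :=
    Continuous.div (by fun_prop) (by fun_prop) fun θ => by positivity
  calc ∫ θ in (0 : ℝ)..2 * Real.pi, ρ * (1 + (ρ * Real.cos θ) ^ 2)⁻¹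
      ≤ ∫ θ in (0 : ℝ)..2 * Real.pi, (2 * (|ρ * Real.sin θ| / (1 + (ρ * Real.cos θ) ^ 2)) + 2) := by
        refine intervalIntegral.integral_mono_on (by positivity) (hc1.intervalIntegrable _ _)
          (((hc2.const_mul 2).add continuous_const).intervalIntegrable _ _) fun θ _ => ?_
        have h0 : 0 < 1 + (ρ * Real.cos θ) ^ 2 := by positivity
        rw [← div_eq_mul_inv, ← mul_div_assoc, div_add' _ _ _ h0.ne', div_le_div_iff_of_pos_right h0,
          abs_mul, abs_of_nonneg hρ]
        have hsc := Real.sin_sq_add_cos_sq θ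
        by_cases hs : 1 / 2 ≤ |Real.sin θ|
        · nlinarith [mul_le_mul_of_nonneg_left hs hρ]
        · have hs2 : (Real.sin θ) ^ 2 ≤ 1 / 4 := by
            rw [← sq_abs]; nlinarith [abs_nonneg (Real.sin θ)]
          have : 3 / 4 * ρ ^ 2 ≤ (ρ * Real.cos θ) ^ 2 := by
            rw [mul_pow]; nlinarith [sq_nonneg ρ]
          nlinarith [sq_nonneg (ρ - 1), mul_nonneg hρ (abs_nonneg (Real.sin θ))]
    _ = 2 * (∫ θ in (0 : ℝ)..2 * Real.pi, |ρ * Real.sin θ| / (1 + (ρ * Real.cos θ) ^ 2)) +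
          2 * (2 * Real.pi) := by
        rw [intervalIntegral.integral_add ((hc2.const_mul 2).intervalIntegrable _ _)
          (continuous_const.intervalIntegrable _ _), intervalIntegral.integral_const_mul]
        simp; ring
    _ ≤ _ := by linarith [integral_abs_sin_div ρ hρ]

/-- The Fourier transform of the arc `{t v_θ : 0 ≤ θ ≤ a}` with the cutoff in `t`. -/
def arcSymbol (a : ℝ) (ξ : Plane) : ℂ :=
  ∫ θ in (0 : ℝ)..a, (𝓕 cut : 𝓢(ℝ, ℂ)) (inner ℝ (dir θ) ξ)

theorem continuous_arcSymbol (a : ℝ) : Continuous (arcSymbol a) := by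
  unfold arcSymbol
  refine intervalIntegral.continuous_parametric_intervalIntegral_of_continuous' ?_ 0 a
  have := continuous_dir
  have h2 := (𝓕 cut : 𝓢(ℝ, ℂ)).continuous
  fun_prop

/-- Decay of order one holds for every arc at once, because the integrand is dominated by a positive
function that can be integrated over the full circle. -/
theorem exists_arcSymbol_bound : ∃ C : ℝ, 0 < C ∧ ∀ a ∈ Icc 0 (2 * Real.pi), ∀ ξ : Plane,
    ‖ξ‖ * ‖arcSymbol a ξ‖ ≤ C ∧ ‖arcSymbol a ξ‖ ≤ C := by
  obtain ⟨C, hC, h⟩ := exists_fourier_cut_bound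
  have hp := Real.pi_pos
  refine ⟨C * (8 * Real.pi), by positivity, fun a ha ξ => ?_⟩
  have hci : Continuous fun θ => (1 + (inner ℝ (dir θ) ξ) ^ 2)⁻¹ := by
    have := continuous_dir
    exact Continuous.inv₀ (by fun_prop) fun θ => by positivity
  have hb : ‖arcSymbol a ξ‖ ≤ C * ∫ θ in (0 : ℝ)..2 * Real.pi, (1 + (inner ℝ (dir θ) ξ) ^ 2)⁻¹ := by
    rw [← intervalIntegral.integral_const_mul]
    have h1 : ‖arcSymbol a ξ‖ ≤ ∫ θ in (0 : ℝ)..a, C * (1 + (inner ℝ (dir θ) ξ) ^ 2)⁻¹ := by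
      refine intervalIntegral.norm_integral_le_of_norm_le ha.1 (ae_of_all _ fun θ _ => ?_)
        ((hci.const_mul C).intervalIntegrable _ _)
      simpa [div_eq_mul_inv] using h (inner ℝ (dir θ) ξ)
    refine h1.trans ?_
    refine intervalIntegral.integral_mono_interval le_rfl ha.1 ha.2
      (ae_of_all _ fun θ => by positivity) ((hci.const_mul C).intervalIntegrable _ _)
  constructor
  · calc ‖ξ‖ * ‖arcSymbol a ξ‖ ≤ ‖ξ‖ * (C * ∫ θ in (0 : ℝ)..2 * Real.pi,
          (1 + (inner ℝ (dir θ) ξ) ^ 2)⁻¹) := by gcongr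
      _ = C * (‖ξ‖ * ∫ θ in (0 : ℝ)..2 * Real.pi, (1 + (inner ℝ (dir θ) ξ) ^ 2)⁻¹) := by ring
      _ ≤ _ := mul_le_mul_of_nonneg_left (norm_mul_integral_le ξ) hC.le
  · refine hb.trans ?_
    gcongr
    calc ∫ θ in (0 : ℝ)..2 * Real.pi, (1 + (inner ℝ (dir θ) ξ) ^ 2)⁻¹
        ≤ ∫ θ in (0 : ℝ)..2 * Real.pi, (1 : ℝ) := by
          refine intervalIntegral.integral_mono_on (by positivity) (hci.intervalIntegrable _ _)
            (continuous_const.intervalIntegrable _ _) fun θ _ => ?_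
          refine inv_le_one_of_one_le₀ ?_
          nlinarith [sq_nonneg (inner ℝ (dir θ) ξ)]
      _ ≤ _ := by simp; linarith

/-- The smoothly cut off integral of `∂ᵢ f` over the arc `0 ≤ θ ≤ a` of directions. -/
def arcOp (i : Fin 2) (a : ℝ) (f : 𝓢(Plane, ℂ)) (x : Plane) : ℂ :=
  ∫ θ in (0 : ℝ)..a, ∫ t : ℝ, cut t * (∂_{basisVec i} f : 𝓢(Plane, ℂ)) (x + t • dir θ)

/-- Once the function is written as a Fourier integral, Fubini's theorem does the rest: the
`t`-integral of the character against `cut` is the transform of `cut` at `dir θ · ξ`. -/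
theorem arcOp_eq_fourier (i : Fin 2) {a : ℝ} (ha : 0 ≤ a) (φ : 𝓢(Plane, ℂ)) (x : Plane) :
    arcOp i a (𝓕 φ) x = 𝓕 (fun ξ => - (freq i ξ * φ ξ * arcSymbol a ξ)) x := by
  obtain ⟨ψ, hψ, hd⟩ := lineDerivOp_fourier_apply i φ
  unfold arcOp
  rw [hd]
  have e1 : ∀ θ t : ℝ, cut t * (-(𝓕 ψ : 𝓢(Plane, ℂ))) (x + t • dir θ) =
      ∫ ξ, - ((Real.fourierChar (-(inner ℝ ξ x)) : ℂ) * ψ ξ *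
        ((Real.fourierChar (-(t * inner ℝ (dir θ) ξ)) : ℂ) * cut t)) := by
    intro θ t
    rw [integral_neg, neg_apply, SchwartzMap.fourier_coe, Real.fourier_eq, mul_neg,
      ← integral_const_mul]
    congr 1
    refine integral_congr_ae (ae_of_all _ fun ξ => ?_)
    simp only [Circle.smul_def, smul_eq_mul]
    rw [inner_add_right, inner_smul_right, neg_add, AddChar.map_add_eq_mul, Circle.coe_mul,
      real_inner_comm ξ (dir θ)]
    ring
  have hcI : ∀ θ, Integrable (fun p : ℝ × Plane => - ((Real.fourierChar (-(inner ℝ p.2 x)) : ℂ) * ψ p.2 *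
        ((Real.fourierChar (-(p.1 * inner ℝ (dir θ) p.2)) : ℂ) * cut p.1))) (volume.prod volume) := by
    intro θ
    refine Integrable.mono' ((cut.integrable (μ := volume)).norm.mul_prod
      (ψ.integrable (μ := volume)).norm) ?_
      (ae_of_all _ fun p => ?_)
    · refine Continuous.aestronglyMeasurable ?_
      have h1 := ψ.continuous
      have h2 := cut.continuous
      have h3 := Real.continuous_fourierChar
      fun_prop
    · rw [norm_neg, norm_mul, norm_mul, norm_mul, Circle.norm_coe, Circle.norm_coe, one_mul,
        one_mul, mul_comm]
  have e2 : ∀ θ : ℝ, ∫ t : ℝ, cut t * (-(𝓕 ψ : 𝓢(Plane, ℂ))) (x + t • dir θ) =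
      ∫ ξ, - ((Real.fourierChar (-(inner ℝ ξ x)) : ℂ) * ψ ξ *
        (𝓕 cut : 𝓢(ℝ, ℂ)) (inner ℝ (dir θ) ξ)) := by
    intro θ
    simp_rw [e1]
    rw [integral_integral_swap (hcI θ)]
    refine integral_congr_ae (ae_of_all _ fun ξ => ?_)
    beta_reduce
    rw [integral_neg, integral_const_mul, SchwartzMap.fourier_coe, Real.fourier_eq]
    simp only [Circle.smul_def, smul_eq_mul]
    congr 2
    refine integral_congr_ae (ae_of_all _ fun t => ?_)
    simp [mul_comm]
  simp_rw [e2]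
  rw [intervalIntegral.integral_of_le ha, integral_integral_swap]
  · rw [Real.fourier_eq]
    refine integral_congr_ae (ae_of_all _ fun ξ => ?_)
    beta_reduce
    rw [integral_neg, integral_const_mul, ← intervalIntegral.integral_of_le ha, hψ]
    simp only [Circle.smul_def, smul_eq_mul, arcSymbol]
    ring
  · obtain ⟨C, hC, hb⟩ := exists_fourier_cut_bound
    have hconst : Integrable (fun _ : ℝ => C) (volume.restrict (Ioc 0 a)) := by
      rw [integrable_const_iff]; right; exact ⟨by simp⟩
    refine Integrable.mono' (hconst.mul_prod (ψ.integrable (μ := volume)).norm) ?_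
      (ae_of_all _ fun p => ?_)
    · refine Continuous.aestronglyMeasurable ?_
      have h1 := ψ.continuous
      have h2 := (𝓕 cut : 𝓢(ℝ, ℂ)).continuous
      have h3 := Real.continuous_fourierChar
      have h4 := continuous_dir
      fun_prop
    · simp only [Function.uncurry, norm_neg, norm_mul, Circle.norm_coe, one_mul]
      rw [mul_comm]
      gcongr
      refine (hb _).trans (div_le_self hC.le ?_)
      nlinarith [sq_nonneg (inner ℝ (dir p.1) p.2)]

/-- Integrals of first derivatives over arcs of directions are bounded in `L²`. -/
theorem exists_arcOp_bound : ∃ C : ℝ≥0, ∀ i, ∀ a ∈ Icc 0 (2 * Real.pi), ∀ f : 𝓢(Plane, ℂ),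
    Continuous (arcOp i a f) ∧ eLpNorm (arcOp i a f) 2 volume ≤ C * eLpNorm f 2 volume := by
  obtain ⟨C, hC, hb⟩ := exists_arcSymbol_bound
  refine ⟨⟨2 * Real.pi * C, by positivity⟩, fun i a ha f => ?_⟩
  obtain ⟨φ, rfl⟩ : ∃ φ : 𝓢(Plane, ℂ), f = 𝓕 φ :=
    ⟨𝓕⁻ f, (FourierTransform.fourier_fourierInv_eq f).symm⟩
  obtain ⟨ψ, hψ, -⟩ := lineDerivOp_fourier_apply i φ
  set h : Plane → ℂ := fun ξ => - (freq i ξ * φ ξ * arcSymbol a ξ) with hh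
  have hcont : Continuous h := by
    have := continuous_freq i
    have := continuous_arcSymbol a
    have := φ.continuous
    fun_prop
  -- Mere boundedness of the arc symbol gives integrability, since `freq i * φ` is again a Schwartz
  -- function.
  have hle : ∀ ξ, ‖h ξ‖ ≤ C * ‖ψ ξ‖ := fun ξ => by
    rw [hh, hψ]
    simp only [norm_neg, norm_mul]
    nlinarith [(hb a ha ξ).2, mul_nonneg (norm_nonneg (freq i ξ)) (norm_nonneg (φ ξ))]
  -- The decay of the arc symbol cancels `|freq i ξ| ≤ 2π|ξ|`, so the multiplier is bounded
  -- uniformly in `a`.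
  have hle2 : ∀ ξ, ‖h ξ‖ ≤ (2 * Real.pi * C) * ‖φ ξ‖ := fun ξ => by
    have h1 : ‖freq i ξ‖ ≤ 2 * Real.pi * ‖ξ‖ := by
      have h3 : ‖ξ i‖ ≤ ‖ξ‖ := PiLp.norm_apply_le ξ i
      simp only [freq, norm_mul, Complex.norm_ofNat, Complex.norm_real, Complex.norm_I, mul_one,
        Real.norm_of_nonneg Real.pi_pos.le]
      gcongr
    rw [hh]
    simp only [norm_neg, norm_mul]
    calc ‖freq i ξ‖ * ‖φ ξ‖ * ‖arcSymbol a ξ‖ ≤ (2 * Real.pi * ‖ξ‖) * ‖φ ξ‖ * ‖arcSymbol a ξ‖ := by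
          gcongr
      _ = (2 * Real.pi) * (‖ξ‖ * ‖arcSymbol a ξ‖) * ‖φ ξ‖ := by ring
      _ ≤ _ := by
          gcongr
          exact (hb a ha ξ).1
  have hint : Integrable h := ((ψ.integrable (μ := volume)).norm.const_mul C).mono'
    hcont.aestronglyMeasurable (ae_of_all _ fun ξ => by simpa using hle ξ)
  have h2 : MemLp h 2 volume := (φ.memLp 2).of_le_mul (c := 2 * Real.pi * C)
    hcont.aestronglyMeasurable (ae_of_all _ hle2)
  have he : arcOp i a (𝓕 φ) = 𝓕 h := funext fun x => arcOp_eq_fourier i ha.1 φ x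
  rw [he]
  refine ⟨continuous_fourier_of_integrable hint, ?_⟩
  rw [eLpNorm_fourier_eq hint h2]
  have h3 : eLpNorm (𝓕 φ : 𝓢(Plane, ℂ)) 2 volume = eLpNorm φ 2 volume := by
    rw [← enorm_toLp_schwartz, ← enorm_toLp_schwartz, ← SchwartzMap.toLp_fourier_eq,
      ← ofReal_norm, Lp.norm_fourier_eq, ofReal_norm]
  rw [h3]
  exact eLpNorm_le_nnreal_smul_eLpNorm_of_ae_le_mul (c := ⟨2 * Real.pi * C, by positivity⟩)
    (f := h) (g := φ) (ae_of_all _ hle2) 2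

/-! ### Integrals depending smoothly on a point of the disk -/

theorem isOpen_disk : IsOpen disk := Metric.isOpen_ball

theorem measurableSet_disk : MeasurableSet disk := isOpen_disk.measurableSet

/-- Minkowski's integral inequality for a finite measure. -/
theorem eLpNorm_integral_le {X P : Type*} [MeasurableSpace X] [MeasurableSpace P]
    (μ : Measure X) [SFinite μ] (ν : Measure P) [IsFiniteMeasure ν] {G : X → P → ℂ}
    (hG : AEStronglyMeasurable (Function.uncurry G) (μ.prod ν)) {B : ℝ≥0∞}
    (hB : ∀ᵐ p ∂ν, eLpNorm (fun x => G x p) 2 μ ≤ B) :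
    eLpNorm (fun x => ∫ p, G x p ∂ν) 2 μ ≤ ν univ * B := by
  rw [← sq_le_sq_iff_ennreal, eLpNorm_two_sq]
  have hGe : AEMeasurable (fun q : X × P => ‖G q.1 q.2‖ₑ) (μ.prod ν) := hG.enorm
  calc ∫⁻ x, ‖∫ p, G x p ∂ν‖ₑ ^ 2 ∂μ
      ≤ ∫⁻ x, ν univ * ∫⁻ p, ‖G x p‖ₑ ^ 2 ∂ν ∂μ := by
        refine lintegral_mono_ae ?_
        filter_upwards [hG.prodMk_left] with x hx
        have h1 : ‖∫ p, G x p ∂ν‖ₑ ≤ ∫⁻ p, ‖G x p‖ₑ ∂ν := enorm_integral_le_lintegral_enorm _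
        -- Cauchy–Schwarz against the constant one; this is where the total mass of `ν` enters.
        have h2 := ENNReal.lintegral_mul_le_Lp_mul_Lq ν (p := 2) (q := 2)
          (by constructor <;> norm_num) hx.enorm (aemeasurable_const (b := (1 : ℝ≥0∞)))
        simp only [Pi.mul_apply, mul_one, lintegral_const, one_mul, one_pow,
          ENNReal.rpow_ofNat] at h2
        calc ‖∫ p, G x p ∂ν‖ₑ ^ 2
            ≤ ((∫⁻ p, ‖G x p‖ₑ ^ 2 ∂ν) ^ (1 / 2 : ℝ) * ν univ ^ (1 / 2 : ℝ)) ^ 2 := by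
              gcongr
              exact h1.trans h2
          _ = _ := by
              rw [mul_pow, ← ENNReal.rpow_natCast, ← ENNReal.rpow_natCast, ← ENNReal.rpow_mul,
                ← ENNReal.rpow_mul]
              norm_num
              rw [mul_comm]
    _ = ν univ * ∫⁻ p, ∫⁻ x, ‖G x p‖ₑ ^ 2 ∂μ ∂ν := by
        rw [lintegral_const_mul' _ _ (measure_ne_top _ _), lintegral_lintegral_swap]
        exact hGe.pow_const 2
    _ ≤ ν univ * ∫⁻ _, B ^ 2 ∂ν := by
        gcongr 1
        refine lintegral_mono_ae ?_
        filter_upwards [hB] with p hp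
        rw [← eLpNorm_two_sq]
        gcongr
    _ = _ := by rw [lintegral_const]; ring

theorem contDiffOn_dirDeriv {V : Type*} [NormedAddCommGroup V] [NormedSpace ℝ V] {U : Set V}
    (hU : IsOpen U) {F : V → ℂ} (hF : ContDiffOn ℝ ∞ F U) (w : V) :
    ContDiffOn ℝ ∞ (dirDeriv w F) U :=
  (hF.fderiv_of_isOpen hU (m := ∞) (by simp)).clm_apply contDiffOn_const

theorem dirDeriv_congr {V : Type*} [NormedAddCommGroup V] [NormedSpace ℝ V] {U : Set V}
    (hU : IsOpen U) {F G : V → ℂ} (h : EqOn F G U) (w : V) :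
    EqOn (dirDeriv w F) (dirDeriv w G) U := fun z hz => by
  unfold dirDeriv
  rw [(h.eventuallyEq_of_mem (hU.mem_nhds hz)).fderiv_eq]

set_option linter.unusedSectionVars false

section Param

variable {P : Type*} [NormedAddCommGroup P] [NormedSpace ℝ P] [MeasurableSpace P] [BorelSpace P]
  [SecondCountableTopology P]
  {V : Type*} [NormedAddCommGroup V] [NormedSpace ℝ V] [FiniteDimensional ℝ V] {U : Set V}

/-- The integral of `G` over the parameter. -/
def paramInt (ν : Measure P) (G : V × P → ℂ) (x : V) : ℂ := ∫ p, G (x, p) ∂ν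

/-- Functions of `(x, p)` that are smooth for `x` in the open set `U`. -/
abbrev SmoothOnProd (U : Set V) (G : V × P → ℂ) : Prop := ContDiffOn ℝ ∞ G (U ×ˢ univ)

theorem isOpen_prod_univ (hU : IsOpen U) : IsOpen (U ×ˢ (univ : Set P)) := hU.prod isOpen_univ

theorem mem_prod_univ_of_mem {x : V} (hx : x ∈ U) (p : P) : (x, p) ∈ U ×ˢ (univ : Set P) :=
  ⟨hx, mem_univ _⟩

/-- A finite measure that lives on a compact set. -/
structure CompactlyCarried (ν : Measure P) (K : Set P) : Prop where
  isCompact : IsCompact K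
  ae_mem : ∀ᵐ p ∂ν, p ∈ K

theorem SmoothOnProd.integrable {G : V × P → ℂ} (hG : SmoothOnProd U G) {ν : Measure P}
    [IsFiniteMeasure ν] {K : Set P} (hK : CompactlyCarried ν K) {x : V} (hx : x ∈ U) :
    Integrable (fun p => G (x, p)) ν := by
  have hc : Continuous fun p => G (x, p) := by
    rw [← continuousOn_univ]
    exact hG.continuousOn.comp (by fun_prop) fun p _ => mem_prod_univ_of_mem hx p
  obtain ⟨C, hC⟩ := hK.isCompact.exists_bound_of_continuousOn hc.continuousOn
  exact Integrable.of_bound hc.aestronglyMeasurable C (hK.ae_mem.mono hC)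

/-- Differentiation under the integral sign. -/
theorem SmoothOnProd.hasFDerivAt_paramInt {G : V × P → ℂ} (hG : SmoothOnProd U G)
    (hU : IsOpen U)
    {ν : Measure P} [IsFiniteMeasure ν] {K : Set P} (hK : CompactlyCarried ν K) {x : V}
    (hx : x ∈ U) :
    HasFDerivAt (paramInt ν G)
      (∫ p, (fderiv ℝ G (x, p)).comp (ContinuousLinearMap.inl ℝ V P) ∂ν) x := by
  obtain ⟨ε, hε, hball⟩ := Metric.isOpen_iff.1 hU x hx
  have hsub : Metric.closedBall x (ε / 2) ⊆ U :=
    (Metric.closedBall_subset_ball (by linarith)).trans hball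
  have hcd : ContinuousOn (fderiv ℝ G) (U ×ˢ univ) :=
    hG.continuousOn_fderiv_of_isOpen (isOpen_prod_univ hU) (by simp)
  obtain ⟨C, hC⟩ := ((isCompact_closedBall x (ε / 2)).prod hK.isCompact).exists_bound_of_continuousOn
    (hcd.mono (prod_mono hsub (subset_univ _)))
  have hci : ∀ y ∈ U, Continuous fun p => (fderiv ℝ G (y, p)) := fun y hy => by
    rw [← continuousOn_univ]
    exact hcd.comp (by fun_prop) fun p _ => mem_prod_univ_of_mem hy p
  refine hasFDerivAt_integral_of_dominated_of_fderiv_le (𝕜 := ℝ)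
    (bound := fun _ => C * ‖ContinuousLinearMap.inl ℝ V P‖)
    (F := fun y p => G (y, p))
    (F' := fun y p => (fderiv ℝ G (y, p)).comp (ContinuousLinearMap.inl ℝ V P))
    (Metric.closedBall_mem_nhds x (half_pos hε)) ?_ (hG.integrable hK hx) ?_ ?_
    (integrable_const _) ?_
  · filter_upwards [hU.mem_nhds hx] with y hy
    exact (hG.integrable hK hy).aestronglyMeasurable
  · exact ((hci x hx).clm_comp continuous_const).aestronglyMeasurable
  · filter_upwards [hK.ae_mem] with p hp y hy
    refine (ContinuousLinearMap.opNorm_comp_le _ _).trans ?_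
    gcongr
    exact hC (y, p) ⟨hy, hp⟩
  · refine ae_of_all _ fun p y hy => ?_
    have h1 : HasFDerivAt G (fderiv ℝ G (y, p)) (y, p) :=
      ((hG.contDiffAt ((isOpen_prod_univ hU).mem_nhds (mem_prod_univ_of_mem (hsub hy) p))).differentiableAt
        (by simp)).hasFDerivAt
    exact h1.comp y (hasFDerivAt_prodMk_left y p)

theorem SmoothOnProd.integrable_fderiv {G : V × P → ℂ} (hG : SmoothOnProd U G)
    (hU : IsOpen U)
    {ν : Measure P} [IsFiniteMeasure ν] {K : Set P} (hK : CompactlyCarried ν K) {x : V}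
    (hx : x ∈ U) :
    Integrable (fun p => (fderiv ℝ G (x, p)).comp (ContinuousLinearMap.inl ℝ V P)) ν := by
  have hcd : ContinuousOn (fderiv ℝ G) (U ×ˢ univ) :=
    hG.continuousOn_fderiv_of_isOpen (isOpen_prod_univ hU) (by simp)
  have hc : Continuous fun p => (fderiv ℝ G (x, p)).comp (ContinuousLinearMap.inl ℝ V P) := by
    refine Continuous.clm_comp ?_ continuous_const
    rw [← continuousOn_univ]
    exact hcd.comp (by fun_prop) fun p _ => mem_prod_univ_of_mem hx p
  obtain ⟨C, hC⟩ := hK.isCompact.exists_bound_of_continuousOn hc.continuousOn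
  exact Integrable.of_bound hc.aestronglyMeasurable C (hK.ae_mem.mono hC)

theorem SmoothOnProd.dirDeriv_paramInt {G : V × P → ℂ} (hG : SmoothOnProd U G)
    (hU : IsOpen U)
    {ν : Measure P} [IsFiniteMeasure ν] {K : Set P} (hK : CompactlyCarried ν K) {x : V}
    (hx : x ∈ U) (v : V) :
    dirDeriv v (paramInt ν G) x = paramInt ν (dirDeriv (V := V × P) (v, 0) G) x := by
  unfold dirDeriv
  rw [(hG.hasFDerivAt_paramInt hU hK hx).fderiv,
    ContinuousLinearMap.integral_apply (hG.integrable_fderiv hU hK hx)]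
  rfl

/-- A directional derivative of a parameter integral is the parameter integral of another smooth
integrand, so induction on the order applies to all integrands at once. -/
theorem SmoothOnProd.contDiffOn_paramInt {G : V × P → ℂ} (hG : SmoothOnProd U G)
    (hU : IsOpen U)
    {ν : Measure P} [IsFiniteMeasure ν] {K : Set P} (hK : CompactlyCarried ν K) :
    ContDiffOn ℝ ∞ (paramInt ν G) U := by
  rw [contDiffOn_infty]
  intro n
  induction n generalizing G with
  | zero =>
    rw [Nat.cast_zero, contDiffOn_zero]
    exact fun x hx => (hG.hasFDerivAt_paramInt hU hK hx).continuousAt.continuousWithinAt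
  | succ n ih =>
    rw [Nat.cast_succ, contDiffOn_succ_iff_fderiv_of_isOpen hU]
    refine ⟨fun x hx => (hG.hasFDerivAt_paramInt hU hK hx).differentiableAt.differentiableWithinAt,
      by simp, ?_⟩
    rw [contDiffOn_clm_apply]
    intro v
    exact (ih (contDiffOn_dirDeriv (isOpen_prod_univ hU) hG (v, 0))).congr fun x hx =>
      hG.dirDeriv_paramInt hU hK hx v

theorem SmoothOnProd.aestronglyMeasurable {G : Plane × P → ℂ} (hG : SmoothOnProd disk G)
    {ν : Measure P} [SFinite ν] :
    AEStronglyMeasurable G ((volume.restrict disk).prod ν) := by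
  have h : (volume.restrict disk).prod ν = ((volume : Measure Plane).prod ν).restrict (disk ×ˢ univ) := by
    rw [← Measure.prod_restrict, Measure.restrict_univ]
  rw [h]
  exact hG.continuousOn.aestronglyMeasurable (measurableSet_disk.prod MeasurableSet.univ)

theorem SmoothOnProd.eLpNorm_paramInt_le {G : Plane × P → ℂ} (hG : SmoothOnProd disk G)
    {ν : Measure P} [IsFiniteMeasure ν] {B : ℝ≥0∞}
    (hB : ∀ᵐ p ∂ν, eLpNorm (fun x => G (x, p)) 2 (volume.restrict disk) ≤ B) :
    eLpNorm (paramInt ν G) 2 (volume.restrict disk) ≤ ν univ * B :=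
  eLpNorm_integral_le (volume.restrict disk) ν (G := fun x p => G (x, p)) hG.aestronglyMeasurable hB

end Param

/-! ### Kernels in coordinates -/

/-- The coordinate directions of `(x₁, x₂, θ, t)`. -/
def kDir : Fin 4 → Plane × ℝ × ℝ :=
  ![(basisVec 0, 0, 0), (basisVec 1, 0, 0), (0, 1, 0), (0, 0, 1)]

/-- The partial derivatives of a kernel in coordinates. -/
def kd (j : Fin 4) (b : Plane × ℝ × ℝ → ℂ) : Plane × ℝ × ℝ → ℂ := dirDeriv (kDir j) b

theorem isOpen_coordDomain : IsOpen coordDomain := isOpen_disk.prod isOpen_univ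

theorem mem_coordDomain {z : Plane × ℝ × ℝ} : z ∈ coordDomain ↔ z.1 ∈ disk := by
  simp [coordDomain]

theorem dirDeriv_add {V : Type*} [NormedAddCommGroup V] [NormedSpace ℝ V] {w : V} {F G : V → ℂ}
    {z : V} (hF : DifferentiableAt ℝ F z) (hG : DifferentiableAt ℝ G z) :
    dirDeriv w (fun y => F y + G y) z = dirDeriv w F z + dirDeriv w G z := by
  simp only [dirDeriv]
  rw [fderiv_fun_add hF hG]
  rfl

theorem dirDeriv_mul {V : Type*} [NormedAddCommGroup V] [NormedSpace ℝ V] {w : V} {F G : V → ℂ}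
    {z : V} (hF : DifferentiableAt ℝ F z) (hG : DifferentiableAt ℝ G z) :
    dirDeriv w (fun y => F y * G y) z = dirDeriv w F z * G z + F z * dirDeriv w G z := by
  simp only [dirDeriv]
  rw [fderiv_fun_mul hF hG]
  simp
  ring

/-- Smooth kernels in coordinates, periodic in the angle. -/
structure IsKernel (b : Plane × ℝ × ℝ → ℂ) : Prop where
  smooth : ContDiffOn ℝ ∞ b coordDomain
  periodic : ∀ x ∈ disk, ∀ θ t, b (x, θ + 2 * Real.pi, t) = b (x, θ, t)

theorem IsKernel.differentiableAt {b : Plane × ℝ × ℝ → ℂ} (hb : IsKernel b) {z : Plane × ℝ × ℝ}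
    (hz : z ∈ coordDomain) : DifferentiableAt ℝ b z :=
  (hb.smooth.contDiffAt (isOpen_coordDomain.mem_nhds hz)).differentiableAt (by simp)

theorem IsKernel.kd {b : Plane × ℝ × ℝ → ℂ} (hb : IsKernel b) (j : Fin 4) : IsKernel (kd j b) where
  smooth := contDiffOn_dirDeriv isOpen_coordDomain hb.smooth _
  periodic x hx θ t := by
    have h1 : EqOn (fun z => b (z + (0, 2 * Real.pi, 0))) b coordDomain := fun z hz => by
      have h0 : z + (0, 2 * Real.pi, 0) = (z.1, z.2.1 + 2 * Real.pi, z.2.2) := by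
        ext <;> simp
      beta_reduce
      rw [h0]
      exact hb.periodic z.1 (mem_coordDomain.1 hz) z.2.1 z.2.2
    have h2 := dirDeriv_congr isOpen_coordDomain h1 (kDir j) (x := (x, θ, t))
      (mem_coordDomain.2 hx)
    simp only [dirDeriv, fderiv_comp_add_right] at h2
    simpa [DiskOp.kd, dirDeriv] using h2

theorem IsKernel.add {b c : Plane × ℝ × ℝ → ℂ} (hb : IsKernel b) (hc : IsKernel c) :
    IsKernel (fun z => b z + c z) where
  smooth := hb.smooth.add hc.smooth
  periodic x hx θ t := by rw [hb.periodic x hx, hc.periodic x hx]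

/-- All partial derivatives of `b` of order at most `K` are bounded by `M`. -/
def Bdd : ℕ → ℝ≥0∞ → (Plane × ℝ × ℝ → ℂ) → Prop
  | 0, M, b => ∀ z ∈ coordDomain, ‖b z‖ₑ ≤ M
  | K + 1, M, b => Bdd K M b ∧ ∀ j, Bdd K M (kd j b)

theorem Bdd.zero {K : ℕ} {M : ℝ≥0∞} {b : Plane × ℝ × ℝ → ℂ} (h : Bdd K M b) : Bdd 0 M b := by
  induction K with
  | zero => exact h
  | succ K ih => exact ih h.1

theorem Bdd.mono {K : ℕ} {M N : ℝ≥0∞} {b : Plane × ℝ × ℝ → ℂ} (h : Bdd K M b) (hMN : M ≤ N) :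
    Bdd K N b := by
  induction K generalizing b with
  | zero => exact fun z hz => (h z hz).trans hMN
  | succ K ih => exact ⟨ih h.1, fun j => ih (h.2 j)⟩

theorem Bdd.of_le {K L : ℕ} {M : ℝ≥0∞} {b : Plane × ℝ × ℝ → ℂ} (h : Bdd K M b) (hL : L ≤ K) :
    Bdd L M b := by
  induction K generalizing b with
  | zero => rw [Nat.le_zero.1 hL]; exact h
  | succ K ih =>
    rcases hL.eq_or_lt with rfl | hL
    · exact h
    · exact ih h.1 (Nat.lt_succ_iff.1 hL)

theorem Bdd.congr {K : ℕ} {M : ℝ≥0∞} {b c : Plane × ℝ × ℝ → ℂ} (h : Bdd K M b)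
    (hbc : EqOn c b coordDomain) : Bdd K M c := by
  induction K generalizing b c with
  | zero => exact fun z hz => by rw [hbc hz]; exact h z hz
  | succ K ih =>
    exact ⟨ih h.1 hbc, fun j => ih (h.2 j) (dirDeriv_congr isOpen_coordDomain hbc _)⟩

theorem Bdd.add {K : ℕ} {M N : ℝ≥0∞} {b c : Plane × ℝ × ℝ → ℂ} (h : Bdd K M b) (h' : Bdd K N c)
    (hb : IsKernel b) (hc : IsKernel c) : Bdd K (M + N) (fun z => b z + c z) := by
  induction K generalizing b c with
  | zero => exact fun z hz => (enorm_add_le _ _).trans (add_le_add (h z hz) (h' z hz))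
  | succ K ih =>
    exact ⟨ih h.1 h'.1 hb hc, fun j => (ih (h.2 j) (h'.2 j) (hb.kd j) (hc.kd j)).congr
      fun z hz => dirDeriv_add (hb.differentiableAt hz) (hc.differentiableAt hz)⟩

/-- Multiplication of a kernel by `cos (θ + a)`. -/
def trigMul (a : ℝ) (b : Plane × ℝ × ℝ → ℂ) : Plane × ℝ × ℝ → ℂ :=
  fun z => (Real.cos (z.2.1 + a) : ℂ) * b z

theorem contDiff_trig (a : ℝ) : ContDiff ℝ ∞ fun z : Plane × ℝ × ℝ => (Real.cos (z.2.1 + a) : ℂ) :=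
  Complex.ofRealCLM.contDiff.comp (Real.contDiff_cos.comp (by fun_prop))

theorem IsKernel.trigMul {b : Plane × ℝ × ℝ → ℂ} (hb : IsKernel b) (a : ℝ) :
    IsKernel (trigMul a b) where
  smooth := (contDiff_trig a).contDiffOn.mul hb.smooth
  periodic x hx θ t := by
    simp only [DiskOp.trigMul]
    rw [hb.periodic x hx, add_right_comm, Real.cos_add_two_pi]

theorem dirDeriv_trig (a : ℝ) (w z : Plane × ℝ × ℝ) :
    dirDeriv w (fun z : Plane × ℝ × ℝ => (Real.cos (z.2.1 + a) : ℂ)) z =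
      w.2.1 * (Real.cos (z.2.1 + (a + Real.pi / 2)) : ℂ) := by
  have h1 : HasFDerivAt (fun z : Plane × ℝ × ℝ => z.2.1 + a)
      ((ContinuousLinearMap.fst ℝ ℝ ℝ).comp (ContinuousLinearMap.snd ℝ Plane (ℝ × ℝ))) z :=
    (((ContinuousLinearMap.fst ℝ ℝ ℝ).comp
      (ContinuousLinearMap.snd ℝ Plane (ℝ × ℝ))).hasFDerivAt).add_const a
  have h2 := Complex.ofRealCLM.hasFDerivAt.comp z h1.cos
  have h3 : dirDeriv w (fun z : Plane × ℝ × ℝ => (Real.cos (z.2.1 + a) : ℂ)) z = _ :=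
    congrArg (fun L => L w) h2.fderiv
  rw [h3, ← add_assoc, Real.cos_add_pi_div_two]
  simp
  ring

theorem kd_trigMul {b : Plane × ℝ × ℝ → ℂ} (hb : IsKernel b) (a : ℝ) (j : Fin 4) :
    EqOn (kd j (trigMul a b))
      (fun z => ((kDir j).2.1 : ℂ) * trigMul (a + Real.pi / 2) b z + trigMul a (kd j b) z)
      coordDomain := fun z hz => by
  have h1 := dirDeriv_mul (w := kDir j) (((contDiff_trig a).differentiable (by simp)) z)
    (hb.differentiableAt hz)
  rw [dirDeriv_trig] at h1
  refine h1.trans ?_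
  simp only [trigMul, kd]
  ring

theorem kDir_angle (j : Fin 4) : (kDir j).2.1 = 0 ∨ (kDir j).2.1 = 1 := by
  fin_cases j <;> simp [kDir]

/-- Differentiating the cosine shifts its phase by a quarter turn and stays in the family. Each
derivative at most doubles the number of terms, whence `2 ^ K`. -/
theorem Bdd.trigMul {K : ℕ} {M : ℝ≥0∞} {b : Plane × ℝ × ℝ → ℂ} (h : Bdd K M b) (hb : IsKernel b)
    (a : ℝ) : Bdd K (2 ^ K * M) (trigMul a b) := by
  induction K generalizing b a with
  | zero =>
    intro z hz
    rw [pow_zero, one_mul]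
    simp only [DiskOp.trigMul, enorm_mul]
    refine le_trans (mul_le_of_le_one_left' ?_) (h z hz)
    rw [← ofReal_norm, Complex.norm_real, ENNReal.ofReal_le_one]
    exact Real.abs_cos_le_one _
  | succ K ih =>
    have hle : 2 ^ K * M ≤ 2 ^ (K + 1) * M := by
      gcongr
      · norm_num
      · omega
    refine ⟨(ih h.1 hb a).mono hle, fun j => ?_⟩
    rcases kDir_angle j with hj | hj
    · refine ((ih (h.2 j) (hb.kd j) a).mono hle).congr fun z hz => ?_
      rw [kd_trigMul hb a j hz, hj]
      simp
    · refine (((ih h.1 hb (a + Real.pi / 2)).add (ih (h.2 j) (hb.kd j) a)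
        (hb.trigMul _) ((hb.kd j).trigMul _)).mono (le_of_eq (by ring))).congr fun z hz => ?_
      rw [kd_trigMul hb a j hz, hj]
      simp

/-! ### Radial means and Taylor's formula in `t` -/

/-- The measure `dτ` on `[0, 1]`. -/
abbrev unitMeas : Measure ℝ := volume.restrict (Ioc 0 1)

theorem compactlyCarried_unitMeas : CompactlyCarried unitMeas (Icc (0 : ℝ) 1) where
  isCompact := isCompact_Icc
  ae_mem := (ae_restrict_mem measurableSet_Ioc).mono fun _ h => Ioc_subset_Icc_self h

/-- The integrand `τ ^ n h(x, θ, τ t)`. -/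
def radInt (n : ℕ) (h : Plane × ℝ × ℝ → ℂ) (q : (Plane × ℝ × ℝ) × ℝ) : ℂ :=
  (q.2 : ℂ) ^ n * h (q.1.1, q.1.2.1, q.2 * q.1.2.2)

/-- The kernel `∫₀¹ τ ^ n h(x, θ, τ t) dτ`. -/
def radMean (n : ℕ) (h : Plane × ℝ × ℝ → ℂ) : Plane × ℝ × ℝ → ℂ := paramInt unitMeas (radInt n h)

theorem IsKernel.smoothOnProd_radInt {h : Plane × ℝ × ℝ → ℂ} (hh : IsKernel h) (n : ℕ) :
    SmoothOnProd coordDomain (radInt n h) := by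
  refine ContDiffOn.mul ?_ ?_
  · exact ((Complex.ofRealCLM.contDiff.comp contDiff_snd).pow n).contDiffOn
  · exact hh.smooth.comp (t := coordDomain) (ContDiff.contDiffOn (by fun_prop)) fun q hq =>
      mem_coordDomain.2 (mem_coordDomain.1 hq.1)

theorem IsKernel.radMean {h : Plane × ℝ × ℝ → ℂ} (hh : IsKernel h) (n : ℕ) :
    IsKernel (radMean n h) where
  smooth := (hh.smoothOnProd_radInt n).contDiffOn_paramInt isOpen_coordDomain
    compactlyCarried_unitMeas
  periodic x hx θ t := by
    simp only [DiskOp.radMean, paramInt, radInt]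
    simp_rw [hh.periodic x hx]

theorem dirDeriv_radInt {h : Plane × ℝ × ℝ → ℂ} (hh : IsKernel h) (n : ℕ) (w : Plane × ℝ × ℝ)
    {q : (Plane × ℝ × ℝ) × ℝ} (hq : q.1 ∈ coordDomain) :
    dirDeriv (V := (Plane × ℝ × ℝ) × ℝ) (w, 0) (radInt n h) q =
      (q.2 : ℂ) ^ n * dirDeriv (V := Plane × ℝ × ℝ) (w.1, w.2.1, q.2 * w.2.2) h
        (q.1.1, q.1.2.1, q.2 * q.1.2.2) := by
  have hz : (q.1.1, q.1.2.1, q.2 * q.1.2.2) ∈ coordDomain :=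
    mem_coordDomain.2 (mem_coordDomain.1 hq)
  have h0 : HasDerivAt (fun s : ℝ => q + s • ((w, 0) : (Plane × ℝ × ℝ) × ℝ)) (w, 0) 0 := by
    simpa using ((hasDerivAt_id (0 : ℝ)).smul_const ((w, 0) : (Plane × ℝ × ℝ) × ℝ)).const_add q
  have hd : DifferentiableAt ℝ (radInt n h) q :=
    (((hh.smoothOnProd_radInt n).contDiffAt
      ((isOpen_prod_univ isOpen_coordDomain).mem_nhds ⟨hq, mem_univ _⟩))).differentiableAt (by simp)
  have hA : HasDerivAt (fun s : ℝ => radInt n h (q + s • ((w, 0) : (Plane × ℝ × ℝ) × ℝ)))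
      (dirDeriv (V := (Plane × ℝ × ℝ) × ℝ) (w, 0) (radInt n h) q) 0 := by
    have hd' : HasFDerivAt (radInt n h) (fderiv ℝ (radInt n h) q)
      (q + (0 : ℝ) • ((w, 0) : (Plane × ℝ × ℝ) × ℝ)) := by simpa using hd.hasFDerivAt
    exact hd'.comp_hasDerivAt 0 h0
  have h1 : HasDerivAt (fun s : ℝ => ((q.1.1, q.1.2.1, q.2 * q.1.2.2) : Plane × ℝ × ℝ) +
      s • (w.1, w.2.1, q.2 * w.2.2)) (w.1, w.2.1, q.2 * w.2.2) 0 := by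
    have h2 := ((hasDerivAt_id (0 : ℝ)).smul_const
      ((w.1, w.2.1, q.2 * w.2.2) : Plane × ℝ × ℝ)).const_add
        ((q.1.1, q.1.2.1, q.2 * q.1.2.2) : Plane × ℝ × ℝ)
    rwa [one_smul] at h2
  have hd2 : HasFDerivAt h (fderiv ℝ h (q.1.1, q.1.2.1, q.2 * q.1.2.2))
      (((q.1.1, q.1.2.1, q.2 * q.1.2.2) : Plane × ℝ × ℝ) +
        (0 : ℝ) • (w.1, w.2.1, q.2 * w.2.2)) := by
    simpa using (hh.differentiableAt hz).hasFDerivAt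
  have hB := (hd2.comp_hasDerivAt 0 h1).const_mul ((q.2 : ℂ) ^ n)
  refine hA.unique (hB.congr_of_eventuallyEq (Eventually.of_forall fun s => ?_))
  simp only [radInt, Function.comp]
  congr 2
  · simp
  · ext <;> simp <;> ring

/-- A derivative in `t` produces a factor `τ` by the chain rule and raises the exponent; the other
derivatives leave it unchanged. This is why `radMean` carries a power of `τ`. -/
theorem kd_radMean {h : Plane × ℝ × ℝ → ℂ} (hh : IsKernel h) (n : ℕ) (j : Fin 4) :
    ∃ n', EqOn (kd j (radMean n h)) (radMean n' (kd j h)) coordDomain := by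
  have key : ∀ z ∈ coordDomain, kd j (radMean n h) z =
      paramInt unitMeas (dirDeriv (V := (Plane × ℝ × ℝ) × ℝ) (kDir j, 0) (radInt n h)) z :=
    fun z hz => (hh.smoothOnProd_radInt n).dirDeriv_paramInt isOpen_coordDomain
      compactlyCarried_unitMeas hz _
  have hcase : (kDir j).2.2 = 0 ∨ kDir j = (0, 0, 1) := by fin_cases j <;> simp [kDir]
  rcases hcase with hj | hj
  · refine ⟨n, fun z hz => ?_⟩
    rw [key z hz]
    unfold radMean paramInt
    congr 1
    ext τ
    have h1 : (((kDir j).1, (kDir j).2.1, τ * (kDir j).2.2) : Plane × ℝ × ℝ) = kDir j := by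
      ext <;> simp [hj]
    exact (dirDeriv_radInt hh n (kDir j) (q := (z, τ)) hz).trans (by rw [h1]; rfl)
  · refine ⟨n + 1, fun z hz => ?_⟩
    rw [key z hz]
    unfold radMean paramInt
    congr 1
    ext τ
    have h1 : (((kDir j).1, (kDir j).2.1, τ * (kDir j).2.2) : Plane × ℝ × ℝ) = τ • kDir j := by
      rw [hj]; simp
    refine (dirDeriv_radInt hh n (kDir j) (q := (z, τ)) hz).trans ?_
    rw [h1]
    simp only [radInt, kd, dirDeriv, map_smul, pow_succ, Complex.real_smul]
    ring

theorem Bdd.radMean {K : ℕ} {M : ℝ≥0∞} {h : Plane × ℝ × ℝ → ℂ} (hM : Bdd K M h) (hh : IsKernel h)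
    (n : ℕ) : Bdd K M (radMean n h) := by
  induction K generalizing h n with
  | zero =>
    intro z hz
    have h1 : ‖DiskOp.radMean n h z‖ₑ ≤ ∫⁻ τ in Ioc (0 : ℝ) 1, M := by
      refine (enorm_integral_le_lintegral_enorm _).trans ?_
      refine setLIntegral_mono measurable_const fun τ hτ => ?_
      rw [radInt, enorm_mul]
      refine le_trans (mul_le_of_le_one_left' ?_) (hM _ (mem_coordDomain.2 (mem_coordDomain.1 hz)))
      rw [enorm_pow]
      refine pow_le_one₀ zero_le ?_
      rw [← ofReal_norm, Complex.norm_real, ENNReal.ofReal_le_one, Real.norm_of_nonneg hτ.1.le]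
      exact hτ.2
    simpa using h1
  | succ K ih =>
    refine ⟨ih hM.1 hh n, fun j => ?_⟩
    obtain ⟨n', h'⟩ := kd_radMean hh n j
    exact (ih (hM.2 j) (hh.kd j) n').congr h'

/-- Taylor's formula in the last variable. -/
theorem sub_eq_mul_radMean {b : Plane × ℝ × ℝ → ℂ} (hb : IsKernel b) {x : Plane} (hx : x ∈ disk)
    (θ t : ℝ) : b (x, θ, t) - b (x, θ, 0) = t * radMean 0 (kd 3 b) (x, θ, t) := by
  have hd : ∀ τ : ℝ, HasDerivAt (fun τ : ℝ => b (x, θ, τ * t)) (t * kd 3 b (x, θ, τ * t)) τ := by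
    intro τ
    have h1 : HasDerivAt (fun τ : ℝ => ((x, θ, τ * t) : Plane × ℝ × ℝ)) (0, 0, t) τ := by
      refine (hasDerivAt_const τ x).prodMk ((hasDerivAt_const τ θ).prodMk ?_)
      simpa using (hasDerivAt_id τ).mul_const t
    have h2 := (hb.differentiableAt (z := (x, θ, τ * t))
      (mem_coordDomain.2 hx)).hasFDerivAt.comp_hasDerivAt τ h1
    have h3 : ((0, 0, t) : Plane × ℝ × ℝ) = t • (0, 0, 1) := by simp
    rw [h3, map_smul, Complex.real_smul] at h2
    exact h2
  have hc : Continuous fun τ : ℝ => (t : ℂ) * kd 3 b (x, θ, τ * t) := by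
    refine continuous_const.mul ?_
    rw [← continuousOn_univ]
    exact (hb.kd 3).smooth.continuousOn.comp (by fun_prop) fun τ _ => mem_coordDomain.2 hx
  have h3 := intervalIntegral.integral_eq_sub_of_hasDerivAt (a := 0) (b := 1)
    (fun τ _ => hd τ) (hc.intervalIntegrable _ _)
  simp only [one_mul, zero_mul] at h3
  rw [← h3, intervalIntegral.integral_const_mul, intervalIntegral.integral_of_le zero_le_one]
  simp [radMean, paramInt, radInt]

/-! ### Integral operators along lines -/

theorem schwartz_lineDeriv (f : 𝓢(Plane, ℂ)) (i : Fin 2) (x : Plane) :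
    (∂_{basisVec i} f : 𝓢(Plane, ℂ)) x = fderiv ℝ f x (basisVec i) :=
  SchwartzMap.lineDerivOp_apply_eq_fderiv _ _ _

theorem schwartz_hasFDerivAt (f : 𝓢(Plane, ℂ)) (x : Plane) : HasFDerivAt f (fderiv ℝ f x) x :=
  f.differentiableAt.hasFDerivAt

/-- Functions that vanish outside the closed ball of radius two. -/
def SuppTwo (f : Plane → ℂ) : Prop := ∀ x, 2 < ‖x‖ → f x = 0

theorem SuppTwo.lineDeriv {f : 𝓢(Plane, ℂ)} (hf : SuppTwo f) (i : Fin 2) :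
    SuppTwo (∂_{basisVec i} f : 𝓢(Plane, ℂ)) := fun x hx => by
  have h : (f : Plane → ℂ) =ᶠ[𝓝 x] fun _ => 0 := by
    filter_upwards [(isOpen_lt continuous_const continuous_norm).mem_nhds hx] with y hy
    exact hf y hy
  rw [schwartz_lineDeriv, h.fderiv_eq]
  simp

theorem lt_norm_add_smul_dir {x : Plane} (hx : x ∈ disk) (θ : ℝ) {t : ℝ} (ht : 3 ≤ |t|) :
    2 < ‖x + t • dir θ‖ := by
  have h1 : ‖x‖ < 1 := by simpa [disk] using hx
  have h2 : ‖t • dir θ‖ = |t| := by rw [norm_smul, dir_norm, mul_one, Real.norm_eq_abs]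
  have h3 := norm_sub_norm_le (t • dir θ) (-x)
  rw [norm_neg, sub_neg_eq_add, add_comm (t • dir θ), h2] at h3
  linarith

theorem hasDerivAt_dir (θ : ℝ) : HasDerivAt dir (dir (θ + Real.pi / 2)) θ := by
  have h : ∀ θ, dir θ = Real.cos θ • basisVec 0 + Real.sin θ • basisVec 1 := fun θ => by
    ext i
    fin_cases i <;> simp [dir, basisVec]
  rw [h (θ + _), Real.cos_add_pi_div_two, Real.sin_add_pi_div_two]
  refine HasDerivAt.congr_of_eventuallyEq ?_ (Eventually.of_forall h)
  exact ((Real.hasDerivAt_cos θ).smul_const _).add ((Real.hasDerivAt_sin θ).smul_const _)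

/-- The phase shifts with `dir θ j = cos (θ + shift j)`. -/
def shift : Fin 2 → ℝ := ![0, -(Real.pi / 2)]

/-- The parts along and across the ray: applied to `f (x + t • dir θ)`, the first is a
`t`-derivative and the second, multiplied by `t`, is a `θ`-derivative. -/
theorem basisVec_eq_dir (j : Fin 2) (θ : ℝ) :
    basisVec j = Real.cos (θ + shift j) • dir θ +
      Real.cos (θ + (shift j + Real.pi / 2)) • dir (θ + Real.pi / 2) := by
  have h := Real.sin_sq_add_cos_sq θ
  ext i
  fin_cases j <;> fin_cases i <;>
    simp [basisVec, shift, dir, Real.cos_add_pi_div_two, Real.sin_add_pi_div_two,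
      ← sub_eq_add_neg, Real.cos_sub_pi_div_two] <;> nlinarith

theorem hasDerivAt_line (f : 𝓢(Plane, ℂ)) (x : Plane) (θ t : ℝ) :
    HasDerivAt (fun t : ℝ => f (x + t • dir θ)) (fderiv ℝ f (x + t • dir θ) (dir θ)) t := by
  have h : HasDerivAt (fun t : ℝ => x + t • dir θ) (dir θ) t := by
    simpa using ((hasDerivAt_id t).smul_const (dir θ)).const_add x
  exact (schwartz_hasFDerivAt f _).comp_hasDerivAt t h

theorem hasDerivAt_arc (f : 𝓢(Plane, ℂ)) (x : Plane) (θ t : ℝ) :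
    HasDerivAt (fun θ : ℝ => f (x + t • dir θ))
      (t * fderiv ℝ f (x + t • dir θ) (dir (θ + Real.pi / 2))) θ := by
  have h : HasDerivAt (fun θ : ℝ => x + t • dir θ) (t • dir (θ + Real.pi / 2)) θ :=
    ((hasDerivAt_dir θ).const_smul t).const_add x
  have h2 := (schwartz_hasFDerivAt f _).comp_hasDerivAt θ h
  rw [map_smul, Complex.real_smul] at h2
  exact h2

theorem IsKernel.hasDerivAt_t {b : Plane × ℝ × ℝ → ℂ} (hb : IsKernel b) {x : Plane} (hx : x ∈ disk)
    (θ t : ℝ) : HasDerivAt (fun t => b (x, θ, t)) (DiskOp.kd 3 b (x, θ, t)) t := by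
  have h1 : HasDerivAt (fun t : ℝ => ((x, θ, t) : Plane × ℝ × ℝ)) (0, 0, 1) t :=
    (hasDerivAt_const t x).prodMk ((hasDerivAt_const t θ).prodMk (hasDerivAt_id t))
  exact (hb.differentiableAt (z := (x, θ, t))
    (mem_coordDomain.2 hx)).hasFDerivAt.comp_hasDerivAt t h1

theorem IsKernel.hasDerivAt_angle {b : Plane × ℝ × ℝ → ℂ} (hb : IsKernel b) {x : Plane}
    (hx : x ∈ disk) (θ t : ℝ) :
    HasDerivAt (fun θ => b (x, θ, t)) (DiskOp.kd 2 b (x, θ, t)) θ := by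
  have h1 : HasDerivAt (fun θ : ℝ => ((x, θ, t) : Plane × ℝ × ℝ)) (0, 1, 0) θ :=
    (hasDerivAt_const θ x).prodMk ((hasDerivAt_id θ).prodMk (hasDerivAt_const θ t))
  exact (hb.differentiableAt (z := (x, θ, t))
    (mem_coordDomain.2 hx)).hasFDerivAt.comp_hasDerivAt θ h1

/-- The measure `dθ dt` on the box `[0, 2π] × [-3, 3]`. -/
abbrev boxMeas : Measure (ℝ × ℝ) :=
  (volume.restrict (Ioc 0 (2 * Real.pi))).prod (volume.restrict (Ioc (-3) 3))

theorem compactlyCarried_boxMeas :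
    CompactlyCarried boxMeas (Icc 0 (2 * Real.pi) ×ˢ Icc (-3 : ℝ) 3) where
  isCompact := isCompact_Icc.prod isCompact_Icc
  ae_mem := by
    rw [boxMeas, Measure.prod_restrict]
    exact (ae_restrict_mem (measurableSet_Ioc.prod measurableSet_Ioc)).mono fun _ h =>
      prod_mono Ioc_subset_Icc_self Ioc_subset_Icc_self h

theorem integrable_boxMeas {g : ℝ × ℝ → ℂ} (hg : Continuous g) : Integrable g boxMeas := by
  obtain ⟨C, hC⟩ := compactlyCarried_boxMeas.isCompact.exists_bound_of_continuousOn
    hg.continuousOn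
  exact Integrable.of_bound hg.aestronglyMeasurable C (compactlyCarried_boxMeas.ae_mem.mono hC)

/-- The integrand of the operator with kernel `b`. -/
def kInt (b : Plane × ℝ × ℝ → ℂ) (f : Plane → ℂ) (z : Plane × ℝ × ℝ) : ℂ :=
  b z * f (z.1 + z.2.2 • dir z.2.1)

/-- The operator with kernel `b` in coordinates. -/
def kOp (b : Plane × ℝ × ℝ → ℂ) (f : Plane → ℂ) : Plane → ℂ := paramInt boxMeas (kInt b f)

theorem contDiff_ray : ContDiff ℝ ∞ fun z : Plane × ℝ × ℝ => z.1 + z.2.2 • dir z.2.1 := by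
  have := contDiff_dir
  fun_prop

theorem IsKernel.smoothOnProd_kInt {b : Plane × ℝ × ℝ → ℂ} (hb : IsKernel b) (f : 𝓢(Plane, ℂ)) :
    SmoothOnProd disk (kInt b f) :=
  hb.smooth.mul ((f.smooth ⊤).comp contDiff_ray).contDiffOn

theorem IsKernel.continuous_kInt {b : Plane × ℝ × ℝ → ℂ} (hb : IsKernel b) (f : 𝓢(Plane, ℂ))
    {x : Plane} (hx : x ∈ disk) : Continuous fun p => kInt b f (x, p) := by
  rw [← continuousOn_univ]
  exact (hb.smoothOnProd_kInt f).continuousOn.comp (by fun_prop) fun p _ =>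
    mem_prod_univ_of_mem hx p

theorem IsKernel.contDiffOn_kOp {b : Plane × ℝ × ℝ → ℂ} (hb : IsKernel b) (f : 𝓢(Plane, ℂ)) :
    ContDiffOn ℝ ∞ (kOp b f) disk :=
  (hb.smoothOnProd_kInt f).contDiffOn_paramInt isOpen_disk compactlyCarried_boxMeas

theorem kOp_add_left {b c : Plane × ℝ × ℝ → ℂ} (hb : IsKernel b) (hc : IsKernel c)
    (f : 𝓢(Plane, ℂ)) {x : Plane} (hx : x ∈ disk) :
    kOp (fun z => b z + c z) f x = kOp b f x + kOp c f x := by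
  simp only [kOp, paramInt]
  rw [← integral_add (integrable_boxMeas (hb.continuous_kInt f hx))
    (integrable_boxMeas (hc.continuous_kInt f hx))]
  simp only [kInt, add_mul]

/-- The index of the `i`-th space variable. -/
abbrev spaceIdx (i : Fin 2) : Fin 4 := Fin.castAdd 2 i

theorem kDir_spaceIdx (i : Fin 2) : kDir (spaceIdx i) = (basisVec i, 0, 0) := by
  fin_cases i <;> rfl

theorem dirDeriv_kOp {b : Plane × ℝ × ℝ → ℂ} (hb : IsKernel b) (f : 𝓢(Plane, ℂ)) (i : Fin 2)
    {x : Plane} (hx : x ∈ disk) :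
    dirDeriv (basisVec i) (kOp b f) x =
      kOp (kd (spaceIdx i) b) f x + kOp b (∂_{basisVec i} f : 𝓢(Plane, ℂ)) x := by
  have h1 : dirDeriv (basisVec i) (kOp b f) x = _ :=
    (hb.smoothOnProd_kInt f).dirDeriv_paramInt isOpen_disk compactlyCarried_boxMeas hx _
  rw [h1]
  simp only [kOp, paramInt]
  rw [← integral_add (integrable_boxMeas ((hb.kd _).continuous_kInt f hx))
    (integrable_boxMeas (hb.continuous_kInt _ hx))]
  congr 1
  ext p
  have h3 := dirDeriv_mul (w := (basisVec i, (0 : ℝ × ℝ)))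
    (hb.differentiableAt (z := (x, p)) (mem_coordDomain.2 hx))
    ((((f.smooth ⊤).comp contDiff_ray).differentiable (by simp)) (x, p))
  refine h3.trans ?_
  simp only [kInt, kd, kDir_spaceIdx, schwartz_lineDeriv, Function.comp]
  congr 2
  have hr : HasFDerivAt (fun z : Plane × ℝ × ℝ => z.1 + z.2.2 • dir z.2.1) _ (x, p) :=
    ((contDiff_ray.differentiable (by simp)) (x, p)).hasFDerivAt
  have h5 : HasDerivAt (fun s : ℝ => ((x, p) : Plane × ℝ × ℝ) + s • (basisVec i, (0 : ℝ × ℝ)))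
      (basisVec i, 0) 0 := by
    have := ((hasDerivAt_id (0 : ℝ)).smul_const ((basisVec i, 0) : Plane × ℝ × ℝ)).const_add
      ((x, p) : Plane × ℝ × ℝ)
    rwa [one_smul] at this
  have hy : HasFDerivAt (fun z : Plane × ℝ × ℝ => f (z.1 + z.2.2 • dir z.2.1))
      (fderiv ℝ (fun z : Plane × ℝ × ℝ => f (z.1 + z.2.2 • dir z.2.1)) (x, p))
      ((x, p) + (0 : ℝ) • ((basisVec i, (0 : ℝ × ℝ)) : Plane × ℝ × ℝ)) := by
    rw [zero_smul, add_zero]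
    exact ((((f.smooth ⊤).comp contDiff_ray).differentiable (by simp)) (x, p)).hasFDerivAt
  have h6 := hy.comp_hasDerivAt 0 h5
  have h7 : HasDerivAt (fun s : ℝ => (x + p.2 • dir p.1) + s • basisVec i) (basisVec i) 0 := by
    have := ((hasDerivAt_id (0 : ℝ)).smul_const (basisVec i)).const_add (x + p.2 • dir p.1)
    rwa [one_smul] at this
  have h8 : HasFDerivAt f (fderiv ℝ f (x + p.2 • dir p.1))
      ((x + p.2 • dir p.1) + (0 : ℝ) • basisVec i) := by
    simpa using schwartz_hasFDerivAt f (x + p.2 • dir p.1)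
  have h9 := h8.comp_hasDerivAt 0 h7
  refine h6.unique (h9.congr_of_eventuallyEq (Eventually.of_forall fun s => ?_))
  simp only [Function.comp]
  congr 1
  simp only [Prod.fst_add, Prod.smul_fst, Prod.snd_add, Prod.smul_snd, smul_zero, add_zero]
  abel

theorem eLpNorm_mul_le_of_enorm_le {X : Type*} [MeasurableSpace X] {μ : Measure X} {c f : X → ℂ}
    {M : ℝ≥0∞} (hc : ∀ᵐ x ∂μ, ‖c x‖ₑ ≤ M) (hf : AEStronglyMeasurable f μ) :
    eLpNorm (fun x => c x * f x) 2 μ ≤ M * eLpNorm f 2 μ := by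
  rw [← sq_le_sq_iff_ennreal, mul_pow, eLpNorm_two_sq, eLpNorm_two_sq,
    ← lintegral_const_mul'' _ (hf.enorm.pow_const 2)]
  refine lintegral_mono_ae ?_
  filter_upwards [hc] with x hx
  rw [enorm_mul, mul_pow]
  gcongr

/-- For fixed `(θ, t)` the integrand is a translate of `f` times a bounded function of `x`;
Minkowski's inequality sums over the box. -/
theorem eLpNorm_kOp_le {b : Plane × ℝ × ℝ → ℂ} (hb : IsKernel b) {M : ℝ≥0∞} (hM : Bdd 0 M b)
    (f : 𝓢(Plane, ℂ)) :
    eLpNorm (kOp b f) 2 (volume.restrict disk) ≤ boxMeas univ * (M * eLpNorm f 2 volume) := by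
  refine (hb.smoothOnProd_kInt f).eLpNorm_paramInt_le (ae_of_all _ fun p => ?_)
  have hmp : MeasurePreserving (fun x : Plane => x + p.2 • dir p.1) volume volume :=
    measurePreserving_add_right volume _
  have h1 : eLpNorm (fun x : Plane => f (x + p.2 • dir p.1)) 2 volume = eLpNorm f 2 volume :=
    eLpNorm_comp_measurePreserving f.continuous.aestronglyMeasurable hmp
  refine (eLpNorm_mul_le_of_enorm_le (M := M) ?_ ?_).trans ?_
  · filter_upwards [ae_restrict_mem measurableSet_disk] with x hx
    exact hM (x, p) (mem_coordDomain.2 hx)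
  · exact (f.continuous.comp (continuous_id.add (continuous_const (y := p.2 • dir p.1)))
      ).aestronglyMeasurable
  · gcongr
    exact (eLpNorm_mono_measure _ Measure.restrict_le_self).trans h1.le

/-- The restriction of a kernel to `t = 0`. -/
def bZero (b : Plane × ℝ × ℝ → ℂ) : Plane × ℝ × ℝ → ℂ := fun z => b (z.1, z.2.1, 0)

theorem IsKernel.bZero {b : Plane × ℝ × ℝ → ℂ} (hb : IsKernel b) : IsKernel (bZero b) where
  smooth := hb.smooth.comp (t := coordDomain) (ContDiff.contDiffOn (by fun_prop)) fun _ hz =>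
    mem_coordDomain.2 (mem_coordDomain.1 hz)
  periodic x hx θ _ := hb.periodic x hx θ 0

/-- The first remainder kernel in `kOp b (∂ⱼ f)`. -/
def remOne (j : Fin 2) (b : Plane × ℝ × ℝ → ℂ) : Plane × ℝ × ℝ → ℂ := trigMul (shift j) (kd 3 b)

/-- The second remainder kernel in `kOp b (∂ⱼ f)`. -/
def remTwo (j : Fin 2) (b : Plane × ℝ × ℝ → ℂ) : Plane × ℝ × ℝ → ℂ :=
  kd 2 (trigMul (shift j + Real.pi / 2) (radMean 0 (kd 3 b)))

theorem IsKernel.remOne {b : Plane × ℝ × ℝ → ℂ} (hb : IsKernel b) (j : Fin 2) :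
    IsKernel (remOne j b) := (hb.kd 3).trigMul _

theorem IsKernel.remTwo {b : Plane × ℝ × ℝ → ℂ} (hb : IsKernel b) (j : Fin 2) :
    IsKernel (remTwo j b) := (((hb.kd 3).radMean 0).trigMul _).kd 2

theorem Bdd.remOne {K : ℕ} {M : ℝ≥0∞} {b : Plane × ℝ × ℝ → ℂ} (h : Bdd (K + 1) M b)
    (hb : IsKernel b) (j : Fin 2) : Bdd K (2 ^ K * M) (remOne j b) := (h.2 3).trigMul (hb.kd 3) _

theorem Bdd.remTwo {K : ℕ} {M : ℝ≥0∞} {b : Plane × ℝ × ℝ → ℂ} (h : Bdd (K + 2) M b)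
    (hb : IsKernel b) (j : Fin 2) : Bdd K (2 ^ (K + 1) * M) (remTwo j b) :=
  ((((h.2 3 : Bdd (K + 1) M _).radMean (hb.kd 3) 0).trigMul ((hb.kd 3).radMean 0) _)).2 2

theorem integral_boxMeas_deriv_t {F F' : ℝ → ℝ → ℂ} (hF' : Continuous fun p : ℝ × ℝ => F' p.1 p.2)
    (hd : ∀ θ t, HasDerivAt (F θ) (F' θ t) t) (h : ∀ θ, F θ 3 = F θ (-3)) :
    ∫ p, F' p.1 p.2 ∂boxMeas = 0 := by
  rw [integral_prod _ (integrable_boxMeas hF')]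
  refine integral_eq_zero_of_ae (ae_of_all _ fun θ => ?_)
  have h1 := intervalIntegral.integral_eq_sub_of_hasDerivAt (a := -3) (b := 3)
    (fun t _ => hd θ t) ((hF'.comp (by fun_prop : Continuous fun t : ℝ => (θ, t))).intervalIntegrable
      _ _)
  rw [h θ, sub_self, intervalIntegral.integral_of_le (by norm_num)] at h1
  exact h1

theorem integral_boxMeas_deriv_angle {F F' : ℝ → ℝ → ℂ}
    (hF' : Continuous fun p : ℝ × ℝ => F' p.1 p.2)
    (hd : ∀ θ t, HasDerivAt (fun θ => F θ t) (F' θ t) θ) (h : ∀ t, F (2 * Real.pi) t = F 0 t) :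
    ∫ p, F' p.1 p.2 ∂boxMeas = 0 := by
  rw [integral_prod_symm _ (integrable_boxMeas hF')]
  refine integral_eq_zero_of_ae (ae_of_all _ fun t => ?_)
  have h1 := intervalIntegral.integral_eq_sub_of_hasDerivAt (a := 0) (b := 2 * Real.pi)
    (fun θ _ => hd θ t) ((hF'.comp (by fun_prop : Continuous fun θ : ℝ => (θ, t))).intervalIntegrable
      _ _)
  rw [h t, sub_self, intervalIntegral.integral_of_le Real.two_pi_pos.le] at h1
  exact h1

theorem dir_two_pi : dir (2 * Real.pi) = dir 0 := by simp [dir]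

theorem IsKernel.continuous_slice {b : Plane × ℝ × ℝ → ℂ} (hb : IsKernel b) {x : Plane}
    (hx : x ∈ disk) : Continuous fun p : ℝ × ℝ => b (x, p) := by
  rw [← continuousOn_univ]
  exact hb.smooth.continuousOn.comp (by fun_prop) fun p _ => mem_coordDomain.2 hx

theorem continuous_fderiv_ray (f : 𝓢(Plane, ℂ)) (x : Plane) {w : ℝ × ℝ → Plane}
    (hw : Continuous w) :
    Continuous fun p : ℝ × ℝ => fderiv ℝ f (x + p.2 • dir p.1) (w p) := by
  have h := (f.smooth 1).continuous_fderiv (by simp)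
  have := continuous_dir
  exact (h.comp (by fun_prop)).clm_apply hw

/-- Integration by parts in `t` and in the angle removes the derivative from `f`, up to the part of
the kernel at `t = 0`. -/
theorem kOp_lineDeriv {b : Plane × ℝ × ℝ → ℂ} (hb : IsKernel b) {f : 𝓢(Plane, ℂ)} (hf : SuppTwo f)
    (j : Fin 2) {x : Plane} (hx : x ∈ disk) :
    kOp b (∂_{basisVec j} f : 𝓢(Plane, ℂ)) x =
      kOp (bZero b) (∂_{basisVec j} f : 𝓢(Plane, ℂ)) x - kOp (remOne j b) f x
        - kOp (remTwo j b) f x := by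
  have hk := hb.kd 3
  have hr := hk.radMean 0
  have ht := hr.trigMul (shift j + Real.pi / 2)
  have hcd := continuous_dir
  have c1 := hb.continuous_slice hx
  have c2 := hb.bZero.continuous_slice hx
  have c3 := hk.continuous_slice hx
  have c4 := (ht.kd 2).continuous_slice hx
  have c5 := ht.continuous_slice hx
  have cf : Continuous fun p : ℝ × ℝ => f (x + p.2 • dir p.1) := f.continuous.comp (by fun_prop)
  -- the two total derivatives
  let F₁ : ℝ → ℝ → ℂ := fun θ t =>
    (Real.cos (θ + shift j) : ℂ) * ((b (x, θ, t) - bZero b (x, θ, t)) * f (x + t • dir θ))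
  let F₁' : ℝ → ℝ → ℂ := fun θ t => (Real.cos (θ + shift j) : ℂ) * (kd 3 b (x, θ, t) *
    f (x + t • dir θ) + (b (x, θ, t) - bZero b (x, θ, t)) * fderiv ℝ f (x + t • dir θ) (dir θ))
  let B : Plane × ℝ × ℝ → ℂ := trigMul (shift j + Real.pi / 2) (radMean 0 (kd 3 b))
  let F₂' : ℝ → ℝ → ℂ := fun θ t => kd 2 B (x, θ, t) * f (x + t • dir θ) +
    B (x, θ, t) * (t * fderiv ℝ f (x + t • dir θ) (dir (θ + Real.pi / 2)))
  have C₁ : Continuous fun p : ℝ × ℝ => F₁' p.1 p.2 := by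
    refine Continuous.mul (by fun_prop) (Continuous.add (c3.mul cf) ((c1.sub c2).mul ?_))
    exact continuous_fderiv_ray f x (w := fun p => dir p.1) (by fun_prop)
  have C₂ : Continuous fun p : ℝ × ℝ => F₂' p.1 p.2 := by
    refine (c4.mul cf).add (c5.mul (Continuous.mul (by fun_prop) ?_))
    exact continuous_fderiv_ray f x (w := fun p => dir (p.1 + Real.pi / 2)) (by fun_prop)
  -- No boundary terms arise: at `t = ±3` the ray has left the ball of radius two, and in the angle
  -- everything is periodic.
  have I₁ : ∫ p, F₁' p.1 p.2 ∂boxMeas = 0 := by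
    refine integral_boxMeas_deriv_t (F := F₁) C₁ (fun θ t => ?_) fun θ => ?_
    · exact (((hb.hasDerivAt_t hx θ t).sub_const (b (x, θ, 0))).mul
        (hasDerivAt_line f x θ t)).const_mul (Real.cos (θ + shift j) : ℂ)
    · simp only [F₁]
      rw [hf _ (lt_norm_add_smul_dir hx θ (by norm_num)),
        hf _ (lt_norm_add_smul_dir hx θ (by norm_num))]
      simp only [mul_zero]
  have I₂ : ∫ p, F₂' p.1 p.2 ∂boxMeas = 0 := by
    refine integral_boxMeas_deriv_angle
      (F := fun θ t => B (x, θ, t) * f (x + t • dir θ)) C₂ (fun θ t => ?_) fun t => ?_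
    · exact (ht.hasDerivAt_angle hx θ t).mul (hasDerivAt_arc f x θ t)
    · have := ht.periodic x hx 0 t
      rw [zero_add] at this
      rw [dir_two_pi]
      exact congrArg (· * _) this
  -- With `b - bZero b = t * radMean 0 (kd 3 b)`, the factor `t` turns the derivative across the ray
  -- into a `θ`-derivative.
  have key : ∀ p : ℝ × ℝ, kInt b (∂_{basisVec j} f : 𝓢(Plane, ℂ)) (x, p) =
      kInt (bZero b) (∂_{basisVec j} f : 𝓢(Plane, ℂ)) (x, p) - kInt (remOne j b) f (x, p)
        - kInt (remTwo j b) f (x, p) + F₁' p.1 p.2 + F₂' p.1 p.2 := by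
    rintro ⟨θ, t⟩
    have h1 := sub_eq_mul_radMean hb hx θ t
    have h2 : fderiv ℝ f (x + t • dir θ) (basisVec j) = _ :=
      congrArg _ (basisVec_eq_dir j θ)
    rw [map_add, map_smul, map_smul, Complex.real_smul, Complex.real_smul] at h2
    simp only [kInt, schwartz_lineDeriv, F₁', F₂', B, remOne, remTwo, trigMul, bZero]
    rw [h2, h1]
    linear_combination ((Real.cos (θ + shift j) : ℂ) * fderiv ℝ f (x + t • dir θ) (dir θ) +
      (Real.cos (θ + (shift j + Real.pi / 2)) : ℂ) *
        fderiv ℝ f (x + t • dir θ) (dir (θ + Real.pi / 2))) * h1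
  have i1 := integrable_boxMeas (hb.bZero.continuous_kInt (∂_{basisVec j} f : 𝓢(Plane, ℂ)) hx)
  have i2 := integrable_boxMeas ((hb.remOne j).continuous_kInt f hx)
  have i3 := integrable_boxMeas ((hb.remTwo j).continuous_kInt f hx)
  have j1 := integrable_boxMeas C₁
  have j2 := integrable_boxMeas C₂
  simp only [kOp, paramInt]
  simp_rw [key]
  refine (integral_add (((i1.sub i2).sub i3).add j1) j2).trans ?_
  rw [integral_add' ((i1.sub i2).sub i3) j1, integral_sub' (i1.sub i2) i3, integral_sub' i1 i2,
    I₁, I₂, add_zero, add_zero]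

/-! ### `L²` estimates for the operators -/

/-- The smoothly cut off integral of `∂ᵢ f` over the line through `x` with direction `dir θ`. -/
def lineInt (i : Fin 2) (f : 𝓢(Plane, ℂ)) (x : Plane) (θ : ℝ) : ℂ :=
  ∫ t : ℝ, cut t * (∂_{basisVec i} f : 𝓢(Plane, ℂ)) (x + t • dir θ)

theorem continuous_lineInt (i : Fin 2) (f : 𝓢(Plane, ℂ)) :
    Continuous fun q : Plane × ℝ => lineInt i f q.1 q.2 := by
  set g : 𝓢(Plane, ℂ) := ∂_{basisVec i} f with hg
  obtain ⟨C, hC⟩ := g.decay 0 0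
  have hd := continuous_dir
  refine continuous_of_dominated (bound := fun t => ‖cut t‖ * C) (fun q => ?_) (fun q => ?_) ?_ ?_
  · refine Continuous.aestronglyMeasurable (cut.continuous.mul (g.continuous.comp ?_))
    fun_prop
  · refine ae_of_all _ fun t => ?_
    rw [norm_mul]
    gcongr
    simpa using hC.2 (q.1 + t • dir q.2)
  · exact (cut.integrable (μ := volume)).norm.mul_const C
  · refine ae_of_all _ fun t => continuous_const.mul (g.continuous.comp ?_)
    fun_prop

theorem continuous_arcOp (i : Fin 2) (f : 𝓢(Plane, ℂ)) :
    Continuous fun q : Plane × ℝ => arcOp i q.2 f q.1 :=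
  intervalIntegral.continuous_parametric_primitive_of_continuous (a₀ := 0) (f := lineInt i f)
    (continuous_lineInt i f)

/-- For `x` in the disk the integrand vanishes once `|t| ≥ 3`, and `cut` equals one for `|t| ≤ 3`.
The smooth cutoff, introduced for its rapidly decaying transform, is therefore invisible. -/
theorem integral_line_eq_lineInt {f : 𝓢(Plane, ℂ)} (hf : SuppTwo f) (i : Fin 2) {x : Plane}
    (hx : x ∈ disk) (θ : ℝ) :
    ∫ t in Ioc (-3 : ℝ) 3, (∂_{basisVec i} f : 𝓢(Plane, ℂ)) (x + t • dir θ) = lineInt i f x θ := by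
  unfold lineInt
  rw [← setIntegral_eq_integral_of_forall_compl_eq_zero (s := Ioc (-3 : ℝ) 3) (f := fun t : ℝ =>
    cut t * (∂_{basisVec i} f : 𝓢(Plane, ℂ)) (x + t • dir θ))]
  · refine setIntegral_congr_fun measurableSet_Ioc fun t ht => ?_
    rw [cut_eq_one (abs_le.2 ⟨ht.1.le, ht.2⟩), one_mul]
  · intro t ht
    have ht' : 3 ≤ |t| := by
      by_contra! h
      exact ht ⟨(abs_lt.1 h).1, (abs_lt.1 h).2.le⟩
    simp only [hf.lineDeriv i _ (lt_norm_add_smul_dir hx θ ht'), mul_zero]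

/-- Integration by parts in `θ`, with `arcOp` as primitive of the line integral. The kernel now acts
by multiplication only, outside the translation invariant operators `arcOp`. -/
theorem kOp_bZero_lineDeriv {b : Plane × ℝ × ℝ → ℂ} (hb : IsKernel b) {f : 𝓢(Plane, ℂ)}
    (hf : SuppTwo f) (i : Fin 2) {x : Plane} (hx : x ∈ disk) :
    kOp (bZero b) (∂_{basisVec i} f : 𝓢(Plane, ℂ)) x =
      b (x, 2 * Real.pi, 0) * arcOp i (2 * Real.pi) f x -
        ∫ θ in Ioc 0 (2 * Real.pi), kd 2 b (x, θ, 0) * arcOp i θ f x := by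
  have hc : Continuous (lineInt i f x) :=
    (continuous_lineInt i f).comp (by fun_prop : Continuous fun θ : ℝ => (x, θ))
  have h1 : kOp (bZero b) (∂_{basisVec i} f : 𝓢(Plane, ℂ)) x =
      ∫ θ in (0 : ℝ)..2 * Real.pi, b (x, θ, 0) * lineInt i f x θ := by
    rw [kOp, paramInt, integral_prod _ (integrable_boxMeas (hb.bZero.continuous_kInt _ hx)),
      intervalIntegral.integral_of_le Real.two_pi_pos.le]
    refine integral_congr_ae (ae_of_all _ fun θ => ?_)
    simp only [kInt, bZero]
    rw [integral_const_mul, integral_line_eq_lineInt hf i hx]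
  rw [h1, ← intervalIntegral.integral_of_le Real.two_pi_pos.le,
    intervalIntegral.integral_mul_deriv_eq_deriv_mul (v := fun θ => arcOp i θ f x)
      (v' := lineInt i f x) (fun θ _ => hb.hasDerivAt_angle hx θ 0)
      (fun θ _ => intervalIntegral.integral_hasDerivAt_right (hc.intervalIntegrable _ _)
        hc.stronglyMeasurable.stronglyMeasurableAtFilter hc.continuousAt) ?_
      (hc.intervalIntegrable _ _)]
  · have : arcOp i 0 f x = 0 := by simp [arcOp]
    rw [this]
    ring
  · exact (((hb.kd 2).continuous_slice hx).comp
      (by fun_prop : Continuous fun θ : ℝ => (θ, (0 : ℝ)))).intervalIntegrable _ _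

theorem aestronglyMeasurable_of_contDiffOn_disk {u : Plane → ℂ} (hu : ContDiffOn ℝ ∞ u disk) :
    AEStronglyMeasurable u (volume.restrict disk) :=
  hu.continuousOn.aestronglyMeasurable measurableSet_disk

/-- Bounded multiplications after the uniformly bounded arc operators, with Minkowski's inequality
in `θ`. One derivative of the kernel, in the angle, is used. -/
theorem exists_kOp_bZero_bound : ∃ C : ℝ≥0, ∀ b, IsKernel b → ∀ M, Bdd 1 M b →
    ∀ f : 𝓢(Plane, ℂ), SuppTwo f → ∀ i,
      eLpNorm (kOp (bZero b) (∂_{basisVec i} f : 𝓢(Plane, ℂ))) 2 (volume.restrict disk) ≤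
        C * (M * eLpNorm f 2 volume) := by
  obtain ⟨C, hC⟩ := exists_arcOp_bound
  refine ⟨C + (2 * Real.pi).toNNReal * C, fun b hb M hM f hf i => ?_⟩
  have hslice : ∀ θ, Continuous fun x : Plane => ((x, θ, (0 : ℝ)) : Plane × ℝ × ℝ) :=
    fun θ => by fun_prop
  have hbc : ∀ {c : Plane × ℝ × ℝ → ℂ}, IsKernel c → ∀ θ,
      ContinuousOn (fun x : Plane => c (x, θ, 0)) disk := fun hc θ =>
    hc.smooth.continuousOn.comp (hslice θ).continuousOn fun x hx => mem_coordDomain.2 hx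
  have hacont : ∀ θ, Continuous (arcOp i θ f) := fun θ =>
    (continuous_arcOp i f).comp (by fun_prop : Continuous fun x : Plane => (x, θ))
  have hpt : ∀ {c : Plane × ℝ × ℝ → ℂ}, IsKernel c → Bdd 0 M c → ∀ θ ∈ Icc 0 (2 * Real.pi),
      eLpNorm (fun x => c (x, θ, 0) * arcOp i θ f x) 2 (volume.restrict disk) ≤
        M * (C * eLpNorm f 2 volume) := by
    intro c hc hcM θ hθ
    refine (eLpNorm_mul_le_of_enorm_le (M := M) ?_ (hacont θ).aestronglyMeasurable).trans ?_
    · filter_upwards [ae_restrict_mem measurableSet_disk] with x hx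
      exact hcM (x, θ, 0) (mem_coordDomain.2 hx)
    · gcongr
      exact (eLpNorm_mono_measure _ Measure.restrict_le_self).trans (hC i θ hθ f).2
  have hmeas : AEStronglyMeasurable (Function.uncurry fun (x : Plane) (θ : ℝ) =>
      kd 2 b (x, θ, 0) * arcOp i θ f x)
      ((volume.restrict disk).prod (volume.restrict (Ioc 0 (2 * Real.pi)))) := by
    rw [Measure.prod_restrict]
    refine ContinuousOn.aestronglyMeasurable ?_ (measurableSet_disk.prod measurableSet_Ioc)
    refine ContinuousOn.mul ?_ (continuous_arcOp i f).continuousOn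
    exact (hb.kd 2).smooth.continuousOn.comp (f := fun q : Plane × ℝ => (q.1, q.2, (0 : ℝ)))
      (by fun_prop) fun q hq => mem_coordDomain.2 hq.1
  have h2 := eLpNorm_integral_le (volume.restrict disk) (volume.restrict (Ioc 0 (2 * Real.pi)))
    hmeas (B := M * (C * eLpNorm f 2 volume))
    ((ae_restrict_mem measurableSet_Ioc).mono fun θ hθ =>
      hpt (hb.kd 2) (hM.2 2) θ (Ioc_subset_Icc_self hθ))
  have h1 := hpt hb hM.1 (2 * Real.pi) ⟨Real.two_pi_pos.le, le_rfl⟩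
  have hvol : (volume.restrict (Ioc 0 (2 * Real.pi))) univ = ((2 * Real.pi).toNNReal : ℝ≥0∞) := by
    simp [ENNReal.ofReal]
  rw [hvol] at h2
  calc eLpNorm (kOp (bZero b) (∂_{basisVec i} f : 𝓢(Plane, ℂ))) 2 (volume.restrict disk)
      = eLpNorm ((fun x => b (x, 2 * Real.pi, 0) * arcOp i (2 * Real.pi) f x) -
        fun x => ∫ θ in Ioc 0 (2 * Real.pi), kd 2 b (x, θ, 0) * arcOp i θ f x) 2
          (volume.restrict disk) := by
        refine eLpNorm_congr_ae ?_
        filter_upwards [ae_restrict_mem measurableSet_disk] with x hx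
        exact kOp_bZero_lineDeriv hb hf i hx
    _ ≤ _ := eLpNorm_sub_le (((hbc hb _).mul (hacont _).continuousOn).aestronglyMeasurable
        measurableSet_disk) hmeas.integral_prod_right' (by norm_num)
    _ ≤ M * (C * eLpNorm f 2 volume) + (2 * Real.pi).toNNReal * (M * (C * eLpNorm f 2 volume)) :=
        add_le_add h1 h2
    _ = _ := by push_cast; ring

/-! ### Kernels with vanishing principal symbol -/

/-- The principal symbol of the kernel vanishes. -/
def SymbolZero (b : Plane × ℝ × ℝ → ℂ) : Prop :=
  ∀ x ∈ disk, ∀ θ, b (x, θ, 0) + b (x, θ + Real.pi, 0) = 0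

theorem dir_add_pi (θ : ℝ) : dir (θ + Real.pi) = - dir θ := by
  ext i
  fin_cases i <;> simp [dir]

/-- Under `θ ↦ θ + π` the frozen kernel changes sign, while the integral over the line is unchanged;
the two half circles cancel. -/
theorem kOp_bZero_eq_zero {b : Plane × ℝ × ℝ → ℂ} (hb : IsKernel b) (hz : SymbolZero b)
    (f : 𝓢(Plane, ℂ)) {x : Plane} (hx : x ∈ disk) : kOp (bZero b) f x = 0 := by
  set G : ℝ → ℂ := fun θ => ∫ t in (-3 : ℝ)..3, f (x + t • dir θ) with hG
  have hGc : Continuous G := by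
    refine intervalIntegral.continuous_parametric_intervalIntegral_of_continuous' ?_ _ _
    have := continuous_dir
    exact f.continuous.comp (by fun_prop)
  have hGp : ∀ θ, G (θ + Real.pi) = G θ := by
    intro θ
    simp only [hG, dir_add_pi, smul_neg, ← neg_smul]
    rw [intervalIntegral.integral_comp_neg (fun t => f (x + t • dir θ)), neg_neg]
  have hbc : Continuous fun θ => b (x, θ, 0) :=
    (hb.continuous_slice hx).comp (by fun_prop : Continuous fun θ : ℝ => (θ, (0 : ℝ)))
  have h1 : kOp (bZero b) f x = ∫ θ in (0 : ℝ)..2 * Real.pi, b (x, θ, 0) * G θ := by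
    rw [kOp, paramInt, integral_prod _ (integrable_boxMeas (hb.bZero.continuous_kInt _ hx)),
      intervalIntegral.integral_of_le Real.two_pi_pos.le]
    refine integral_congr_ae (ae_of_all _ fun θ => ?_)
    simp only [kInt, bZero, hG]
    rw [integral_const_mul, intervalIntegral.integral_of_le (by norm_num)]
  have hint : ∀ a c, IntervalIntegrable (fun θ => b (x, θ, 0) * G θ) volume a c :=
    fun a c => (hbc.mul hGc).intervalIntegrable _ _
  have h2 := intervalIntegral.integral_comp_add_right (a := 0) (b := Real.pi)
    (fun θ => b (x, θ, 0) * G θ) Real.pi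
  rw [zero_add, ← two_mul] at h2
  rw [h1, ← intervalIntegral.integral_add_adjacent_intervals (hint 0 Real.pi) (hint _ _), ← h2,
    ← intervalIntegral.integral_add (hint _ _) (Continuous.intervalIntegrable
      (u := fun θ => b (x, θ + Real.pi, 0) * G (θ + Real.pi))
      ((hbc.mul hGc).comp (continuous_add_const Real.pi)) _ _)]
  simp_rw [hGp, ← add_mul, hz x hx]
  simp

/-! ### Derivatives of the operators in `L²` -/

/-- The iterated derivative along a word in the coordinate directions. -/
def wD : List (Fin 2) → (Plane → ℂ) → Plane → ℂ
  | [], u => u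
  | i :: w, u => dirDeriv (basisVec i) (wD w u)

theorem wD_append (w w' : List (Fin 2)) (u : Plane → ℂ) : wD (w ++ w') u = wD w (wD w' u) := by
  induction w with
  | nil => rfl
  | cons i w ih => simp only [List.cons_append, wD, ih]

theorem contDiffOn_wD {U : Set Plane} (hU : IsOpen U) {u : Plane → ℂ} (hu : ContDiffOn ℝ ∞ u U)
    (w : List (Fin 2)) : ContDiffOn ℝ ∞ (wD w u) U := by
  induction w with
  | nil => exact hu
  | cons i w ih => exact contDiffOn_dirDeriv hU ih _

theorem wD_congr {U : Set Plane} (hU : IsOpen U) {u v : Plane → ℂ} (h : EqOn u v U)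
    (w : List (Fin 2)) : EqOn (wD w u) (wD w v) U := by
  induction w with
  | nil => exact h
  | cons i w ih => exact dirDeriv_congr hU ih _

theorem differentiableAt_of_contDiffOn {U : Set Plane} (hU : IsOpen U) {u : Plane → ℂ}
    (hu : ContDiffOn ℝ ∞ u U) {x : Plane} (hx : x ∈ U) : DifferentiableAt ℝ u x :=
  (hu.contDiffAt (hU.mem_nhds hx)).differentiableAt (by simp)

theorem wD_add {U : Set Plane} (hU : IsOpen U) {u v : Plane → ℂ} (hu : ContDiffOn ℝ ∞ u U)
    (hv : ContDiffOn ℝ ∞ v U) (w : List (Fin 2)) :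
    EqOn (wD w fun x => u x + v x) (fun x => wD w u x + wD w v x) U := by
  induction w with
  | nil => exact fun x _ => rfl
  | cons i w ih =>
    intro x hx
    refine (dirDeriv_congr hU ih _ hx).trans (dirDeriv_add ?_ ?_)
    · exact differentiableAt_of_contDiffOn hU (contDiffOn_wD hU hu w) hx
    · exact differentiableAt_of_contDiffOn hU (contDiffOn_wD hU hv w) hx

/-- The `L²` norms of all derivatives of order at most `r`. -/
def wS : ℕ → 𝓢(Plane, ℂ) → ℝ≥0∞
  | 0, f => eLpNorm f 2 volume
  | r + 1, f => wS r f + ∑ i, wS r (∂_{basisVec i} f)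

theorem wS_le_succ (r : ℕ) (f : 𝓢(Plane, ℂ)) : wS r f ≤ wS (r + 1) f := le_self_add

theorem wS_lineDeriv_le (r : ℕ) (f : 𝓢(Plane, ℂ)) (i : Fin 2) :
    wS r (∂_{basisVec i} f) ≤ wS (r + 1) f :=
  (Finset.single_le_sum (f := fun i => wS r (∂_{basisVec i} f)) (fun _ _ => zero_le)
    (Finset.mem_univ i)).trans le_add_self

/-- Derivatives of order `n` of the operators whose kernels satisfy `Z` are controlled by `K`
derivatives of the kernel and `r` derivatives of the function. -/
def OpEst (Z : (Plane × ℝ × ℝ → ℂ) → Prop) (n r K : ℕ) : Prop :=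
  ∃ C : ℝ≥0, ∀ b, IsKernel b → Z b → ∀ M, Bdd K M b → ∀ f : 𝓢(Plane, ℂ), SuppTwo f →
    ∀ w : List (Fin 2), w.length = n →
      eLpNorm (wD w (kOp b f)) 2 (volume.restrict disk) ≤ C * (M * wS r f)

theorem OpEst.mono {Z : (Plane × ℝ × ℝ → ℂ) → Prop} {n r r' K K' : ℕ} (h : OpEst Z n r K)
    (hr : r ≤ r') (hK : K ≤ K') : OpEst Z n r' K' := by
  obtain ⟨C, hC⟩ := h
  refine ⟨C, fun b hb hZ M hM f hf w hw => (hC b hb hZ M (hM.of_le hK) f hf w hw).trans ?_⟩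
  gcongr
  induction hr with
  | refl => exact le_rfl
  | step _ ih => exact ih.trans (wS_le_succ _ f)

theorem opEst_zero (Z : (Plane × ℝ × ℝ → ℂ) → Prop) : OpEst Z 0 0 0 := by
  refine ⟨(boxMeas univ).toNNReal, fun b hb _ M hM f _ w hw => ?_⟩
  rw [List.length_eq_zero_iff.1 hw, ENNReal.coe_toNNReal (measure_ne_top _ _)]
  exact eLpNorm_kOp_le hb hM f

/-- The innermost derivative falls either on the kernel, which costs one derivative of `b` and must
preserve `Z`, or on `f`, which costs one unit of `r`. -/
theorem OpEst.succ {Z : (Plane × ℝ × ℝ → ℂ) → Prop}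
    (hZ : ∀ b, IsKernel b → Z b → ∀ i, Z (kd (spaceIdx i) b)) {n r K₁ K₂ K : ℕ}
    (h₁ : OpEst Z n r K₁) (h₂ : OpEst Z n (r + 1) K₂) (hK₁ : K₁ ≤ K) (hK₂ : K₂ + 1 ≤ K) :
    OpEst Z (n + 1) (r + 1) K := by
  obtain ⟨C₁, hC₁⟩ := h₁
  obtain ⟨C₂, hC₂⟩ := h₂
  refine ⟨C₂ + C₁, fun b hb hZb M hM f hf w hw => ?_⟩
  obtain ⟨w, i, rfl⟩ : ∃ w' i, w = w' ++ [i] := by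
    refine ⟨w.dropLast, w.getLast (by rintro rfl; simp at hw), ?_⟩
    rw [List.dropLast_append_getLast]
  have hw' : w.length = n := by simpa using hw
  have s1 := (hb.kd (spaceIdx i)).contDiffOn_kOp f
  have s2 := hb.contDiffOn_kOp (∂_{basisVec i} f : 𝓢(Plane, ℂ))
  have e1 : EqOn (wD (w ++ [i]) (kOp b f)) (fun x => wD w (kOp (kd (spaceIdx i) b) f) x +
      wD w (kOp b (∂_{basisVec i} f : 𝓢(Plane, ℂ))) x) disk := by
    intro x hx
    rw [wD_append, ← wD_add isOpen_disk s1 s2 w hx]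
    exact wD_congr isOpen_disk (fun y hy => dirDeriv_kOp hb f i hy) w hx
  have hM2 : Bdd (K₂ + 1) M b := hM.of_le hK₂
  calc eLpNorm (wD (w ++ [i]) (kOp b f)) 2 (volume.restrict disk)
      = eLpNorm ((wD w (kOp (kd (spaceIdx i) b) f)) +
          wD w (kOp b (∂_{basisVec i} f : 𝓢(Plane, ℂ)))) 2 (volume.restrict disk) := by
        refine eLpNorm_congr_ae ?_
        filter_upwards [ae_restrict_mem measurableSet_disk] with x hx
        exact e1 hx
    _ ≤ _ := eLpNorm_add_le
        (aestronglyMeasurable_of_contDiffOn_disk (contDiffOn_wD isOpen_disk s1 w))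
        (aestronglyMeasurable_of_contDiffOn_disk (contDiffOn_wD isOpen_disk s2 w)) (by norm_num)
    _ ≤ C₂ * (M * wS (r + 1) f) + C₁ * (M * wS (r + 1) f) := by
        gcongr
        · exact hC₂ _ (hb.kd _) (hZ b hb hZb i) M (hM2.2 _) f hf w hw'
        · refine (hC₁ b hb hZb M (hM.of_le hK₁) _ (hf.lineDeriv i) w hw').trans ?_
          gcongr
          exact wS_lineDeriv_le r f i
    _ = _ := by push_cast; ring

theorem IsKernel.neg {b : Plane × ℝ × ℝ → ℂ} (hb : IsKernel b) : IsKernel (fun z => -b z) where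
  smooth := hb.smooth.neg
  periodic x hx θ t := by rw [hb.periodic x hx]

theorem kd_neg (j : Fin 4) (b : Plane × ℝ × ℝ → ℂ) :
    kd j (fun z => -b z) = fun z => -kd j b z := by
  ext z
  simp only [kd, dirDeriv]
  rw [fderiv_fun_neg]
  rfl

theorem Bdd.neg {K : ℕ} {M : ℝ≥0∞} {b : Plane × ℝ × ℝ → ℂ} (h : Bdd K M b) :
    Bdd K M (fun z => -b z) := by
  induction K generalizing b with
  | zero => exact fun z hz => by rw [enorm_neg]; exact h z hz
  | succ K ih => exact ⟨ih h.1, fun j => by rw [kd_neg]; exact ih (h.2 j)⟩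

theorem kOp_neg_left (b : Plane × ℝ × ℝ → ℂ) (f : Plane → ℂ) (x : Plane) :
    kOp (fun z => -b z) f x = -kOp b f x := by
  simp only [kOp, paramInt, kInt, neg_mul, integral_neg]

/-- The kernel of `∂ⱼ ∘ kOp b` without the part that lives at `t = 0`. -/
def remKer (j : Fin 2) (b : Plane × ℝ × ℝ → ℂ) : Plane × ℝ × ℝ → ℂ :=
  fun z => kd (spaceIdx j) b z + (-remOne j b z + -remTwo j b z)

theorem IsKernel.remKer {b : Plane × ℝ × ℝ → ℂ} (hb : IsKernel b) (j : Fin 2) :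
    IsKernel (remKer j b) := (hb.kd _).add ((hb.remOne j).neg.add (hb.remTwo j).neg)

/-- Two derivatives are lost because `remTwo` contains one derivative in `t` and one in the angle.
-/
theorem Bdd.remKer {K : ℕ} {M : ℝ≥0∞} {b : Plane × ℝ × ℝ → ℂ} (h : Bdd (K + 2) M b)
    (hb : IsKernel b) (j : Fin 2) : Bdd K ((1 + 2 ^ K + 2 ^ (K + 1)) * M) (remKer j b) := by
  have h1 : Bdd (K + 1) M b := h.of_le (by omega)
  refine ((h1.2 _).add ((h1.remOne hb j).neg.add (h.remTwo hb j).neg (hb.remOne j).neg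
    (hb.remTwo j).neg) (hb.kd _) ((hb.remOne j).neg.add (hb.remTwo j).neg)).mono (le_of_eq ?_)
  ring

theorem dirDeriv_kOp_eq {b : Plane × ℝ × ℝ → ℂ} (hb : IsKernel b) {f : 𝓢(Plane, ℂ)}
    (hf : SuppTwo f) (i : Fin 2) {x : Plane} (hx : x ∈ disk) :
    dirDeriv (basisVec i) (kOp b f) x =
      kOp (remKer i b) f x + kOp (bZero b) (∂_{basisVec i} f : 𝓢(Plane, ℂ)) x := by
  have h := kOp_add_left (hb.kd (spaceIdx i)) ((hb.remOne i).neg.add (hb.remTwo i).neg) f hx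
  rw [kOp_add_left (hb.remOne i).neg (hb.remTwo i).neg f hx, kOp_neg_left, kOp_neg_left] at h
  have h' : kOp (remKer i b) f x = _ := h
  rw [dirDeriv_kOp hb f i hx, kOp_lineDeriv hb hf i hx, h']
  ring

/-- The gain of one derivative: a bounded operator with kernel `remKer` plus the frozen term handled
by the arc operators. The factor `4` is `1 + 2 ^ 0 + 2 ^ 1`. -/
theorem opEst_one (Z : (Plane × ℝ × ℝ → ℂ) → Prop) : OpEst Z 1 0 2 := by
  obtain ⟨C, hC⟩ := exists_kOp_bZero_bound
  refine ⟨(boxMeas univ).toNNReal * 4 + C, fun b hb _ M hM f hf w hw => ?_⟩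
  obtain ⟨i, rfl⟩ := List.length_eq_one_iff.1 hw
  have hsm : ContDiffOn ℝ ∞ (kOp (bZero b) (∂_{basisVec i} f : 𝓢(Plane, ℂ))) disk :=
    hb.bZero.contDiffOn_kOp _
  calc eLpNorm (wD [i] (kOp b f)) 2 (volume.restrict disk)
      = eLpNorm (kOp (remKer i b) f + kOp (bZero b) (∂_{basisVec i} f : 𝓢(Plane, ℂ))) 2
          (volume.restrict disk) := by
        refine eLpNorm_congr_ae ?_
        filter_upwards [ae_restrict_mem measurableSet_disk] with x hx
        exact dirDeriv_kOp_eq hb hf i hx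
    _ ≤ _ := eLpNorm_add_le
        (aestronglyMeasurable_of_contDiffOn_disk ((hb.remKer i).contDiffOn_kOp f))
        (aestronglyMeasurable_of_contDiffOn_disk hsm) (by norm_num)
    _ ≤ boxMeas univ * (((1 + 2 ^ 0 + 2 ^ (0 + 1)) * M) * eLpNorm f 2 volume) +
          C * (M * eLpNorm f 2 volume) :=
        add_le_add (eLpNorm_kOp_le (hb.remKer i) (hM.remKer hb i) f) (hC b hb M hM.1 f hf i)
    _ = _ := by
        rw [ENNReal.coe_add, ENNReal.coe_mul, ENNReal.coe_toNNReal (measure_ne_top _ _)]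
        norm_num [wS]
        ring

/-- Without the frozen term the first derivative is the operator with kernel `remKer j b`, to which
`opEst_one` applies whatever its symbol. The losses of two kernel derivatives add up, and `13 = 1 +
2 ^ 2 + 2 ^ 3`. -/
theorem opEst_two : OpEst SymbolZero 2 0 4 := by
  obtain ⟨C, hC⟩ := opEst_one fun _ => True
  refine ⟨C * 13, fun b hb hz M hM f hf w hw => ?_⟩
  obtain ⟨i, j, rfl⟩ := List.length_eq_two.1 hw
  have h1 : EqOn (wD [i, j] (kOp b f)) (wD [i] (kOp (remKer j b) f)) disk := fun x hx => by
    refine dirDeriv_congr isOpen_disk (fun y hy => ?_) _ hx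
    refine (dirDeriv_kOp_eq hb hf j hy).trans ?_
    rw [kOp_bZero_eq_zero hb hz _ hy, add_zero]
    rfl
  calc eLpNorm (wD [i, j] (kOp b f)) 2 (volume.restrict disk)
      = eLpNorm (wD [i] (kOp (remKer j b) f)) 2 (volume.restrict disk) := by
        refine eLpNorm_congr_ae ?_
        filter_upwards [ae_restrict_mem measurableSet_disk] with x hx
        exact h1 hx
    _ ≤ _ := hC _ (hb.remKer j) trivial _ (hM.remKer hb j) f hf [i] rfl
    _ = _ := by
        push_cast
        norm_num
        ring

theorem SymbolZero.kd {b : Plane × ℝ × ℝ → ℂ} (hb : IsKernel b) (hz : SymbolZero b) (i : Fin 2) :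
    SymbolZero (kd (spaceIdx i) b) := by
  intro x hx θ
  have hl : ∀ θ : ℝ, HasDerivAt (fun s : ℝ => b (x + s • basisVec i, θ, 0))
      (DiskOp.kd (spaceIdx i) b (x, θ, 0)) 0 := by
    intro θ
    have h1 : HasDerivAt (fun s : ℝ => ((x + s • basisVec i, θ, 0) : Plane × ℝ × ℝ))
        (basisVec i, 0, 0) 0 := by
      refine HasDerivAt.prodMk ?_ ((hasDerivAt_const _ _).prodMk (hasDerivAt_const _ _))
      simpa using ((hasDerivAt_id (0 : ℝ)).smul_const (basisVec i)).const_add x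
    have h2 : HasFDerivAt b (fderiv ℝ b (x, θ, 0)) (x + (0 : ℝ) • basisVec i, θ, 0) := by
      rw [zero_smul, add_zero]
      exact (hb.differentiableAt (z := (x, θ, 0)) (mem_coordDomain.2 hx)).hasFDerivAt
    have h3 := h2.comp_hasDerivAt 0 h1
    rw [DiskOp.kd, dirDeriv, kDir_spaceIdx]
    exact h3
  have h0 : (fun s : ℝ => b (x + s • basisVec i, θ, 0) + b (x + s • basisVec i, θ + Real.pi, 0))
      =ᶠ[𝓝 0] fun _ => 0 := by
    have hc : Continuous fun s : ℝ => x + s • basisVec i := by fun_prop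
    filter_upwards [(isOpen_disk.preimage hc).mem_nhds (x := 0) (by simpa using hx)] with s hs
    exact hz _ hs θ
  exact ((hl θ).add (hl (θ + Real.pi))).unique ((hasDerivAt_const 0 0).congr_of_eventuallyEq h0)

/-- The estimates for the operators of order `-1`. -/
theorem opEst_order_one (n : ℕ) (hn : n ≤ 2) : OpEst (fun _ => True) n 1 n := by
  have h0 := opEst_zero fun _ => True
  have h11 : OpEst (fun _ => True) 1 1 1 :=
    OpEst.succ (fun _ _ _ _ => trivial) h0 (h0.mono zero_le_one le_rfl) (by norm_num) (by norm_num)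
  interval_cases n
  · exact h0.mono zero_le_one le_rfl
  · exact h11
  · exact OpEst.succ (fun _ _ _ _ => trivial) (opEst_one _) h11 le_rfl le_rfl

/-- The estimates for the operators whose principal symbol vanishes. -/
theorem opEst_order_two (n : ℕ) (hn : n ≤ 4) : OpEst SymbolZero n 2 n := by
  have hZ : ∀ b, IsKernel b → SymbolZero b → ∀ i, SymbolZero (kd (spaceIdx i) b) :=
    fun b hb h i => h.kd hb i
  have h00 := opEst_zero SymbolZero
  have h01 : OpEst SymbolZero 0 1 0 := h00.mono (by norm_num) le_rfl
  have h02 : OpEst SymbolZero 0 2 0 := h00.mono (by norm_num) le_rfl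
  have h10 := opEst_one SymbolZero
  have h11 : OpEst SymbolZero 1 1 1 := OpEst.succ hZ h00 h01 (by norm_num) (by norm_num)
  have h12 : OpEst SymbolZero 1 2 1 := OpEst.succ hZ h01 h02 (by norm_num) (by norm_num)
  have h21 : OpEst SymbolZero 2 1 2 := OpEst.succ hZ h10 h11 (by norm_num) (by norm_num)
  have h22 : OpEst SymbolZero 2 2 2 := OpEst.succ hZ h11 h12 (by norm_num) (by norm_num)
  -- The four kernel derivatives of `opEst_two` are admissible since this estimate enters only the
  -- case `n = 4`.
  have h31 : OpEst SymbolZero 3 1 4 := OpEst.succ hZ opEst_two h21 (by norm_num) (by norm_num)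
  have h32 : OpEst SymbolZero 3 2 3 := OpEst.succ hZ h21 h22 (by norm_num) (by norm_num)
  interval_cases n
  · exact h02
  · exact h12
  · exact h22
  · exact h32
  · exact OpEst.succ hZ h31 h32 (by norm_num) (by norm_num)

/-! ### Norms of derivatives on open sets -/

/-- The supremum of `|u|` over `U`. -/
def supN (U : Set Plane) (u : Plane → ℂ) : ℝ≥0∞ := ⨆ x ∈ U, ‖u x‖ₑ

/-- The norm of `u` in `L²(U)`. -/
def l2N (U : Set Plane) (u : Plane → ℂ) : ℝ≥0∞ := eLpNorm u 2 (volume.restrict U)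

/-- The properties of `supN U` and `l2N U` that matter for estimates of derivatives. -/
structure IsFunNorm (U : Set Plane) (N : (Plane → ℂ) → ℝ≥0∞) : Prop where
  congr : ∀ u v, EqOn u v U → N u = N v
  add_le : ∀ u v, ContDiffOn ℝ ∞ u U → ContDiffOn ℝ ∞ v U → N (fun x => u x + v x) ≤ N u + N v
  mul_le : ∀ u v, ContDiffOn ℝ ∞ u U → ContDiffOn ℝ ∞ v U →
    N (fun x => u x * v x) ≤ supN U u * N v

theorem enorm_le_supN {U : Set Plane} (u : Plane → ℂ) {x : Plane} (hx : x ∈ U) :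
    ‖u x‖ₑ ≤ supN U u := le_iSup₂_of_le x hx le_rfl

theorem isFunNorm_supN (U : Set Plane) : IsFunNorm U (supN U) where
  congr u v h := iSup_congr fun x => iSup_congr fun hx => by rw [h hx]
  add_le u v _ _ := iSup₂_le fun x hx =>
    (enorm_add_le _ _).trans (add_le_add (enorm_le_supN u hx) (enorm_le_supN v hx))
  mul_le u v _ _ := iSup₂_le fun x hx => by
    rw [enorm_mul]
    exact mul_le_mul' (enorm_le_supN u hx) (enorm_le_supN v hx)

theorem isFunNorm_l2N {U : Set Plane} (hU : IsOpen U) : IsFunNorm U (l2N U) where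
  congr u v h := eLpNorm_congr_ae
    ((ae_restrict_mem hU.measurableSet).mono fun x hx => h hx)
  add_le u v hu hv := eLpNorm_add_le (hu.continuousOn.aestronglyMeasurable hU.measurableSet)
    (hv.continuousOn.aestronglyMeasurable hU.measurableSet) (by norm_num)
  mul_le u v _ hv := eLpNorm_mul_le_of_enorm_le
    ((ae_restrict_mem hU.measurableSet).mono fun x hx => enorm_le_supN u hx)
    (hv.continuousOn.aestronglyMeasurable hU.measurableSet)

/-- The sum of the norms of all derivatives of order at most `r`. -/
def dN (N : (Plane → ℂ) → ℝ≥0∞) : ℕ → (Plane → ℂ) → ℝ≥0∞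
  | 0, u => N u
  | r + 1, u => dN N r u + ∑ i, dN N r (dirDeriv (basisVec i) u)

theorem dN_le_succ (N : (Plane → ℂ) → ℝ≥0∞) (r : ℕ) (u : Plane → ℂ) : dN N r u ≤ dN N (r + 1) u :=
  le_self_add

theorem dN_dirDeriv_le (N : (Plane → ℂ) → ℝ≥0∞) (r : ℕ) (u : Plane → ℂ) (i : Fin 2) :
    dN N r (dirDeriv (basisVec i) u) ≤ dN N (r + 1) u :=
  (Finset.single_le_sum (f := fun i => dN N r (dirDeriv (basisVec i) u)) (fun _ _ => zero_le)
    (Finset.mem_univ i)).trans le_add_self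

theorem dN_mono (N : (Plane → ℂ) → ℝ≥0∞) {r r' : ℕ} (h : r ≤ r') (u : Plane → ℂ) :
    dN N r u ≤ dN N r' u := by
  induction h with
  | refl => exact le_rfl
  | step _ ih => exact ih.trans (dN_le_succ _ _ u)

theorem le_dN (N : (Plane → ℂ) → ℝ≥0∞) (r : ℕ) (u : Plane → ℂ) : N u ≤ dN N r u :=
  dN_mono N (Nat.zero_le r) u

theorem dN_le_of_wD (N : (Plane → ℂ) → ℝ≥0∞) {r : ℕ} {u : Plane → ℂ} {B : ℝ≥0∞}
    (h : ∀ w : List (Fin 2), w.length ≤ r → N (wD w u) ≤ B) : dN N r u ≤ 3 ^ r * B := by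
  induction r generalizing u with
  | zero => rw [pow_zero, one_mul]; exact h [] le_rfl
  | succ r ih =>
    have h1 := ih fun w hw => h w (hw.trans (Nat.le_succ r))
    have h2 : ∀ i, dN N r (dirDeriv (basisVec i) u) ≤ 3 ^ r * B := fun i => ih fun w hw => by
      have := h (w ++ [i]) (by simpa using hw)
      rwa [wD_append] at this
    calc dN N (r + 1) u ≤ 3 ^ r * B + ∑ _i : Fin 2, 3 ^ r * B :=
          add_le_add h1 (Finset.sum_le_sum fun i _ => h2 i)
      _ = 3 ^ (r + 1) * B := by
          rw [Fin.sum_univ_two, pow_succ]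
          ring

theorem IsFunNorm.dN_congr {U : Set Plane} {N : (Plane → ℂ) → ℝ≥0∞} (hN : IsFunNorm U N)
    (hU : IsOpen U) {u v : Plane → ℂ} (h : EqOn u v U) (r : ℕ) : dN N r u = dN N r v := by
  induction r generalizing u v with
  | zero => exact hN.congr u v h
  | succ r ih => simp only [dN, ih h, fun i => ih (dirDeriv_congr hU h (basisVec i))]

theorem IsFunNorm.dN_add_le {U : Set Plane} {N : (Plane → ℂ) → ℝ≥0∞} (hN : IsFunNorm U N)
    (hU : IsOpen U) {u v : Plane → ℂ} (hu : ContDiffOn ℝ ∞ u U) (hv : ContDiffOn ℝ ∞ v U) (r : ℕ) :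
    dN N r (fun x => u x + v x) ≤ dN N r u + dN N r v := by
  induction r generalizing u v with
  | zero => exact hN.add_le u v hu hv
  | succ r ih =>
    have h2 : ∀ i, dN N r (dirDeriv (basisVec i) fun x => u x + v x) ≤
        dN N r (dirDeriv (basisVec i) u) + dN N r (dirDeriv (basisVec i) v) := fun i => by
      refine le_trans (le_of_eq (hN.dN_congr hU (fun x hx => ?_) r))
        (ih (contDiffOn_dirDeriv hU hu _) (contDiffOn_dirDeriv hU hv _))
      exact dirDeriv_add (differentiableAt_of_contDiffOn hU hu hx)
        (differentiableAt_of_contDiffOn hU hv hx)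
    calc dN N (r + 1) (fun x => u x + v x) ≤ (dN N r u + dN N r v) +
          ∑ i, (dN N r (dirDeriv (basisVec i) u) + dN N r (dirDeriv (basisVec i) v)) :=
          add_le_add (ih hu hv) (Finset.sum_le_sum fun i _ => h2 i)
      _ = _ := by rw [Finset.sum_add_distrib]; simp only [dN]; ring

theorem IsFunNorm.dN_mul_le {U : Set Plane} {N : (Plane → ℂ) → ℝ≥0∞} (hN : IsFunNorm U N)
    (hU : IsOpen U) {u v : Plane → ℂ} (hu : ContDiffOn ℝ ∞ u U) (hv : ContDiffOn ℝ ∞ v U) (r : ℕ) :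
    dN N r (fun x => u x * v x) ≤ 3 ^ r * (dN (supN U) r u * dN N r v) := by
  induction r generalizing u v with
  | zero => rw [pow_zero, one_mul]; exact hN.mul_le u v hu hv
  | succ r ih =>
    have h2 : ∀ i, dN N r (dirDeriv (basisVec i) fun x => u x * v x) ≤
        3 ^ r * (dN (supN U) r (dirDeriv (basisVec i) u) * dN N r v) +
          3 ^ r * (dN (supN U) r u * dN N r (dirDeriv (basisVec i) v)) := fun i => by
      have du := contDiffOn_dirDeriv hU hu (basisVec i)
      have dv := contDiffOn_dirDeriv hU hv (basisVec i)
      refine le_trans (le_of_eq (hN.dN_congr hU (fun x hx => ?_) r))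
        ((hN.dN_add_le hU (du.mul hv) (hu.mul dv) r).trans (add_le_add (ih du hv) (ih hu dv)))
      exact dirDeriv_mul (differentiableAt_of_contDiffOn hU hu hx)
        (differentiableAt_of_contDiffOn hU hv hx)
    have hA := dN_le_succ (supN U) r u
    have hB := dN_le_succ N r v
    have hA2 : ∑ i, dN (supN U) r (dirDeriv (basisVec i) u) ≤ dN (supN U) (r + 1) u := le_add_self
    have hB2 : ∑ i, dN N r (dirDeriv (basisVec i) v) ≤ dN N (r + 1) v := le_add_self
    calc dN N (r + 1) (fun x => u x * v x)
        ≤ 3 ^ r * (dN (supN U) r u * dN N r v) +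
          ∑ i, (3 ^ r * (dN (supN U) r (dirDeriv (basisVec i) u) * dN N r v) +
          3 ^ r * (dN (supN U) r u * dN N r (dirDeriv (basisVec i) v))) :=
          add_le_add (ih hu hv) (Finset.sum_le_sum fun i _ => h2 i)
      _ = 3 ^ r * (dN (supN U) r u * dN N r v) +
          (3 ^ r * ((∑ i, dN (supN U) r (dirDeriv (basisVec i) u)) * dN N r v) +
          3 ^ r * (dN (supN U) r u * ∑ i, dN N r (dirDeriv (basisVec i) v))) := by
          rw [Finset.sum_add_distrib, ← Finset.mul_sum, ← Finset.mul_sum, ← Finset.mul_sum,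
            ← Finset.sum_mul]
      _ ≤ 3 ^ r * (dN (supN U) (r + 1) u * dN N (r + 1) v) +
          (3 ^ r * (dN (supN U) (r + 1) u * dN N (r + 1) v) +
          3 ^ r * (dN (supN U) (r + 1) u * dN N (r + 1) v)) := by gcongr
      _ = _ := by rw [pow_succ]; ring

/-! ### Weak derivatives of Lipschitz functions -/

theorem tendsto_integral_slope {f h F : Plane → ℂ} {C : ℝ≥0} (hf : LipschitzWith C f)
    (hh : Integrable h) {v : Plane} (hF : ∀ᵐ x, HasLineDerivAt ℝ f (F x) x v) :
    Tendsto (fun t : ℝ => ∫ x, (t⁻¹ • (f (x + t • v) - f x)) * h x) (𝓝[≠] 0)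
      (𝓝 (∫ x, F x * h x)) := by
  refine tendsto_integral_filter_of_dominated_convergence (fun x => C * ‖v‖ * ‖h x‖) ?_ ?_ ?_ ?_
  · refine Eventually.of_forall fun t => AEStronglyMeasurable.mul ?_ hh.aestronglyMeasurable
    have := hf.continuous
    exact Continuous.aestronglyMeasurable (by fun_prop)
  · filter_upwards [self_mem_nhdsWithin] with t ht
    refine ae_of_all _ fun x => ?_
    have ht' : 0 < |t| := abs_pos.2 ht
    rw [norm_mul, norm_smul, norm_inv, Real.norm_eq_abs]
    refine mul_le_mul_of_nonneg_right ?_ (norm_nonneg _)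
    rw [inv_mul_le_iff₀ ht']
    have := hf.dist_le_mul (x + t • v) x
    rw [dist_eq_norm, dist_eq_norm, add_sub_cancel_left, norm_smul, Real.norm_eq_abs] at this
    linarith
  · exact hh.norm.const_mul _
  · filter_upwards [hF] with x hx
    have h1 := hasDerivAt_iff_tendsto_slope_zero.1 hx
    simp only [zero_add, zero_smul, add_zero] at h1
    exact h1.mul_const _

theorem schwartz_lipschitz (φ : 𝓢(Plane, ℂ)) : ∃ C : ℝ≥0, LipschitzWith C φ := by
  obtain ⟨C, hC⟩ := φ.decay 0 1
  refine ⟨⟨C, hC.1.le⟩, lipschitzWith_of_nnnorm_fderiv_le (𝕜 := ℝ) (φ.differentiable) fun x => ?_⟩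
  have := hC.2 x
  rw [pow_zero, one_mul, norm_iteratedFDeriv_one] at this
  exact this

/-- By translation invariance the difference quotient moves from `φ` to `g` before the limit is
taken. For glued functions this replaces a divergence theorem with boundary terms. -/
theorem integral_lineDeriv_mul_eq_neg {g : Plane → ℂ} {C : ℝ≥0} (hg : LipschitzWith C g)
    (hgi : Integrable g) {G : Plane → ℂ} {i : Fin 2}
    (hG : ∀ᵐ x, HasLineDerivAt ℝ g (G x) x (basisVec i)) (φ : 𝓢(Plane, ℂ)) :
    ∫ x, (∂_{basisVec i} φ : 𝓢(Plane, ℂ)) x * g x = - ∫ x, φ x * G x := by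
  obtain ⟨D, hD⟩ := schwartz_lipschitz φ
  have h1 := tendsto_integral_slope hD hgi (v := basisVec i)
    (F := (∂_{basisVec i} φ : 𝓢(Plane, ℂ))) (ae_of_all _ fun x => by
      rw [schwartz_lineDeriv]
      exact (schwartz_hasFDerivAt φ x).hasLineDerivAt _)
  have h2 := tendsto_integral_slope hg (φ.integrable (μ := volume)) (v := -basisVec i)
    (F := fun x => -G x) (hG.mono fun x hx => by
      have := hx.smul (-1)
      simpa using this)
  have h3 : (fun t : ℝ => ∫ x, (t⁻¹ • (φ (x + t • basisVec i) - φ x)) * g x) =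
      fun t : ℝ => ∫ x, (t⁻¹ • (g (x + t • -basisVec i) - g x)) * φ x := by
    ext t
    have i1 : Integrable fun x => φ (x + t • basisVec i) * g x := by
      obtain ⟨B, hB⟩ := φ.decay 0 0
      refine hgi.bdd_mul (c := B) (φ.continuous.comp (by fun_prop)).aestronglyMeasurable
        (ae_of_all _ fun x => ?_)
      simpa using hB.2 (x + t • basisVec i)
    have i2 : Integrable fun x => φ x * g x := by
      obtain ⟨B, hB⟩ := φ.decay 0 0
      refine hgi.bdd_mul (c := B) φ.continuous.aestronglyMeasurable (ae_of_all _ fun x => ?_)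
      simpa using hB.2 x
    have e1 : ∫ x, φ (x + t • basisVec i) * g x = ∫ x, φ x * g (x + t • -basisVec i) := by
      rw [← integral_add_right_eq_self (fun x => φ x * g (x + t • -basisVec i)) (t • basisVec i)]
      simp
    have i3 : Integrable fun x => φ x * g (x + t • -basisVec i) := by
      have := i1.comp_add_right (t • -basisVec i)
      simpa using this
    calc ∫ x, (t⁻¹ • (φ (x + t • basisVec i) - φ x)) * g x
        = t⁻¹ • ((∫ x, φ (x + t • basisVec i) * g x) - ∫ x, φ x * g x) := by
          rw [← integral_sub i1 i2, ← integral_smul]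
          simp only [smul_mul_assoc, sub_mul]
      _ = t⁻¹ • ((∫ x, φ x * g (x + t • -basisVec i)) - ∫ x, φ x * g x) := by rw [e1]
      _ = _ := by
          rw [← integral_sub i3 i2, ← integral_smul]
          congr 1
          ext x
          simp only [smul_mul_assoc]
          congr 1
          ring
  rw [h3] at h1
  have h4 := tendsto_nhds_unique h1 h2
  rw [h4, ← integral_neg]
  congr 1
  ext x
  ring

/-! ### Functions glued along the unit circle -/

/-- Smooth functions with compact support. -/
structure SmoothCc (u : Plane → ℂ) : Prop where
  smooth : ContDiff ℝ ∞ u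
  compact : HasCompactSupport u

theorem SmoothCc.dirDeriv {u : Plane → ℂ} (hu : SmoothCc u) (v : Plane) :
    SmoothCc (dirDeriv v u) where
  smooth := (hu.smooth.fderiv_right (m := ∞) (by simp)).clm_apply contDiff_const
  compact := (hu.compact.fderiv (𝕜 := ℝ)).comp_left (g := fun L : Plane →L[ℝ] ℂ => L v) (by simp)

theorem SmoothCc.lipschitz {u : Plane → ℂ} (hu : SmoothCc u) : ∃ C, LipschitzWith C u :=
  hu.smooth.lipschitzWith_of_hasCompactSupport hu.compact (by simp)

/-- The function equal to `a` in the disk and to `b` outside. -/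
def glue (a b : Plane → ℂ) : Plane → ℂ := fun x => open Classical in if x ∈ disk then a x else b x

theorem glue_of_mem {a b : Plane → ℂ} {x : Plane} (hx : x ∈ disk) : glue a b x = a x := if_pos hx

theorem glue_of_notMem {a b : Plane → ℂ} {x : Plane} (hx : x ∉ disk) : glue a b x = b x := if_neg hx

/-- The exterior of the unit disk. -/
def outer : Set Plane := {x | 1 < ‖x‖}

theorem isOpen_outer : IsOpen outer := isOpen_lt continuous_const continuous_norm

theorem mem_disk_iff {x : Plane} : x ∈ disk ↔ ‖x‖ < 1 := by simp [disk]

theorem ae_mem_disk_or_outer : ∀ᵐ x : Plane, x ∈ disk ∨ x ∈ outer := by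
  have h : volume (Metric.sphere (0 : Plane) 1) = 0 := Measure.addHaar_sphere volume 0 1
  filter_upwards [compl_mem_ae_iff.2 h] with x hx
  have hx' : ‖x‖ ≠ 1 := by simpa using hx
  rcases lt_or_gt_of_ne hx' with h | h
  · exact Or.inl (mem_disk_iff.2 h)
  · exact Or.inr h

theorem exists_sphere_mem_segment {x y : Plane} (hx : x ∈ disk) (hy : y ∉ disk) :
    ∃ z : Plane, ‖z‖ = 1 ∧ dist x z + dist z y = dist x y := by
  rw [mem_disk_iff] at hx hy
  have hc : ContinuousOn (fun s : ℝ => ‖AffineMap.lineMap x y s‖) (Icc 0 1) :=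
    (AffineMap.lineMap_continuous.norm).continuousOn
  obtain ⟨s, hs, hs1⟩ := intermediate_value_Icc zero_le_one hc (show (1 : ℝ) ∈ Icc _ _ by
    simp only [AffineMap.lineMap_apply_zero, AffineMap.lineMap_apply_one]
    exact ⟨hx.le, not_lt.1 hy⟩)
  refine ⟨AffineMap.lineMap x y s, hs1, ?_⟩
  rw [dist_left_lineMap, dist_lineMap_right, Real.norm_of_nonneg hs.1,
    Real.norm_of_nonneg (sub_nonneg.2 hs.2)]
  ring

/-- A segment from the disk to its complement meets the circle, where the two functions agree; the
two Lipschitz bounds are added there. -/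
theorem exists_lipschitz_glue {a b : Plane → ℂ} (ha : SmoothCc a) (hb : SmoothCc b)
    (hab : ∀ x, ‖x‖ = 1 → a x = b x) : ∃ C, LipschitzWith C (glue a b) := by
  obtain ⟨A, hA⟩ := ha.lipschitz
  obtain ⟨B, hB⟩ := hb.lipschitz
  have hA' : LipschitzWith (max A B) a := hA.weaken (le_max_left _ _)
  have hB' : LipschitzWith (max A B) b := hB.weaken (le_max_right _ _)
  have key : ∀ x ∈ disk, ∀ y ∉ disk, dist (a x) (b y) ≤ (max A B : ℝ≥0) * dist x y := by
    intro x hx y hy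
    obtain ⟨z, hz, hd⟩ := exists_sphere_mem_segment hx hy
    calc dist (a x) (b y) ≤ dist (a x) (a z) + dist (b z) (b y) := by
          rw [← hab z hz]; exact dist_triangle _ _ _
      _ ≤ (max A B : ℝ≥0) * dist x z + (max A B : ℝ≥0) * dist z y :=
          add_le_add (hA'.dist_le_mul _ _) (hB'.dist_le_mul _ _)
      _ = _ := by rw [← mul_add, hd]
  refine ⟨max A B, LipschitzWith.of_dist_le_mul fun x y => ?_⟩
  by_cases hx : x ∈ disk <;> by_cases hy : y ∈ disk
  · rw [glue_of_mem hx, glue_of_mem hy]; exact hA'.dist_le_mul _ _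
  · rw [glue_of_mem hx, glue_of_notMem hy]; exact key x hx y hy
  · rw [glue_of_notMem hx, glue_of_mem hy, dist_comm, dist_comm x]; exact key y hy x hx
  · rw [glue_of_notMem hx, glue_of_notMem hy]; exact hB'.dist_le_mul _ _

theorem aestronglyMeasurable_glue {a b : Plane → ℂ} (ha : Continuous a) (hb : Continuous b) :
    AEStronglyMeasurable (glue a b) volume :=
  (StronglyMeasurable.ite measurableSet_disk ha.stronglyMeasurable
    hb.stronglyMeasurable).aestronglyMeasurable

theorem eLpNorm_glue_le {a b : Plane → ℂ} (ha : Continuous a) (hb : Continuous b) :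
    eLpNorm (glue a b) 2 volume ≤ l2N disk a + l2N outer b := by
  have h : glue a b =ᵐ[volume] disk.indicator a + outer.indicator b := by
    filter_upwards [ae_mem_disk_or_outer] with x hx
    rcases hx with hx | hx
    · have h2 : x ∉ outer := fun h => lt_asymm (mem_disk_iff.1 hx) h
      simp [glue_of_mem hx, hx, h2]
    · have h2 : x ∉ disk := fun h => lt_asymm (mem_disk_iff.1 h) hx
      simp [glue_of_notMem h2, hx, h2]
  rw [eLpNorm_congr_ae h]
  refine (eLpNorm_add_le (ha.aestronglyMeasurable.indicator measurableSet_disk)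
    (hb.aestronglyMeasurable.indicator isOpen_outer.measurableSet) (by norm_num)).trans ?_
  rw [eLpNorm_indicator_eq_eLpNorm_restrict measurableSet_disk,
    eLpNorm_indicator_eq_eLpNorm_restrict isOpen_outer.measurableSet]
  exact le_rfl

theorem SmoothCc.memLp {u : Plane → ℂ} (hu : SmoothCc u) : MemLp u 2 volume :=
  hu.smooth.continuous.memLp_of_hasCompactSupport hu.compact

theorem memLp_glue {a b : Plane → ℂ} (ha : SmoothCc a) (hb : SmoothCc b) :
    MemLp (glue a b) 2 volume := by
  refine ⟨aestronglyMeasurable_glue ha.smooth.continuous hb.smooth.continuous, ?_⟩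
  refine (eLpNorm_glue_le ha.smooth.continuous hb.smooth.continuous).trans_lt
    (ENNReal.add_lt_top.2 ⟨?_, ?_⟩)
  · exact (eLpNorm_mono_measure _ Measure.restrict_le_self).trans_lt ha.memLp.2
  · exact (eLpNorm_mono_measure _ Measure.restrict_le_self).trans_lt hb.memLp.2

/-- The glued function as an element of `L²`. -/
def glueL {a b : Plane → ℂ} (ha : SmoothCc a) (hb : SmoothCc b) : L2 := (memLp_glue ha hb).toLp _

theorem planeSobolevNorm_zero_glueL_le {a b : Plane → ℂ} (ha : SmoothCc a) (hb : SmoothCc b) :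
    planeSobolevNorm 0 (glueL ha hb) ≤ l2N disk a + l2N outer b := by
  rw [planeSobolevNorm_zero, glueL, enorm_toLp]
  exact eLpNorm_glue_le ha.smooth.continuous hb.smooth.continuous

theorem integrable_glue {a b : Plane → ℂ} (ha : SmoothCc a) (hb : SmoothCc b) :
    Integrable (glue a b) := by
  refine Integrable.mono' (g := fun x => ‖a x‖ + ‖b x‖)
    ((ha.smooth.continuous.integrable_of_hasCompactSupport ha.compact).norm.add
      (hb.smooth.continuous.integrable_of_hasCompactSupport hb.compact).norm)
    (aestronglyMeasurable_glue ha.smooth.continuous hb.smooth.continuous) (ae_of_all _ fun x => ?_)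
  by_cases hx : x ∈ disk
  · rw [glue_of_mem hx]; exact le_add_of_nonneg_right (norm_nonneg _)
  · rw [glue_of_notMem hx]; exact le_add_of_nonneg_left (norm_nonneg _)

/-- The glued function is Lipschitz and classically differentiable off the circle, which is a null
set. -/
theorem isWeakDeriv_glueL {a b : Plane → ℂ} (ha : SmoothCc a) (hb : SmoothCc b)
    (hab : ∀ x, ‖x‖ = 1 → a x = b x) (i : Fin 2) :
    IsWeakDeriv i (glueL ha hb) (glueL (ha.dirDeriv (basisVec i)) (hb.dirDeriv (basisVec i))) := by
  obtain ⟨C, hC⟩ := exists_lipschitz_glue ha hb hab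
  have hd : ∀ᵐ x, HasLineDerivAt ℝ (glue a b)
      (glue (dirDeriv (basisVec i) a) (dirDeriv (basisVec i) b) x) x (basisVec i) := by
    filter_upwards [ae_mem_disk_or_outer] with x hx
    rcases hx with hx | hx
    · rw [glue_of_mem hx]
      have h1 : glue a b =ᶠ[𝓝 x] a := by
        filter_upwards [isOpen_disk.mem_nhds hx] with y hy using glue_of_mem hy
      exact (((ha.smooth.differentiable (by simp)) x).hasFDerivAt.congr_of_eventuallyEq
        h1).hasLineDerivAt _
    · have h2 : ∀ y ∈ outer, y ∉ disk := fun y hy h => lt_asymm (mem_disk_iff.1 h) hy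
      rw [glue_of_notMem (h2 x hx)]
      have h1 : glue a b =ᶠ[𝓝 x] b := by
        filter_upwards [isOpen_outer.mem_nhds hx] with y hy using glue_of_notMem (h2 y hy)
      exact (((hb.smooth.differentiable (by simp)) x).hasFDerivAt.congr_of_eventuallyEq
        h1).hasLineDerivAt _
  refine isWeakDeriv_of_integral fun φ => ?_
  have h := integral_lineDeriv_mul_eq_neg hC (integrable_glue ha hb) hd φ
  have e1 : ∫ x, (∂_{basisVec i} φ : 𝓢(Plane, ℂ)) x * glueL ha hb x =
      ∫ x, (∂_{basisVec i} φ : 𝓢(Plane, ℂ)) x * glue a b x :=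
    integral_congr_ae ((memLp_glue ha hb).coeFn_toLp.mono fun x hx => congrArg _ hx)
  have e2 : ∫ x, φ x * glueL (ha.dirDeriv (basisVec i)) (hb.dirDeriv (basisVec i)) x =
      ∫ x, φ x * glue (dirDeriv (basisVec i) a) (dirDeriv (basisVec i) b) x :=
    integral_congr_ae ((memLp_glue (ha.dirDeriv (basisVec i))
      (hb.dirDeriv (basisVec i))).coeFn_toLp.mono fun x hx => congrArg _ hx)
  rw [e1, e2, h]

theorem planeSobolevNorm_one_glueL_le {a b : Plane → ℂ} (ha : SmoothCc a) (hb : SmoothCc b)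
    (hab : ∀ x, ‖x‖ = 1 → a x = b x) :
    planeSobolevNorm 1 (glueL ha hb) ≤ dN (l2N disk) 1 a + dN (l2N outer) 1 b := by
  have h := planeSobolevNorm_succ_le (fun i => isWeakDeriv_glueL ha hb hab i) 0
  rw [zero_add] at h
  refine h.trans ((add_le_add (planeSobolevNorm_zero_glueL_le ha hb) (Finset.sum_le_sum fun i _ =>
    planeSobolevNorm_zero_glueL_le _ _)).trans (le_of_eq ?_))
  rw [Finset.sum_add_distrib]
  simp only [dN]
  ring

theorem planeSobolevNorm_two_glueL_le {a b : Plane → ℂ} (ha : SmoothCc a) (hb : SmoothCc b)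
    (hab : ∀ x, ‖x‖ = 1 → a x = b x)
    (hab' : ∀ x, ‖x‖ = 1 → ∀ i, dirDeriv (basisVec i) a x = dirDeriv (basisVec i) b x) :
    planeSobolevNorm 2 (glueL ha hb) ≤ dN (l2N disk) 2 a + dN (l2N outer) 2 b := by
  have h := planeSobolevNorm_succ_le (fun i => isWeakDeriv_glueL ha hb hab i) 1
  rw [one_add_one_eq_two] at h
  refine h.trans ((add_le_add (planeSobolevNorm_one_glueL_le ha hb hab) (Finset.sum_le_sum
    fun i _ => planeSobolevNorm_one_glueL_le _ _ fun x hx => hab' x hx i)).trans (le_of_eq ?_))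
  rw [Finset.sum_add_distrib]
  simp only [dN]
  ring

/-! ### Radial power maps -/

/-- The map `x ↦ |x|ᵃ x`. -/
def powMap (a : ℝ) (x : Plane) : Plane := ‖x‖ ^ a • x

/-- The derivative of `powMap a`. -/
def powMapDeriv (a : ℝ) (x : Plane) : Plane →L[ℝ] Plane :=
  ‖x‖ ^ a • (ContinuousLinearMap.id ℝ Plane + (a * (‖x‖ ^ 2)⁻¹) • (innerSL ℝ x).smulRight x)

theorem norm_powMap (a : ℝ) {x : Plane} (hx : x ≠ 0) : ‖powMap a x‖ = ‖x‖ ^ (1 + a) := by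
  have h := norm_pos_iff.2 hx
  rw [powMap, norm_smul, Real.norm_of_nonneg (by positivity), Real.rpow_add h, Real.rpow_one,
    mul_comm]

theorem contDiffAt_powMap (a : ℝ) {x : Plane} (hx : x ≠ 0) : ContDiffAt ℝ ∞ (powMap a) x :=
  ((contDiffAt_norm ℝ hx).rpow_const_of_ne (norm_ne_zero_iff.2 hx)).smul contDiffAt_id

theorem hasFDerivAt_powMap (a : ℝ) {x : Plane} (hx : x ≠ 0) :
    HasFDerivAt (powMap a) (powMapDeriv a x) x := by
  have h0 := norm_pos_iff.2 hx
  have h1 : HasFDerivAt (fun x : Plane => ‖x‖ ^ 2) (2 • innerSL ℝ x) x :=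
    (hasStrictFDerivAt_norm_sq x).hasFDerivAt
  have h2 : HasFDerivAt (fun x : Plane => (‖x‖ ^ 2) ^ (a / 2)) _ x :=
    h1.rpow_const (p := a / 2) (Or.inl (by positivity))
  have h3 : ∀ y : Plane, (‖y‖ ^ 2) ^ (a / 2) = ‖y‖ ^ a := fun y => by
    rw [← Real.rpow_natCast, ← Real.rpow_mul (norm_nonneg y)]
    norm_num
    congr 1
    ring
  simp_rw [h3] at h2
  have h4 := h2.smul (hasFDerivAt_id x)
  refine h4.congr_fderiv ?_
  ext1 v
  have h5 : (‖x‖ ^ 2) ^ (a / 2 - 1) = ‖x‖ ^ a * (‖x‖ ^ 2)⁻¹ := by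
    rw [Real.rpow_sub_one (by positivity), h3, div_eq_mul_inv]
  simp [powMapDeriv, h5, smul_smul, -PiLp.smul_apply]
  congr 1
  ring

/-- The eigenvalues are `‖x‖ ^ a` in the tangential and `(1 + a) ‖x‖ ^ a` in the radial direction.
-/
theorem det_powMapDeriv (a : ℝ) {x : Plane} (hx : x ≠ 0) :
    (powMapDeriv a x).det = ‖x‖ ^ (2 * a) * (1 + a) := by
  have h0 := norm_pos_iff.2 hx
  have h1 : (powMapDeriv a x).det =
      (LinearMap.toMatrix (EuclideanSpace.basisFun (Fin 2) ℝ).toBasis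
        (EuclideanSpace.basisFun (Fin 2) ℝ).toBasis (powMapDeriv a x : Plane →ₗ[ℝ] Plane)).det := by
    rw [LinearMap.det_toMatrix]
  have h2 : ‖x‖ ^ 2 = x 0 ^ 2 + x 1 ^ 2 := by
    rw [EuclideanSpace.norm_sq_eq]
    simp
  have h3 : ‖x‖ ^ (2 * a) = ‖x‖ ^ a * ‖x‖ ^ a := by rw [two_mul, Real.rpow_add h0]
  have h4 : (‖x‖ ^ 2)⁻¹ * (x 0 ^ 2 + x 1 ^ 2) = 1 := by
    rw [← h2]; exact inv_mul_cancel₀ (by positivity)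
  rw [h1, Matrix.det_fin_two, h3]
  simp [LinearMap.toMatrix_apply, powMapDeriv, PiLp.inner_apply]
  linear_combination (‖x‖ ^ a * ‖x‖ ^ a * a) * h4

theorem powMap_injOn {a : ℝ} (ha : 1 + a ≠ 0) : InjOn (powMap a) {0}ᶜ := by
  intro x hx y hy h
  have hx0 : 0 < ‖x‖ := norm_pos_iff.2 hx
  have hy0 : 0 < ‖y‖ := norm_pos_iff.2 hy
  have h1 : ‖x‖ = ‖y‖ := by
    have h2 := congrArg norm h
    rw [norm_powMap a hx, norm_powMap a hy] at h2
    exact (Real.rpow_left_inj hx0.le hy0.le ha).1 h2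
  simp only [powMap, h1] at h
  exact smul_right_injective Plane (Real.rpow_pos_of_pos hy0 a).ne' h

theorem lintegral_powMap {a : ℝ} (ha : 1 + a ≠ 0) {s : Set Plane} (hs : MeasurableSet s)
    (h0 : (0 : Plane) ∉ s) (f : Plane → ℝ≥0∞) :
    ∫⁻ x in powMap a '' s, f x =
      ∫⁻ x in s, ENNReal.ofReal (‖x‖ ^ (2 * a) * |1 + a|) * f (powMap a x) := by
  have hne : ∀ x ∈ s, x ≠ 0 := fun x hx h => h0 (h ▸ hx)
  rw [lintegral_image_eq_lintegral_abs_det_fderiv_mul volume hs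
    (fun x hx => (hasFDerivAt_powMap a (hne x hx)).hasFDerivWithinAt)
    ((powMap_injOn ha).mono fun x hx => hne x hx)]
  refine setLIntegral_congr_fun hs fun x hx => ?_
  rw [det_powMapDeriv a (hne x hx), abs_mul, abs_of_nonneg (by positivity : 0 ≤ ‖x‖ ^ (2 * a))]

theorem powMap_mem_disk {a : ℝ} (ha : 1 + a < 0) {x : Plane} (hx : x ∈ outer) :
    powMap a x ∈ disk := by
  have h1 : 1 < ‖x‖ := hx
  rw [mem_disk_iff, norm_powMap a (norm_pos_iff.1 (by linarith))]
  exact Real.rpow_lt_one_of_one_lt_of_neg h1 ha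

/-! ### Reflection across the unit circle -/

/-- Smooth functions with compact support away from the origin. -/
structure Annular (m : Plane → ℂ) : Prop extends SmoothCc m where
  zero_notMem : (0 : Plane) ∉ tsupport m

theorem Annular.mul {m g : Plane → ℂ} (hm : Annular m) (hg : ∀ x ≠ 0, ContDiffAt ℝ ∞ g x) :
    Annular (fun x => m x * g x) where
  smooth := by
    rw [contDiff_iff_contDiffAt]
    intro x
    by_cases hx : x = 0
    · subst hx
      have h : (fun x => m x * g x) =ᶠ[𝓝 0] fun _ => 0 := by
        filter_upwards [(isClosed_tsupport m).isOpen_compl.mem_nhds hm.zero_notMem] with y hy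
        rw [image_eq_zero_of_notMem_tsupport hy, zero_mul]
      exact contDiffAt_const.congr_of_eventuallyEq h
    · exact hm.smooth.contDiffAt.mul (hg x hx)
  compact := hm.compact.mul_right
  zero_notMem h := hm.zero_notMem (tsupport_mul_subset_left h)

theorem Annular.dirDeriv {m : Plane → ℂ} (hm : Annular m) (v : Plane) :
    Annular (dirDeriv v m) where
  toSmoothCc := hm.toSmoothCc.dirDeriv v
  zero_notMem h := by
    have h1 : tsupport (DiskOp.dirDeriv v m) ⊆ tsupport m :=
      (closure_mono fun x (hx : fderiv ℝ m x v ≠ 0) (hx0 : fderiv ℝ m x = 0) => hx (by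
        rw [hx0, zero_apply])).trans (tsupport_fderiv_subset ℝ)
    exact hm.zero_notMem (h1 h)

/-- A function composed with a power map and multiplied by `m`. -/
def pull (a : ℝ) (m v : Plane → ℂ) (x : Plane) : ℂ := m x * v (powMap a x)

theorem Annular.pull {m v : Plane → ℂ} (hm : Annular m) (hv : SmoothCc v) (a : ℝ) :
    Annular (pull a m v) :=
  hm.mul fun _ hx => hv.smooth.contDiffAt.comp _ (contDiffAt_powMap a hx)

/-- The coefficients in the chain rule for `pull`. -/
def pullCoeff (a : ℝ) (m : Plane → ℂ) (i j : Fin 2) (x : Plane) : ℂ :=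
  m x * ((fderiv ℝ (powMap a) x (basisVec i) j : ℝ) : ℂ)

theorem Annular.pullCoeff {m : Plane → ℂ} (hm : Annular m) (a : ℝ) (i j : Fin 2) :
    Annular (pullCoeff a m i j) := by
  refine hm.mul fun x hx => ?_
  have h1 : ContDiffAt ℝ ∞ (fun x => fderiv ℝ (powMap a) x (basisVec i)) x :=
    ((contDiffAt_powMap a hx).fderiv_right (m := ∞) (by simp)).clm_apply contDiffAt_const
  exact Complex.ofRealCLM.contDiff.contDiffAt.comp x
    ((EuclideanSpace.proj (𝕜 := ℝ) j : Plane →L[ℝ] ℝ).contDiff.contDiffAt.comp x h1)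

theorem eq_sum_basisVec (v : Plane) : v = ∑ i, v i • basisVec i := by
  ext j
  fin_cases j <;> simp [basisVec, Fin.sum_univ_two]

theorem dirDeriv_pull {m v : Plane → ℂ} (hm : Annular m) (hv : SmoothCc v) (a : ℝ) (i : Fin 2)
    {x : Plane} (hx : x ≠ 0) :
    dirDeriv (basisVec i) (pull a m v) x = pull a (dirDeriv (basisVec i) m) v x +
      (pull a (pullCoeff a m i 0) (dirDeriv (basisVec 0) v) x +
        pull a (pullCoeff a m i 1) (dirDeriv (basisVec 1) v) x) := by
  have hp := (contDiffAt_powMap a hx).differentiableAt (by simp)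
  have hvd := (hv.smooth.differentiable (by simp)) (powMap a x)
  have hmd := (hm.smooth.differentiable (by simp)) x
  refine (dirDeriv_mul hmd (G := fun x => v (powMap a x)) (hvd.comp x hp)).trans ?_
  have h1 : dirDeriv (basisVec i) (fun x => v (powMap a x)) x =
      fderiv ℝ v (powMap a x) (fderiv ℝ (powMap a) x (basisVec i)) :=
    congrArg (fun L => L (basisVec i)) (fderiv_comp x hvd hp)
  rw [h1]
  conv_lhs => rw [eq_sum_basisVec (fderiv ℝ (powMap a) x (basisVec i))]
  simp only [Fin.sum_univ_two, map_add, map_smul, Complex.real_smul, pull, pullCoeff, dirDeriv]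
  ring

theorem ne_zero_of_mem_outer {x : Plane} (hx : x ∈ outer) : x ≠ 0 := by
  have h1 : 1 < ‖x‖ := hx
  exact norm_pos_iff.1 (by linarith)

/-- The chain rule gives functions of the form `pull` again, with new annular factors. Induction
over all factors `m` at once leaves only order zero to be checked for each norm. -/
theorem exists_dN_pull_le {N N' : (Plane → ℂ) → ℝ≥0∞} (hN : IsFunNorm outer N) (a : ℝ)
    (hbase : ∀ m, Annular m → ∃ C : ℝ≥0, ∀ v, SmoothCc v → N (pull a m v) ≤ C * N' v) (r : ℕ)
    {m : Plane → ℂ} (hm : Annular m) :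
    ∃ C : ℝ≥0, ∀ v, SmoothCc v → dN N r (pull a m v) ≤ C * dN N' r v := by
  induction r generalizing m with
  | zero => exact hbase m hm
  | succ r ih =>
    obtain ⟨C, hC⟩ := ih hm
    choose C₁ h₁ using fun i => ih (hm.dirDeriv (basisVec i))
    choose C₂ h₂ using fun i j => ih (hm.pullCoeff a i j)
    refine ⟨C + ∑ i, (C₁ i + (C₂ i 0 + C₂ i 1)), fun v hv => ?_⟩
    have hi : ∀ i, dN N r (dirDeriv (basisVec i) (pull a m v)) ≤
        ((C₁ i + (C₂ i 0 + C₂ i 1) : ℝ≥0) : ℝ≥0∞) * dN N' (r + 1) v := fun i => by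
      have s1 := ((hm.dirDeriv (basisVec i)).pull hv a).smooth.contDiffOn (s := outer)
      have s2 := ((hm.pullCoeff a i 0).pull (hv.dirDeriv (basisVec 0)) a).smooth.contDiffOn
        (s := outer)
      have s3 := ((hm.pullCoeff a i 1).pull (hv.dirDeriv (basisVec 1)) a).smooth.contDiffOn
        (s := outer)
      rw [hN.dN_congr isOpen_outer (fun x hx => dirDeriv_pull hm hv a i (ne_zero_of_mem_outer hx))]
      refine (hN.dN_add_le isOpen_outer s1 (s2.add s3) r).trans ?_
      refine (add_le_add le_rfl (hN.dN_add_le isOpen_outer s2 s3 r)).trans ?_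
      push_cast
      rw [add_mul, add_mul]
      gcongr
      · exact (h₁ i v hv).trans (by gcongr; exact dN_le_succ N' r v)
      · exact (h₂ i 0 _ (hv.dirDeriv _)).trans (by gcongr; exact dN_dirDeriv_le N' r v 0)
      · exact (h₂ i 1 _ (hv.dirDeriv _)).trans (by gcongr; exact dN_dirDeriv_le N' r v 1)
    calc dN N (r + 1) (pull a m v) ≤ C * dN N' (r + 1) v +
          ∑ i, ((C₁ i + (C₂ i 0 + C₂ i 1) : ℝ≥0) : ℝ≥0∞) * dN N' (r + 1) v := by
          refine add_le_add ((hC v hv).trans ?_) (Finset.sum_le_sum fun i _ => hi i)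
          gcongr
          exact dN_le_succ N' r v
      _ = _ := by
          rw [← Finset.sum_mul, ENNReal.coe_add, add_mul, ENNReal.ofNNReal_finsetSum]

/-- Change of variables: `powMap a` sends the exterior into the disk. The inverse Jacobian is
absorbed by the bounded function `m x * ‖x‖ ^ (-a)`. -/
theorem exists_l2N_pull_le {a : ℝ} (ha : 1 + a < 0) {m : Plane → ℂ} (hm : Annular m) :
    ∃ C : ℝ≥0, ∀ v, SmoothCc v → l2N outer (pull a m v) ≤ C * l2N disk v := by
  have hw : Annular fun x => m x * ((‖x‖ ^ (-a) : ℝ) : ℂ) := hm.mul fun x hx =>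
    Complex.ofRealCLM.contDiff.contDiffAt.comp x
      ((contDiffAt_norm ℝ hx).rpow_const_of_ne (norm_ne_zero_iff.2 hx))
  obtain ⟨B, hB⟩ := hw.compact.exists_bound_of_continuous hw.smooth.continuous
  have hB0 : 0 ≤ B := (norm_nonneg _).trans (hB 0)
  have hJ : 0 < |1 + a| := abs_pos.2 ha.ne
  refine ⟨(B * |1 + a|⁻¹ ^ (1 / 2 : ℝ)).toNNReal, fun v hv => ?_⟩
  rw [← sq_le_sq_iff_ennreal, mul_pow, l2N, l2N, eLpNorm_two_sq, eLpNorm_two_sq]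
  have hc : ((B * |1 + a|⁻¹ ^ (1 / 2 : ℝ)).toNNReal : ℝ≥0∞) ^ 2 =
      ENNReal.ofReal (B ^ 2 * |1 + a|⁻¹) := by
    rw [← ENNReal.ofReal, ← ENNReal.ofReal_pow (by positivity), mul_pow, ← Real.rpow_natCast
      (|1 + a|⁻¹ ^ (1 / 2 : ℝ)), ← Real.rpow_mul (by positivity)]
    norm_num
  have hsub : powMap a '' outer ⊆ disk := image_subset_iff.2 fun x hx => powMap_mem_disk ha hx
  calc ∫⁻ x in outer, ‖pull a m v x‖ₑ ^ 2
      ≤ ∫⁻ x in outer, ENNReal.ofReal (B ^ 2 * |1 + a|⁻¹) *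
          (ENNReal.ofReal (‖x‖ ^ (2 * a) * |1 + a|) * ‖v (powMap a x)‖ₑ ^ 2) := by
        refine setLIntegral_mono' isOpen_outer.measurableSet fun x hx => ?_
        have hx0 := norm_pos_iff.2 (ne_zero_of_mem_outer hx)
        rw [pull, enorm_mul, mul_pow, ← mul_assoc, ← ENNReal.ofReal_mul (by positivity)]
        gcongr
        rw [← ofReal_norm, ← ENNReal.ofReal_pow (norm_nonneg _)]
        refine ENNReal.ofReal_le_ofReal ?_
        have h1 := hB x
        rw [norm_mul, Complex.norm_real, Real.norm_of_nonneg (by positivity), Real.rpow_neg hx0.le,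
          ← div_eq_mul_inv, div_le_iff₀ (by positivity)] at h1
        have h2 : ‖x‖ ^ (2 * a) = (‖x‖ ^ a) ^ 2 := by
          rw [two_mul, Real.rpow_add hx0, sq]
        calc ‖m x‖ ^ 2 ≤ (B * ‖x‖ ^ a) ^ 2 := by gcongr
          _ = _ := by
            rw [h2]
            field_simp
    _ = ENNReal.ofReal (B ^ 2 * |1 + a|⁻¹) * ∫⁻ x in powMap a '' outer, ‖v x‖ₑ ^ 2 := by
        rw [lintegral_const_mul' _ _ ENNReal.ofReal_ne_top,
          lintegral_powMap ha.ne isOpen_outer.measurableSet fun h => ne_zero_of_mem_outer h rfl]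
    _ ≤ _ := by
        rw [hc]
        gcongr

theorem exists_supN_pull_le {a : ℝ} (ha : 1 + a < 0) {m : Plane → ℂ} (hm : Annular m) :
    ∃ C : ℝ≥0, ∀ v, SmoothCc v → supN outer (pull a m v) ≤ C * supN disk v := by
  obtain ⟨B, hB⟩ := hm.compact.exists_bound_of_continuous hm.smooth.continuous
  refine ⟨B.toNNReal, fun v _ => iSup₂_le fun x hx => ?_⟩
  rw [pull, enorm_mul]
  gcongr
  · rw [← ofReal_norm]
    exact ENNReal.ofReal_le_ofReal (hB x)
  · exact enorm_le_supN v (powMap_mem_disk ha hx)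

/-- Equal to one on the ball of radius `r`, vanishing outside the ball of radius `R`. -/
def ballBump (r R : ℝ) (h0 : 0 < r) (h : r < R) : ContDiffBump (0 : Plane) := ⟨r, R, h0, h⟩

/-- A cutoff near the unit circle. -/
def ringCut (x : Plane) : ℂ :=
  ((ballBump 2 3 (by norm_num) (by norm_num) x - ballBump 4⁻¹ 2⁻¹ (by norm_num) (by norm_num) x :
    ℝ) : ℂ)

theorem ringCut_eq_one {x : Plane} (h1 : 1 / 2 < ‖x‖) (h2 : ‖x‖ < 2) : ringCut x = 1 := by
  rw [ringCut, ContDiffBump.one_of_mem_closedBall, ContDiffBump.zero_of_le_dist]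
  · simp
  · simp [ballBump]; linarith
  · simp [ballBump]; linarith

theorem annular_ringCut : Annular ringCut where
  smooth := Complex.ofRealCLM.contDiff.comp ((ContDiffBump.contDiff _).sub (ContDiffBump.contDiff _))
  compact := ((ContDiffBump.hasCompactSupport _).sub (ContDiffBump.hasCompactSupport _)).comp_left
    (g := fun r : ℝ => (r : ℂ)) (by simp)
  zero_notMem := by
    rw [notMem_tsupport_iff_eventuallyEq]
    filter_upwards [Metric.ball_mem_nhds (0 : Plane) (show (0 : ℝ) < 4⁻¹ by norm_num)] with x hx
    have hx' : ‖x‖ < 4⁻¹ := by simpa using hx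
    rw [ringCut, ContDiffBump.one_of_mem_closedBall, ContDiffBump.one_of_mem_closedBall]
    · simp
    · simp [ballBump]; linarith
    · simp [ballBump]; linarith

/-- The reflection of `v` across the unit circle; it agrees with `v` to first order there. -/
def refl (v : Plane → ℂ) (x : Plane) : ℂ :=
  pull (-2) (fun x => ringCut x * 2) v x + pull (-4) (fun x => ringCut x * (-1)) v x

theorem annular_ringCut_mul (c : ℂ) : Annular fun x => ringCut x * c :=
  annular_ringCut.mul fun _ _ => contDiffAt_const

theorem SmoothCc.add {u v : Plane → ℂ} (hu : SmoothCc u) (hv : SmoothCc v) :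
    SmoothCc (fun x => u x + v x) := ⟨hu.smooth.add hv.smooth, hu.compact.add hv.compact⟩

theorem SmoothCc.refl {v : Plane → ℂ} (hv : SmoothCc v) : SmoothCc (refl v) :=
  ((annular_ringCut_mul 2).pull hv (-2)).toSmoothCc.add
    ((annular_ringCut_mul (-1)).pull hv (-4)).toSmoothCc

theorem powMap_of_norm_eq_one (a : ℝ) {x : Plane} (hx : ‖x‖ = 1) : powMap a x = x := by
  simp [powMap, hx]

theorem refl_eq {v : Plane → ℂ} {x : Plane} (hx : ‖x‖ = 1) : v x = refl v x := by
  simp only [refl, pull, powMap_of_norm_eq_one _ hx]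
  rw [ringCut_eq_one (by linarith) (by linarith)]
  ring

/-- On the circle composition with `powMap a` multiplies the radial derivative by `1 + a` and keeps
the tangential one. With `a = -2, -4` and coefficients `2, -1` this gives `2 · (-1) - (-3) = 1`
radially and `2 - 1 = 1` for the rest. -/
theorem dirDeriv_refl_eq {v : Plane → ℂ} (hv : SmoothCc v) {x : Plane} (hx : ‖x‖ = 1) (w : Plane) :
    dirDeriv w v x = dirDeriv w (refl v) x := by
  have hx0 : x ≠ 0 := norm_pos_iff.1 (by linarith)
  have h1 : refl v =ᶠ[𝓝 x] fun y => 2 * v (powMap (-2) y) - v (powMap (-4) y) := by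
    have ho : IsOpen {y : Plane | 1 / 2 < ‖y‖ ∧ ‖y‖ < 2} :=
      (isOpen_lt continuous_const continuous_norm).inter (isOpen_lt continuous_norm continuous_const)
    filter_upwards [ho.mem_nhds (show x ∈ {y : Plane | 1 / 2 < ‖y‖ ∧ ‖y‖ < 2} by
      constructor <;> linarith)] with y hy
    simp only [refl, pull]
    rw [ringCut_eq_one hy.1 hy.2]
    ring
  have hd : ∀ a : ℝ, HasFDerivAt (fun y => v (powMap a y))
      ((fderiv ℝ v x).comp (powMapDeriv a x)) x := fun a => by
    have := ((hv.smooth.differentiable (by simp)) (powMap a x)).hasFDerivAt.comp x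
      (hasFDerivAt_powMap a hx0)
    rwa [powMap_of_norm_eq_one a hx] at this
  have h2 := ((hd (-2)).const_mul (2 : ℂ)).fun_sub (hd (-4))
  unfold dirDeriv
  rw [h1.fderiv_eq, h2.fderiv]
  simp [powMapDeriv, hx]
  ring

theorem exists_dN_refl_le {N N' : (Plane → ℂ) → ℝ≥0∞} (hN : IsFunNorm outer N)
    (hbase : ∀ a : ℝ, 1 + a < 0 → ∀ m, Annular m → ∃ C : ℝ≥0, ∀ v, SmoothCc v →
      N (pull a m v) ≤ C * N' v) (r : ℕ) :
    ∃ C : ℝ≥0, ∀ v, SmoothCc v → dN N r (refl v) ≤ C * dN N' r v := by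
  obtain ⟨C₁, h₁⟩ := exists_dN_pull_le hN (-2) (hbase (-2) (by norm_num)) r (annular_ringCut_mul 2)
  obtain ⟨C₂, h₂⟩ := exists_dN_pull_le hN (-4) (hbase (-4) (by norm_num)) r
    (annular_ringCut_mul (-1))
  refine ⟨C₁ + C₂, fun v hv => ?_⟩
  rw [ENNReal.coe_add, add_mul]
  exact (hN.dN_add_le isOpen_outer ((annular_ringCut_mul 2).pull hv (-2)).smooth.contDiffOn
    ((annular_ringCut_mul (-1)).pull hv (-4)).smooth.contDiffOn r).trans
    (add_le_add (h₁ v hv) (h₂ v hv))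

/-- The extension of `v` from the disk by reflection. -/
def extL {v : Plane → ℂ} (hv : SmoothCc v) : L2 := glueL hv hv.refl

theorem exists_extL_bound : ∃ C : ℝ≥0, ∀ k : ℕ, k ≤ 2 → ∀ v, ∀ hv : SmoothCc v,
    planeSobolevNorm k (extL hv) ≤ C * dN (l2N disk) k v := by
  choose C hC using fun r => exists_dN_refl_le (isFunNorm_l2N isOpen_outer)
    (fun a ha m hm => exists_l2N_pull_le ha hm) r
  refine ⟨1 + (C 0 + C 1 + C 2), fun k hk v hv => ?_⟩
  have h1 : planeSobolevNorm k (extL hv) ≤ dN (l2N disk) k v + dN (l2N outer) k (refl v) := by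
    interval_cases k
    · exact_mod_cast planeSobolevNorm_zero_glueL_le hv hv.refl
    · exact_mod_cast planeSobolevNorm_one_glueL_le hv hv.refl fun x hx => refl_eq hx
    · exact_mod_cast planeSobolevNorm_two_glueL_le hv hv.refl (fun x hx => refl_eq hx)
        fun x hx i => dirDeriv_refl_eq hv hx _
  have h2 : C k ≤ C 0 + C 1 + C 2 := by
    interval_cases k
    · rw [add_assoc]; exact le_self_add
    · rw [add_right_comm]; exact le_add_self
    · exact le_add_self
  refine h1.trans ?_
  rw [ENNReal.coe_add, ENNReal.coe_one, add_mul, one_mul]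
  gcongr
  refine (hC k v hv).trans ?_
  gcongr

/-! ### Dilations -/

theorem one_lt_dil_radius {ρ : ℝ} (h0 : 0 < ρ) (h1 : ρ < 1) : 1 < (1 + ρ⁻¹) / 2 := by
  have := (one_lt_inv₀ h0).2 h1
  linarith

/-- The cutoff used for dilations. -/
def dilCut (ρ : ℝ) (h0 : 0 < ρ) (h1 : ρ < 1) : ContDiffBump (0 : Plane) :=
  ballBump 1 ((1 + ρ⁻¹) / 2) one_pos (one_lt_dil_radius h0 h1)

/-- A function with compact support that equals `u (ρ x)` for `x` in the disk. -/
def dil (ρ : ℝ) (h0 : 0 < ρ) (h1 : ρ < 1) (u : Plane → ℂ) (x : Plane) : ℂ :=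
  (dilCut ρ h0 h1 x : ℂ) * u (ρ • x)

theorem smul_mem_disk {ρ : ℝ} (h0 : 0 < ρ) (h1 : ρ < 1) {x : Plane} (hx : x ∈ disk) :
    ρ • x ∈ disk := by
  rw [mem_disk_iff] at hx ⊢
  rw [norm_smul, Real.norm_of_nonneg h0.le]
  nlinarith [norm_nonneg x]

theorem dil_eq {ρ : ℝ} (h0 : 0 < ρ) (h1 : ρ < 1) (u : Plane → ℂ) {x : Plane} (hx : x ∈ disk) :
    dil ρ h0 h1 u x = u (ρ • x) := by
  rw [dil, ContDiffBump.one_of_mem_closedBall]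
  · simp
  · simpa [dilCut, ballBump] using (mem_disk_iff.1 hx).le

theorem dilCut_lt {ρ : ℝ} (h0 : 0 < ρ) (h1 : ρ < 1) {x : Plane} (hx : ρ • x ∉ disk) :
    (dilCut ρ h0 h1).rOut < ‖x‖ := by
  have h2 := (one_lt_inv₀ h0).2 h1
  rw [mem_disk_iff, norm_smul, Real.norm_of_nonneg h0.le, not_lt] at hx
  have h3 : ρ⁻¹ ≤ ‖x‖ := by rwa [inv_le_iff_one_le_mul₀' h0]
  simp only [dilCut, ballBump]
  linarith

theorem dil_congr {ρ : ℝ} (h0 : 0 < ρ) (h1 : ρ < 1) {u v : Plane → ℂ} (h : EqOn u v disk) :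
    dil ρ h0 h1 u = dil ρ h0 h1 v := by
  ext x
  by_cases hx : ρ • x ∈ disk
  · rw [dil, dil, h hx]
  · have h2 : dilCut ρ h0 h1 x = 0 :=
      ContDiffBump.zero_of_le_dist _ (by simpa using (dilCut_lt h0 h1 hx).le)
    simp [dil, h2]

/-- The cutoff radius `(1 + ρ⁻¹) / 2` lies strictly between `1` and `ρ⁻¹`, so on the support of the
cutoff `u` is evaluated inside the open disk. -/
theorem smoothCc_dil {ρ : ℝ} (h0 : 0 < ρ) (h1 : ρ < 1) {u : Plane → ℂ}
    (hu : ContDiffOn ℝ ∞ u disk) : SmoothCc (dil ρ h0 h1 u) := by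
  have hcs : HasCompactSupport fun x => (dilCut ρ h0 h1 x : ℂ) :=
    (dilCut ρ h0 h1).hasCompactSupport.comp_left (g := fun r : ℝ => (r : ℂ)) (by simp)
  refine ⟨?_, hcs.mul_right⟩
  rw [contDiff_iff_contDiffAt]
  intro x
  by_cases hx : ρ • x ∈ disk
  · refine (Complex.ofRealCLM.contDiff.comp (dilCut ρ h0 h1).contDiff).contDiffAt.mul ?_
    exact (hu.contDiffAt (isOpen_disk.mem_nhds hx)).comp x (contDiffAt_id.const_smul ρ)
  · have h2 : dil ρ h0 h1 u =ᶠ[𝓝 x] fun _ => 0 := by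
      filter_upwards [(isOpen_lt continuous_const continuous_norm).mem_nhds
        (dilCut_lt h0 h1 hx)] with y hy
      have : dilCut ρ h0 h1 y = 0 := ContDiffBump.zero_of_le_dist _ (by simpa using le_of_lt hy)
      simp [dil, this]
    exact contDiffAt_const.congr_of_eventuallyEq h2

theorem dirDeriv_const_mul_comp_smul {u : Plane → ℂ} (hu : ContDiffOn ℝ ∞ u disk) {ρ : ℝ}
    (h0 : 0 < ρ) (h1 : ρ < 1) (κ : ℂ) (v : Plane) {x : Plane} (hx : x ∈ disk) :
    dirDeriv v (fun x => κ * u (ρ • x)) x = κ * ρ * dirDeriv v u (ρ • x) := by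
  have h2 : HasFDerivAt (fun x : Plane => ρ • x) (ρ • ContinuousLinearMap.id ℝ Plane) x :=
    (hasFDerivAt_id x).const_smul ρ
  have h3 := (((differentiableAt_of_contDiffOn isOpen_disk hu
    (smul_mem_disk h0 h1 hx)).hasFDerivAt.comp x h2).const_mul κ)
  have h4 : dirDeriv v (fun x => κ * u (ρ • x)) x = _ := congrArg (fun L => L v) h3.fderiv
  rw [h4]
  simp [dirDeriv]
  ring

/-- The factor `κ` collects the powers of `ρ ≤ 1` produced by the derivatives and keeps the
induction closed. -/
theorem dN_comp_smul_le {N : (Plane → ℂ) → ℝ≥0∞} (hN : IsFunNorm disk N) {ρ : ℝ} (h0 : 0 < ρ)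
    (h1 : ρ < 1) (hbase : ∀ κ : ℂ, ‖κ‖ ≤ 1 → ∀ u, N (fun x => κ * u (ρ • x)) ≤ 2 * N u) (r : ℕ)
    {κ : ℂ} (hκ : ‖κ‖ ≤ 1) {u : Plane → ℂ} (hu : ContDiffOn ℝ ∞ u disk) :
    dN N r (fun x => κ * u (ρ • x)) ≤ 2 * dN N r u := by
  induction r generalizing κ u with
  | zero => exact hbase κ hκ u
  | succ r ih =>
    have h2 : ∀ i, dN N r (dirDeriv (basisVec i) fun x => κ * u (ρ • x)) ≤
        2 * dN N r (dirDeriv (basisVec i) u) := fun i => by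
      rw [hN.dN_congr isOpen_disk (fun x hx => dirDeriv_const_mul_comp_smul hu h0 h1 κ _ hx)]
      refine ih ?_ (contDiffOn_dirDeriv isOpen_disk hu _)
      rw [norm_mul, Complex.norm_real, Real.norm_of_nonneg h0.le]
      exact mul_le_one₀ hκ h0.le h1.le
    calc dN N (r + 1) (fun x => κ * u (ρ • x))
        ≤ 2 * dN N r u + ∑ i, 2 * dN N r (dirDeriv (basisVec i) u) :=
          add_le_add (ih hκ hu) (Finset.sum_le_sum fun i _ => h2 i)
      _ = _ := by rw [← Finset.mul_sum, ← mul_add]; rfl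

theorem dN_dil_le {N : (Plane → ℂ) → ℝ≥0∞} (hN : IsFunNorm disk N) {ρ : ℝ} (h0 : 0 < ρ)
    (h1 : ρ < 1) (hbase : ∀ κ : ℂ, ‖κ‖ ≤ 1 → ∀ u, N (fun x => κ * u (ρ • x)) ≤ 2 * N u) (r : ℕ)
    {u : Plane → ℂ} (hu : ContDiffOn ℝ ∞ u disk) : dN N r (dil ρ h0 h1 u) ≤ 2 * dN N r u := by
  have h2 := dN_comp_smul_le hN h0 h1 hbase r (κ := 1) (by simp) hu
  rw [hN.dN_congr isOpen_disk (fun x hx => dil_eq h0 h1 u hx)]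
  simpa using h2

theorem supN_comp_smul_le {ρ : ℝ} (h0 : 0 < ρ) (h1 : ρ < 1) (κ : ℂ) (hκ : ‖κ‖ ≤ 1)
    (u : Plane → ℂ) : supN disk (fun x => κ * u (ρ • x)) ≤ 2 * supN disk u := by
  refine iSup₂_le fun x hx => ?_
  rw [enorm_mul]
  gcongr
  · rw [← ofReal_norm]
    exact (ENNReal.ofReal_le_one.2 hκ).trans (by norm_num)
  · exact enorm_le_supN u (smul_mem_disk h0 h1 hx)

/-- The Jacobian `ρ ^ 2` is at least `1 / 4`, which gives the factor `2` uniformly in `ρ`. -/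
theorem l2N_comp_smul_le {ρ : ℝ} (h0 : 1 / 2 ≤ ρ) (h1 : ρ < 1) (κ : ℂ) (hκ : ‖κ‖ ≤ 1)
    (u : Plane → ℂ) : l2N disk (fun x => κ * u (ρ • x)) ≤ 2 * l2N disk u := by
  have hρ : 0 < ρ := by linarith
  rw [← sq_le_sq_iff_ennreal, mul_pow, l2N, l2N, eLpNorm_two_sq, eLpNorm_two_sq]
  have hdet : (ρ • ContinuousLinearMap.id ℝ Plane).det = ρ ^ 2 := by
    have : ((ρ • ContinuousLinearMap.id ℝ Plane : Plane →L[ℝ] Plane) : Plane →ₗ[ℝ] Plane) =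
      ρ • LinearMap.id := rfl
    rw [ContinuousLinearMap.det, this, LinearMap.det_smul]
    simp
  have hi := lintegral_image_eq_lintegral_abs_det_fderiv_mul volume measurableSet_disk
    (f := fun x : Plane => ρ • x) (f' := fun _ => ρ • ContinuousLinearMap.id ℝ Plane)
    (fun x _ => ((hasFDerivAt_id x).const_smul ρ).hasFDerivWithinAt)
    (smul_right_injective Plane hρ.ne').injOn (fun x => ‖u x‖ₑ ^ 2)
  rw [hdet] at hi
  have hsub : (fun x : Plane => ρ • x) '' disk ⊆ disk :=
    image_subset_iff.2 fun x hx => smul_mem_disk hρ h1 hx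
  calc ∫⁻ x in disk, ‖κ * u (ρ • x)‖ₑ ^ 2
      ≤ ∫⁻ x in disk, 2 ^ 2 * (ENNReal.ofReal |ρ ^ 2| * ‖u (ρ • x)‖ₑ ^ 2) := by
        refine lintegral_mono fun x => ?_
        rw [enorm_mul, mul_pow, ← mul_assoc]
        gcongr
        have e1 : ‖κ‖ₑ ^ 2 ≤ 1 := by
          rw [← ofReal_norm]
          exact pow_le_one₀ zero_le (ENNReal.ofReal_le_one.2 hκ)
        refine e1.trans ?_
        have e2 : (2 : ℝ≥0∞) ^ 2 = ENNReal.ofReal 4 := by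
          rw [ENNReal.ofReal_ofNat]; norm_num
        rw [e2, ← ENNReal.ofReal_mul (by norm_num), ENNReal.one_le_ofReal, abs_of_nonneg (by positivity)]
        nlinarith
    _ = 2 ^ 2 * ∫⁻ x in (fun x : Plane => ρ • x) '' disk, ‖u x‖ₑ ^ 2 := by
        rw [hi, lintegral_const_mul' _ _ (by norm_num)]
    _ ≤ _ := by
        gcongr

/-! ### Passing to the limit in dilations -/

/-- The dilation factors that tend to one. -/
def dilSeq (n : ℕ) : ℝ := 1 - 1 / ((n : ℝ) + 2)

theorem dilSeq_ge (n : ℕ) : 1 / 2 ≤ dilSeq n := by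
  have : 1 / ((n : ℝ) + 2) ≤ 1 / 2 := by
    apply one_div_le_one_div_of_le <;> [norm_num; skip]
    linarith [(Nat.cast_nonneg n : (0 : ℝ) ≤ n)]
  rw [dilSeq]; linarith

theorem dilSeq_pos (n : ℕ) : 0 < dilSeq n := by linarith [dilSeq_ge n]

theorem dilSeq_lt (n : ℕ) : dilSeq n < 1 := by
  have : 0 < 1 / ((n : ℝ) + 2) := by positivity
  rw [dilSeq]; linarith

theorem tendsto_dilSeq : Tendsto dilSeq atTop (𝓝 1) := by
  have h : Tendsto (fun n : ℕ => 1 / ((n : ℝ) + 2)) atTop (𝓝 0) :=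
    tendsto_const_nhds.div_atTop
      (tendsto_atTop_add_const_right _ _ tendsto_natCast_atTop_atTop)
  rw [← sub_zero (1 : ℝ)]
  exact h.const_sub 1

/-- The dilations of `u` along `dilSeq`. -/
abbrev dilN (n : ℕ) (u : Plane → ℂ) : Plane → ℂ := dil (dilSeq n) (dilSeq_pos n) (dilSeq_lt n) u

theorem smoothCc_dilN (n : ℕ) {u : Plane → ℂ} (hu : ContDiffOn ℝ ∞ u disk) :
    SmoothCc (dilN n u) := smoothCc_dil _ _ hu

theorem dN_l2N_dilN_le (n r : ℕ) {u : Plane → ℂ} (hu : ContDiffOn ℝ ∞ u disk) :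
    dN (l2N disk) r (dilN n u) ≤ 2 * dN (l2N disk) r u :=
  dN_dil_le (isFunNorm_l2N isOpen_disk) _ _ (l2N_comp_smul_le (dilSeq_ge n) (dilSeq_lt n)) r hu

theorem dN_supN_dilN_le (n r : ℕ) {u : Plane → ℂ} (hu : ContDiffOn ℝ ∞ u disk) :
    dN (supN disk) r (dilN n u) ≤ 2 * dN (supN disk) r u :=
  dN_dil_le (isFunNorm_supN disk) _ _ (supN_comp_smul_le (dilSeq_pos n) (dilSeq_lt n)) r hu

theorem tendsto_l2N_dilN_sub {u : Plane → ℂ} (hu : ContDiffOn ℝ ∞ u disk) {B : ℝ}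
    (hB : ∀ x ∈ disk, ‖u x‖ ≤ B) :
    Tendsto (fun n => l2N disk (fun x => dilN n u x - u x)) atTop (𝓝 0) := by
  have hmeas : ∀ n, AEStronglyMeasurable (fun x => dilN n u x - u x) (volume.restrict disk) :=
    fun n => ((smoothCc_dilN n hu).smooth.continuous.continuousOn.sub
      hu.continuousOn).aestronglyMeasurable measurableSet_disk
  have h1 : Tendsto (fun n => ∫⁻ x in disk, ‖dilN n u x - u x‖ₑ ^ 2) atTop (𝓝 0) := by
    have h2 := tendsto_lintegral_of_dominated_convergence' (μ := volume.restrict disk)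
      (F := fun n x => ‖dilN n u x - u x‖ₑ ^ 2) (f := fun _ => 0)
      (fun _ => ENNReal.ofReal (2 * B) ^ 2) (fun n => (hmeas n).enorm.pow_const 2) ?_ ?_ ?_
    · simpa using h2
    · intro n
      filter_upwards [ae_restrict_mem measurableSet_disk] with x hx
      gcongr
      rw [← ofReal_norm]
      refine ENNReal.ofReal_le_ofReal ((norm_sub_le _ _).trans ?_)
      rw [dilN, dil_eq _ _ _ hx]
      linarith [hB x hx, hB _ (smul_mem_disk (dilSeq_pos n) (dilSeq_lt n) hx)]
    · rw [lintegral_const, Measure.restrict_apply_univ]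
      exact ENNReal.mul_ne_top (by finiteness) (by
        rw [disk]; exact measure_ball_lt_top.ne)
    · filter_upwards [ae_restrict_mem measurableSet_disk] with x hx
      have h3 : Tendsto (fun n => dilN n u x) atTop (𝓝 (u x)) := by
        have h4 : Tendsto (fun n => dilSeq n • x) atTop (𝓝 x) := by
          simpa using tendsto_dilSeq.smul_const x
        have h5 := ((hu.continuousOn.continuousAt (isOpen_disk.mem_nhds hx)).tendsto.comp h4)
        refine h5.congr fun n => ?_
        rw [dilN, dil_eq _ _ _ hx]
        rfl
      have h6 := (h3.sub_const (u x)).enorm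
      rw [sub_self, enorm_zero] at h6
      simpa [Function.comp_def] using ((ENNReal.continuous_pow 2).tendsto 0).comp h6
  have h3 : ∀ n, l2N disk (fun x => dilN n u x - u x) =
      (∫⁻ x in disk, ‖dilN n u x - u x‖ₑ ^ 2) ^ (1 / 2 : ℝ) := fun n => by
    rw [← eLpNorm_two_sq, ← ENNReal.rpow_natCast, ← ENNReal.rpow_mul]
    norm_num [l2N]
  simp_rw [h3]
  simpa [Function.comp_def] using
    ((ENNReal.continuous_rpow_const (y := (1 / 2 : ℝ))).tendsto 0).comp h1

theorem SmoothCc.sub {u v : Plane → ℂ} (hu : SmoothCc u) (hv : SmoothCc v) :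
    SmoothCc (fun x => u x - v x) := ⟨hu.smooth.sub hv.smooth, hu.compact.sub hv.compact⟩

theorem glue_sub (a b a' b' : Plane → ℂ) (x : Plane) :
    glue (fun x => a x - a' x) (fun x => b x - b' x) x = glue a b x - glue a' b' x := by
  by_cases hx : x ∈ disk
  · simp only [glue_of_mem hx]
  · simp only [glue_of_notMem hx]

theorem glueL_sub {a b a' b' : Plane → ℂ} (ha : SmoothCc a) (hb : SmoothCc b) (ha' : SmoothCc a')
    (hb' : SmoothCc b') :
    glueL (ha.sub ha') (hb.sub hb') = glueL ha hb - glueL ha' hb' := by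
  rw [glueL, glueL, glueL, ← MemLp.toLp_sub]
  congr 1
  ext x
  exact glue_sub a b a' b' x

theorem refl_sub (u v : Plane → ℂ) :
    refl (fun x => u x - v x) = fun x => refl u x - refl v x := by
  ext x
  simp only [refl, pull]
  ring

theorem extL_sub {u v : Plane → ℂ} (hu : SmoothCc u) (hv : SmoothCc v) :
    extL (hu.sub hv) = extL hu - extL hv := by
  rw [extL, extL, extL, ← glueL_sub]
  congr 1
  exact refl_sub u v

theorem glueL_congr {a b a' b' : Plane → ℂ} (ha : SmoothCc a) (hb : SmoothCc b) (ha' : SmoothCc a')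
    (hb' : SmoothCc b') (h : a = a') (h' : b = b') : glueL ha hb = glueL ha' hb' := by
  subst h h'; rfl

theorem extL_congr {u v : Plane → ℂ} (hu : SmoothCc u) (hv : SmoothCc v) (h : u = v) :
    extL hu = extL hv := by
  subst h; rfl

theorem extL_ae_eq {u : Plane → ℂ} (hu : SmoothCc u) : extL hu =ᵐ[volume.restrict disk] u := by
  filter_upwards [ae_restrict_of_ae (memLp_glue hu hu.refl).coeFn_toLp,
    ae_restrict_mem measurableSet_disk] with x h1 h2
  rw [extL, glueL, h1, glue_of_mem h2]

/-- The dilates of `u` converge to `u` in `L²` of the disk. Extension is linear and bounded on `L²`,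
so the extensions are Cauchy; their limit extends `u` and inherits the bound by lower
semicontinuity. -/
theorem sobolevNorm_disk_le_of_dil {u : Plane → ℂ} (hu : ContDiffOn ℝ ∞ u disk) {B : ℝ}
    (hB : ∀ x ∈ disk, ‖u x‖ ≤ B) {s : ℝ} {M : ℝ≥0∞}
    (h : ∀ n, planeSobolevNorm s (extL (smoothCc_dilN n hu)) ≤ M) : sobolevNorm disk s u ≤ M := by
  obtain ⟨C, hC⟩ := exists_extL_bound
  set g : ℕ → L2 := fun n => extL (smoothCc_dilN n hu) with hg
  have hδ := tendsto_l2N_dilN_sub hu hB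
  have hmeas : ∀ n, AEStronglyMeasurable (fun x => dilN n u x - u x) (volume.restrict disk) :=
    fun n => ((smoothCc_dilN n hu).smooth.continuous.continuousOn.sub
      hu.continuousOn).aestronglyMeasurable measurableSet_disk
  have hdist : ∀ n m, edist (g n) (g m) ≤ C * (l2N disk (fun x => dilN n u x - u x) +
      l2N disk (fun x => dilN m u x - u x)) := by
    intro n m
    rw [edist_eq_enorm_sub, ← planeSobolevNorm_zero, hg]
    simp only
    rw [← extL_sub]
    have h1 := hC 0 (by norm_num) _ ((smoothCc_dilN n hu).sub (smoothCc_dilN m hu))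
    rw [Nat.cast_zero] at h1
    refine h1.trans ?_
    gcongr
    have e : (fun x => dilN n u x - dilN m u x) =
        (fun x => dilN n u x - u x) - fun x => dilN m u x - u x := by ext x; simp
    simp only [dN]
    rw [e]
    exact eLpNorm_sub_le (hmeas n) (hmeas m) (by norm_num)
  have hcauchy : CauchySeq g := by
    rw [EMetric.cauchySeq_iff]
    intro ε hε
    have h2 : Tendsto (fun p : ℕ × ℕ => (C : ℝ≥0∞) * (l2N disk (fun x => dilN p.1 u x - u x) +
        l2N disk (fun x => dilN p.2 u x - u x))) (atTop ×ˢ atTop) (𝓝 0) := by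
      have := (hδ.comp tendsto_fst).add (hδ.comp (tendsto_snd (f := atTop (α := ℕ))))
      simpa using ENNReal.Tendsto.const_mul (a := (C : ℝ≥0∞)) this (Or.inr ENNReal.coe_ne_top)
    rw [prod_atTop_atTop_eq] at h2
    obtain ⟨⟨n₀, m₀⟩, hN⟩ := eventually_atTop.1 (h2.eventually (gt_mem_nhds hε))
    exact ⟨max n₀ m₀, fun n hn m hm => (hdist n m).trans_lt
      (hN (n, m) ⟨(le_max_left _ _).trans hn, (le_max_right _ _).trans hm⟩)⟩
  obtain ⟨g₀, hg₀⟩ := cauchySeq_tendsto_of_complete hcauchy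
  refine iInf₂_le_of_le g₀ ?_ (planeSobolevNorm_le_of_tendsto s hg₀ h)
  have hz : eLpNorm ((g₀ : Plane → ℂ) - u) 2 (volume.restrict disk) = 0 := by
    have h3 : ∀ n, eLpNorm ((g₀ : Plane → ℂ) - u) 2 (volume.restrict disk) ≤
        edist (g n) g₀ + l2N disk (fun x => dilN n u x - u x) := by
      intro n
      have e : (g₀ : Plane → ℂ) - u =ᵐ[volume.restrict disk]
          ((g₀ : Plane → ℂ) - g n) + fun x => dilN n u x - u x := by
        filter_upwards [extL_ae_eq (smoothCc_dilN n hu)] with x hx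
        simp only [Pi.sub_apply, Pi.add_apply, hg]
        rw [hx]
        ring
      rw [eLpNorm_congr_ae e, edist_comm, Lp.edist_def]
      refine (eLpNorm_add_le ((Lp.aestronglyMeasurable g₀).sub
        (Lp.aestronglyMeasurable (g n))).restrict (hmeas n) (by norm_num)).trans ?_
      exact add_le_add (eLpNorm_mono_measure _ Measure.restrict_le_self) le_rfl
    have h4 : Tendsto (fun n => edist (g n) g₀ + l2N disk (fun x => dilN n u x - u x)) atTop
        (𝓝 0) := by
      simpa using (tendsto_iff_edist_tendsto_0.1 hg₀).add hδ
    exact le_antisymm (ge_of_tendsto' h4 h3) zero_le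
  have hm : AEStronglyMeasurable ((g₀ : Plane → ℂ) - u) (volume.restrict disk) :=
    (Lp.aestronglyMeasurable g₀).restrict.sub
      (hu.continuousOn.aestronglyMeasurable measurableSet_disk)
  have h5 := (eLpNorm_eq_zero_iff hm (by norm_num)).1 hz
  filter_upwards [h5] with x hx
  exact sub_eq_zero.1 hx

/-! ### Interpolation on the disk -/

theorem dirDeriv_schwartz (φ : 𝓢(Plane, ℂ)) (i : Fin 2) :
    dirDeriv (basisVec i) φ = (∂_{basisVec i} φ : 𝓢(Plane, ℂ)) := by
  ext x
  rw [schwartz_lineDeriv]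
  rfl

theorem planeSobolevNorm_lineDeriv_le (φ : 𝓢(Plane, ℂ)) (i : Fin 2) (r : ℕ) :
    planeSobolevNorm r ((∂_{basisVec i} φ : 𝓢(Plane, ℂ)).toLp 2 volume) ≤
      7 * planeSobolevNorm (r + 1 : ℕ) (φ.toLp 2 volume) := by
  have := (isWeakDeriv_schwartz i φ).planeSobolevNorm_le r
  exact_mod_cast this

/-- Each order multiplies the constant by `15 = 1 + 2 · 7`. -/
theorem wS_le_planeSobolevNorm (r : ℕ) (φ : 𝓢(Plane, ℂ)) :
    wS r φ ≤ 15 ^ r * planeSobolevNorm r (φ.toLp 2 volume) := by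
  induction r generalizing φ with
  | zero => simp [wS, planeSobolevNorm_zero, enorm_toLp_schwartz]
  | succ r ih =>
    have h1 : planeSobolevNorm r (φ.toLp 2 volume) ≤
        planeSobolevNorm (r + 1 : ℕ) (φ.toLp 2 volume) :=
      planeSobolevNorm_mono (by push_cast; linarith) _
    calc wS (r + 1) φ ≤ 15 ^ r * planeSobolevNorm (r + 1 : ℕ) (φ.toLp 2 volume) +
          ∑ _i : Fin 2, 15 ^ r * (7 * planeSobolevNorm (r + 1 : ℕ) (φ.toLp 2 volume)) := by
          refine add_le_add ((ih φ).trans (by gcongr)) (Finset.sum_le_sum fun i _ => ?_)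
          exact (ih _).trans (by gcongr; exact planeSobolevNorm_lineDeriv_le φ i r)
      _ = _ := by
          rw [Fin.sum_univ_two, pow_succ]
          ring

theorem dN_l2N_le_wS (U : Set Plane) (r : ℕ) (φ : 𝓢(Plane, ℂ)) : dN (l2N U) r φ ≤ wS r φ := by
  induction r generalizing φ with
  | zero => exact eLpNorm_mono_measure _ Measure.restrict_le_self
  | succ r ih =>
    refine add_le_add (ih φ) (Finset.sum_le_sum fun i _ => ?_)
    rw [dirDeriv_schwartz]
    exact ih _

/-- Interpolation for operators with values in functions on the disk. -/
theorem exists_sobolevNorm_disk_interp : ∃ C : ℝ≥0, ∀ k : ℕ, k ≤ 2 →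
    ∀ T : 𝓢(Plane, ℂ) → Plane → ℂ, (∀ φ, ContDiffOn ℝ ∞ (T φ) disk) →
    (∀ φ, ∃ B : ℝ, ∀ x ∈ disk, ‖T φ x‖ ≤ B) →
    (∀ φ ψ, EqOn (T (φ - ψ)) (fun x => T φ x - T ψ x) disk) → ∀ M : ℝ≥0∞,
    (∀ φ, dN (l2N disk) 0 (T φ) ≤ M * planeSobolevNorm 0 (φ.toLp 2 volume)) →
    (∀ φ, dN (l2N disk) k (T φ) ≤ M * planeSobolevNorm k (φ.toLp 2 volume)) →
    ∀ s : ℝ, 0 ≤ s → s ≤ k → ∀ φ,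
      sobolevNorm disk s (T φ) ≤ C * (M * planeSobolevNorm s (φ.toLp 2 volume)) := by
  obtain ⟨C, hC⟩ := exists_extL_bound
  refine ⟨2 * (C * 2), fun k hk T hT hB hsub M h0 h1 s hs hsk φ => ?_⟩
  obtain ⟨B, hB⟩ := hB φ
  -- For each fixed `n` the map sending `φ` to the extension of the dilate of `T φ` is additive with
  -- values in `L²` of the plane, so interpolation applies; its bounds do not depend on `n`.
  refine sobolevNorm_disk_le_of_dil (hT φ) hB fun n => ?_
  have hS : ∀ j : ℕ, j ≤ 2 → ∀ φ, dN (l2N disk) j (T φ) ≤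
      M * planeSobolevNorm j (φ.toLp 2 volume) → planeSobolevNorm j (extL (smoothCc_dilN n (hT φ))) ≤
        (C * 2 * M) * planeSobolevNorm j (φ.toLp 2 volume) := fun j hj φ h => by
    refine (hC j hj _ _).trans ?_
    rw [mul_assoc, mul_assoc]
    gcongr
    exact (dN_l2N_dilN_le n j (hT φ)).trans (by gcongr)
  have h0' := fun φ => hS 0 (by norm_num) φ (by exact_mod_cast h0 φ)
  rw [Nat.cast_zero] at h0'
  have hfin : ∀ x : ℝ≥0∞, 2 * (C * 2 * M) * x = ((2 * (C * 2) : ℝ≥0) : ℝ≥0∞) * (M * x) :=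
    fun x => by push_cast; ring
  rw [← hfin]
  rcases Nat.eq_zero_or_pos k with rfl | hkpos
  · obtain rfl : s = 0 := le_antisymm (by simpa using hsk) hs
    refine (h0' φ).trans ?_
    rw [mul_assoc 2, two_mul]
    exact le_self_add
  · refine planeSobolevNorm_interp (k := k) (by omega) (fun φ => extL (smoothCc_dilN n (hT φ)))
      (fun φ ψ => ?_) h0' (fun φ => hS k hk φ (h1 φ)) hs hsk φ
    rw [← extL_sub]
    refine extL_congr _ _ ((dil_congr _ _ (hsub φ ψ)).trans ?_)
    ext x
    simp only [dil]
    ring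

/-! ### Multiplication by functions that are smooth up to the boundary -/

/-- Smooth functions on the disk with bounded derivatives. -/
structure IsCoef (c : Plane → ℂ) : Prop where
  smooth : ContDiffOn ℝ ∞ c disk
  bounded : ∀ r, dN (supN disk) r c ≠ ⊤

theorem closure_disk : closure disk = Metric.closedBall (0 : Plane) 1 :=
  closure_ball 0 one_ne_zero

/-- Derivatives within the closed disk are continuous on a compact set and agree with ordinary ones
in the interior. -/
theorem isCoef_of_contDiffOn_closure {c : Plane → ℂ} (hc : ContDiffOn ℝ ∞ c (closure disk)) :
    IsCoef c := by
  refine ⟨hc.mono subset_closure, fun r => ?_⟩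
  have huniq : UniqueDiffOn ℝ (closure disk) := by
    rw [closure_disk]
    refine uniqueDiffOn_convex (convex_closedBall 0 1) ?_
    rw [interior_closedBall 0 one_ne_zero]
    exact ⟨0, by simp⟩
  have hcpt : IsCompact (closure disk) := by rw [closure_disk]; exact isCompact_closedBall 0 1
  induction r generalizing c with
  | zero =>
    obtain ⟨B, hB⟩ := hcpt.exists_bound_of_continuousOn hc.continuousOn
    refine ne_top_of_le_ne_top (ENNReal.ofReal_ne_top (r := B)) (iSup₂_le fun x hx => ?_)
    rw [← ofReal_norm]
    exact ENNReal.ofReal_le_ofReal (hB x (subset_closure hx))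
  | succ r ih =>
    refine ENNReal.add_ne_top.2 ⟨ih hc, ENNReal.sum_ne_top.2 fun i _ => ?_⟩
    have h1 : EqOn (dirDeriv (basisVec i) c)
        (fun x => fderivWithin ℝ c (closure disk) x (basisVec i)) disk := fun x hx => by
      beta_reduce
      rw [fderivWithin_of_mem_nhds (mem_of_superset (isOpen_disk.mem_nhds hx) subset_closure)]
      rfl
    rw [(isFunNorm_supN disk).dN_congr isOpen_disk h1]
    exact ih ((hc.fderivWithin huniq (m := ∞) (by simp)).clm_apply contDiffOn_const)

theorem IsCoef.dirDeriv {c : Plane → ℂ} (hc : IsCoef c) (i : Fin 2) :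
    IsCoef (dirDeriv (basisVec i) c) where
  smooth := contDiffOn_dirDeriv isOpen_disk hc.smooth _
  bounded r := ne_top_of_le_ne_top (hc.bounded (r + 1)) (dN_dirDeriv_le _ _ _ _)

theorem IsTestFunction.eq_zero {f : Plane → ℂ} (hf : IsTestFunction f) {x : Plane}
    (hx : x ∉ disk) : f x = 0 :=
  image_eq_zero_of_notMem_tsupport fun h => hx (hf.support_subset h)

/-- A test function as a Schwartz function. -/
def IsTestFunction.schw {f : Plane → ℂ} (hf : IsTestFunction f) : 𝓢(Plane, ℂ) :=
  hf.compact_support.toSchwartzMap hf.smooth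

theorem IsTestFunction.schw_coe {f : Plane → ℂ} (hf : IsTestFunction f) : (hf.schw : Plane → ℂ) = f :=
  rfl

/-- A test function as an element of `L²`. -/
def IsTestFunction.toL2 {f : Plane → ℂ} (hf : IsTestFunction f) : L2 := hf.schw.toLp 2 volume

theorem IsTestFunction.mul {c f : Plane → ℂ} (hc : ContDiffOn ℝ ∞ c disk) (hf : IsTestFunction f) :
    IsTestFunction (fun x => c x * f x) where
  smooth := by
    rw [contDiff_iff_contDiffAt]
    intro x
    by_cases hx : x ∈ tsupport f
    · exact (hc.contDiffAt (isOpen_disk.mem_nhds (hf.support_subset hx))).mul hf.smooth.contDiffAt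
    · have h : (fun x => c x * f x) =ᶠ[𝓝 x] fun _ => 0 := by
        filter_upwards [(isClosed_tsupport f).isOpen_compl.mem_nhds hx] with y hy
        rw [image_eq_zero_of_notMem_tsupport hy, mul_zero]
      exact contDiffAt_const.congr_of_eventuallyEq h
  compact_support := hf.compact_support.mul_left
  support_subset := (tsupport_mul_subset_right).trans hf.support_subset

theorem SmoothCc.mul_schwartz {u : Plane → ℂ} (hu : SmoothCc u) (φ : 𝓢(Plane, ℂ)) :
    SmoothCc (fun x => u x * φ x) := ⟨hu.smooth.mul (φ.smooth ⊤), hu.compact.mul_right⟩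

/-- Multiplication by the reflected extension of `a`. -/
def mulExt {a : Plane → ℂ} (ha : SmoothCc a) (φ : 𝓢(Plane, ℂ)) : L2 :=
  glueL (ha.mul_schwartz φ) (ha.refl.mul_schwartz φ)

theorem mulExt_sub {a : Plane → ℂ} (ha : SmoothCc a) (φ ψ : 𝓢(Plane, ℂ)) :
    mulExt ha (φ - ψ) = mulExt ha φ - mulExt ha ψ := by
  rw [mulExt, mulExt, mulExt, ← glueL_sub]
  refine glueL_congr _ _ _ _ ?_ ?_ <;>
  · ext x
    rw [sub_apply]
    ring

/-- The reflected multiplier matches `a` only to first order on the circle, but so do its products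
with `φ`, and this suffices for `H²`. The constants are `9 = 3 ^ 2` from the product rule and `225 =
15 ^ 2`. -/
theorem exists_mulExt_bound : ∃ C : ℝ≥0, ∀ k : ℕ, k = 0 ∨ k = 2 → ∀ a, ∀ ha : SmoothCc a, ∀ φ,
    planeSobolevNorm k (mulExt ha φ) ≤
      C * (dN (supN disk) 2 a * planeSobolevNorm k (φ.toLp 2 volume)) := by
  choose C hC using fun r => exists_dN_refl_le (isFunNorm_supN outer)
    (fun a ha m hm => exists_supN_pull_le ha hm) r
  refine ⟨9 * 225 * (1 + (C 0 + C 2)), fun k hk a ha φ => ?_⟩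
  have hd : ∀ {b : Plane → ℂ}, SmoothCc b → ∀ x i, dirDeriv (basisVec i) (fun x => b x * φ x) x =
      dirDeriv (basisVec i) b x * φ x + b x * dirDeriv (basisVec i) φ x := fun hb x i =>
    dirDeriv_mul ((hb.smooth.differentiable (by simp)) x) (φ.differentiable x)
  have h1 : planeSobolevNorm k (mulExt ha φ) ≤ dN (l2N disk) k (fun x => a x * φ x) +
      dN (l2N outer) k (fun x => refl a x * φ x) := by
    rcases hk with rfl | rfl
    · have := planeSobolevNorm_zero_glueL_le (ha.mul_schwartz φ) (ha.refl.mul_schwartz φ)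
      rwa [← Nat.cast_zero] at this
    · have := planeSobolevNorm_two_glueL_le (ha.mul_schwartz φ) (ha.refl.mul_schwartz φ)
        (fun x hx => by rw [refl_eq (v := a) hx])
        fun x hx i => by rw [hd ha, hd ha.refl, refl_eq (v := a) hx, dirDeriv_refl_eq ha hx]
      rwa [← Nat.cast_ofNat] at this
  have hk2 : k ≤ 2 := by rcases hk with rfl | rfl <;> norm_num
  have h2 : dN (l2N disk) k (fun x => a x * φ x) ≤
      3 ^ k * (dN (supN disk) k a * dN (l2N disk) k φ) :=
    (isFunNorm_l2N isOpen_disk).dN_mul_le isOpen_disk ha.smooth.contDiffOn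
      (φ.smooth ⊤).contDiffOn k
  have h3 : dN (l2N outer) k (fun x => refl a x * φ x) ≤
      3 ^ k * (dN (supN outer) k (refl a) * dN (l2N outer) k φ) :=
    (isFunNorm_l2N isOpen_outer).dN_mul_le isOpen_outer ha.refl.smooth.contDiffOn
      (φ.smooth ⊤).contDiffOn k
  have h4 : ∀ V, dN (l2N V) k φ ≤ 225 * planeSobolevNorm k (φ.toLp 2 volume) := fun V => by
    refine ((dN_l2N_le_wS V k φ).trans (wS_le_planeSobolevNorm k φ)).trans ?_
    gcongr
    calc (15 : ℝ≥0∞) ^ k ≤ 15 ^ 2 := pow_le_pow_right₀ (by norm_num) hk2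
      _ = 225 := by norm_num
  have h5 : (3 : ℝ≥0∞) ^ k ≤ 9 := by
    calc (3 : ℝ≥0∞) ^ k ≤ 3 ^ 2 := pow_le_pow_right₀ (by norm_num) hk2
      _ = 9 := by norm_num
  have h6 : dN (supN outer) k (refl a) ≤ ((C 0 + C 2 : ℝ≥0) : ℝ≥0∞) * dN (supN disk) 2 a := by
    refine (hC k a ha).trans ?_
    gcongr
    · rcases hk with rfl | rfl
      · exact le_self_add
      · exact le_add_self
    · exact dN_mono _ hk2 a
  have h7 := dN_mono (supN disk) hk2 a
  calc planeSobolevNorm k (mulExt ha φ)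
      ≤ 9 * (dN (supN disk) 2 a * (225 * planeSobolevNorm k (φ.toLp 2 volume))) +
        9 * (((C 0 + C 2 : ℝ≥0) : ℝ≥0∞) * dN (supN disk) 2 a *
          (225 * planeSobolevNorm k (φ.toLp 2 volume))) := by
        refine h1.trans (add_le_add (h2.trans ?_) (h3.trans ?_))
        · gcongr
          exact h4 disk
        · gcongr
          exact h4 outer
    _ = _ := by push_cast; ring

theorem eLpNorm_eq_l2N_disk {u : Plane → ℂ} (hu : ∀ x ∉ disk, u x = 0) :
    eLpNorm u 2 volume = l2N disk u := by
  rw [l2N, ← eLpNorm_indicator_eq_eLpNorm_restrict measurableSet_disk]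
  congr 1
  ext x
  by_cases hx : x ∈ disk
  · rw [indicator_of_mem hx]
  · rw [indicator_of_notMem hx, hu x hx]

/-- Multiplication by a coefficient is bounded on Sobolev spaces, for test functions. -/
theorem exists_planeSobolevNorm_mul_le {c : Plane → ℂ} (hc : IsCoef c) : ∃ C : ℝ≥0, ∀ f,
    ∀ hf : IsTestFunction f, ∀ s : ℝ, 0 ≤ s → s ≤ 2 →
      planeSobolevNorm s (IsTestFunction.mul hc.smooth hf).toL2 ≤ C * planeSobolevNorm s hf.toL2 := by
  obtain ⟨C, hC⟩ := exists_mulExt_bound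
  refine ⟨2 * (C * (2 * (dN (supN disk) 2 c).toNNReal)), fun f hf s hs hs2 => ?_⟩
  have hM : ∀ n, dN (supN disk) 2 (dilN n c) ≤ ((2 * (dN (supN disk) 2 c).toNNReal : ℝ≥0) : ℝ≥0∞) :=
    fun n => by
      rw [ENNReal.coe_mul, ENNReal.coe_toNNReal (hc.bounded 2)]
      exact dN_supN_dilN_le n 2 hc.smooth
  -- Interpolation requires a multiplier on the whole plane; the reflected extensions of the dilates
  -- of `c` provide one with bounds independent of `n`.
  have hbd : ∀ n, planeSobolevNorm s (mulExt (smoothCc_dilN n hc.smooth) hf.schw) ≤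
      ((2 * (C * (2 * (dN (supN disk) 2 c).toNNReal)) : ℝ≥0) : ℝ≥0∞) *
        planeSobolevNorm s hf.toL2 := fun n => by
    have h := fun k hk φ => (hC k hk _ (smoothCc_dilN n hc.smooth) φ).trans
      (show _ ≤ ((C * (2 * (dN (supN disk) 2 c).toNNReal) : ℝ≥0) : ℝ≥0∞) *
        planeSobolevNorm k (φ.toLp 2 volume) by
        rw [ENNReal.coe_mul, mul_assoc]
        gcongr
        exact hM n)
    have h0 := fun φ => h 0 (Or.inl rfl) φ
    rw [Nat.cast_zero] at h0
    have := planeSobolevNorm_interp (k := 2) (Or.inr rfl)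
      (mulExt (smoothCc_dilN n hc.smooth)) (mulExt_sub _) h0 (fun φ => h 2 (Or.inr rfl) φ) hs
      (by exact_mod_cast hs2) hf.schw
    exact this
  -- The products with `f` converge in `L²` because `f` vanishes outside the disk, where the
  -- extensions play no role.
  refine planeSobolevNorm_le_of_tendsto s ?_ hbd
  obtain ⟨Bc, hBc⟩ : ∃ B : ℝ, ∀ x ∈ disk, ‖c x‖ ≤ B := by
    refine ⟨(supN disk c).toReal, fun x hx => ?_⟩
    rw [← toReal_enorm]
    exact ENNReal.toReal_mono (hc.bounded 0) (enorm_le_supN c hx)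
  obtain ⟨Bf, hBf⟩ := hf.compact_support.exists_bound_of_continuous hf.smooth.continuous
  rw [tendsto_iff_edist_tendsto_0]
  have hδ := ENNReal.Tendsto.const_mul (a := (Bf.toNNReal : ℝ≥0∞))
    (tendsto_l2N_dilN_sub hc.smooth hBc) (Or.inr ENNReal.coe_ne_top)
  rw [mul_zero] at hδ
  refine tendsto_of_tendsto_of_tendsto_of_le_of_le tendsto_const_nhds hδ (fun _ => zero_le)
    fun n => ?_
  have hn := smoothCc_dilN n hc.smooth
  have e1 : (mulExt hn hf.schw : Plane → ℂ) -
      ((IsTestFunction.mul hc.smooth hf).toL2 : Plane → ℂ) =ᵐ[volume]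
      fun x => f x * (dilN n c x - c x) := by
    filter_upwards [(memLp_glue (hn.mul_schwartz hf.schw) (hn.refl.mul_schwartz hf.schw)).coeFn_toLp,
      (IsTestFunction.mul hc.smooth hf).schw.coeFn_toLp 2 volume] with x h1 h2
    rw [Pi.sub_apply, mulExt, glueL, h1, IsTestFunction.toL2, h2, IsTestFunction.schw_coe]
    by_cases hx : x ∈ disk
    · rw [glue_of_mem hx, IsTestFunction.schw_coe]
      ring
    · rw [glue_of_notMem hx, IsTestFunction.schw_coe, hf.eq_zero hx]
      ring
  rw [Lp.edist_def, eLpNorm_congr_ae e1, eLpNorm_eq_l2N_disk fun x hx => by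
    rw [hf.eq_zero hx, zero_mul]]
  refine eLpNorm_mul_le_of_enorm_le (ae_of_all _ fun x => ?_)
    ((hn.smooth.continuous.continuousOn.sub hc.smooth.continuousOn).aestronglyMeasurable
      measurableSet_disk)
  rw [← ofReal_norm]
  exact ENNReal.ofReal_le_ofReal (hBf x)

/-! ### Sobolev norms on open sets -/

theorem sobolevNorm_congr {Ω : Set Plane} (hΩ : MeasurableSet Ω) {u v : Plane → ℂ}
    (h : EqOn u v Ω) (s : ℝ) : sobolevNorm Ω s u = sobolevNorm Ω s v := by
  have hae : u =ᵐ[volume.restrict Ω] v := (ae_restrict_mem hΩ).mono fun x hx => h hx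
  refine iInf_congr fun g => ?_
  have : (g =ᵐ[volume.restrict Ω] u) ↔ g =ᵐ[volume.restrict Ω] v :=
    ⟨fun hg => hg.trans hae, fun hg => hg.trans hae.symm⟩
  simp only [this]

theorem sobolevNorm_add_le (Ω : Set Plane) (s : ℝ) (u v : Plane → ℂ) :
    sobolevNorm Ω s (fun x => u x + v x) ≤ sobolevNorm Ω s u + sobolevNorm Ω s v := by
  simp only [sobolevNorm, ENNReal.iInf_add, ENNReal.add_iInf]
  refine le_iInf₂ fun h hh => le_iInf₂ fun g hg => ?_
  refine iInf₂_le_of_le (g + h) ?_ (planeSobolevNorm_add_le s g h)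
  filter_upwards [ae_restrict_of_ae (Lp.coeFn_add g h), hg, hh] with x h1 h2 h3
  rw [h1, Pi.add_apply, h2, h3]

theorem sobolevNorm_zero_fun (Ω : Set Plane) (s : ℝ) : sobolevNorm Ω s (fun _ => 0) = 0 := by
  refine le_antisymm (iInf₂_le_of_le 0 (ae_restrict_of_ae (Lp.coeFn_zero _ _ _)) ?_) zero_le
  have := planeSobolevNorm_smul s 0 (0 : L2)
  simp only [zero_smul, enorm_zero, zero_mul] at this
  exact this.le

theorem sobolevNorm_sum_le {ι : Type*} (t : Finset ι) (Ω : Set Plane) (s : ℝ)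
    (u : ι → Plane → ℂ) :
    sobolevNorm Ω s (fun x => ∑ i ∈ t, u i x) ≤ ∑ i ∈ t, sobolevNorm Ω s (u i) := by
  classical
  induction t using Finset.induction_on with
  | empty => simp [sobolevNorm_zero_fun]
  | insert a t ha ih =>
    simp only [Finset.sum_insert ha]
    exact (sobolevNorm_add_le Ω s _ _).trans (add_le_add le_rfl ih)

/-! ### Differential operators and line integral operators -/

theorem wS_eq_dN (r : ℕ) (φ : 𝓢(Plane, ℂ)) : wS r φ = dN (l2N univ) r φ := by
  induction r generalizing φ with
  | zero => simp [wS, dN, l2N]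
  | succ r ih => simp only [wS, dN, ih, dirDeriv_schwartz]

theorem SmoothCc.dN_supN_ne_top {u : Plane → ℂ} (hu : SmoothCc u) (r : ℕ) :
    dN (supN univ) r u ≠ ⊤ := by
  induction r generalizing u with
  | zero =>
    obtain ⟨B, hB⟩ := hu.compact.exists_bound_of_continuous hu.smooth.continuous
    refine ne_top_of_le_ne_top (ENNReal.ofReal_ne_top (r := B)) (iSup₂_le fun x _ => ?_)
    rw [← ofReal_norm]
    exact ENNReal.ofReal_le_ofReal (hB x)
  | succ r ih =>
    exact ENNReal.add_ne_top.2 ⟨ih hu, ENNReal.sum_ne_top.2 fun i _ => ih (hu.dirDeriv _)⟩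

/-- A smooth function with compact support as a Schwartz function. -/
def SmoothCc.schw {u : Plane → ℂ} (hu : SmoothCc u) : 𝓢(Plane, ℂ) :=
  hu.compact.toSchwartzMap hu.smooth

/-- The cutoff to the ball of radius two. -/
def diskCut (x : Plane) : ℂ := (ballBump 1 2 one_pos one_lt_two x : ℂ)

theorem smoothCc_diskCut : SmoothCc diskCut where
  smooth := Complex.ofRealCLM.contDiff.comp (ContDiffBump.contDiff _)
  compact := (ContDiffBump.hasCompactSupport _).comp_left (g := fun r : ℝ => (r : ℂ)) (by simp)

/-- Schwartz functions cut off to the ball of radius two. -/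
def diskCutS (φ : 𝓢(Plane, ℂ)) : 𝓢(Plane, ℂ) := (smoothCc_diskCut.mul_schwartz φ).schw

theorem diskCutS_apply (φ : 𝓢(Plane, ℂ)) (x : Plane) : diskCutS φ x = diskCut x * φ x := rfl

theorem diskCutS_sub (φ ψ : 𝓢(Plane, ℂ)) : diskCutS (φ - ψ) = diskCutS φ - diskCutS ψ := by
  ext x
  simp only [diskCutS_apply, sub_apply, mul_sub]

theorem suppTwo_diskCutS (φ : 𝓢(Plane, ℂ)) : SuppTwo (diskCutS φ) := fun x hx => by
  have : ballBump 1 2 one_pos one_lt_two x = 0 :=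
    ContDiffBump.zero_of_le_dist _ (by simpa [ballBump] using hx.le)
  rw [diskCutS_apply, diskCut, this]
  simp

/-- The cutoff is needed because interpolation runs over all Schwartz functions, while the estimates
along lines require support in the ball of radius two. -/
theorem diskCutS_testFunction {f : Plane → ℂ} (hf : IsTestFunction f) : diskCutS hf.schw = hf.schw := by
  ext x
  rw [diskCutS_apply]
  by_cases hx : x ∈ disk
  · have : ballBump 1 2 one_pos one_lt_two x = 1 :=
      ContDiffBump.one_of_mem_closedBall _ (by simpa [ballBump] using (mem_disk_iff.1 hx).le)
    rw [diskCut, this]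
    simp
  · rw [IsTestFunction.schw_coe, hf.eq_zero hx, mul_zero]

theorem exists_wS_diskCutS_le (r : ℕ) : ∃ C : ℝ≥0, ∀ φ,
    wS r (diskCutS φ) ≤ C * planeSobolevNorm r (φ.toLp 2 volume) := by
  refine ⟨3 ^ r * ((dN (supN univ) r diskCut).toNNReal * 15 ^ r), fun φ => ?_⟩
  rw [wS_eq_dN]
  refine ((isFunNorm_l2N isOpen_univ).dN_mul_le isOpen_univ
    smoothCc_diskCut.smooth.contDiffOn (φ.smooth ⊤).contDiffOn r).trans ?_
  rw [← wS_eq_dN]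
  push_cast
  rw [ENNReal.coe_toNNReal (smoothCc_diskCut.dN_supN_ne_top r), mul_assoc, mul_assoc]
  gcongr
  exact wS_le_planeSobolevNorm r φ

theorem kOp_sub_right {b : Plane × ℝ × ℝ → ℂ} (hb : IsKernel b) (f g : 𝓢(Plane, ℂ)) {x : Plane}
    (hx : x ∈ disk) : kOp b (f - g : 𝓢(Plane, ℂ)) x = kOp b f x - kOp b g x := by
  simp only [kOp, paramInt]
  rw [← integral_sub (integrable_boxMeas (hb.continuous_kInt f hx))
    (integrable_boxMeas (hb.continuous_kInt g hx))]
  simp only [kInt, sub_apply, mul_sub]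

theorem kOp_add_right {b : Plane × ℝ × ℝ → ℂ} (hb : IsKernel b) (f g : 𝓢(Plane, ℂ)) {x : Plane}
    (hx : x ∈ disk) : kOp b (fun y => f y + g y) x = kOp b f x + kOp b g x := by
  simp only [kOp, paramInt]
  rw [← integral_add (integrable_boxMeas (hb.continuous_kInt f hx))
    (integrable_boxMeas (hb.continuous_kInt g hx))]
  simp only [kInt, mul_add]

theorem kOp_neg_right (b : Plane × ℝ × ℝ → ℂ) (f : Plane → ℂ) (x : Plane) :
    kOp b (fun y => -f y) x = -kOp b f x := by
  simp only [kOp, paramInt, kInt, mul_neg, integral_neg]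

theorem wD_sub {U : Set Plane} (hU : IsOpen U) {u v : Plane → ℂ} (hu : ContDiffOn ℝ ∞ u U)
    (hv : ContDiffOn ℝ ∞ v U) (w : List (Fin 2)) :
    EqOn (wD w fun x => u x - v x) (fun x => wD w u x - wD w v x) U := by
  intro x hx
  have h := wD_add hU (hu.sub hv) hv w hx
  simp only [sub_add_cancel] at h
  exact eq_sub_of_add_eq h.symm

/-- Only finiteness matters here: the limit of dilations requires bounded functions, but no constant
depends on the bound. -/
theorem supN_wD_kOp_ne_top {b : Plane × ℝ × ℝ → ℂ} (hb : IsKernel b) {M : ℝ≥0∞} (hM0 : M ≠ ⊤)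
    (w : List (Fin 2)) (hM : Bdd w.length M b) (f : 𝓢(Plane, ℂ)) :
    supN disk (wD w (kOp b f)) ≠ ⊤ := by
  induction hn : w.length generalizing w b f with
  | zero =>
    rw [List.length_eq_zero_iff.1 hn]
    obtain ⟨B, hB⟩ := f.decay 0 0
    refine ne_top_of_le_ne_top (b := boxMeas univ * (M * ENNReal.ofReal B)) ?_
      (iSup₂_le fun x hx => ?_)
    · exact ENNReal.mul_ne_top (measure_ne_top _ _) (ENNReal.mul_ne_top hM0 ENNReal.ofReal_ne_top)
    · refine (enorm_integral_le_lintegral_enorm _).trans ?_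
      calc ∫⁻ p, ‖kInt b f (x, p)‖ₑ ∂boxMeas ≤ ∫⁻ _, M * ENNReal.ofReal B ∂boxMeas := by
            refine lintegral_mono fun p => ?_
            rw [kInt, enorm_mul]
            gcongr
            · exact hM.zero _ (mem_coordDomain.2 hx)
            · rw [← ofReal_norm]
              refine ENNReal.ofReal_le_ofReal ?_
              simpa using hB.2 (x + p.2 • dir p.1)
        _ = _ := by rw [lintegral_const, mul_comm]
  | succ n ih =>
    obtain ⟨w, i, rfl⟩ : ∃ w' i, w = w' ++ [i] := by
      refine ⟨w.dropLast, w.getLast (by rintro rfl; simp at hn), ?_⟩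
      rw [List.dropLast_append_getLast]
    have hw : w.length = n := by simpa using hn
    have s1 := (hb.kd (spaceIdx i)).contDiffOn_kOp f
    have s2 := hb.contDiffOn_kOp (∂_{basisVec i} f : 𝓢(Plane, ℂ))
    have e1 : EqOn (wD (w ++ [i]) (kOp b f)) (fun x => wD w (kOp (kd (spaceIdx i) b) f) x +
        wD w (kOp b (∂_{basisVec i} f : 𝓢(Plane, ℂ))) x) disk := by
      intro x hx
      rw [wD_append, ← wD_add isOpen_disk s1 s2 w hx]
      exact wD_congr isOpen_disk (fun y hy => dirDeriv_kOp hb f i hy) w hx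
    rw [(isFunNorm_supN disk).congr _ _ e1]
    have hM2 : Bdd (w.length + 1) M b := by simpa using hM
    exact ne_top_of_le_ne_top (ENNReal.add_ne_top.2 ⟨ih (hb.kd _) w (hM2.2 _) f hw,
      ih hb w hM2.1 _ hw⟩) ((isFunNorm_supN disk).add_le _ _ (contDiffOn_wD isOpen_disk s1 w)
        (contDiffOn_wD isOpen_disk s2 w))

/-! ### Operators that gain `m` derivatives, between differential operators -/

/-- A class of kernels whose operators gain `m` derivatives. -/
structure IsGaining (Z : (Plane × ℝ × ℝ → ℂ) → Prop) (m : ℕ) : Prop where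
  le_two : m ≤ 2
  kd : ∀ b, IsKernel b → Z b → ∀ i, Z (kd (spaceIdx i) b)
  low : ∀ n ≤ m, OpEst Z n 0 (2 * n)
  high : ∀ n ≤ 2 * m, OpEst Z n m n

theorem isGaining_of_le_one {m : ℕ} (hm : m ≤ 1) : IsGaining (fun _ => True) m where
  le_two := hm.trans one_le_two
  kd _ _ _ _ := trivial
  low n hn := by
    have : n ≤ 1 := hn.trans hm
    interval_cases n
    · exact opEst_zero _
    · exact opEst_one _
  high n hn := by
    interval_cases m
    · obtain rfl : n = 0 := by omega
      exact opEst_zero _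
    · exact opEst_order_one n hn

theorem isGaining_two : IsGaining SymbolZero 2 where
  le_two := le_rfl
  kd _ hb h i := h.kd hb i
  low n hn := by
    interval_cases n
    · exact opEst_zero _
    · exact opEst_one _
    · exact opEst_two
  high n hn := opEst_order_two n hn

/-- Interpolation between two endpoints. In `L²` the field `low` costs `2 |γ| ≤ 2m - j` kernel
derivatives. In `H^m` at most `m + |γ| ≤ 2m - j` derivatives fall on the operator, and `high` costs
as many. -/
theorem IsGaining.exists_bound {Z : (Plane × ℝ × ℝ → ℂ) → Prop} {m : ℕ} (hZ : IsGaining Z m)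
    {d : Plane → ℂ} (hd : IsCoef d) (γ : List (Fin 2)) {j : ℕ} (hγ : γ.length + j ≤ m) :
    ∃ C : ℝ≥0, ∀ b, IsKernel b → Z b → ∀ M ≠ ⊤, Bdd (2 * m - j) M b → ∀ s : ℝ, 0 ≤ s → s ≤ m →
      ∀ φ : 𝓢(Plane, ℂ), sobolevNorm disk s (fun x => d x * wD γ (kOp b (diskCutS φ)) x) ≤
        C * (M * planeSobolevNorm s (φ.toLp 2 volume)) := by
  obtain ⟨C₀, h₀⟩ := exists_sobolevNorm_disk_interp
  obtain ⟨C₁, h₁⟩ := hZ.low γ.length (by omega)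
  choose! C₂ h₂ using hZ.high
  obtain ⟨C₃, h₃⟩ := exists_wS_diskCutS_le 0
  obtain ⟨C₄, h₄⟩ := exists_wS_diskCutS_le m
  set A : ℝ≥0 := (dN (supN disk) m d).toNNReal with hA
  have hAe : (A : ℝ≥0∞) = dN (supN disk) m d := ENNReal.coe_toNNReal (hd.bounded m)
  set S : ℝ≥0 := ∑ n ∈ Finset.range (2 * m + 1), C₂ n with hS
  have hSn : ∀ n ≤ 2 * m, C₂ n ≤ S := fun n hn =>
    Finset.single_le_sum (f := C₂) (fun _ _ => zero_le) (Finset.mem_range.2 (by omega))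
  set L : ℝ≥0 := A * (C₁ * C₃) + 3 ^ m * (A * (3 ^ m * (S * C₄))) with hL
  refine ⟨C₀ * L, fun b hb hZb M hM0 hM s hs hsm φ => ?_⟩
  have hsmooth : ∀ φ, ContDiffOn ℝ ∞ (wD γ (kOp b (diskCutS φ))) disk := fun φ =>
    contDiffOn_wD isOpen_disk (hb.contDiffOn_kOp _) γ
  have key := h₀ m hZ.le_two (fun φ x => d x * wD γ (kOp b (diskCutS φ)) x)
    (fun φ => hd.smooth.mul (hsmooth φ)) (fun φ => ?_) (fun φ ψ x hx => ?_) (L * M) (fun φ => ?_)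
    (fun φ => ?_) s hs hsm φ
  · refine key.trans (le_of_eq ?_)
    rw [ENNReal.coe_mul]
    ring
  · have h5 := supN_wD_kOp_ne_top hb hM0 γ (hM.of_le (by omega)) (diskCutS φ)
    have h6 : supN disk (fun x => d x * wD γ (kOp b (diskCutS φ)) x) ≠ ⊤ :=
      ne_top_of_le_ne_top (ENNReal.mul_ne_top (hd.bounded 0) h5)
        ((isFunNorm_supN disk).mul_le _ _ hd.smooth (hsmooth φ))
    refine ⟨(supN disk fun x => d x * wD γ (kOp b (diskCutS φ)) x).toReal, fun x hx => ?_⟩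
    rw [← toReal_enorm]
    exact ENNReal.toReal_mono h6
      (enorm_le_supN (fun x => d x * wD γ (kOp b (diskCutS φ)) x) hx)
  · have h5 : EqOn (kOp b (diskCutS (φ - ψ)))
        (fun x => kOp b (diskCutS φ) x - kOp b (diskCutS ψ) x) disk := fun y hy => by
      rw [diskCutS_sub]
      exact kOp_sub_right hb _ _ hy
    have h6 := (wD_congr isOpen_disk h5 γ hx).trans
      (wD_sub isOpen_disk (hb.contDiffOn_kOp _) (hb.contDiffOn_kOp _) γ hx)
    simp only [h6, mul_sub]
  · have h5 := h₁ b hb hZb M (hM.of_le (by omega)) _ (suppTwo_diskCutS φ) γ rfl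
    calc dN (l2N disk) 0 (fun x => d x * wD γ (kOp b (diskCutS φ)) x)
        ≤ supN disk d * l2N disk (wD γ (kOp b (diskCutS φ))) :=
          (isFunNorm_l2N isOpen_disk).mul_le _ _ hd.smooth (hsmooth φ)
      _ ≤ A * (C₁ * (M * (C₃ * planeSobolevNorm 0 (φ.toLp 2 volume)))) := by
          rw [hAe]
          have h3' := h₃ φ
          rw [Nat.cast_zero] at h3'
          gcongr
          · exact le_dN (supN disk) m d
          · exact h5.trans (by gcongr)
      _ = (A * (C₁ * C₃) : ℝ≥0) * M * planeSobolevNorm 0 (φ.toLp 2 volume) := by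
          push_cast; ring
      _ ≤ _ := by
          gcongr
          exact le_self_add
  · have h5 : dN (l2N disk) m (wD γ (kOp b (diskCutS φ))) ≤
        3 ^ m * (S * (M * (C₄ * planeSobolevNorm m (φ.toLp 2 volume)))) := by
      refine dN_le_of_wD _ fun w hw => ?_
      rw [← wD_append]
      have hlen : (w ++ γ).length ≤ 2 * m - j := by
        rw [List.length_append]; omega
      refine (h₂ _ (hlen.trans (Nat.sub_le _ _)) b hb hZb M (hM.of_le hlen) _
        (suppTwo_diskCutS φ) _ rfl).trans ?_
      gcongr
      · exact hSn _ (hlen.trans (Nat.sub_le _ _))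
      · exact h₄ φ
    calc dN (l2N disk) m (fun x => d x * wD γ (kOp b (diskCutS φ)) x)
        ≤ 3 ^ m * (dN (supN disk) m d * dN (l2N disk) m (wD γ (kOp b (diskCutS φ)))) :=
          (isFunNorm_l2N isOpen_disk).dN_mul_le isOpen_disk hd.smooth (hsmooth φ) m
      _ ≤ 3 ^ m * (A * (3 ^ m * (S * (M * (C₄ * planeSobolevNorm m (φ.toLp 2 volume)))))) := by
          rw [hAe]
          gcongr
      _ = (3 ^ m * (A * (3 ^ m * (S * C₄))) : ℝ≥0) * M *
            planeSobolevNorm m (φ.toLp 2 volume) := by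
          push_cast; ring
      _ ≤ _ := by
          gcongr
          exact le_add_self

theorem IsCoef.neg {c : Plane → ℂ} (hc : IsCoef c) : IsCoef (fun x => -c x) where
  smooth := hc.smooth.neg
  bounded r := by
    have h := (isFunNorm_supN disk).dN_mul_le isOpen_disk (u := fun _ => -1) contDiffOn_const
      hc.smooth r
    have h2 : dN (supN disk) r (fun _ => (-1 : ℂ)) ≠ ⊤ :=
      (isCoef_of_contDiffOn_closure contDiffOn_const).bounded r
    simp only [neg_one_mul] at h
    exact ne_top_of_le_ne_top (ENNReal.mul_ne_top (by finiteness)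
      (ENNReal.mul_ne_top h2 (hc.bounded r))) h

theorem IsTestFunction.dirDeriv {f : Plane → ℂ} (hf : IsTestFunction f) (v : Plane) :
    IsTestFunction (dirDeriv v f) where
  smooth := (SmoothCc.dirDeriv ⟨hf.smooth, hf.compact_support⟩ v).smooth
  compact_support := (SmoothCc.dirDeriv ⟨hf.smooth, hf.compact_support⟩ v).compact
  support_subset := by
    refine (closure_mono fun x (hx : fderiv ℝ f x v ≠ 0) (hx0 : fderiv ℝ f x = 0) => hx (by
        rw [hx0, zero_apply])).trans ((tsupport_fderiv_subset ℝ).trans hf.support_subset)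

theorem IsTestFunction.wD {f : Plane → ℂ} (hf : IsTestFunction f) (w : List (Fin 2)) :
    IsTestFunction (wD w f) := by
  induction w with
  | nil => exact hf
  | cons i w ih => exact ih.dirDeriv _

theorem IsTestFunction.suppTwo {f : Plane → ℂ} (hf : IsTestFunction f) : SuppTwo f := fun x hx =>
  hf.eq_zero fun h => by linarith [mem_disk_iff.1 h]

theorem mul_dirDeriv_eq {c g : Plane → ℂ} (hc : IsCoef c) (hg : IsTestFunction g) (i : Fin 2)
    (x : Plane) : c x * dirDeriv (basisVec i) g x =
      dirDeriv (basisVec i) (fun y => c y * g y) x + -dirDeriv (basisVec i) c x * g x := by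
  by_cases hx : x ∈ disk
  · rw [dirDeriv_mul (differentiableAt_of_contDiffOn isOpen_disk hc.smooth hx)
      ((hg.smooth.differentiable (by simp)) x)]
    ring
  · rw [hg.eq_zero hx, (hg.dirDeriv _).eq_zero hx,
      ((IsTestFunction.mul hc.smooth hg).dirDeriv _).eq_zero hx]
    ring

/-- A derivative on the right of the operator can be moved to the left. -/
theorem kOp_mul_dirDeriv {b : Plane × ℝ × ℝ → ℂ} (hb : IsKernel b) {c g : Plane → ℂ}
    (hc : IsCoef c) (hg : IsTestFunction g) (i : Fin 2) {x : Plane} (hx : x ∈ disk) :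
    kOp b (fun y => c y * dirDeriv (basisVec i) g y) x =
      dirDeriv (basisVec i) (kOp b fun y => c y * g y) x +
        (kOp (kd (spaceIdx i) b) (fun y => -c y * g y) x +
          kOp b (fun y => -dirDeriv (basisVec i) c y * g y) x) := by
  have hcg := IsTestFunction.mul hc.smooth hg
  have hdg := IsTestFunction.mul (hc.dirDeriv i).neg.smooth hg
  have h1 : (fun y => c y * dirDeriv (basisVec i) g y) =
      fun y => (hcg.dirDeriv (basisVec i)).schw y + hdg.schw y := by
    ext y
    exact mul_dirDeriv_eq hc hg i y
  have h2 : dirDeriv (basisVec i) (kOp b fun y => c y * g y) x = _ := dirDeriv_kOp hb hcg.schw i hx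
  have h3 : ((∂_{basisVec i} hcg.schw : 𝓢(Plane, ℂ)) : Plane → ℂ) =
      (hcg.dirDeriv (basisVec i)).schw := by
    rw [← dirDeriv_schwartz]
    rfl
  rw [h1, kOp_add_right hb _ _ hx, h2, h3]
  simp only [neg_mul, kOp_neg_right, IsTestFunction.schw_coe]
  ring

/-- Each derivative of the word `w` either joins `γ` on the left, or falls on the kernel and raises
`j`, or falls on the coefficient. The sum `|γ| + |w| + j` never grows, so the budget of `2m - j`
kernel derivatives persists. -/
theorem IsGaining.exists_word_bound {Z : (Plane × ℝ × ℝ → ℂ) → Prop} {m : ℕ} (hZ : IsGaining Z m)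
    {d : Plane → ℂ} (hd : IsCoef d) (w : List (Fin 2)) {c : Plane → ℂ} (hc : IsCoef c)
    (γ : List (Fin 2)) {j : ℕ} (hγ : γ.length + w.length + j ≤ m) :
    ∃ C : ℝ≥0, ∀ b, IsKernel b → Z b → ∀ M ≠ ⊤, Bdd (2 * m - j) M b → ∀ s : ℝ, 0 ≤ s → s ≤ m →
      ∀ f, ∀ hf : IsTestFunction f,
        sobolevNorm disk s (fun x => d x * wD γ (kOp b fun y => c y * wD w f y) x) ≤
          C * (M * planeSobolevNorm s hf.toL2) := by
  induction w generalizing c γ j with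
  | nil =>
    obtain ⟨C₁, h₁⟩ := hZ.exists_bound hd γ (j := j) (by simpa using hγ)
    obtain ⟨C₂, h₂⟩ := exists_planeSobolevNorm_mul_le hc
    refine ⟨C₁ * C₂, fun b hb hZb M hM0 hM s hs hsm f hf => ?_⟩
    have hcf := IsTestFunction.mul hc.smooth hf
    have h3 := h₁ b hb hZb M hM0 hM s hs hsm hcf.schw
    rw [diskCutS_testFunction] at h3
    have h4 := h₂ f hf s hs (hsm.trans (by exact_mod_cast hZ.le_two))
    calc _ ≤ C₁ * (M * planeSobolevNorm s hcf.toL2) := h3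
      _ ≤ C₁ * (M * (C₂ * planeSobolevNorm s hf.toL2)) := by gcongr
      _ = _ := by push_cast; ring
  | cons i w ih =>
    simp only [List.length_cons] at hγ
    obtain ⟨C₁, h₁⟩ := ih hc (γ ++ [i]) (j := j) (by simp; omega)
    obtain ⟨C₂, h₂⟩ := ih hc.neg γ (j := j + 1) (by omega)
    obtain ⟨C₃, h₃⟩ := ih (hc.dirDeriv i).neg γ (j := j) (by omega)
    refine ⟨C₁ + (C₂ + C₃), fun b hb hZb M hM0 hM s hs hsm f hf => ?_⟩
    have hM' : Bdd ((2 * m - (j + 1)) + 1) M b := hM.of_le (by omega)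
    have hg := hf.wD w
    have s1 : ContDiffOn ℝ ∞ (dirDeriv (basisVec i) (kOp b fun y => c y * wD w f y)) disk :=
      contDiffOn_dirDeriv isOpen_disk (hb.contDiffOn_kOp (IsTestFunction.mul hc.smooth hg).schw) _
    have s2 : ContDiffOn ℝ ∞ (kOp (DiskOp.kd (spaceIdx i) b) fun y => -c y * wD w f y) disk :=
      (hb.kd _).contDiffOn_kOp (IsTestFunction.mul hc.neg.smooth hg).schw
    have s3 : ContDiffOn ℝ ∞ (kOp b fun y => -dirDeriv (basisVec i) c y * wD w f y) disk :=
      hb.contDiffOn_kOp (IsTestFunction.mul (hc.dirDeriv i).neg.smooth hg).schw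
    have e : EqOn (fun x => d x * wD γ (kOp b fun y => c y * wD (i :: w) f y) x)
        (fun x => d x * wD (γ ++ [i]) (kOp b fun y => c y * wD w f y) x +
          (d x * wD γ (kOp (DiskOp.kd (spaceIdx i) b) fun y => -c y * wD w f y) x +
            d x * wD γ (kOp b fun y => -dirDeriv (basisVec i) c y * wD w f y) x)) disk := by
      intro x hx
      have h4 := wD_congr isOpen_disk (fun y hy => kOp_mul_dirDeriv hb hc hg i hy) γ hx
      rw [wD_add isOpen_disk s1 (s2.add s3) γ hx] at h4
      simp only [wD_add isOpen_disk s2 s3 γ hx] at h4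
      refine (congrArg (d x * ·) h4).trans ?_
      simp only [wD_append, wD]
      ring
    rw [sobolevNorm_congr measurableSet_disk e]
    refine (sobolevNorm_add_le _ _ _ _).trans ((add_le_add le_rfl
      (sobolevNorm_add_le _ _ _ _)).trans ?_)
    rw [ENNReal.coe_add, ENNReal.coe_add, add_mul, add_mul]
    gcongr
    · exact h₁ b hb hZb M hM0 hM s hs hsm f hf
    · exact h₂ _ (hb.kd _) (hZ.kd b hb hZb i) M hM0 (hM'.2 _) s hs hsm f hf
    · exact h₃ b hb hZb M hM0 hM s hs hsm f hf

/-! ### Kernels in coordinates -/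

/-- Needed because `cNorm` takes the derivatives in one fixed order, whereas `Bdd` admits every
order. -/
theorem kd_comm {b : Plane × ℝ × ℝ → ℂ} (hb : IsKernel b) (i j : Fin 4) :
    EqOn (kd i (kd j b)) (kd j (kd i b)) coordDomain := by
  intro z hz
  have hc : ContDiffAt ℝ ∞ b z := hb.smooth.contDiffAt (isOpen_coordDomain.mem_nhds hz)
  have hd : DifferentiableAt ℝ (fderiv ℝ b) z :=
    (hc.fderiv_right (m := 1) (by norm_cast)).differentiableAt (by simp)
  have h : ∀ v w, dirDeriv v (dirDeriv w b) z = fderiv ℝ (fderiv ℝ b) z v w := fun v w => by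
    have := (hd.hasFDerivAt.clm_apply (hasFDerivAt_const w z)).fderiv
    unfold dirDeriv
    rw [this]
    simp
  have hs : IsSymmSndFDerivAt ℝ b z := hc.isSymmSndFDerivAt (by
    rw [minSmoothness_of_isRCLikeNormedField]; norm_cast)
  exact (h _ _).trans ((hs.eq _ _).trans (h _ _).symm)

theorem IsKernel.iterate_kd {b : Plane × ℝ × ℝ → ℂ} (hb : IsKernel b) (i : Fin 4) (n : ℕ) :
    IsKernel ((DiskOp.kd i)^[n] b) := by
  induction n with
  | zero => exact hb
  | succ n ih =>
    rw [Function.iterate_succ_apply']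
    exact ih.kd i

theorem iterate_kd_congr {b c : Plane × ℝ × ℝ → ℂ} (h : EqOn b c coordDomain) (i : Fin 4) (n : ℕ) :
    EqOn ((kd i)^[n] b) ((kd i)^[n] c) coordDomain := by
  induction n with
  | zero => exact h
  | succ n ih =>
    simp only [Function.iterate_succ_apply']
    exact dirDeriv_congr isOpen_coordDomain ih _

theorem kd_iterate_comm {b : Plane × ℝ × ℝ → ℂ} (hb : IsKernel b) (i j : Fin 4) (n : ℕ) :
    EqOn (kd j ((kd i)^[n] b)) ((kd i)^[n] (kd j b)) coordDomain := by
  induction n generalizing b with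
  | zero => exact fun _ _ => rfl
  | succ n ih =>
    simp only [Function.iterate_succ_apply]
    exact (ih (hb.kd i)).trans (iterate_kd_congr (kd_comm hb j i) i n)

theorem Kernel.IsSmooth.isKernel {A : Kernel} (hA : A.IsSmooth) : IsKernel A.inCoords where
  smooth := hA
  periodic x _ θ t := by simp [Kernel.inCoords, dir]

theorem Kernel.partialDeriv_eq (A : Kernel) (α : Fin 4 → ℕ) : A.partialDeriv α =
    (kd 0)^[α 0] ((kd 1)^[α 1] ((kd 2)^[α 2] ((kd 3)^[α 3] A.inCoords))) := rfl

theorem Kernel.IsSmooth.kd_partialDeriv {A : Kernel} (hA : A.IsSmooth) (α : Fin 4 → ℕ)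
    (j : Fin 4) :
    EqOn (kd j (A.partialDeriv α)) (A.partialDeriv (α + Pi.single j 1)) coordDomain := by
  have hb := hA.isKernel
  have k3 := hb.iterate_kd 3 (α 3)
  have k2 := k3.iterate_kd 2 (α 2)
  have k1 := k2.iterate_kd 1 (α 1)
  have h0 := kd_iterate_comm k1 0 j (α 0)
  have h1 := kd_iterate_comm k2 1 j (α 1)
  have h2 := kd_iterate_comm k3 2 j (α 2)
  have g1 := h0.trans (iterate_kd_congr h1 0 (α 0))
  have g2 := g1.trans (iterate_kd_congr (iterate_kd_congr h2 1 (α 1)) 0 (α 0))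
  simp only [Kernel.partialDeriv_eq, Pi.add_apply]
  fin_cases j
  · simp only [Fin.zero_eta, Pi.single_eq_same, Function.iterate_succ_apply',
      Pi.single_eq_of_ne (show (1 : Fin 4) ≠ 0 by decide),
      Pi.single_eq_of_ne (show (2 : Fin 4) ≠ 0 by decide),
      Pi.single_eq_of_ne (show (3 : Fin 4) ≠ 0 by decide), add_zero]
    exact fun _ _ => rfl
  · simp only [Fin.mk_one, Pi.single_eq_same, Function.iterate_succ_apply',
      Pi.single_eq_of_ne (show (0 : Fin 4) ≠ 1 by decide),
      Pi.single_eq_of_ne (show (2 : Fin 4) ≠ 1 by decide),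
      Pi.single_eq_of_ne (show (3 : Fin 4) ≠ 1 by decide), add_zero]
    exact h0
  · simp only [Fin.reduceFinMk, Pi.single_eq_same, Function.iterate_succ_apply',
      Pi.single_eq_of_ne (show (0 : Fin 4) ≠ 2 by decide),
      Pi.single_eq_of_ne (show (1 : Fin 4) ≠ 2 by decide),
      Pi.single_eq_of_ne (show (3 : Fin 4) ≠ 2 by decide), add_zero]
    exact g1
  · simp only [Fin.reduceFinMk, Pi.single_eq_same, Function.iterate_succ_apply',
      Pi.single_eq_of_ne (show (0 : Fin 4) ≠ 3 by decide),
      Pi.single_eq_of_ne (show (1 : Fin 4) ≠ 3 by decide),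
      Pi.single_eq_of_ne (show (2 : Fin 4) ≠ 3 by decide), add_zero]
    exact g2

theorem Kernel.IsSmooth.bdd_partialDeriv {A : Kernel} (hA : A.IsSmooth) (K n : ℕ)
    (α : Fin 4 → ℕ) (hα : ∑ i, α i + n ≤ K) : Bdd n (A.cNorm K) (A.partialDeriv α) := by
  induction n generalizing α with
  | zero =>
    intro z hz
    exact le_iSup₂_of_le α hα (le_iSup₂_of_le z hz le_rfl)
  | succ n ih =>
    refine ⟨ih α (by omega), fun j => (ih (α + Pi.single j 1) ?_).congr (hA.kd_partialDeriv α j)⟩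
    simp only [Pi.add_apply, Finset.sum_add_distrib, Finset.sum_pi_single', Finset.mem_univ, if_true]
    omega

theorem Kernel.IsSmooth.bdd {A : Kernel} (hA : A.IsSmooth) (K : ℕ) :
    Bdd K (A.cNorm K) A.inCoords :=
  hA.bdd_partialDeriv K K 0 (by simp)

/-- Choose the covector `dir (θ - π / 2)`, whose rotation by a right angle is `dir θ`. -/
theorem Kernel.symbolZero {A : Kernel} (h : ∀ x ∈ disk, ∀ ξ ∈ circle, A.symbol x ξ = 0) :
    SymbolZero A.inCoords := by
  intro x hx θ
  have h1 := h x hx (dir (θ - Real.pi / 2)) (by simp [circle, dir_norm])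
  have h2 : perp (dir (θ - Real.pi / 2)) = dir θ := by
    ext i
    fin_cases i <;> simp [perp, dir, Real.cos_sub_pi_div_two, Real.sin_sub_pi_div_two]
  rw [Kernel.symbol, h2, ← dir_add_pi] at h1
  have h3 : A x (dir θ) 0 + A x (dir (θ + Real.pi)) 0 = 0 := by simpa [Real.pi_ne_zero] using h1
  exact h3

theorem Kernel.IsSmooth.op_eq {A : Kernel} (hA : A.IsSmooth) {g : 𝓢(Plane, ℂ)} (hg : SuppTwo g)
    {x : Plane} (hx : x ∈ disk) : A.op g x = kOp A.inCoords g x := by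
  have hi := integrable_boxMeas (hA.isKernel.continuous_kInt g hx)
  rw [kOp, paramInt, integral_prod _ hi, Kernel.op,
    intervalIntegral.integral_of_le (by positivity)]
  refine integral_congr_ae (ae_of_all _ fun θ => ?_)
  refine (setIntegral_eq_integral_of_forall_compl_eq_zero fun t ht => ?_).symm
  have h3 : 3 ≤ |t| := by
    by_contra! h
    exact ht ⟨(abs_lt.1 h).1, (abs_lt.1 h).2.le⟩
  rw [hg _ (lt_norm_add_smul_dir hx θ h3), mul_zero]

/-! ### Differential operators as sums of words -/

/-- The word of a multi-index. -/
def word (α : ℕ × ℕ) : List (Fin 2) := List.replicate α.1 0 ++ List.replicate α.2 1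

theorem wD_replicate (n : ℕ) (i : Fin 2) (u : Plane → ℂ) :
    wD (List.replicate n i) u = (dirDeriv (basisVec i))^[n] u := by
  induction n with
  | zero => rfl
  | succ n ih => rw [List.replicate_succ, wD, ih, Function.iterate_succ_apply']

theorem length_word_le {p : ℕ} {α : ℕ × ℕ} (hα : α ∈ multiIndices p) : (word α).length ≤ p := by
  rw [word, List.length_append, List.length_replicate, List.length_replicate]
  exact (Finset.mem_filter.1 hα).2

theorem DiffOp.apply_eq {p : ℕ} (P : DiffOp p) (u : Plane → ℂ) :
    P.apply u = fun x => ∑ α ∈ multiIndices p, P.coeff α x * wD (word α) u x := by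
  ext x
  simp only [DiffOp.apply, word, wD_append, wD_replicate]

theorem DiffOp.isCoef {p : ℕ} (P : DiffOp p) {α : ℕ × ℕ} (hα : α ∈ multiIndices p) :
    IsCoef (P.coeff α) := isCoef_of_contDiffOn_closure (P.smooth_coeff α hα)

theorem IsTestFunction.add {f g : Plane → ℂ} (hf : IsTestFunction f) (hg : IsTestFunction g) :
    IsTestFunction (fun x => f x + g x) where
  smooth := hf.smooth.add hg.smooth
  compact_support := hf.compact_support.add hg.compact_support
  support_subset := (tsupport_add f g).trans (union_subset hf.support_subset hg.support_subset)

theorem isTestFunction_zero : IsTestFunction fun _ => 0 where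
  smooth := contDiff_const
  compact_support := HasCompactSupport.zero
  support_subset := by
    rw [tsupport_eq_empty_iff.2 (by rfl)]
    exact empty_subset _

theorem isTestFunction_sum {ι : Type*} {t : Finset ι} {u : ι → Plane → ℂ}
    (hu : ∀ i ∈ t, IsTestFunction (u i)) : IsTestFunction fun x => ∑ i ∈ t, u i x := by
  classical
  induction t using Finset.induction_on with
  | empty => simpa using isTestFunction_zero
  | insert a t ha ih =>
    simp only [Finset.sum_insert ha]
    exact (hu a (Finset.mem_insert_self _ _)).add (ih fun i hi => hu i (Finset.mem_insert_of_mem hi))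

theorem kOp_sum_right {b : Plane × ℝ × ℝ → ℂ} (hb : IsKernel b) {ι : Type*} {t : Finset ι}
    {u : ι → Plane → ℂ} (hu : ∀ i ∈ t, IsTestFunction (u i)) {x : Plane} (hx : x ∈ disk) :
    kOp b (fun y => ∑ i ∈ t, u i y) x = ∑ i ∈ t, kOp b (u i) x := by
  simp only [kOp, paramInt]
  rw [← integral_finsetSum _ fun i hi =>
    integrable_boxMeas (hb.continuous_kInt (hu i hi).schw hx)]
  simp only [kInt, Finset.mul_sum]

theorem wD_zero_fun (w : List (Fin 2)) : wD w (fun _ => 0) = fun _ => 0 := by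
  induction w with
  | nil => rfl
  | cons i w ih =>
    rw [wD, ih]
    ext x
    simp [dirDeriv]

theorem wD_sum {U : Set Plane} (hU : IsOpen U) {ι : Type*} {t : Finset ι} {u : ι → Plane → ℂ}
    (hu : ∀ i ∈ t, ContDiffOn ℝ ∞ (u i) U) (w : List (Fin 2)) :
    EqOn (wD w fun x => ∑ i ∈ t, u i x) (fun x => ∑ i ∈ t, wD w (u i) x) U := by
  classical
  induction t using Finset.induction_on with
  | empty => simp only [Finset.sum_empty, wD_zero_fun]; exact fun _ _ => rfl
  | insert a t ha ih =>
    simp only [Finset.sum_insert ha]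
    have h1 : ∀ i ∈ t, ContDiffOn ℝ ∞ (u i) U := fun i hi => hu i (Finset.mem_insert_of_mem hi)
    intro x hx
    rw [wD_add hU (hu a (Finset.mem_insert_self _ _)) (ContDiffOn.sum h1) w hx]
    exact congrArg _ (ih h1 hx)

theorem op_apply_eq {p q : ℕ} (P : DiffOp p) (Q : DiffOp q) {A : Kernel} (hA : A.IsSmooth)
    {f : Plane → ℂ} (hf : IsTestFunction f) :
    EqOn (P.apply (A.op (Q.apply f))) (fun x => ∑ α ∈ multiIndices p, ∑ β ∈ multiIndices q,
      P.coeff α x * wD (word α)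
        (kOp A.inCoords fun y => Q.coeff β y * wD (word β) f y) x) disk := by
  have hu : ∀ β ∈ multiIndices q, IsTestFunction fun y => Q.coeff β y * wD (word β) f y :=
    fun β hβ => IsTestFunction.mul (Q.isCoef hβ).smooth (hf.wD _)
  have hs := isTestFunction_sum hu
  have h1 : EqOn (A.op (Q.apply f)) (fun x => ∑ β ∈ multiIndices q,
      kOp A.inCoords (fun y => Q.coeff β y * wD (word β) f y) x) disk := fun x hx => by
    rw [Q.apply_eq]
    exact (hA.op_eq (g := hs.schw) hs.suppTwo hx).trans (kOp_sum_right hA.isKernel hu hx)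
  intro x hx
  rw [P.apply_eq]
  refine Finset.sum_congr rfl fun α _ => ?_
  rw [wD_congr isOpen_disk h1 _ hx, wD_sum isOpen_disk
    (fun β hβ => hA.isKernel.contDiffOn_kOp (hu β hβ).schw) _ hx, Finset.mul_sum]

theorem IsGaining.exists_diffOp_bound {p q : ℕ} (P : DiffOp p) (Q : DiffOp q)
    {Z : (Plane × ℝ × ℝ → ℂ) → Prop} (hZ : IsGaining Z (p + q)) :
    ∃ C : ℝ≥0, ∀ A : Kernel, A.IsSmooth → Z A.inCoords → A.cNorm (2 * (p + q)) ≠ ⊤ →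
      ∀ s : ℝ, 0 ≤ s → s ≤ ((p + q : ℕ) : ℝ) → ∀ f, ∀ hf : IsTestFunction f,
        sobolevNorm disk s (P.apply (A.op (Q.apply f))) ≤
          C * A.cNorm (2 * (p + q)) * planeSobolevNorm s hf.toL2 := by
  have h : ∀ α β, ∃ C : ℝ≥0, α ∈ multiIndices p → β ∈ multiIndices q →
      ∀ b, IsKernel b → Z b → ∀ M ≠ ⊤, Bdd (2 * (p + q)) M b → ∀ s : ℝ, 0 ≤ s →
      s ≤ ((p + q : ℕ) : ℝ) → ∀ f, ∀ hf : IsTestFunction f,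
        sobolevNorm disk s (fun x => P.coeff α x *
          wD (word α) (kOp b fun y => Q.coeff β y * wD (word β) f y) x) ≤
          C * (M * planeSobolevNorm s hf.toL2) := by
    intro α β
    by_cases hα : α ∈ multiIndices p
    · by_cases hβ : β ∈ multiIndices q
      · obtain ⟨C, hC⟩ := hZ.exists_word_bound (P.isCoef hα) (word β) (Q.isCoef hβ) (word α) (j := 0)
          (by have := length_word_le hα; have := length_word_le hβ; omega)
        exact ⟨C, fun _ _ => hC⟩
      · exact ⟨0, fun _ h => absurd h hβ⟩
    · exact ⟨0, fun h => absurd h hα⟩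
  choose C hC using h
  refine ⟨∑ α ∈ multiIndices p, ∑ β ∈ multiIndices q, C α β, fun A hA hZA hN s hs hsm f hf => ?_⟩
  rw [sobolevNorm_congr measurableSet_disk (op_apply_eq P Q hA hf)]
  refine (sobolevNorm_sum_le _ _ _ _).trans ?_
  rw [ENNReal.ofNNReal_finsetSum, Finset.sum_mul, Finset.sum_mul]
  refine Finset.sum_le_sum fun α hα => (sobolevNorm_sum_le _ _ _ _).trans ?_
  rw [ENNReal.ofNNReal_finsetSum, Finset.sum_mul, Finset.sum_mul]
  refine Finset.sum_le_sum fun β hβ => ?_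
  rw [mul_assoc]
  exact hC α β hα hβ _ hA.isKernel hZA _ hN (hA.bdd _) s hs hsm f hf

/-- The bound of the conjugated operator by the Sobolev norm of the plane. -/
theorem exists_diffOp_bound {p q : ℕ} (P : DiffOp p) (Q : DiffOp q) :
    ∃ C : ℝ≥0, ∀ A : Kernel, A.IsSmooth →
      (p + q ≤ 1 ∨ (p + q ≤ 2 ∧ ∀ x ∈ disk, ∀ ξ ∈ circle, A.symbol x ξ = 0)) →
      A.cNorm (2 * (p + q)) ≠ ⊤ →
      ∀ s : ℝ, 0 ≤ s → s ≤ ((p + q : ℕ) : ℝ) → ∀ f, ∀ hf : IsTestFunction f,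
        sobolevNorm disk s (P.apply (A.op (Q.apply f))) ≤
          C * A.cNorm (2 * (p + q)) * planeSobolevNorm s hf.toL2 := by
  rcases Nat.lt_or_ge 2 (p + q) with h2 | h2
  -- For `p + q > 2` no kernel is admitted.
  · exact ⟨0, fun A _ hc => by omega⟩
  rcases h2.eq_or_lt with h2 | h2
  · obtain ⟨C, hC⟩ := IsGaining.exists_diffOp_bound P Q (Z := SymbolZero)
      (by rw [h2]; exact isGaining_two)
    exact ⟨C, fun A hA hc => hC A hA (Kernel.symbolZero (hc.resolve_left (by omega)).2)⟩
  · obtain ⟨C, hC⟩ := IsGaining.exists_diffOp_bound P Q (isGaining_of_le_one (Nat.le_of_lt_succ h2))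
    exact ⟨C, fun A hA _ => hC A hA trivial⟩

/-! ### Radial scaling in the punctured disk -/

/-- The punctured unit disk. -/
def puncDisk : Set Plane := disk \ {0}

theorem measurableSet_puncDisk : MeasurableSet puncDisk :=
  measurableSet_disk.diff (measurableSet_singleton 0)

theorem mem_puncDisk {x : Plane} : x ∈ puncDisk ↔ 0 < ‖x‖ ∧ ‖x‖ < 1 := by
  rw [puncDisk, Set.mem_sdiff, mem_disk_iff, mem_singleton_iff, norm_pos_iff, and_comm]

theorem restrict_puncDisk : volume.restrict puncDisk = volume.restrict disk :=
  Measure.restrict_congr_set (sdiff_ae_eq_self.2 (measure_mono_null inter_subset_right (by simp)))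

theorem image_powMap_puncDisk {a : ℝ} (ha : 0 ≤ a) : powMap a '' puncDisk = puncDisk := by
  ext y
  constructor
  · rintro ⟨x, hx, rfl⟩
    have hx' := mem_puncDisk.1 hx
    rw [mem_puncDisk, norm_powMap a (norm_pos_iff.1 hx'.1)]
    exact ⟨Real.rpow_pos_of_pos hx'.1 _, Real.rpow_lt_one hx'.1.le hx'.2 (by linarith)⟩
  · intro hy
    have hy' := mem_puncDisk.1 hy
    have hy0 := norm_pos_iff.1 hy'.1
    have h1 : 1 + -a / (1 + a) = (1 + a)⁻¹ := by field_simp; ring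
    refine ⟨powMap (-a / (1 + a)) y, ?_, ?_⟩
    · rw [mem_puncDisk, norm_powMap _ hy0, h1]
      exact ⟨Real.rpow_pos_of_pos hy'.1 _, Real.rpow_lt_one hy'.1.le hy'.2 (by positivity)⟩
    · rw [powMap, norm_powMap _ hy0, h1, powMap, smul_smul, ← Real.rpow_mul hy'.1.le,
        ← Real.rpow_add hy'.1]
      have : (1 + a)⁻¹ * a + -a / (1 + a) = 0 := by field_simp; ring
      rw [this, Real.rpow_zero, one_smul]

theorem lintegral_powMap_puncDisk {a : ℝ} (ha : 0 ≤ a) (F : Plane → ℝ≥0∞) :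
    ENNReal.ofReal (1 + a) * ∫⁻ x in puncDisk, ENNReal.ofReal (‖x‖ ^ (2 * a)) * F (powMap a x) =
      ∫⁻ x in puncDisk, F x := by
  have h := lintegral_powMap (a := a) (by linarith) measurableSet_puncDisk (by simp [puncDisk]) F
  rw [image_powMap_puncDisk ha] at h
  rw [h, ← lintegral_const_mul' _ _ ENNReal.ofReal_ne_top]
  refine setLIntegral_congr_fun measurableSet_puncDisk fun x _ => ?_
  rw [abs_of_nonneg (by linarith), ENNReal.ofReal_mul (by positivity)]
  ring

/-- The composition with a power map, normalised to act almost isometrically on `L²`. -/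
def radScale (a : ℝ) (u : Plane → ℂ) (x : Plane) : ℂ := ((‖x‖ ^ a : ℝ) : ℂ) * u (powMap a x)

theorem measurable_powMap : Measurable fun p : Plane × ℝ => powMap p.2 p.1 := by
  unfold powMap
  fun_prop

theorem measurable_radScale {u : Plane → ℂ} (hu : Continuous u) :
    Measurable fun p : Plane × ℝ => radScale p.2 u p.1 := by
  unfold radScale
  exact (Complex.measurable_ofReal.comp (by fun_prop)).mul
    (hu.measurable.comp measurable_powMap)

theorem enorm_radScale_sq (a : ℝ) (u : Plane → ℂ) (x : Plane) :
    ‖radScale a u x‖ₑ ^ 2 = ENNReal.ofReal (‖x‖ ^ (2 * a)) * ‖u (powMap a x)‖ₑ ^ 2 := by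
  rw [radScale, enorm_mul, mul_pow, ← ofReal_norm, Complex.norm_real,
    ← ENNReal.ofReal_pow (norm_nonneg _), Real.norm_of_nonneg (by positivity), ← Real.rpow_natCast,
    ← Real.rpow_mul (norm_nonneg _), mul_comm a, Nat.cast_ofNat]

theorem l2N_radScale_le {a : ℝ} (ha : 0 ≤ a) (u : Plane → ℂ) :
    l2N puncDisk (radScale a u) ≤ l2N puncDisk u := by
  rw [← sq_le_sq_iff_ennreal, l2N, l2N, eLpNorm_two_sq, eLpNorm_two_sq,
    ← lintegral_powMap_puncDisk ha fun x => ‖u x‖ₑ ^ 2]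
  simp only [enorm_radScale_sq]
  refine le_mul_of_one_le_left zero_le ?_
  rw [ENNReal.one_le_ofReal]
  linarith

/-- The Euler operator `1 + x · ∇`. -/
def euler (φ : 𝓢(Plane, ℂ)) (x : Plane) : ℂ := φ x + fderiv ℝ φ x x

theorem continuous_euler (φ : 𝓢(Plane, ℂ)) : Continuous (euler φ) :=
  φ.continuous.add (((φ.smooth 1).continuous_fderiv (by simp)).clm_apply continuous_id)

/-- The power maps act on `log ‖x‖` as dilations, so a factor `log ‖x‖` appears. It is exactly what
the weight `logWeight x ^ (1 / 2)` removes. -/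
theorem hasDerivAt_radScale (φ : 𝓢(Plane, ℂ)) {x : Plane} (hx : x ≠ 0) (a : ℝ) :
    HasDerivAt (fun a => radScale a φ x) ((Real.log ‖x‖ : ℂ) * radScale a (euler φ) x) a := by
  have hx0 := norm_pos_iff.2 hx
  have h1 : HasDerivAt (fun a : ℝ => ‖x‖ ^ a) (‖x‖ ^ a * Real.log ‖x‖) a :=
    (Real.hasStrictDerivAt_const_rpow hx0 a).hasDerivAt
  have h2 : HasDerivAt (fun a => powMap a x) ((‖x‖ ^ a * Real.log ‖x‖) • x) a := h1.smul_const x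
  have h3 := (schwartz_hasFDerivAt φ (powMap a x)).comp_hasDerivAt a h2
  have h4 := h1.ofReal_comp.mul h3
  refine h4.congr_deriv ?_
  have h5 : (‖x‖ ^ a * Real.log ‖x‖) • x = Real.log ‖x‖ • powMap a x := by
    rw [powMap, smul_smul, mul_comm]
  rw [h5, map_smul, Complex.real_smul]
  simp only [radScale, euler, Function.comp_apply]
  push_cast
  ring

theorem radScale_zero (u : Plane → ℂ) (x : Plane) : radScale 0 u x = u x := by
  simp [radScale, powMap]

theorem radScale_one_sub_eq (φ : 𝓢(Plane, ℂ)) {x : Plane} (hx : x ≠ 0) :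
    radScale 1 φ x - φ x =
      ∫ a in Ioc (0 : ℝ) 1, (Real.log ‖x‖ : ℂ) * radScale a (euler φ) x := by
  have hc : Continuous fun a => (Real.log ‖x‖ : ℂ) * radScale a (euler φ) x := by
    have h1 : Continuous fun a : ℝ => ‖x‖ ^ a :=
      continuous_const.rpow continuous_id fun _ => Or.inl (norm_ne_zero_iff.2 hx)
    have h2 : Continuous fun a : ℝ => powMap a x := h1.smul continuous_const
    unfold radScale
    exact continuous_const.mul ((Complex.continuous_ofReal.comp h1).mul
      ((continuous_euler φ).comp h2))
  rw [← intervalIntegral.integral_of_le zero_le_one,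
    intervalIntegral.integral_eq_sub_of_hasDerivAt (fun a _ => hasDerivAt_radScale φ hx a)
      (hc.intervalIntegrable _ _), radScale_zero]

/-! ### The Hardy inequality -/

/-- The square of the inverse of the logarithmic distance to the unit circle. -/
def logWeight (x : Plane) : ℝ := (Real.log ‖x‖ ^ 2)⁻¹

theorem logWeight_nonneg (x : Plane) : 0 ≤ logWeight x := by unfold logWeight; positivity

theorem measurable_logWeight : Measurable logWeight := by unfold logWeight; fun_prop

theorem logWeight_powMap (a : ℝ) {x : Plane} (hx : x ≠ 0) :
    logWeight (powMap a x) = ((1 + a) ^ 2)⁻¹ * logWeight x := by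
  rw [logWeight, norm_powMap a hx, Real.log_rpow (norm_pos_iff.2 hx), mul_pow, mul_inv, logWeight]

/-- The weighted norm in the Hardy inequality. -/
def hardyN (s : ℝ) (u : Plane → ℂ) : ℝ≥0∞ :=
  eLpNorm (fun x => ((logWeight x ^ (s / 2) : ℝ) : ℂ) * u x) 2 (volume.restrict puncDisk)

theorem hardyN_sq (s : ℝ) (u : Plane → ℂ) :
    hardyN s u ^ 2 = ∫⁻ x in puncDisk, ENNReal.ofReal (logWeight x ^ s) * ‖u x‖ₑ ^ 2 := by
  rw [hardyN, eLpNorm_two_sq]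
  refine lintegral_congr fun x => ?_
  have h := logWeight_nonneg x
  rw [enorm_mul, mul_pow, ← ofReal_norm, Complex.norm_real, Real.norm_of_nonneg (by positivity),
    ← ENNReal.ofReal_pow (by positivity), ← Real.rpow_natCast, ← Real.rpow_mul h]
  norm_num

theorem hardyN_add_le (s : ℝ) {u v : Plane → ℂ} (hu : Measurable u) (hv : Measurable v) :
    hardyN s (fun x => u x + v x) ≤ hardyN s u + hardyN s v := by
  have hm : Measurable fun x => ((logWeight x ^ (s / 2) : ℝ) : ℂ) :=
    Complex.measurable_ofReal.comp (measurable_logWeight.pow_const _)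
  unfold hardyN
  simp only [mul_add]
  exact eLpNorm_add_le (hm.mul hu).aestronglyMeasurable (hm.mul hv).aestronglyMeasurable
    (by norm_num)

/-- Under `powMap 1` the logarithm doubles and the Jacobian is `2 ‖x‖ ^ 2`, so the square of the
norm is multiplied by `4 ^ s / 2`. The factor equals one only at the exceptional exponent `s = 1 /
2`. -/
theorem hardyN_radScale (s : ℝ) (u : Plane → ℂ) :
    hardyN s (radScale 1 u) = ENNReal.ofReal (2 ^ (s - 1 / 2)) * hardyN s u := by
  have h : hardyN s (radScale 1 u) ^ 2 = (ENNReal.ofReal (2 ^ (s - 1 / 2)) * hardyN s u) ^ 2 := by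
    rw [mul_pow, hardyN_sq, hardyN_sq, ← lintegral_powMap_puncDisk zero_le_one fun x =>
      ENNReal.ofReal (logWeight x ^ s) * ‖u x‖ₑ ^ 2, ← mul_assoc,
      ← ENNReal.ofReal_pow (by positivity), ← ENNReal.ofReal_mul (by positivity),
      ← lintegral_const_mul' _ _ ENNReal.ofReal_ne_top]
    refine setLIntegral_congr_fun measurableSet_puncDisk fun x hx => ?_
    have hx0 : x ≠ 0 := norm_pos_iff.1 (mem_puncDisk.1 hx).1
    have hw := logWeight_nonneg x
    rw [enorm_radScale_sq, logWeight_powMap _ hx0, ← mul_assoc, ← mul_assoc, ← mul_assoc,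
      ← ENNReal.ofReal_mul (by positivity), ← ENNReal.ofReal_mul (by positivity),
      ← ENNReal.ofReal_mul (by positivity)]
    congr 2
    have e1 : ((2 : ℝ) ^ (s - 1 / 2)) ^ 2 * (1 + 1) = 4 ^ s := by
      rw [← Real.rpow_natCast, ← Real.rpow_mul (by norm_num), one_add_one_eq_two,
        show (4 : ℝ) = 2 ^ (2 : ℝ) by norm_num, ← Real.rpow_mul (by norm_num)]
      rw [show (2 : ℝ) * s = (s - 1 / 2) * (2 : ℕ) + 1 by push_cast; ring,
        Real.rpow_add_one (by norm_num)]
    have e2 : (((1 + 1 : ℝ) ^ 2)⁻¹ * logWeight x) ^ s = (4 ^ s)⁻¹ * logWeight x ^ s := by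
      rw [Real.mul_rpow (by norm_num) hw, Real.inv_rpow (by norm_num)]
      norm_num
    rw [e1, e2]
    have : (4 : ℝ) ^ s ≠ 0 := by positivity
    field_simp
  exact le_antisymm (sq_le_sq_iff_ennreal.1 h.le) (sq_le_sq_iff_ennreal.1 h.ge)

theorem l2N_euler_le (φ : 𝓢(Plane, ℂ)) :
    l2N puncDisk (euler φ) ≤ 15 * planeSobolevNorm 1 (φ.toLp 2 volume) := by
  have h1 := wS_le_planeSobolevNorm 1 φ
  rw [pow_one, Nat.cast_one] at h1
  refine le_trans ?_ h1
  have h2 : ∀ i : Fin 2, eLpNorm (fun x : Plane => ((x i : ℝ) : ℂ) *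
      (∂_{basisVec i} φ : 𝓢(Plane, ℂ)) x) 2 (volume.restrict puncDisk) ≤
      eLpNorm (∂_{basisVec i} φ : 𝓢(Plane, ℂ)) 2 volume := fun i => by
    refine (eLpNorm_mul_le_of_enorm_le (M := 1) ?_
      (SchwartzMap.continuous _).aestronglyMeasurable).trans ?_
    · filter_upwards [ae_restrict_mem measurableSet_puncDisk] with x hx
      rw [← ofReal_norm, Complex.norm_real, ← ENNReal.ofReal_one]
      exact ENNReal.ofReal_le_ofReal ((PiLp.norm_apply_le x i).trans (mem_puncDisk.1 hx).2.le)
    · rw [one_mul]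
      exact eLpNorm_mono_measure _ Measure.restrict_le_self
  have h3 : euler φ = fun x => φ x + (((x 0 : ℝ) : ℂ) * (∂_{basisVec 0} φ : 𝓢(Plane, ℂ)) x +
      ((x 1 : ℝ) : ℂ) * (∂_{basisVec 1} φ : 𝓢(Plane, ℂ)) x) := by
    ext x
    rw [euler]
    nth_rewrite 3 [eq_sum_basisVec x]
    simp only [schwartz_lineDeriv, Fin.sum_univ_two, map_add, map_smul, Complex.real_smul]
  have hc : ∀ i : Fin 2, Continuous fun x : Plane => ((x i : ℝ) : ℂ) *
      (∂_{basisVec i} φ : 𝓢(Plane, ℂ)) x := fun i =>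
    (Complex.continuous_ofReal.comp (by fun_prop)).mul (SchwartzMap.continuous _)
  rw [h3, l2N]
  refine (eLpNorm_add_le φ.continuous.aestronglyMeasurable
    ((hc 0).add (hc 1)).aestronglyMeasurable (by norm_num)).trans ?_
  simp only [wS, Fin.sum_univ_two]
  gcongr
  · exact Measure.restrict_le_self
  · exact (eLpNorm_add_le (hc 0).aestronglyMeasurable (hc 1).aestronglyMeasurable
      (by norm_num)).trans (add_le_add (h2 0) (h2 1))

/-- The endpoint `s = 1`: integrate the derivative in `a` over `[0, 1]`. The weight cancels the
logarithm, and `radScale a` does not increase the `L²` norm. -/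
theorem hardyN_one_sub_le (φ : 𝓢(Plane, ℂ)) :
    hardyN 1 (fun x => radScale 1 φ x - φ x) ≤
      15 * planeSobolevNorm 1 (φ.toLp 2 volume) := by
  set c : Plane → ℂ := fun x => ((logWeight x ^ (1 / 2 : ℝ) * Real.log ‖x‖ : ℝ) : ℂ) with hc
  have hcm : Measurable c := Complex.measurable_ofReal.comp
    ((measurable_logWeight.pow_const _).mul (by fun_prop))
  have hc1 : ∀ x, ‖c x‖ₑ ≤ 1 := fun x => by
    rw [← ofReal_norm, Complex.norm_real, ← ENNReal.ofReal_one]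
    refine ENNReal.ofReal_le_ofReal ?_
    rw [logWeight, ← Real.sqrt_eq_rpow, Real.sqrt_inv, Real.sqrt_sq_eq_abs, norm_mul, norm_inv,
      Real.norm_eq_abs, Real.norm_eq_abs, abs_abs]
    exact inv_mul_le_one
  have e : ∀ x ∈ puncDisk, ((logWeight x ^ (1 / 2 : ℝ) : ℝ) : ℂ) * (radScale 1 φ x - φ x) =
      ∫ a in Ioc (0 : ℝ) 1, c x * radScale a (euler φ) x := fun x hx => by
    rw [radScale_one_sub_eq φ (norm_pos_iff.1 (mem_puncDisk.1 hx).1), ← integral_const_mul]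
    simp only [hc, Complex.ofReal_mul, mul_assoc]
  rw [hardyN, eLpNorm_congr_ae (ae_restrict_of_forall_mem measurableSet_puncDisk e)]
  have hm : ∀ a : ℝ, AEStronglyMeasurable (radScale a (euler φ)) (volume.restrict puncDisk) :=
    fun a => ((measurable_radScale (continuous_euler φ)).comp
      (measurable_id.prodMk measurable_const)).aestronglyMeasurable
  refine (eLpNorm_integral_le (volume.restrict puncDisk) (volume.restrict (Ioc (0 : ℝ) 1))
    (G := fun x a => c x * radScale a (euler φ) x)
    ((hcm.comp measurable_fst).mul (measurable_radScale (continuous_euler φ))).aestronglyMeasurable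
    (B := l2N puncDisk (euler φ)) ?_).trans ?_
  · filter_upwards [ae_restrict_mem measurableSet_Ioc] with a ha
    refine (eLpNorm_mul_le_of_enorm_le (ae_of_all _ hc1) (hm a)).trans ?_
    rw [one_mul]
    exact l2N_radScale_le ha.1.le _
  · simpa using l2N_euler_le φ

/-! ### The splitting of functions on the disk -/

/-- The low frequency part is replaced by a Schwartz function close to it in `H¹`, since rescalings
and cutoffs will act on it pointwise. -/
theorem exists_schwartz_split (g : L2) {r : ℝ} (hr : 0 < r) : ∃ φ : 𝓢(Plane, ℂ),
    ‖g - φ.toLp 2 volume‖ₑ ^ 2 + ENNReal.ofReal r * planeSobolevNorm 1 (φ.toLp 2 volume) ^ 2 ≤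
      8 * ∫⁻ ξ, ENNReal.ofReal (min 1 ((r * weight ξ) ^ 1)) * ‖(𝓕 g : L2) ξ‖ₑ ^ 2 := by
  set K := ∫⁻ ξ, ENNReal.ofReal (min 1 ((r * weight ξ) ^ 1)) * ‖(𝓕 g : L2) ξ‖ₑ ^ 2 with hK
  obtain ⟨g₁, hg₁⟩ := exists_isLowPart hr g
  have h1 := hg₁.split_le hr (k := 1) (Or.inl rfl)
  rw [pow_one, Nat.cast_one, ← hK] at h1
  have hKtop : K ≠ ⊤ := by
    refine ne_top_of_le_ne_top (b := ‖g‖ₑ ^ 2) (by finiteness) ?_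
    rw [← planeSobolevNorm_zero, planeSobolevNorm_sq]
    refine lintegral_mono fun ξ => ?_
    beta_reduce
    gcongr
    simp
  have hr' : ENNReal.ofReal r ≠ 0 := by simpa using hr
  rcases eq_or_ne K 0 with h0 | h0
  · rw [h0, mul_zero, nonpos_iff_eq_zero, add_eq_zero] at h1
    have hg1 : planeSobolevNorm 1 g₁ = 0 := by simpa [hr'] using h1.2
    have hg1' : g₁ = 0 := by
      have := (planeSobolevNorm_mono zero_le_one g₁).trans hg1.le
      rwa [planeSobolevNorm_zero, nonpos_iff_eq_zero, enorm_eq_zero] at this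
    refine ⟨0, ?_⟩
    have h2 : (0 : 𝓢(Plane, ℂ)).toLp 2 volume = g₁ := by
      rw [hg1']
      exact map_zero (toLpCLM ℝ ℂ 2 (volume : Measure Plane))
    rw [h2, h0, mul_zero, h1.1, h1.2, add_zero]
  have hfin : planeSobolevNorm 1 g₁ ≠ ⊤ := fun h => by
    rw [h] at h1
    have : ENNReal.ofReal r * (⊤ : ℝ≥0∞) ^ 2 = ⊤ := by simp [hr']
    rw [this, add_top, top_le_iff] at h1
    exact ENNReal.mul_ne_top (by norm_num) hKtop h1
  -- The approximation error is made small relative to `K`, which is why `K = 0` had to be treated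
  -- separately.
  obtain ⟨ε, hε, hε2⟩ : ∃ ε : ℝ≥0∞, ε ≠ 0 ∧ (1 + ENNReal.ofReal r) * ε ^ 2 ≤ K := by
    refine ⟨(K / (1 + ENNReal.ofReal r)) ^ (1 / 2 : ℝ), ?_, ?_⟩
    · have : K / (1 + ENNReal.ofReal r) ≠ 0 := ENNReal.div_ne_zero.2 ⟨h0, by finiteness⟩
      simp [this]
    · rw [← ENNReal.rpow_natCast, ← ENNReal.rpow_mul]
      norm_num
      exact ENNReal.mul_div_le
  obtain ⟨φ, hφ⟩ := exists_schwartz_approx 1 hfin hε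
  have hφ0 : ‖φ.toLp 2 volume - g₁‖ₑ ≤ ε := by
    rw [← planeSobolevNorm_zero]
    exact (planeSobolevNorm_mono zero_le_one _).trans hφ
  refine ⟨φ, ?_⟩
  have e1 : ‖g - φ.toLp 2 volume‖ₑ ≤ ‖g - g₁‖ₑ + ε := by
    have : g - φ.toLp 2 volume = (g - g₁) - (φ.toLp 2 volume - g₁) := by abel
    rw [this]
    exact (enorm_sub_le).trans (add_le_add le_rfl hφ0)
  have e2 : planeSobolevNorm 1 (φ.toLp 2 volume) ≤ planeSobolevNorm 1 g₁ + ε := by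
    have : φ.toLp 2 volume = g₁ + (φ.toLp 2 volume - g₁) := by abel
    rw [this]
    exact (planeSobolevNorm_add_le _ _ _).trans (add_le_add le_rfl hφ)
  calc _ ≤ (‖g - g₁‖ₑ + ε) ^ 2 + ENNReal.ofReal r * (planeSobolevNorm 1 g₁ + ε) ^ 2 := by gcongr
    _ ≤ 2 * (‖g - g₁‖ₑ ^ 2 + ε ^ 2) +
        ENNReal.ofReal r * (2 * (planeSobolevNorm 1 g₁ ^ 2 + ε ^ 2)) := by
        gcongr <;> exact add_sq_le_two_mul _ _
    _ = 2 * (‖g - g₁‖ₑ ^ 2 + ENNReal.ofReal r * planeSobolevNorm 1 g₁ ^ 2) +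
        2 * ((1 + ENNReal.ofReal r) * ε ^ 2) := by ring
    _ ≤ 2 * (2 * K) + 2 * K := by gcongr
    _ ≤ 2 * (2 * K) + 4 * K := by gcongr; norm_num
    _ = 8 * K := by ring

theorem exists_disk_split {f : Plane → ℂ} {g : L2} (hg : g =ᵐ[volume.restrict disk] f) {r : ℝ}
    (hr : 0 < r) : ∃ φ : 𝓢(Plane, ℂ), l2N disk (fun x => f x - φ x) ^ 2 +
      ENNReal.ofReal r * planeSobolevNorm 1 (φ.toLp 2 volume) ^ 2 ≤
      8 * ∫⁻ ξ, ENNReal.ofReal (min 1 ((r * weight ξ) ^ 1)) * ‖(𝓕 g : L2) ξ‖ₑ ^ 2 := by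
  obtain ⟨φ, hφ⟩ := exists_schwartz_split g hr
  refine ⟨φ, le_trans ?_ hφ⟩
  gcongr
  rw [Lp.enorm_def, l2N]
  refine le_trans (le_of_eq (eLpNorm_congr_ae ?_)) (eLpNorm_mono_measure _ Measure.restrict_le_self)
  filter_upwards [hg, ae_restrict_of_ae (Lp.coeFn_sub g (φ.toLp 2 volume)),
    ae_restrict_of_ae (φ.coeFn_toLp 2 volume)] with x h1 h2 h3
  rw [h2, Pi.sub_apply, h1, h3]

theorem IsTestFunction.exists_radius {f : Plane → ℂ} (hf : IsTestFunction f) :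
    ∃ ρ : ℝ, 0 < ρ ∧ ρ < 1 ∧ ∀ x, ρ < ‖x‖ → f x = 0 := by
  rcases (tsupport f).eq_empty_or_nonempty with h | h
  · refine ⟨1 / 2, by norm_num, by norm_num, fun x _ => image_eq_zero_of_notMem_tsupport ?_⟩
    rw [h]
    exact notMem_empty x
  · obtain ⟨y, hy, hmax⟩ := hf.compact_support.exists_isMaxOn h continuous_norm.continuousOn
    refine ⟨max (1 / 2) ‖y‖, by positivity,
      max_lt (by norm_num) (mem_disk_iff.1 (hf.support_subset hy)), fun x hx =>
      image_eq_zero_of_notMem_tsupport fun hx' => ?_⟩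
    exact absurd (isMaxOn_iff.1 hmax x hx') (not_le.2 ((le_max_right _ _).trans_lt hx))

/-- The weight is singular only at the circle, away from the support of `f`. Finiteness is what
permits absorbing the Hardy norm later. -/
theorem IsTestFunction.hardyN_ne_top {f : Plane → ℂ} (hf : IsTestFunction f) {s : ℝ} (hs : 0 ≤ s) :
    hardyN s f ≠ ⊤ := by
  obtain ⟨ρ, hρ0, hρ1, hρ⟩ := hf.exists_radius
  obtain ⟨B, hB⟩ := hf.compact_support.exists_bound_of_continuous hf.smooth.continuous
  have hfin : IsFiniteMeasure (volume.restrict puncDisk) := by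
    rw [restrict_puncDisk]
    exact ⟨by rw [Measure.restrict_apply_univ]; exact measure_ball_lt_top⟩
  have hlog := Real.log_neg hρ0 hρ1
  have hb : ∀ᵐ x ∂volume.restrict puncDisk,
      ‖((logWeight x ^ (s / 2) : ℝ) : ℂ) * f x‖ ≤ ((Real.log ρ ^ 2)⁻¹) ^ (s / 2) * B := by
    filter_upwards [ae_restrict_mem measurableSet_puncDisk] with x hx
    have hx' := mem_puncDisk.1 hx
    have hB0 : 0 ≤ B := (norm_nonneg _).trans (hB 0)
    have hw := logWeight_nonneg x
    rcases lt_or_ge ρ ‖x‖ with h | h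
    · rw [hρ x h, mul_zero, norm_zero]
      positivity
    · rw [norm_mul, Complex.norm_real, Real.norm_of_nonneg (by positivity)]
      gcongr
      · have h1 : Real.log ‖x‖ ≤ Real.log ρ := Real.log_le_log hx'.1 h
        refine inv_anti₀ (by nlinarith) ?_
        nlinarith
      · exact hB x
  refine ne_top_of_le_ne_top ?_ (eLpNorm_le_of_ae_bound hb)
  exact ENNReal.mul_ne_top (ENNReal.rpow_ne_top_of_nonneg (by simp) (measure_ne_top _ _))
    ENNReal.ofReal_ne_top

/-- Absorption of `a`: the first inequality serves `κ < 1`, the second `κ > 1`. -/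
theorem le_inv_abs_sub_one_mul {κ : ℝ} (hκ0 : 0 < κ) (hκ : κ ≠ 1) {a b : ℝ≥0∞} (ha : a ≠ ⊤)
    (h1 : a ≤ ENNReal.ofReal κ * a + b) (h2 : ENNReal.ofReal κ * a ≤ a + b) :
    a ≤ ENNReal.ofReal |κ - 1|⁻¹ * b := by
  have hpos : 0 < |κ - 1| := abs_pos.2 (sub_ne_zero.2 hκ)
  rcases eq_or_ne b ⊤ with rfl | hb
  · rw [ENNReal.mul_top (by simpa using hpos)]
    exact le_top
  obtain ⟨x, hx, rfl⟩ : ∃ x : ℝ, 0 ≤ x ∧ a = ENNReal.ofReal x :=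
    ⟨a.toReal, ENNReal.toReal_nonneg, (ENNReal.ofReal_toReal ha).symm⟩
  obtain ⟨y, hy, rfl⟩ : ∃ y : ℝ, 0 ≤ y ∧ b = ENNReal.ofReal y :=
    ⟨b.toReal, ENNReal.toReal_nonneg, (ENNReal.ofReal_toReal hb).symm⟩
  rw [← ENNReal.ofReal_mul hκ0.le, ← ENNReal.ofReal_add (by positivity) hy,
    ENNReal.ofReal_le_ofReal_iff (by positivity)] at h1 h2
  rw [← ENNReal.ofReal_mul (by positivity)]
  refine ENNReal.ofReal_le_ofReal ?_
  rw [← div_eq_inv_mul, le_div_iff₀ hpos]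
  rcases abs_cases (κ - 1) with ⟨h, -⟩ | ⟨h, -⟩ <;> rw [h] <;> linarith

theorem measurable_radScale_left (a : ℝ) {u : Plane → ℂ} (hu : Continuous u) :
    Measurable (radScale a u) :=
  (Complex.measurable_ofReal.comp (measurable_norm.pow_const a)).mul
    (hu.measurable.comp ((measurable_norm.pow_const a).smul measurable_id))

/-- The low frequency functional that is integrated in the interpolation of `g`. -/
def freqSplit (g : L2) (r : ℝ) : ℝ≥0∞ :=
  ∫⁻ ξ, ENNReal.ofReal (min 1 ((r * weight ξ) ^ 1)) * ‖(𝓕 g : L2) ξ‖ₑ ^ 2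

/-- The map `u ↦ radScale 1 u - u` has norm at most `2` on `L²` and is bounded by
`hardyN_one_sub_le` on `H¹`. Interpolating along the splitting of `g` gives `60 ^ 2 = 2 · 15 ^ 2 ·
8`. No extra condition on `f` at the circle is used. -/
theorem exists_hardyN_sub_le {s : ℝ} (hs : 0 < s) (hs1 : s < 1) {f : Plane → ℂ}
    (hf : IsTestFunction f) {g : L2} (hg : g =ᵐ[volume.restrict disk] f) :
    hardyN s (fun x => radScale 1 f x - f x) ≤ 60 * planeSobolevNorm s g := by
  have hrm := fun {u : Plane → ℂ} (hu : Continuous u) => measurable_radScale_left 1 hu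
  have key := interp_weighted (volume.restrict puncDisk) measurable_logWeight logWeight_nonneg
    (H := fun x => radScale 1 f x - f x) ((hrm hf.smooth.continuous).sub
      hf.smooth.continuous.measurable).aestronglyMeasurable one_ne_zero hs
    (Φ := fun r => 1800 * freqSplit g r) (fun r hr => by
      obtain ⟨φ, hφ⟩ := exists_disk_split hg hr
      have hu : Continuous fun x => f x - φ x := hf.smooth.continuous.sub φ.continuous
      refine ⟨fun x => radScale 1 (fun x => f x - φ x) x - (f x - φ x),
        fun x => radScale 1 φ x - φ x, ((hrm hu).sub hu.measurable).aestronglyMeasurable,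
        ae_of_all _ fun x => by simp only [radScale]; ring, ?_⟩
      have e0 : ∫⁻ x in puncDisk, ‖radScale 1 (fun x => f x - φ x) x - (f x - φ x)‖ₑ ^ 2 ≤
          (2 * l2N disk (fun x => f x - φ x)) ^ 2 := by
        rw [← eLpNorm_two_sq]
        gcongr
        refine (eLpNorm_sub_le (hrm hu).aestronglyMeasurable hu.aestronglyMeasurable
          (by norm_num)).trans ?_
        rw [two_mul]
        have : l2N disk (fun x => f x - φ x) = l2N puncDisk (fun x => f x - φ x) := by
          rw [l2N, l2N, restrict_puncDisk]
        rw [this]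
        exact add_le_add (l2N_radScale_le zero_le_one _) le_rfl
      have e1 : ∫⁻ x in puncDisk, ENNReal.ofReal (logWeight x ^ 1) *
          ‖radScale 1 φ x - φ x‖ₑ ^ 2 ≤ (15 * planeSobolevNorm 1 (φ.toLp 2 volume)) ^ 2 := by
        have := hardyN_sq 1 (fun x => radScale 1 φ x - φ x)
        simp only [Real.rpow_one] at this
        simp only [pow_one]
        rw [← this]
        gcongr
        exact hardyN_one_sub_le φ
      calc _ ≤ (2 * l2N disk (fun x => f x - φ x)) ^ 2 + ENNReal.ofReal (r ^ 1) *
            (15 * planeSobolevNorm 1 (φ.toLp 2 volume)) ^ 2 := by gcongr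
        _ = 4 * l2N disk (fun x => f x - φ x) ^ 2 +
            225 * (ENNReal.ofReal r * planeSobolevNorm 1 (φ.toLp 2 volume) ^ 2) := by
            rw [pow_one]; ring
        _ ≤ 225 * l2N disk (fun x => f x - φ x) ^ 2 +
            225 * (ENNReal.ofReal r * planeSobolevNorm 1 (φ.toLp 2 volume) ^ 2) := by
            gcongr; norm_num
        _ ≤ 225 * (8 * freqSplit g r) := by rw [← mul_add]; gcongr; exact hφ
        _ = 1800 * freqSplit g r := by ring)
  have e : ∀ r, 2 * (1800 * freqSplit g r) * ENNReal.ofReal (r ^ (-s - 1)) =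
      3600 * (freqSplit g r * ENNReal.ofReal (r ^ (-s - 1))) := fun r => by ring
  simp only [e] at key
  rw [lintegral_const_mul' _ _ (by norm_num), ← hardyN_sq] at key
  simp only [freqSplit] at key
  rw [lintegral_interp_planeSobolevNorm g one_ne_zero hs, mul_left_comm,
    ENNReal.mul_le_mul_iff_right (interpConst_ne_zero _ _)
      (interpConst_ne_top hs (by simpa using hs1))] at key
  rw [← sq_le_sq_iff_ennreal, mul_pow]
  refine key.trans (le_of_eq ?_)
  norm_num

/-- The fractional Hardy inequality in the disk. -/
theorem exists_hardyN_le {s : ℝ} (hs : 0 < s) (hs1 : s < 1) (hne : s ≠ 1 / 2) :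
    ∃ C : ℝ≥0, ∀ f, IsTestFunction f → ∀ g : L2, g =ᵐ[volume.restrict disk] f →
      hardyN s f ≤ C * planeSobolevNorm s g := by
  have hκ : (2 : ℝ) ^ (s - 1 / 2) ≠ 1 := by
    intro h
    have h2 := congrArg Real.log h
    rw [Real.log_rpow two_pos, Real.log_one, mul_eq_zero] at h2
    exact h2.elim (fun h => hne (by linarith)) (Real.log_pos one_lt_two).ne'
  refine ⟨(|(2 : ℝ) ^ (s - 1 / 2) - 1|⁻¹ * 60).toNNReal, fun f hf g hg => ?_⟩
  have hb := exists_hardyN_sub_le hs hs1 hf hg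
  have hfm : Measurable f := hf.smooth.continuous.measurable
  have hrm := measurable_radScale_left 1 hf.smooth.continuous
  have hneg : hardyN s (fun x => f x - radScale 1 f x) =
      hardyN s (fun x => radScale 1 f x - f x) := by
    unfold hardyN
    rw [← eLpNorm_neg]
    congr 1
    ext x
    simp only [Pi.neg_apply]
    ring
  -- The triangle inequality in both directions covers `s < 1 / 2` and `s > 1 / 2`.
  have h1 := hardyN_add_le s (v := fun x => f x - radScale 1 f x) hrm (hfm.sub hrm)
  have h2 := hardyN_add_le s (v := fun x => radScale 1 f x - f x) hfm (hrm.sub hfm)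
  simp only [add_sub_cancel] at h1 h2
  rw [hardyN_radScale, hneg] at h1
  rw [show (fun x => radScale 1 f x) = radScale 1 f from rfl, hardyN_radScale] at h2
  refine (le_inv_abs_sub_one_mul (by positivity) hκ (hf.hardyN_ne_top hs.le) h1 h2).trans ?_
  rw [ENNReal.ofNNReal_toNNReal, ENNReal.ofReal_mul (by positivity), mul_assoc]
  gcongr
  simpa using hb

/-! ### Cutoffs near the unit circle -/

theorem deriv_smoothTransition_eq_zero {u : ℝ} (hu : u < 0 ∨ 1 < u) :
    deriv Real.smoothTransition u = 0 := by
  rcases hu with hu | hu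
  · have h : Real.smoothTransition =ᶠ[𝓝 u] fun _ => 0 := by
      filter_upwards [Iio_mem_nhds hu] with v hv
      exact Real.smoothTransition.zero_of_nonpos (le_of_lt hv)
    rw [h.deriv_eq, deriv_const]
  · have h : Real.smoothTransition =ᶠ[𝓝 u] fun _ => 1 := by
      filter_upwards [Ioi_mem_nhds hu] with v hv
      exact Real.smoothTransition.one_of_one_le (le_of_lt hv)
    rw [h.deriv_eq, deriv_const]

theorem exists_deriv_smoothTransition_bound :
    ∃ B : ℝ≥0, ∀ u, |deriv Real.smoothTransition u| ≤ B := by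
  have hc : Continuous (deriv Real.smoothTransition) :=
    (Real.smoothTransition.contDiff (n := 1)).continuous_deriv le_rfl
  obtain ⟨B, hB⟩ := isCompact_Icc.exists_bound_of_continuousOn
    (hc.continuousOn (s := Icc (0 : ℝ) 1))
  refine ⟨B.toNNReal, fun u => ?_⟩
  by_cases hu : u ∈ Icc (0 : ℝ) 1
  · exact (hB u hu).trans (Real.le_coe_toNNReal B)
  · rw [deriv_smoothTransition_eq_zero, abs_zero]
    · positivity
    · rw [mem_Icc, not_and_or, not_le, not_le] at hu
      exact hu

/-- A cutoff in the disk that equals one away from the `ε`-neighbourhood of the circle. -/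
def edgeCut (ε : ℝ) (x : Plane) : ℝ := Real.smoothTransition ((1 - ‖x‖ ^ 2) / ε - 1)

theorem edgeCut_mem (ε : ℝ) (x : Plane) : 0 ≤ edgeCut ε x ∧ edgeCut ε x ≤ 1 :=
  ⟨Real.smoothTransition.nonneg _, Real.smoothTransition.le_one _⟩

theorem edgeCut_eq_one {ε : ℝ} (hε : 0 < ε) {x : Plane} (hx : 2 * ε ≤ 1 - ‖x‖ ^ 2) :
    edgeCut ε x = 1 := by
  refine Real.smoothTransition.one_of_one_le ?_
  rw [le_sub_iff_add_le, le_div_iff₀ hε]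
  linarith

theorem edgeCut_eq_zero {ε : ℝ} (hε : 0 < ε) {x : Plane} (hx : x ∉ disk) : edgeCut ε x = 0 := by
  refine Real.smoothTransition.zero_of_nonpos ?_
  rw [mem_disk_iff, not_lt] at hx
  have : (1 - ‖x‖ ^ 2) / ε ≤ 0 := div_nonpos_of_nonpos_of_nonneg (by nlinarith) hε.le
  linarith

theorem contDiff_edgeCut (ε : ℝ) : ContDiff ℝ ∞ (edgeCut ε) :=
  Real.smoothTransition.contDiff.comp
    (((contDiff_const.sub (contDiff_norm_sq ℝ)).div_const ε).sub contDiff_const)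

theorem smoothCc_edgeCut {ε : ℝ} (hε : 0 < ε) : SmoothCc fun x => (edgeCut ε x : ℂ) where
  smooth := Complex.ofRealCLM.contDiff.comp (contDiff_edgeCut ε)
  compact := HasCompactSupport.intro (isCompact_closedBall (0 : Plane) 1) fun x hx => by
    rw [edgeCut_eq_zero hε fun h => hx (Metric.ball_subset_closedBall h), Complex.ofReal_zero]

theorem dirDeriv_edgeCut (ε : ℝ) (i : Fin 2) (x : Plane) :
    dirDeriv (basisVec i) (fun x => (edgeCut ε x : ℂ)) x =
      ((deriv Real.smoothTransition ((1 - ‖x‖ ^ 2) / ε - 1) * (-2 * x i / ε) : ℝ) : ℂ) := by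
  have h1 : HasFDerivAt (fun x : Plane => ‖x‖ ^ 2) (2 • innerSL ℝ x) x :=
    (hasStrictFDerivAt_norm_sq x).hasFDerivAt
  have h2 : HasFDerivAt (fun x : Plane => (1 - ‖x‖ ^ 2) / ε - 1) _ x :=
    ((h1.const_sub 1).mul_const ε⁻¹).sub_const 1
  have h3 : HasDerivAt Real.smoothTransition _ ((1 - ‖x‖ ^ 2) / ε - 1) :=
    ((Real.smoothTransition.contDiff (n := 1)).differentiable (by simp) _).hasDerivAt
  have h4 := Complex.ofRealCLM.hasFDerivAt.comp x (h3.comp_hasFDerivAt x h2)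
  have h5 : dirDeriv (basisVec i) (fun x => (edgeCut ε x : ℂ)) x = _ :=
    congrArg (fun L : Plane →L[ℝ] ℂ => L (basisVec i)) h4.fderiv
  rw [h5]
  simp [inner_basisVec]
  ring

/-- The weight `4 / (1 - |x|²)²`. -/
def edgeWeight (x : Plane) : ℝ := 4 / (1 - ‖x‖ ^ 2) ^ 2

theorem edgeWeight_nonneg (x : Plane) : 0 ≤ edgeWeight x := by unfold edgeWeight; positivity

theorem measurable_edgeWeight : Measurable edgeWeight := by unfold edgeWeight; fun_prop

theorem one_le_mul_edgeWeight {r : ℝ} (hr : 0 < r) {x : Plane} (hx : x ∈ disk)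
    (h : 1 - ‖x‖ ^ 2 ≤ 2 * √r) : 1 ≤ r * edgeWeight x := by
  rw [mem_disk_iff] at hx
  have h0 : 0 < 1 - ‖x‖ ^ 2 := by nlinarith [norm_nonneg x]
  have h1 := Real.sq_sqrt hr.le
  rw [edgeWeight, mul_div_assoc', le_div_iff₀ (by positivity)]
  nlinarith [Real.sqrt_nonneg r]

theorem norm_one_sub_edgeCut_sq_le {r : ℝ} (hr : 0 < r) {x : Plane} (hx : x ∈ disk) :
    (1 - edgeCut (√r) x) ^ 2 ≤ min 1 ((r * edgeWeight x) ^ 1) := by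
  have hw := edgeWeight_nonneg x
  have h1 := edgeCut_mem (√r) x
  rcases le_total (2 * √r) (1 - ‖x‖ ^ 2) with h | h
  · rw [edgeCut_eq_one (Real.sqrt_pos.2 hr) h]
    simp only [sub_self]
    rw [zero_pow two_ne_zero]
    exact le_min zero_le_one (by positivity)
  · rw [pow_one, min_eq_left (one_le_mul_edgeWeight hr hx h)]
    nlinarith

/-- The `H¹` term of the splitting carries `r`, so the cutoff has width `√r`: its gradient times
`√r` is bounded, and it vanishes where `1 - ‖x‖ ^ 2 > 2 √r`. The `4` in `edgeWeight` is adapted to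
this threshold. -/
theorem dirDeriv_edgeCut_sq_le {B : ℝ≥0} (hB : ∀ u, |deriv Real.smoothTransition u| ≤ B) {r : ℝ}
    (hr : 0 < r) (i : Fin 2) {x : Plane} (hx : x ∈ disk) :
    ‖(√r : ℂ) * dirDeriv (basisVec i) (fun x => (edgeCut (√r) x : ℂ)) x‖ ^ 2 ≤
      (2 * B) ^ 2 * min 1 ((r * edgeWeight x) ^ 1) := by
  have hw := edgeWeight_nonneg x
  have hr' := Real.sqrt_pos.2 hr
  rw [dirDeriv_edgeCut, ← Complex.ofReal_mul, Complex.norm_real, Real.norm_eq_abs]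
  rcases lt_or_ge (2 * √r) (1 - ‖x‖ ^ 2) with h | h
  · rw [deriv_smoothTransition_eq_zero]
    · rw [zero_mul, mul_zero, abs_zero, zero_pow two_ne_zero]
      exact mul_nonneg (by positivity) (le_min zero_le_one (by positivity))
    · right
      rw [lt_sub_iff_add_lt, lt_div_iff₀ hr']
      linarith
  · rw [pow_one, min_eq_left (one_le_mul_edgeWeight hr hx h), mul_one]
    have h1 : √r * (deriv Real.smoothTransition ((1 - ‖x‖ ^ 2) / √r - 1) * (-2 * x i / √r)) =
        deriv Real.smoothTransition ((1 - ‖x‖ ^ 2) / √r - 1) * (-2 * x i) := by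
      field_simp
    rw [h1, abs_mul, abs_mul]
    have h2 : |x i| ≤ 1 := (PiLp.norm_apply_le x i).trans (mem_disk_iff.1 hx).le
    have h3 := hB ((1 - ‖x‖ ^ 2) / √r - 1)
    rw [abs_neg, abs_two, mul_comm]
    gcongr
    linarith

/-! ### Extension by zero -/

/-- The part of `f` near the unit circle, measured in `L²`. -/
def edgePart (f : Plane → ℂ) (r : ℝ) : ℝ≥0∞ :=
  ∫⁻ x in disk, ENNReal.ofReal (min 1 ((r * edgeWeight x) ^ 1)) * ‖f x‖ₑ ^ 2

theorem l2N_le_of_sq_le {c : Plane → ℂ} {f : Plane → ℂ} {B : ℝ} (hB : 0 ≤ B) {r : ℝ}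
    (hc : ∀ x ∈ disk, ‖c x‖ ^ 2 ≤ B ^ 2 * min 1 ((r * edgeWeight x) ^ 1)) :
    l2N disk (fun x => c x * f x) ≤ ENNReal.ofReal B * edgePart f r ^ (1 / 2 : ℝ) := by
  have e : (edgePart f r ^ (1 / 2 : ℝ)) ^ 2 = edgePart f r := by
    rw [← ENNReal.rpow_natCast, ← ENNReal.rpow_mul]
    norm_num
  rw [← sq_le_sq_iff_ennreal, mul_pow, e, l2N, eLpNorm_two_sq, ← ENNReal.ofReal_pow hB, edgePart,
    ← lintegral_const_mul' _ _ ENNReal.ofReal_ne_top]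
  refine setLIntegral_mono' measurableSet_disk fun x hx => ?_
  rw [enorm_mul, mul_pow, ← mul_assoc, ← ENNReal.ofReal_mul (by positivity)]
  gcongr
  rw [← ofReal_norm, ← ENNReal.ofReal_pow (norm_nonneg _)]
  exact ENNReal.ofReal_le_ofReal (hc x hx)

theorem l2N_disk_mul_le_of_norm_le {c u : Plane → ℂ} {B : ℝ} (hc : ∀ x ∈ disk, ‖c x‖ ≤ B)
    (hu : Continuous u) : l2N disk (fun x => c x * u x) ≤ ENNReal.ofReal B * l2N disk u := by
  refine eLpNorm_mul_le_of_enorm_le ?_ hu.aestronglyMeasurable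
  filter_upwards [ae_restrict_mem measurableSet_disk] with x hx
  rw [← ofReal_norm]
  exact ENNReal.ofReal_le_ofReal (hc x hx)

theorem l2N_add_le_of_continuous {u v : Plane → ℂ} (hu : Continuous u) (hv : Continuous v) :
    l2N disk (fun x => u x + v x) ≤ l2N disk u + l2N disk v :=
  eLpNorm_add_le hu.aestronglyMeasurable hv.aestronglyMeasurable (by norm_num)

theorem planeSobolevNorm_one_le (φ : 𝓢(Plane, ℂ)) :
    planeSobolevNorm 1 (φ.toLp 2 volume) ≤ eLpNorm φ 2 volume +
      ∑ i, eLpNorm (∂_{basisVec i} φ : 𝓢(Plane, ℂ)) 2 volume := by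
  have h := planeSobolevNorm_succ_le (fun i => isWeakDeriv_schwartz i φ) 0
  simpa [planeSobolevNorm_zero, enorm_toLp_schwartz] using h

theorem eLpNorm_lineDeriv_le (φ : 𝓢(Plane, ℂ)) (i : Fin 2) :
    eLpNorm (∂_{basisVec i} φ : 𝓢(Plane, ℂ)) 2 volume ≤
      7 * planeSobolevNorm 1 (φ.toLp 2 volume) := by
  have h := (isWeakDeriv_schwartz i φ).planeSobolevNorm_le 0
  simpa [planeSobolevNorm_zero, enorm_toLp_schwartz] using h

theorem eLpNorm_le_planeSobolevNorm_one (φ : 𝓢(Plane, ℂ)) :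
    eLpNorm φ 2 volume ≤ planeSobolevNorm 1 (φ.toLp 2 volume) := by
  rw [← enorm_toLp_schwartz, ← planeSobolevNorm_zero]
  exact planeSobolevNorm_mono zero_le_one _

theorem enorm_toL2_sub (f : Plane → ℂ) (hf : IsTestFunction f) (ψ : 𝓢(Plane, ℂ)) :
    ‖hf.toL2 - ψ.toLp 2 volume‖ₑ = eLpNorm (fun x => f x - ψ x) 2 volume := by
  rw [Lp.enorm_def]
  refine eLpNorm_congr_ae ?_
  filter_upwards [Lp.coeFn_sub hf.toL2 (ψ.toLp 2 volume), hf.schw.coeFn_toLp 2 volume,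
    ψ.coeFn_toLp 2 volume] with x h1 h2 h3
  rw [h1, Pi.sub_apply, h3, IsTestFunction.toL2, h2, IsTestFunction.schw_coe]

/-- A splitting of `f` on the disk becomes one of its extension by zero on multiplying `φ` by the
edge cutoff. The additional errors involve `f` only near the circle and are measured by `edgePart`.
-/
theorem exists_cutoff_bound : ∃ C : ℝ≥0, ∀ f, ∀ hf : IsTestFunction f, ∀ φ : 𝓢(Plane, ℂ),
    ∀ r : ℝ, 0 < r → ∃ ψ : 𝓢(Plane, ℂ),
      ‖hf.toL2 - ψ.toLp 2 volume‖ₑ ^ 2 +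
        ENNReal.ofReal r * planeSobolevNorm 1 (ψ.toLp 2 volume) ^ 2 ≤
      C * (l2N disk (fun x => f x - φ x) ^ 2 +
        ENNReal.ofReal r * planeSobolevNorm 1 (φ.toLp 2 volume) ^ 2 + edgePart f r) := by
  obtain ⟨B, hB⟩ := exists_deriv_smoothTransition_bound
  refine ⟨((15 + 4 * B) ^ 2 + 1) * 4, fun f hf φ r hr => ?_⟩
  have hε := Real.sqrt_pos.2 hr
  have hχ := smoothCc_edgeCut hε
  set χ : Plane → ℂ := fun x => (edgeCut (√r) x : ℂ) with hχdef
  set ψ : 𝓢(Plane, ℂ) := (hχ.mul_schwartz φ).schw with hψ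
  have hψ_apply : ∀ x, ψ x = χ x * φ x := fun x => rfl
  have hfc := hf.smooth.continuous
  have hu : Continuous fun x => f x - φ x := hfc.sub φ.continuous
  have hχc := hχ.smooth.continuous
  have hχ0 : ∀ x ∉ disk, χ x = 0 := fun x hx => by
    simp only [hχdef, edgeCut_eq_zero hε hx, Complex.ofReal_zero]
  have hχ1 : ∀ x, ‖χ x‖ ≤ 1 := fun x => by
    have := edgeCut_mem (√r) x
    rw [hχdef, Complex.norm_real, Real.norm_of_nonneg this.1]
    exact this.2
  set a := l2N disk fun x => f x - φ x with ha
  set β := planeSobolevNorm 1 (φ.toLp 2 volume) with hβ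
  set L := ENNReal.ofReal √r with hL
  have hL2 : L ^ 2 = ENNReal.ofReal r := by
    rw [hL, ← ENNReal.ofReal_pow (Real.sqrt_nonneg _), Real.sq_sqrt hr.le]
  set e := edgePart f r ^ (1 / 2 : ℝ) with he
  have he2 : e ^ 2 = edgePart f r := by
    rw [he, ← ENNReal.rpow_natCast, ← ENNReal.rpow_mul]
    norm_num
  have hedge : ∀ x ∈ disk, min 1 ((r * edgeWeight x) ^ 1) ≤ 1 := fun x _ => min_le_left _ _
  have h0 : ‖hf.toL2 - ψ.toLp 2 volume‖ₑ ≤ a + e := by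
    rw [enorm_toL2_sub, eLpNorm_eq_l2N_disk fun x hx => by
      rw [hf.eq_zero hx, hψ_apply, hχ0 x hx]; ring]
    have e1 : (fun x => f x - ψ x) = fun x => χ x * (f x - φ x) + (1 - χ x) * f x := by
      ext x
      rw [hψ_apply]
      ring
    rw [e1]
    refine (l2N_add_le_of_continuous (hχc.mul hu) ((continuous_const.sub hχc).mul hfc)).trans
      (add_le_add ?_ ?_)
    · refine (l2N_disk_mul_le_of_norm_le (fun x _ => hχ1 x) hu).trans ?_
      rw [ENNReal.ofReal_one, one_mul]
    · refine (l2N_le_of_sq_le zero_le_one (r := r) fun x hx => ?_).trans ?_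
      · rw [one_pow, one_mul]
        refine le_trans (le_of_eq ?_) (norm_one_sub_edgeCut_sq_le hr hx)
        change ‖(1 : ℂ) - (edgeCut (√r) x : ℂ)‖ ^ 2 = _
        rw [← Complex.ofReal_one, ← Complex.ofReal_sub, Complex.norm_real, Real.norm_eq_abs,
          sq_abs]
      · rw [ENNReal.ofReal_one, one_mul]
  have hder : ∀ i : Fin 2, L * eLpNorm (∂_{basisVec i} ψ : 𝓢(Plane, ℂ)) 2 volume ≤
      7 * (L * β) + 2 * B * (a + e) := fun i => by
    set D : Plane → ℂ := fun x => (√r : ℂ) * dirDeriv (basisVec i) χ x with hD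
    have hDc : Continuous D := continuous_const.mul (hχ.dirDeriv (basisVec i)).smooth.continuous
    have hDb : ∀ x ∈ disk, ‖D x‖ ^ 2 ≤ (2 * B) ^ 2 * min 1 ((r * edgeWeight x) ^ 1) := fun x hx =>
      dirDeriv_edgeCut_sq_le hB hr i hx
    have hDb1 : ∀ x ∈ disk, ‖D x‖ ≤ 2 * B := fun x hx => by
      refine abs_le_of_sq_le_sq' ((hDb x hx).trans ?_) (by positivity) |>.2
      exact mul_le_of_le_one_right (by positivity) (hedge x hx)
    have hd : ∀ x, (∂_{basisVec i} ψ : 𝓢(Plane, ℂ)) x = dirDeriv (basisVec i) χ x * φ x +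
        χ x * (∂_{basisVec i} φ : 𝓢(Plane, ℂ)) x := fun x => by
      rw [← dirDeriv_schwartz, ← dirDeriv_schwartz]
      exact dirDeriv_mul ((hχ.smooth.differentiable (by simp)) x) (φ.differentiable x)
    have e1 : (fun x => D x * φ x + (√r : ℂ) * (χ x * (∂_{basisVec i} φ : 𝓢(Plane, ℂ)) x)) =
        (√r : ℂ) • ((∂_{basisVec i} ψ : 𝓢(Plane, ℂ)) : Plane → ℂ) := by
      ext x
      rw [Pi.smul_apply, hd, smul_eq_mul]
      ring
    have hout : ∀ x ∉ disk, (∂_{basisVec i} ψ : 𝓢(Plane, ℂ)) x = 0 := fun x hx => by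
      have h1 : dirDeriv (basisVec i) χ x = 0 := by
        rw [dirDeriv_edgeCut, deriv_smoothTransition_eq_zero]
        · simp
        · left
          rw [mem_disk_iff, not_lt] at hx
          have : (1 - ‖x‖ ^ 2) / √r ≤ 0 := div_nonpos_of_nonpos_of_nonneg (by nlinarith) hε.le
          linarith
      rw [hd, h1, hχ0 x hx]
      ring
    have hLn : L = ‖(√r : ℂ)‖ₑ := by
      rw [← ofReal_norm, Complex.norm_real, Real.norm_of_nonneg hε.le]
    rw [eLpNorm_eq_l2N_disk hout, hLn, l2N, ← eLpNorm_const_smul, ← e1]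
    -- In the term with the derivative of the cutoff, `φ` is written as `f - (f - φ)`: near the
    -- circle only `f` is controlled by the Hardy inequality.
    have hφi : Continuous (∂_{basisVec i} φ : 𝓢(Plane, ℂ)) := SchwartzMap.continuous _
    have e2 : (fun x => D x * φ x) = fun x => (-D x) * (f x - φ x) + D x * f x := by
      ext x
      ring
    refine (l2N_add_le_of_continuous (hDc.mul φ.continuous)
      (continuous_const.mul (hχc.mul hφi))).trans ?_
    rw [add_comm]
    refine add_le_add ?_ ?_
    · have h2 : l2N disk (fun x => (√r : ℂ) * (χ x * (∂_{basisVec i} φ : 𝓢(Plane, ℂ)) x)) ≤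
          ENNReal.ofReal √r * (ENNReal.ofReal 1 *
            l2N disk (∂_{basisVec i} φ : 𝓢(Plane, ℂ))) := by
        refine (l2N_disk_mul_le_of_norm_le (B := √r) (fun x _ => ?_) (hχc.mul hφi)).trans ?_
        · rw [Complex.norm_real, Real.norm_of_nonneg hε.le]
        · gcongr
          exact l2N_disk_mul_le_of_norm_le (fun x _ => hχ1 x) hφi
      refine h2.trans ?_
      rw [ENNReal.ofReal_one, one_mul, ← hL, ← hLn, mul_left_comm]
      gcongr
      exact (eLpNorm_mono_measure _ Measure.restrict_le_self).trans (eLpNorm_lineDeriv_le φ i)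
    · change l2N disk (fun x => D x * φ x) ≤ _
      rw [e2]
      refine (l2N_add_le_of_continuous (hDc.neg.mul hu) (hDc.mul hfc)).trans ?_
      have hB2 : ENNReal.ofReal (2 * B) = 2 * B := by
        rw [ENNReal.ofReal_mul (by norm_num)]
        simp
      rw [mul_add, ← hB2]
      refine add_le_add ?_ (l2N_le_of_sq_le (by positivity) hDb)
      exact l2N_disk_mul_le_of_norm_le (fun x hx => (norm_neg (D x)).trans_le (hDb1 x hx)) hu
  have h1 : L * planeSobolevNorm 1 (ψ.toLp 2 volume) ≤ (15 + 4 * B) * (L * β + (a + e)) := by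
    have h2 : eLpNorm ψ 2 volume ≤ β := by
      refine le_trans ?_ (eLpNorm_le_planeSobolevNorm_one φ)
      refine eLpNorm_mono fun x => ?_
      rw [hψ_apply, norm_mul]
      exact mul_le_of_le_one_left (norm_nonneg _) (hχ1 x)
    calc L * planeSobolevNorm 1 (ψ.toLp 2 volume)
        ≤ L * (eLpNorm ψ 2 volume + ∑ i, eLpNorm (∂_{basisVec i} ψ : 𝓢(Plane, ℂ)) 2 volume) := by
          gcongr
          exact planeSobolevNorm_one_le ψ
      _ ≤ L * β + ((7 * (L * β) + 2 * B * (a + e)) + (7 * (L * β) + 2 * B * (a + e))) := by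
          rw [Fin.sum_univ_two, mul_add, mul_add]
          gcongr
          · exact hder 0
          · exact hder 1
      _ = 15 * (L * β) + 4 * B * (a + e) := by ring
      _ ≤ 15 * (L * β) + 4 * B * (a + e) + (15 * (a + e) + 4 * B * (L * β)) := le_self_add
      _ = _ := by ring
  refine ⟨ψ, ?_⟩
  calc ‖hf.toL2 - ψ.toLp 2 volume‖ₑ ^ 2 +
        ENNReal.ofReal r * planeSobolevNorm 1 (ψ.toLp 2 volume) ^ 2
      ≤ (L * β + (a + e)) ^ 2 + ((15 + 4 * B) * (L * β + (a + e))) ^ 2 := by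
        rw [← hL2, ← mul_pow]
        gcongr
        exact h0.trans le_add_self
    _ = ((15 + 4 * B) ^ 2 + 1) * (L * β + (a + e)) ^ 2 := by ring
    _ ≤ ((15 + 4 * B) ^ 2 + 1) * (4 * (a ^ 2 + L ^ 2 * β ^ 2 + e ^ 2)) := by
        gcongr
        calc (L * β + (a + e)) ^ 2 ≤ 2 * ((L * β) ^ 2 + (a + e) ^ 2) := add_sq_le_two_mul _ _
          _ ≤ 2 * ((L * β) ^ 2 + 2 * (a ^ 2 + e ^ 2)) := by
              gcongr
              exact add_sq_le_two_mul _ _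
          _ ≤ 2 * ((L * β) ^ 2 + 2 * (a ^ 2 + e ^ 2)) + 2 * (L * β) ^ 2 := le_self_add
          _ = _ := by ring
    _ = _ := by
        rw [hL2, he2]
        push_cast
        ring

/-- For `‖x‖ ≥ 1 / 2` one has `-log ‖x‖ ≤ 2 (1 - ‖x‖ ^ 2)`, so the logarithmic weight dominates; for
smaller `‖x‖` the edge weight is bounded and the `L²` term suffices. -/
theorem lintegral_edgeWeight_le {s : ℝ} (hs : 0 < s) (hs1 : s < 1) (f : Plane → ℂ)
    (hf : Continuous f) :
    ∫⁻ x in disk, ENNReal.ofReal (edgeWeight x ^ s) * ‖f x‖ₑ ^ 2 ≤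
      16 * (hardyN s f ^ 2 + l2N disk f ^ 2) := by
  rw [hardyN_sq, l2N, eLpNorm_two_sq, ← restrict_puncDisk,
    ← lintegral_add_right _ (hf.measurable.enorm.pow_const 2),
    ← lintegral_const_mul' _ _ (by norm_num)]
  refine setLIntegral_mono' measurableSet_puncDisk fun x hx => ?_
  have hx' := mem_puncDisk.1 hx
  have hw := logWeight_nonneg x
  have hew := edgeWeight_nonneg x
  have h0 : 0 < 1 - ‖x‖ ^ 2 := by nlinarith
  have key : edgeWeight x ^ s ≤ 16 * (logWeight x ^ s + 1) := by
    have h16 : (16 : ℝ) ^ s ≤ 16 := by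
      calc (16 : ℝ) ^ s ≤ 16 ^ (1 : ℝ) := Real.rpow_le_rpow_of_exponent_le (by norm_num) hs1.le
        _ = 16 := Real.rpow_one _
    have hws : 0 ≤ logWeight x ^ s := by positivity
    rcases le_total ‖x‖ (1 / 2) with h | h
    · have h1 : edgeWeight x ≤ 16 := by
        rw [edgeWeight, div_le_iff₀ (by positivity)]
        nlinarith
      calc edgeWeight x ^ s ≤ 16 ^ s := Real.rpow_le_rpow hew h1 hs.le
        _ ≤ _ := by linarith
    · have hlog : Real.log ‖x‖ < 0 := Real.log_neg hx'.1 hx'.2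
      have h1 : -Real.log ‖x‖ ≤ 2 * (1 - ‖x‖ ^ 2) := by
        have h2 := Real.one_sub_inv_le_log_of_pos hx'.1
        have h3 : ‖x‖⁻¹ - 1 ≤ 2 * (1 - ‖x‖) := by
          rw [inv_eq_one_div, div_sub_one hx'.1.ne', div_le_iff₀ hx'.1]
          nlinarith
        nlinarith
      have h2 : edgeWeight x ≤ 16 * logWeight x := by
        rw [edgeWeight, logWeight, ← div_eq_mul_inv, div_le_div_iff₀ (by positivity)
          (by nlinarith)]
        nlinarith
      calc edgeWeight x ^ s ≤ (16 * logWeight x) ^ s := Real.rpow_le_rpow hew h2 hs.le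
        _ = 16 ^ s * logWeight x ^ s := Real.mul_rpow (by norm_num) hw
        _ ≤ 16 * logWeight x ^ s := by gcongr
        _ ≤ _ := by linarith
  calc ENNReal.ofReal (edgeWeight x ^ s) * ‖f x‖ₑ ^ 2
      ≤ ENNReal.ofReal (16 * (logWeight x ^ s + 1)) * ‖f x‖ₑ ^ 2 := by gcongr
    _ = 16 * (ENNReal.ofReal (logWeight x ^ s) * ‖f x‖ₑ ^ 2 + ‖f x‖ₑ ^ 2) := by
        rw [ENNReal.ofReal_mul (by norm_num), ENNReal.ofReal_add (by positivity) (by norm_num),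
          ENNReal.ofReal_one]
        norm_num
        ring

theorem l2N_disk_le_of_ae_eq {f : Plane → ℂ} {g : L2} (hg : g =ᵐ[volume.restrict disk] f) :
    l2N disk f ≤ planeSobolevNorm 0 g := by
  rw [planeSobolevNorm_zero, Lp.enorm_def, l2N, ← eLpNorm_congr_ae hg]
  exact eLpNorm_mono_measure _ Measure.restrict_le_self

theorem aemeasurable_freqSplit_mul (g : L2) {s : ℝ} :
    AEMeasurable (fun r => freqSplit g r * ENNReal.ofReal (r ^ (-s - 1)))
      (volume.restrict (Ioi 0)) := by
  have h : Monotone (freqSplit g) := fun r r' hr => by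
    refine lintegral_mono fun ξ => ?_
    have := weight_pos ξ
    simp only [pow_one]
    gcongr
  exact (h.measurable.mul (by fun_prop)).aemeasurable

/-- Integrating the cutoff bound against `r ^ (-s - 1)` turns the frequency term into the `H^s` norm
of `g` and `edgePart` into the Hardy integral with `edgeWeight ^ s`; the latter is bounded by the
Hardy inequality. -/
theorem exists_zeroExtension_bound_of_lt_one {s : ℝ} (hs : 0 < s) (hs1 : s < 1) (hne : s ≠ 1 / 2) :
    ∃ C : ℝ≥0, ∀ f, ∀ hf : IsTestFunction f, ∀ g : L2, g =ᵐ[volume.restrict disk] f →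
      planeSobolevNorm s hf.toL2 ≤ C * planeSobolevNorm s g := by
  obtain ⟨C₁, h₁⟩ := exists_hardyN_le hs hs1 hne
  obtain ⟨C₂, h₂⟩ := exists_cutoff_bound
  refine ⟨1 + 2 * C₂ * (8 + 16 * (C₁ ^ 2 + 1)), fun f hf g hg => ?_⟩
  have key := interp_weighted volume measurable_weight (fun ξ => (weight_pos ξ).le)
    (H := (𝓕 hf.toL2 : L2)) (Lp.aestronglyMeasurable _) one_ne_zero hs
    (Φ := fun r => C₂ * (8 * freqSplit g r + edgePart f r))
    (fun r hr => by
      obtain ⟨φ, hφ⟩ := exists_disk_split hg hr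
      obtain ⟨ψ, hψ⟩ := h₂ f hf φ r hr
      refine ⟨(𝓕 (hf.toL2 - ψ.toLp 2 volume) : L2), (𝓕 (ψ.toLp 2 volume) : L2),
        Lp.aestronglyMeasurable _, ?_, ?_⟩
      · have e : hf.toL2 = (hf.toL2 - ψ.toLp 2 volume) + ψ.toLp 2 volume := by abel
        nth_rewrite 1 [e]
        rw [FourierTransform.fourier_add]
        exact Lp.coeFn_add _ _
      · rw [← planeSobolevNorm_zero, planeSobolevNorm_sq, planeSobolevNorm_sq] at hψ
        simp only [Real.rpow_zero, ENNReal.ofReal_one, one_mul, Real.rpow_one] at hψ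
        simp only [pow_one]
        refine hψ.trans ?_
        gcongr
        exact hφ)
  have e : ∀ r, 2 * (C₂ * (8 * freqSplit g r + edgePart f r)) * ENNReal.ofReal (r ^ (-s - 1)) =
      2 * C₂ * (8 * (freqSplit g r * ENNReal.ofReal (r ^ (-s - 1))) +
        edgePart f r * ENNReal.ofReal (r ^ (-s - 1))) := fun r => by ring
  have hK : ∫⁻ r in Ioi (0 : ℝ), freqSplit g r * ENNReal.ofReal (r ^ (-s - 1)) =
      interpConst 1 s * planeSobolevNorm s g ^ 2 :=
    lintegral_interp_planeSobolevNorm g one_ne_zero hs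
  have hM : ∫⁻ r in Ioi (0 : ℝ), edgePart f r * ENNReal.ofReal (r ^ (-s - 1)) =
      interpConst 1 s * ∫⁻ x in disk, ENNReal.ofReal (edgeWeight x ^ s) * ‖f x‖ₑ ^ 2 :=
    lintegral_interp (volume.restrict disk) measurable_edgeWeight edgeWeight_nonneg
      hf.smooth.continuous.aestronglyMeasurable one_ne_zero hs
  simp only [e] at key
  rw [lintegral_const_mul' _ _ (by finiteness), lintegral_add_left'
    ((aemeasurable_freqSplit_mul g).const_mul _), lintegral_const_mul' _ _ (by norm_num), hK, hM,
    ← planeSobolevNorm_sq] at key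
  have e2 : 2 * (C₂ : ℝ≥0∞) * (8 * (interpConst 1 s * planeSobolevNorm s g ^ 2) +
      interpConst 1 s * ∫⁻ x in disk, ENNReal.ofReal (edgeWeight x ^ s) * ‖f x‖ₑ ^ 2) =
      interpConst 1 s * (2 * C₂ * (8 * planeSobolevNorm s g ^ 2 +
        ∫⁻ x in disk, ENNReal.ofReal (edgeWeight x ^ s) * ‖f x‖ₑ ^ 2)) := by ring
  rw [e2, ENNReal.mul_le_mul_iff_right (interpConst_ne_zero _ _)
      (interpConst_ne_top hs (by simpa using hs1))] at key
  have h3 := lintegral_edgeWeight_le hs hs1 f hf.smooth.continuous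
  have h4 := h₁ f hf g hg
  have h5 := (l2N_disk_le_of_ae_eq hg).trans (planeSobolevNorm_mono hs.le g)
  rw [← sq_le_sq_iff_ennreal]
  calc planeSobolevNorm s hf.toL2 ^ 2
      ≤ 2 * C₂ * (8 * planeSobolevNorm s g ^ 2 + 16 * ((C₁ * planeSobolevNorm s g) ^ 2 +
          planeSobolevNorm s g ^ 2)) := by
        refine key.trans ?_
        gcongr
        refine h3.trans ?_
        gcongr
    _ = (2 * C₂ * (8 + 16 * (C₁ ^ 2 + 1))) * planeSobolevNorm s g ^ 2 := by ring
    _ ≤ (1 + 2 * C₂ * (8 + 16 * (C₁ ^ 2 + 1))) ^ 2 * planeSobolevNorm s g ^ 2 := by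
        gcongr
        refine le_trans le_add_self (le_self_pow₀ ?_ two_ne_zero)
        exact le_self_add
    _ = _ := by
        push_cast
        ring

/-- Weak derivatives are local: test functions supported in the disk do not distinguish `g` from
`f`. -/
theorem IsWeakDeriv.ae_eq_on_disk {i : Fin 2} {g G : L2} (h : IsWeakDeriv i g G) {f : Plane → ℂ}
    (hf : IsTestFunction f) (hg : g =ᵐ[volume.restrict disk] f) :
    G =ᵐ[volume.restrict disk] dirDeriv (basisVec i) f := by
  have hloc : LocallyIntegrable (fun x => (G : Plane → ℂ) x - dirDeriv (basisVec i) f x) volume :=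
    (locallyIntegrable_L2 G).sub (hf.dirDeriv (basisVec i)).smooth.continuous.locallyIntegrable
  have key := isOpen_disk.ae_eq_zero_of_integral_contDiff_smul_eq_zero
    (hloc.locallyIntegrableOn disk) fun χ hχ hχc hχd => by
    obtain ⟨φ, hφ⟩ := exists_schwartz_eq_ofReal hχ hχc
    have hφ0 : ∀ x ∉ disk, (∂_{basisVec i} φ : 𝓢(Plane, ℂ)) x = 0 := fun x hx => by
      have h1 : (φ : Plane → ℂ) =ᶠ[𝓝 x] fun _ => 0 := by
        filter_upwards [(isClosed_tsupport χ).isOpen_compl.mem_nhds fun hx' => hx (hχd hx')]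
          with y hy
        rw [hφ, image_eq_zero_of_notMem_tsupport hy, Complex.ofReal_zero]
      rw [← dirDeriv_schwartz, dirDeriv, h1.fderiv_eq]
      simp
    have h1 := h.integral_eq φ
    have h2 := (isWeakDeriv_schwartz i hf.schw).integral_eq φ
    have h3 : ∫ x, (∂_{basisVec i} φ : 𝓢(Plane, ℂ)) x * g x =
        ∫ x, (∂_{basisVec i} φ : 𝓢(Plane, ℂ)) x * hf.schw.toLp 2 volume x := by
      refine integral_congr_ae ?_
      have hg' := (ae_restrict_iff' measurableSet_disk).1 hg
      filter_upwards [hg', hf.schw.coeFn_toLp 2 volume] with x h4 h5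
      by_cases hx : x ∈ disk
      · rw [h4 hx, h5, IsTestFunction.schw_coe]
      · rw [hφ0 x hx, zero_mul, zero_mul]
    have h4 : ∫ x, φ x * (∂_{basisVec i} hf.schw : 𝓢(Plane, ℂ)).toLp 2 volume x =
        ∫ x, φ x * dirDeriv (basisVec i) f x := by
      refine integral_congr_ae ?_
      filter_upwards [(∂_{basisVec i} hf.schw : 𝓢(Plane, ℂ)).coeFn_toLp 2 volume] with x hx
      rw [hx, ← dirDeriv_schwartz, IsTestFunction.schw_coe]
    rw [h3, h2, neg_inj, h4] at h1
    have i1 := integrable_schwartz_mul φ G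
    have i2 : Integrable fun x => φ x * dirDeriv (basisVec i) f x := by
      refine (integrable_schwartz_mul φ (hf.dirDeriv (basisVec i)).toL2).congr ?_
      filter_upwards [(hf.dirDeriv (basisVec i)).schw.coeFn_toLp 2 volume] with x hx
      rw [IsTestFunction.toL2, hx, IsTestFunction.schw_coe]
    have e : (fun x => χ x • ((G : Plane → ℂ) x - dirDeriv (basisVec i) f x)) =
        fun x => φ x * G x - φ x * dirDeriv (basisVec i) f x := by
      ext x
      rw [hφ, Complex.real_smul]
      ring
    rw [e, integral_sub i1 i2, h1, sub_self]
  rw [Filter.EventuallyEq, ae_restrict_iff' measurableSet_disk]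
  filter_upwards [key] with x hx hxd
  exact sub_eq_zero.1 (hx hxd)

theorem zeroExtension_bound_zero {f : Plane → ℂ} (hf : IsTestFunction f) {g : L2}
    (hg : g =ᵐ[volume.restrict disk] f) : planeSobolevNorm 0 hf.toL2 ≤ planeSobolevNorm 0 g := by
  rw [planeSobolevNorm_zero hf.toL2, IsTestFunction.toL2, enorm_toLp_schwartz,
    IsTestFunction.schw_coe, eLpNorm_eq_l2N_disk fun x hx => hf.eq_zero hx]
  exact l2N_disk_le_of_ae_eq hg

/-- Derivatives of `f` are test functions, and the weak derivatives of an extension of `f` extend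
them, so the bound at `s` applies to each of them. -/
theorem exists_zeroExtension_bound_succ {s : ℝ} (hs : 0 ≤ s) {C : ℝ≥0}
    (hC : ∀ f, ∀ hf : IsTestFunction f, ∀ g : L2, g =ᵐ[volume.restrict disk] f →
      planeSobolevNorm s hf.toL2 ≤ C * planeSobolevNorm s g) :
    ∃ C : ℝ≥0, ∀ f, ∀ hf : IsTestFunction f, ∀ g : L2, g =ᵐ[volume.restrict disk] f →
      planeSobolevNorm (s + 1) hf.toL2 ≤ C * planeSobolevNorm (s + 1) g := by
  refine ⟨1 + 15 * C, fun f hf g hg => ?_⟩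
  rcases eq_or_ne (planeSobolevNorm (s + 1) g) ⊤ with h | h
  · rw [h, ENNReal.mul_top]
    · exact le_top
    · rw [ENNReal.coe_ne_zero]
      positivity
  have h1 : planeSobolevNorm 1 g ≠ ⊤ :=
    ne_top_of_le_ne_top h (planeSobolevNorm_mono (by linarith) g)
  choose G hG using fun i => exists_isWeakDeriv h1 i
  have h2 := planeSobolevNorm_succ_le (g := hf.toL2) (fun i => isWeakDeriv_schwartz i hf.schw) s
  have h3 : ∀ i, (∂_{basisVec i} hf.schw : 𝓢(Plane, ℂ)).toLp 2 volume =
      (hf.dirDeriv (basisVec i)).toL2 := fun i => by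
    have : (∂_{basisVec i} hf.schw : 𝓢(Plane, ℂ)) = (hf.dirDeriv (basisVec i)).schw := by
      ext x
      rw [← dirDeriv_schwartz]
      rfl
    rw [this, IsTestFunction.toL2]
  simp only [h3] at h2
  have h4 : ∀ i, planeSobolevNorm s (hf.dirDeriv (basisVec i)).toL2 ≤
      C * (7 * planeSobolevNorm (s + 1) g) := fun i =>
    (hC _ (hf.dirDeriv (basisVec i)) (G i) ((hG i).ae_eq_on_disk hf hg)).trans (by
      gcongr
      exact (hG i).planeSobolevNorm_le s)
  calc planeSobolevNorm (s + 1) hf.toL2 ≤ C * planeSobolevNorm (s + 1) g +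
        (C * (7 * planeSobolevNorm (s + 1) g) + C * (7 * planeSobolevNorm (s + 1) g)) := by
        refine h2.trans ?_
        rw [Fin.sum_univ_two]
        gcongr
        · exact (hC f hf g hg).trans (by gcongr; exact planeSobolevNorm_mono (by linarith) g)
        · exact h4 0
        · exact h4 1
    _ = (15 * C) * planeSobolevNorm (s + 1) g := by ring
    _ ≤ _ := by
        push_cast
        gcongr
        exact le_add_self

/-- Extension by zero is bounded, away from the exceptional exponents. -/
theorem exists_zeroExtension_bound {s : ℝ} (hs : 0 ≤ s) (hs2 : s ≤ 2) (h1 : s ≠ 1 / 2)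
    (h3 : s ≠ 3 / 2) : ∃ C : ℝ≥0, ∀ f, ∀ hf : IsTestFunction f, ∀ g : L2,
      g =ᵐ[volume.restrict disk] f → planeSobolevNorm s hf.toL2 ≤ C * planeSobolevNorm s g := by
  have h01 : ∀ s : ℝ, 0 ≤ s → s < 1 → s ≠ 1 / 2 → ∃ C : ℝ≥0, ∀ f, ∀ hf : IsTestFunction f,
      ∀ g : L2, g =ᵐ[volume.restrict disk] f →
        planeSobolevNorm s hf.toL2 ≤ C * planeSobolevNorm s g := fun s hs hs1 hne => by
    rcases hs.eq_or_lt with rfl | hs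
    · exact ⟨1, fun f hf g hg => by simpa using zeroExtension_bound_zero hf hg⟩
    · exact exists_zeroExtension_bound_of_lt_one hs hs1 hne
  have hone : ∃ C : ℝ≥0, ∀ f, ∀ hf : IsTestFunction f, ∀ g : L2, g =ᵐ[volume.restrict disk] f →
        planeSobolevNorm 1 hf.toL2 ≤ C * planeSobolevNorm 1 g := by
    obtain ⟨C, hC⟩ := h01 0 le_rfl one_pos (by norm_num)
    have := exists_zeroExtension_bound_succ le_rfl hC
    rwa [zero_add] at this
  rcases lt_or_ge s 1 with hs1 | hs1
  · exact h01 s hs hs1 h1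
  · obtain ⟨C, hC⟩ : ∃ C : ℝ≥0, ∀ f, ∀ hf : IsTestFunction f, ∀ g : L2,
        g =ᵐ[volume.restrict disk] f →
          planeSobolevNorm (s - 1) hf.toL2 ≤ C * planeSobolevNorm (s - 1) g := by
      rcases hs2.eq_or_lt with rfl | hs2
      · rw [show (2 : ℝ) - 1 = 1 by norm_num]
        exact hone
      · exact h01 (s - 1) (by linarith) (by linarith) fun h => h3 (by linarith)
    have := exists_zeroExtension_bound_succ (by linarith) hC
    rwa [sub_add_cancel] at this

/-! ### The main estimates -/

theorem planeSobolevNorm_toL2_le_sobolevNorm_univ {f : Plane → ℂ} (hf : IsTestFunction f) (s : ℝ) :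
    planeSobolevNorm s hf.toL2 ≤ sobolevNorm univ s f := by
  refine le_iInf₂ fun g hg => le_of_eq ?_
  congr 1
  refine Lp.ext ?_
  rw [Measure.restrict_univ] at hg
  exact (hf.schw.coeFn_toLp 2 volume).trans hg.symm

/-- A nonzero constant is required to pull it out of an infimum that may be infinite. -/
theorem le_mul_sobolevNorm_disk {f : Plane → ℂ} {s : ℝ} {a : ℝ≥0∞} {C : ℝ≥0} (hC : C ≠ 0)
    (h : ∀ g : L2, g =ᵐ[volume.restrict disk] f → a ≤ C * planeSobolevNorm s g) :
    a ≤ C * sobolevNorm disk s f := by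
  have hC' : (C : ℝ≥0∞) ≠ 0 := ENNReal.coe_ne_zero.2 hC
  simp only [sobolevNorm, ENNReal.mul_iInf_of_ne hC' ENNReal.coe_ne_top]
  exact le_iInf₂ h

theorem IsTestFunction.eq_zero_of_toL2_norm {f : Plane → ℂ} (hf : IsTestFunction f) {s : ℝ}
    (hs : 0 ≤ s) (h : planeSobolevNorm s hf.toL2 = 0) : f = fun _ => 0 := by
  have h1 := (planeSobolevNorm_mono hs hf.toL2).trans h.le
  rw [planeSobolevNorm_zero, nonpos_iff_eq_zero, IsTestFunction.toL2, enorm_toLp_schwartz,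
    IsTestFunction.schw_coe, eLpNorm_eq_zero_iff hf.smooth.continuous.aestronglyMeasurable
      (by norm_num)] at h1
  exact (hf.smooth.continuous.ae_eq_iff_eq volume continuous_const).1 h1

theorem DiffOp.apply_zero {p : ℕ} (P : DiffOp p) : P.apply (fun _ => 0) = fun _ => 0 := by
  rw [P.apply_eq]
  simp only [wD_zero_fun, mul_zero, Finset.sum_const_zero]

theorem sobolevNorm_diffOp_zero {p q : ℕ} (P : DiffOp p) (Q : DiffOp q) (A : Kernel) (s : ℝ) :
    sobolevNorm disk s (P.apply (A.op (Q.apply fun _ => 0))) = 0 := by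
  have h : A.op (fun _ => 0) = fun _ => 0 := by
    ext x
    simp [Kernel.op]
  rw [Q.apply_zero, h, P.apply_zero, sobolevNorm_zero_fun]

/-- A bound for kernels with finite norm holds for all kernels, with the convention `0 · ∞ = 0`. -/
theorem sobolevNorm_diffOp_le {p q : ℕ} (P : DiffOp p) (Q : DiffOp q) {A : Kernel} {s : ℝ}
    (hs : 0 ≤ s) {f : Plane → ℂ} (hf : IsTestFunction f) {C C' : ℝ≥0} {N : ℝ≥0∞}
    (hN : planeSobolevNorm s hf.toL2 ≤ C' * N)
    (h : A.cNorm (2 * (p + q)) ≠ ⊤ → sobolevNorm disk s (P.apply (A.op (Q.apply f))) ≤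
      C * A.cNorm (2 * (p + q)) * planeSobolevNorm s hf.toL2) :
    sobolevNorm disk s (P.apply (A.op (Q.apply f))) ≤
      (C * C' + 1 : ℝ≥0) * A.cNorm (2 * (p + q)) * N := by
  -- If the kernel norm is infinite, either `N = 0` and `f` vanishes, or the right-hand side is
  -- infinite; the latter needs a nonzero constant, hence the `+ 1`.
  rcases eq_or_ne (A.cNorm (2 * (p + q))) ⊤ with hA | hA
  · rcases eq_or_ne N 0 with h0 | h0
    · rw [h0, mul_zero, nonpos_iff_eq_zero] at hN
      rw [hf.eq_zero_of_toL2_norm hs hN, sobolevNorm_diffOp_zero]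
      exact zero_le
    · rw [hA, ENNReal.mul_top (by rw [ENNReal.coe_ne_zero]; positivity), ENNReal.top_mul h0]
      exact le_top
  · calc _ ≤ C * A.cNorm (2 * (p + q)) * planeSobolevNorm s hf.toL2 := h hA
      _ ≤ C * A.cNorm (2 * (p + q)) * (C' * N) := by gcongr
      _ = (C * C' : ℝ≥0) * A.cNorm (2 * (p + q)) * N := by push_cast; ring
      _ ≤ _ := by
        gcongr
        exact le_self_add

end DiskOp

end

theorem mainTheorem9 {p q : ℕ} (P : DiskOp.DiffOp p) (Q : DiskOp.DiffOp q) :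
    (∃ C : ℝ≥0, 0 < C ∧ ∀ A : DiskOp.Kernel, A.IsSmooth →
      (p + q ≤ 1 ∨
        (p + q ≤ 2 ∧ ∀ x ∈ DiskOp.disk, ∀ ξ ∈ DiskOp.circle, A.symbol x ξ = 0)) →
      ∀ s : ℝ, 0 ≤ s → s ≤ ((p + q : ℕ) : ℝ) →
      ∀ f : DiskOp.Plane → ℂ, DiskOp.IsTestFunction f →
        DiskOp.sobolevNorm DiskOp.disk s (P.apply (A.op (Q.apply f))) ≤
          C * A.cNorm (2 * (p + q)) * DiskOp.sobolevNorm Set.univ s f) ∧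
    (∀ s : ℝ, 0 ≤ s → s ≤ ((p + q : ℕ) : ℝ) → s ≠ 1 / 2 → s ≠ 3 / 2 →
      ∃ C : ℝ≥0, 0 < C ∧ ∀ A : DiskOp.Kernel, A.IsSmooth →
      (p + q ≤ 1 ∨
        (p + q ≤ 2 ∧ ∀ x ∈ DiskOp.disk, ∀ ξ ∈ DiskOp.circle, A.symbol x ξ = 0)) →
      ∀ f : DiskOp.Plane → ℂ, DiskOp.IsTestFunction f →
        DiskOp.sobolevNorm DiskOp.disk s (P.apply (A.op (Q.apply f))) ≤
          C * A.cNorm (2 * (p + q)) * DiskOp.sobolevNorm DiskOp.disk s f) := by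
  obtain ⟨C, hC⟩ := DiskOp.exists_diffOp_bound P Q
  refine ⟨⟨C * 1 + 1, by positivity, fun A hA hc s hs hsm f hf => ?_⟩, fun s hs hsm h1 h3 => ?_⟩
  · refine DiskOp.sobolevNorm_diffOp_le P Q hs hf ?_ fun hN => hC A hA hc hN s hs hsm f hf
    rw [ENNReal.coe_one, one_mul]
    exact DiskOp.planeSobolevNorm_toL2_le_sobolevNorm_univ hf s
  · rcases Nat.lt_or_ge 2 (p + q) with h2 | h2
    · exact ⟨1, one_pos, fun A _ hc => by omega⟩
    have hs2 : s ≤ 2 := hsm.trans (by exact_mod_cast h2)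
    obtain ⟨C', hC'⟩ := DiskOp.exists_zeroExtension_bound hs hs2 h1 h3
    -- The constant `C' + 1` is nonzero, as `le_mul_sobolevNorm_disk` requires.
    refine ⟨C * (C' + 1) + 1, by positivity, fun A hA hc f hf => ?_⟩
    refine DiskOp.sobolevNorm_diffOp_le P Q hs hf ?_ fun hN => hC A hA hc hN s hs hsm f hf
    refine DiskOp.le_mul_sobolevNorm_disk (by positivity) fun g hg => (hC' f hf g hg).trans ?_
    gcongr
    exact le_self_add
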